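/- Let $S$ be a commutative ring, $B=\bigoplus_{n\ge 0}B_n$ a graded $S$-algebra with $B_0=S$, $B_+=\bigoplus_{n\ge1}B_n$, and let $M=\bigoplus_{n\in\mathbb Z}M_n$ be a graded ($S$-central) $B$-$B$-bimodule with $M_n=0$ for all $n>n_0$, for some $n_0$. Assume that all $B_n$ and $M_n$ are projective $S$-modules. Let $d\ge 1$, and let $A=A(B,M,d)=B\oplus M$ be the square-zero extension ($M\cdot M=0$), with the internal grading coming from $B$ and $M$ and with the homological grading in which $B$ has degree $0$ and $M$ has degree $d$. Let $HH^i_{-md}(A)$ be the cohomology, at cochains with $i+md$ arguments, of the complex of normalized $S$-linear Hochschild cochains of $A$ (multilinear maps $A^{n}\to A$ vanishing when an argument is $1$, with the Koszul signs of the homological grading) of homological degree $-md$ and internal degree $0$. An $A_\infty$-structure on $A$ means a strictly unital $S$-linear one, preserving the internal grading, with $m_1=0$ and with $m_2$ the product of $A$; two such are gauge equivalent if there is a strictly unital $A_\infty$-morphism $f$ between them, preserving the internal grading, with $f_1=\mathrm{id}$. Suppose that $P^l=\operatorname{Tor}^B_*(S,M)$ and $P^r=\operatorname{Tor}^B_*(M,S)$,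 computed by the bar complexes $T(B_+)\otimes_S M$ and $M\otimes_S T(B_+)$, are finitely generated projective $S$-modules, concentrated in degree $d+1$ and internal degree $0$. Then: (1) $HH^i_{-md}(A)=0$ for all $m\ge 1$ and $i<2m$. (2) For every $S$-linear map $\varphi:P^r\to M\otimes_S T^{d+1}(B_+)$ sending each class to a cycle of internal degree $0$ representing it, evaluation of Hochschild cocycles on the image of $\varphi$ induces an injective $S$-linear map $HH^2_{-d}(A)\hookrightarrow \operatorname{Hom}_S(P^r,S)$. (3) Gauge equivalence is an equivalence relation on $A_\infty$-structures on $A$, $m_{d+2}$ is a Hochschild cocycle for each of them, and $(m_\bullet)\mapsto [m_{d+2}]$ induces a bijection from the set of gauge equivalence classes of $A_\infty$-structures on $A$ to $HH^2_{-d}(A)$. (4) Let $d=1$ and suppose that $P^r$ is locally free of rank $1$. Let $Q$ be a finitely generated projective $S$-module, $L$ an invertible $S$-module, $n_1,n_2>0$, $\alpha:Q\to B_{n_1}$ and $\beta:Q^\vee\to B_{n_2}\otimes L^{-1}$ $S$-linear maps and $\gamma\in M_{-n_1-n_2}\otimes L$, such that $m_2(\beta\otimes\alpha)(\mathrm{id}_Q)=0$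 in $B\otimes L^{-1}$ and $m_2(\gamma\otimes\beta)=0$ as a map $Q^\vee\to M$ (with $\mathrm{id}_Q\in Q^\vee\otimes Q$, and $L\otimes L^{-1}$ contracted to $S$). Then, up to gauge equivalence, there is at most one $A_\infty$-structure on $A$ with $m_3((\gamma\otimes\beta\otimes\alpha)(\mathrm{id}_Q))=1$. If one exists, then $(m_\bullet)\mapsto m_3((\gamma\otimes\beta\otimes\alpha)(\mathrm{id}_Q))$ induces a bijection from the set of gauge equivalence classes of all $A_\infty$-structures on $A$ to $S$. -/

import Mathlib

open scoped TensorProduct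

noncomputable section

namespace SqZero

/-! ## Subquotients -/

section Subquotient

variable {S E : Type*} [CommRing S] [AddCommGroup E] [Module S E]

/-- The quotient `Z / (W ∩ Z)`, used for cycles `Z` and boundaries `W`. -/
def Subquot (Z W : Submodule S E) : Type _ := Z ⧸ W.submoduleOf Z

instance (Z W : Submodule S E) : AddCommGroup (Subquot Z W) :=
  inferInstanceAs (AddCommGroup (Z ⧸ W.submoduleOf Z))

instance (Z W : Submodule S E) : Module S (Subquot Z W) :=
  inferInstanceAs (Module S (Z ⧸ W.submoduleOf Z))

/-- The class of an element of `Z`. -/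
def Subquot.mk (Z W : Submodule S E) : Z →ₗ[S] Subquot Z W := (W.submoduleOf Z).mkQ

end Subquotient

/-! ## Merging two neighbouring arguments of a multilinear map -/

section Merge

variable {S V W : Type*} [CommRing S] [AddCommGroup V] [Module S V] [AddCommGroup W] [Module S W]

/-- The tuple `(a₀, …, a_j * a_{j+1}, …, a_n)`, where `*` is the bilinear map `mul`. -/
def mergeAt (mul : V →ₗ[S] V →ₗ[S] V) {n : ℕ} (j : Fin n) (a : Fin (n + 1) → V) : Fin n → V :=
  fun k => if k < j then a k.castSucc else if k = j then mul (a k.castSucc) (a k.succ) else a k.succ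

/-- Which entry of the merged tuple the `i`-th entry of the original one contributes to. -/
def mergeIdx {n : ℕ} (j : Fin n) (i : Fin (n + 1)) : Fin n :=
  if h : i.val ≤ j.val then ⟨i.val, by omega⟩ else ⟨i.val - 1, by omega⟩

/-- The entry of the merged tuple which depends on the `i`-th entry, as a linear function of it. -/
def mergeLin (mul : V →ₗ[S] V →ₗ[S] V) {n : ℕ} (j : Fin n) (a : Fin (n + 1) → V)
    (i : Fin (n + 1)) : V →ₗ[S] V :=
  if i = j.castSucc then mul.flip (a j.succ)
  else if i = j.succ then mul (a j.castSucc) else LinearMap.id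

theorem mergeAt_update (mul : V →ₗ[S] V →ₗ[S] V) {n : ℕ} (j : Fin n) (a : Fin (n + 1) → V)
    (i : Fin (n + 1)) (v : V) :
    mergeAt mul j (Function.update a i v) =
      Function.update (mergeAt mul j a) (mergeIdx j i) (mergeLin mul j a i v) := by
  funext k
  obtain ⟨i, hi⟩ := i
  obtain ⟨j, hj⟩ := j
  obtain ⟨k, hk⟩ := k
  simp only [mergeAt, mergeIdx, mergeLin, Function.update_apply, Fin.ext_iff, Fin.lt_def,
    Fin.castSucc_mk, Fin.succ_mk]
  rcases lt_trichotomy k j with h | h | h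
  · have h1 : k ≠ j := by omega
    by_cases hki : k = i
    · subst hki
      have : k ≤ j := by omega
      have h2 : k ≠ j + 1 := by omega
      simp [h, h1, h2, this]
    · by_cases hij : i ≤ j
      · simp [h, hki, hij]
      · have : k ≠ i - 1 := by omega
        simp [h, hki, hij, this]
  · subst h
    by_cases h1 : i = k
    · subst h1; simp
    · by_cases h2 : i = k + 1
      · subst h2; simp
      · have h3 : ¬ (k = i) := fun h => h1 h.symm
        have h4 : ¬ (k + 1 = i) := fun h => h2 h.symm
        by_cases hik : i ≤ k
        · simp [h3, h4, hik]
        · have : ¬ (k = i - 1) := by omega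
          simp [h3, h4, hik, this]
  · have h1 : ¬ k < j := by omega
    have h2 : k ≠ j := by omega
    by_cases h3 : k + 1 = i
    · subst h3
      have h4 : ¬ (k + 1 ≤ j) := by omega
      have h5 : k + 1 ≠ j := by omega
      simp [h1, h2, h4, h5]
    · by_cases hij : i ≤ j
      · have : k ≠ i := by omega
        simp [h1, h2, h3, hij, this]
      · have : k ≠ i - 1 := by omega
        simp [h1, h2, h3, hij, this]

/-- The multilinear map `(a₀, …, a_n) ↦ f (a₀, …, a_j * a_{j+1}, …, a_n)`. -/
def mergeMap (mul : V →ₗ[S] V →ₗ[S] V) {n : ℕ} (f : MultilinearMap S (fun _ : Fin n => V) W)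
    (j : Fin n) : MultilinearMap S (fun _ : Fin (n + 1) => V) W :=
  MultilinearMap.mk' (fun a => f (mergeAt mul j a))
    (fun a i x y => by simp only [mergeAt_update, map_add, MultilinearMap.map_update_add])
    (fun a i c x => by simp only [mergeAt_update, map_smul, MultilinearMap.map_update_smul])

@[simp]
theorem mergeMap_apply (mul : V →ₗ[S] V →ₗ[S] V) {n : ℕ}
    (f : MultilinearMap S (fun _ : Fin n => V) W) (j : Fin n) (a : Fin (n + 1) → V) :
    mergeMap mul f j a = f (mergeAt mul j a) := rfl

end Merge

/-! ## The bar complex `M ⊗ T(V)` -/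

section Bar

variable {S V M : Type*} [CommRing S] [AddCommGroup V] [Module S V] [AddCommGroup M] [Module S M]

variable (S V M) in
/-- `M ⊗ V^{⊗ n}`. -/
abbrev BarTerm (n : ℕ) : Type _ := M ⊗[S] (PiTensorProduct S (fun _ : Fin n => V))

/-- `x ⊗ b₀ ⊗ … ⊗ b_n ↦ (x b₀) ⊗ b₁ ⊗ … ⊗ b_n`. -/
def barFirst (act : M →ₗ[S] V →ₗ[S] M) (n : ℕ) : BarTerm S V M (n + 1) →ₗ[S] BarTerm S V M n :=
  TensorProduct.lift
    ((PiTensorProduct.lift (R := S) (s := fun _ : Fin (n + 1) => V)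
        (E := BarTerm S V M n)).toLinearMap ∘ₗ
      (multilinearCurryLeftEquiv S (fun _ : Fin (n + 1) => V) (BarTerm S V M n)).symm.toLinearMap ∘ₗ
      act.compr₂ ((PiTensorProduct.lift (R := S) (s := fun _ : Fin n => V)
        (E := BarTerm S V M n)).symm.toLinearMap ∘ₗ
          TensorProduct.mk S M (PiTensorProduct S (fun _ : Fin n => V))))

/-- `x ⊗ b₀ ⊗ … ⊗ b_n ↦ x ⊗ b₀ ⊗ … ⊗ b_i b_{i+1} ⊗ … ⊗ b_n`. -/
def barMerge (mul : V →ₗ[S] V →ₗ[S] V) (n : ℕ) (i : Fin n) :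
    BarTerm S V M (n + 1) →ₗ[S] BarTerm S V M n :=
  LinearMap.lTensor M
    (PiTensorProduct.lift (mergeMap mul (PiTensorProduct.tprod S (s := fun _ : Fin n => V)) i))

/-- The differential of the bar complex `M ⊗ T(V)` of a (non-unital) algebra `V` acting on the
right on `M` (it is the complex `Bar(M, S)` when `V` is the augmentation ideal):
`x ⊗ b₀ ⊗ … ⊗ b_n ↦ x b₀ ⊗ b₁ ⊗ … + ∑_{i < n} (-1)^{i+1} x ⊗ b₀ ⊗ … ⊗ b_i b_{i+1} ⊗ … ⊗ b_n`. -/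
def barD (mul : V →ₗ[S] V →ₗ[S] V) (act : M →ₗ[S] V →ₗ[S] M) (n : ℕ) :
    BarTerm S V M (n + 1) →ₗ[S] BarTerm S V M n :=
  barFirst act n + ∑ i : Fin n, (-1 : S) ^ (i.val + 1) • barMerge mul n i

theorem barD_tmul (mul : V →ₗ[S] V →ₗ[S] V) (act : M →ₗ[S] V →ₗ[S] M) (n : ℕ) (x : M)
    (b : Fin (n + 1) → V) :
    barD mul act n (x ⊗ₜ PiTensorProduct.tprod S b) =
      act x (b 0) ⊗ₜ PiTensorProduct.tprod S (Fin.tail b) +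
        ∑ i : Fin n, (-1 : S) ^ (i.val + 1) • x ⊗ₜ PiTensorProduct.tprod S (mergeAt mul i b) := by
  simp [barD, barFirst, barMerge, multilinearCurryLeftEquiv]

/-- The cycles of the bar complex in homological degree `n`. -/
def barCycles (mul : V →ₗ[S] V →ₗ[S] V) (act : M →ₗ[S] V →ₗ[S] M) :
    (n : ℕ) → Submodule S (BarTerm S V M n)
  | 0 => ⊤
  | n + 1 => LinearMap.ker (barD mul act n)

/-- The boundaries of the bar complex in homological degree `n`. -/
def barBoundaries (mul : V →ₗ[S] V →ₗ[S] V) (act : M →ₗ[S] V →ₗ[S] M) (n : ℕ) :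
    Submodule S (BarTerm S V M n) :=
  LinearMap.range (barD mul act n)

/-- The homology of the bar complex in homological degree `n`. -/
abbrev BarHomology (mul : V →ₗ[S] V →ₗ[S] V) (act : M →ₗ[S] V →ₗ[S] M) (n : ℕ) : Type _ :=
  Subquot (barCycles mul act n) (barBoundaries mul act n)

/-- The part of `M ⊗ V^{⊗ n}` of internal degree `k`. -/
def barDegree (𝓥 : ℕ → Submodule S V) (𝓜 : ℤ → Submodule S M) (n : ℕ) (k : ℤ) :
    Submodule S (BarTerm S V M n) :=
  Submodule.span S {z | ∃ (e : ℤ) (x : M) (f : Fin n → ℕ) (b : Fin n → V), x ∈ 𝓜 e ∧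
    (∀ i, b i ∈ 𝓥 (f i)) ∧ e + ∑ i, (f i : ℤ) = k ∧ z = x ⊗ₜ PiTensorProduct.tprod S b}

/-- The homology of the bar complex is a finitely generated projective `S`-module, concentrated
in homological degree `N` and in internal degree `0`. -/
structure BarConcentrated (mul : V →ₗ[S] V →ₗ[S] V) (act : M →ₗ[S] V →ₗ[S] M)
    (𝓥 : ℕ → Submodule S V) (𝓜 : ℤ → Submodule S M) (N : ℕ) : Prop where
  degree : ∀ n, n ≠ N → barCycles mul act n ≤ barBoundaries mul act n
  internal : ∀ k : ℤ, k ≠ 0 →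
    barCycles mul act N ⊓ barDegree 𝓥 𝓜 N k ≤ barBoundaries mul act N
  finite : Module.Finite S (BarHomology mul act N)
  projective : Module.Projective S (BarHomology mul act N)

end Bar

/-! ## Tor over a connected graded algebra -/

section Tor

variable {S B M : Type*} [CommRing S] [Ring B] [Algebra S B] [AddCommGroup M] [Module S M]
  [Module B M] [Module Bᵐᵒᵖ M] [IsScalarTower S B M] [IsScalarTower S Bᵐᵒᵖ M]

/-- The augmentation ideal `B₊ = ⨁_{n ≥ 1} B_n`: the elements whose degree-`0` component is `0`. -/
def plus (𝓑 : ℕ → Submodule S B) [GradedAlgebra 𝓑] : Submodule S B :=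
  LinearMap.ker (GradedAlgebra.proj 𝓑 0)

theorem mul_mem_plus (𝓑 : ℕ → Submodule S B) [GradedAlgebra 𝓑] {a b : B} (ha : a ∈ plus 𝓑) :
    a * b ∈ plus 𝓑 := by
  have h := map_mul (GradedRing.projZeroRingHom 𝓑) a b
  simp only [plus, LinearMap.mem_ker, GradedAlgebra.proj_apply,
    GradedRing.projZeroRingHom_apply] at *
  rw [h, ha, zero_mul]

/-- The multiplication of `B₊`. -/
def plusMul (𝓑 : ℕ → Submodule S B) [GradedAlgebra 𝓑] :
    plus 𝓑 →ₗ[S] plus 𝓑 →ₗ[S] plus 𝓑 :=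
  LinearMap.mk₂ S (fun a b => ⟨a.1 * b.1, mul_mem_plus 𝓑 a.2⟩)
    (fun _ _ _ => Subtype.ext (add_mul _ _ _)) (fun _ _ _ => Subtype.ext (smul_mul_assoc _ _ _))
    (fun _ _ _ => Subtype.ext (mul_add _ _ _)) (fun _ _ _ => Subtype.ext (mul_smul_comm _ _ _))

variable (S B M) in
/-- The right action `x ↦ b ↦ x b` of `B` on `M`. -/
def rightAct : M →ₗ[S] B →ₗ[S] M :=
  LinearMap.mk₂ S (fun x b => MulOpposite.op b • x)
    (fun _ _ _ => smul_add _ _ _)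
    (fun c x b => by
      rw [← algebraMap_smul Bᵐᵒᵖ c x, ← algebraMap_smul Bᵐᵒᵖ c (MulOpposite.op b • x), ← mul_smul,
        ← mul_smul, Algebra.commutes c (MulOpposite.op b)])
    (fun x b b' => by rw [MulOpposite.op_add, add_smul])
    (fun c x b => by rw [MulOpposite.op_smul, smul_assoc])

variable (S B M) in
/-- The left action `x ↦ b ↦ b x` of `B` on `M`. -/
def leftAct : M →ₗ[S] B →ₗ[S] M :=
  LinearMap.mk₂ S (fun x b => b • x)
    (fun _ _ _ => smul_add _ _ _)
    (fun c x b => by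
      rw [← algebraMap_smul B c x, ← algebraMap_smul B c (b • x), ← mul_smul,
        ← mul_smul, Algebra.commutes c b])
    (fun x b b' => by rw [add_smul])
    (fun c x b => by rw [smul_assoc])

/-- The grading of `B₊`. -/
def plusDegree (𝓑 : ℕ → Submodule S B) [GradedAlgebra 𝓑] (n : ℕ) : Submodule S (plus 𝓑) :=
  (𝓑 n).comap (plus 𝓑).subtype

variable (M) in
/-- The right action of `B₊` on `M`. -/
abbrev plusRight (𝓑 : ℕ → Submodule S B) [GradedAlgebra 𝓑] : M →ₗ[S] plus 𝓑 →ₗ[S] M :=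
  (rightAct S B M).compl₂ (plus 𝓑).subtype

variable (M) in
/-- The left action of `B₊` on `M`. -/
abbrev plusLeft (𝓑 : ℕ → Submodule S B) [GradedAlgebra 𝓑] : M →ₗ[S] plus 𝓑 →ₗ[S] M :=
  (leftAct S B M).compl₂ (plus 𝓑).subtype

variable (M) in
/-- `Tor^B_n(M, S)` (for `B` projective over `S`), the homology of `Bar(M, S) = M ⊗ T(B₊)`. -/
abbrev TorRight (𝓑 : ℕ → Submodule S B) [GradedAlgebra 𝓑] (n : ℕ) : Type _ :=
  BarHomology (plusMul 𝓑) (plusRight M 𝓑) n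

/-- `Tor^B_*(M, S)` is a finitely generated projective `S`-module, concentrated in degree `N` and
in internal degree `0`. -/
def TorRightConcentrated (𝓑 : ℕ → Submodule S B) [GradedAlgebra 𝓑] (𝓜 : ℤ → Submodule S M)
    (N : ℕ) : Prop :=
  BarConcentrated (plusMul 𝓑) (plusRight M 𝓑) (plusDegree 𝓑) 𝓜 N

/-- `Tor^B_*(S, M)` is a finitely generated projective `S`-module, concentrated in degree `N` and
in internal degree `0`. The complex `Bar(S, M) = T(B₊) ⊗ M` is written with its tensor factors
in the reversed order, that is, as the complex `Bar(M, S)` of the opposite algebra; its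
differential in degree `n + 1` is thereby multiplied by `(-1)^n`. -/
def TorLeftConcentrated (𝓑 : ℕ → Submodule S B) [GradedAlgebra 𝓑] (𝓜 : ℤ → Submodule S M)
    (N : ℕ) : Prop :=
  BarConcentrated (plusMul 𝓑).flip (plusLeft M 𝓑) (plusDegree 𝓑) 𝓜 N

end Tor

/-! ## Hochschild cohomology of a bigraded algebra

`𝒜 h k` is the part of homological degree `h` and internal degree `k` of the `S`-algebra `A`, and
`σ` is the involution `a ↦ (-1)^h a` for `a` of homological degree `h`; it implements the Koszul
sign rule. -/

section Hochschild

variable {S A : Type*} [CommRing S] [Ring A] [Algebra S A]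

/-- The normalized (reduced) `S`-linear Hochschild cochains with `n` arguments, of homological
degree `j` and of internal degree `0`: the multilinear maps `A^n → A` vanishing as soon as one
argument is the unit. -/
def cochains (𝒜 : ℤ → ℤ → Submodule S A) (n : ℕ) (j : ℤ) :
    Submodule S (MultilinearMap S (fun _ : Fin n => A) A) where
  carrier := {f | (∀ a, (∃ i, a i = 1) → f a = 0) ∧
    ∀ (h k : Fin n → ℤ) (a : Fin n → A), (∀ i, a i ∈ 𝒜 (h i) (k i)) →
      f a ∈ 𝒜 (∑ i, h i + j) (∑ i, k i)}
  add_mem' {f g} hf hg := ⟨fun a ha => by simp [hf.1 a ha, hg.1 a ha],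
    fun h k a ha => Submodule.add_mem _ (hf.2 h k a ha) (hg.2 h k a ha)⟩
  zero_mem' := ⟨fun _ _ => rfl, fun _ _ _ _ => Submodule.zero_mem _⟩
  smul_mem' c f hf := ⟨fun a ha => by simp [hf.1 a ha],
    fun h k a ha => Submodule.smul_mem _ c (hf.2 h k a ha)⟩

/-- The multilinear map `(a₀, …, a_n) ↦ σ^e(a₀) f(a₁, …, a_n)`. -/
def leftTerm (σ : A →ₗ[S] A) (e : ℕ) {n : ℕ} (f : MultilinearMap S (fun _ : Fin n => A) A) :
    MultilinearMap S (fun _ : Fin (n + 1) => A) A :=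
  LinearMap.uncurryLeft (M := fun _ : Fin (n + 1) => A)
    { toFun := fun v => (LinearMap.mulLeft S ((σ ^ e) v)).compMultilinearMap f
      map_add' := fun v w => by ext; simp [add_mul]
      map_smul' := fun c v => by ext; simp }

/-- The multilinear map `(a₀, …, a_n) ↦ f(a₀, …, a_{n-1}) a_n`. -/
def rightTerm {n : ℕ} (f : MultilinearMap S (fun _ : Fin n => A) A) :
    MultilinearMap S (fun _ : Fin (n + 1) => A) A :=
  MultilinearMap.uncurryRight (M := fun _ : Fin (n + 1) => A)
    ((LinearMap.mul S A).compMultilinearMap f)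

/-- The Hochschild differential on cochains with `n` arguments and homological degree `j`:
`(δf)(a₀, …, a_n) = (-1)^{j|a₀|} a₀ f(a₁, …, a_n) + ∑_{i < n} (-1)^{i+1} f(…, a_i a_{i+1}, …)
  + (-1)^{n+1} f(a₀, …, a_{n-1}) a_n`. -/
def hochD (σ : A →ₗ[S] A) (n : ℕ) (j : ℤ) :
    MultilinearMap S (fun _ : Fin n => A) A →ₗ[S] MultilinearMap S (fun _ : Fin (n + 1) => A) A where
  toFun f := leftTerm σ j.natAbs f
    + ∑ i : Fin n, (-1 : S) ^ (i.val + 1) • mergeMap (LinearMap.mul S A) f i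
    + (-1 : S) ^ (n + 1) • rightTerm f
  map_add' f g := by
    ext a
    simp [leftTerm, rightTerm, Finset.sum_add_distrib, smul_add]
    abel
  map_smul' c f := by
    ext a
    simp [leftTerm, rightTerm, Finset.smul_sum, smul_add, smul_comm c]

theorem hochD_apply (σ : A →ₗ[S] A) (n : ℕ) (j : ℤ) (f : MultilinearMap S (fun _ : Fin n => A) A)
    (a : Fin (n + 1) → A) :
    hochD σ n j f a = (σ ^ j.natAbs) (a 0) * f (Fin.tail a)
      + ∑ i : Fin n, (-1 : S) ^ (i.val + 1) • f (mergeAt (LinearMap.mul S A) i a)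
      + (-1 : S) ^ (n + 1) • (f (Fin.init a) * a (Fin.last n)) := by
  simp [hochD, leftTerm, rightTerm]

/-- Hochschild cocycles with `n` arguments and homological degree `j`. -/
def cocycles (𝒜 : ℤ → ℤ → Submodule S A) (σ : A →ₗ[S] A) (n : ℕ) (j : ℤ) :
    Submodule S (MultilinearMap S (fun _ : Fin n => A) A) :=
  cochains 𝒜 n j ⊓ LinearMap.ker (hochD σ n j)

/-- Hochschild coboundaries with `n` arguments and homological degree `j`. -/
def coboundaries (𝒜 : ℤ → ℤ → Submodule S A) (σ : A →ₗ[S] A) :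
    (n : ℕ) → (j : ℤ) → Submodule S (MultilinearMap S (fun _ : Fin n => A) A)
  | 0, _ => ⊥
  | n + 1, j => (cochains 𝒜 n j).map (hochD σ n j)

/-- The Hochschild cohomology represented by cochains with `n` arguments and homological degree
`j`. In the indexing by total degree, this is `HH^{n + j}_j`. -/
abbrev Hoch (𝒜 : ℤ → ℤ → Submodule S A) (σ : A →ₗ[S] A) (n : ℕ) (j : ℤ) : Type _ :=
  Subquot (cocycles 𝒜 σ n j) (coboundaries 𝒜 σ n j)

/-- The class of a cocycle. -/
abbrev hochClass (𝒜 : ℤ → ℤ → Submodule S A) (σ : A →ₗ[S] A) (n : ℕ) (j : ℤ)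
    (f : MultilinearMap S (fun _ : Fin n => A) A) (hf : f ∈ cocycles 𝒜 σ n j) : Hoch 𝒜 σ n j :=
  Subquot.mk (cocycles 𝒜 σ n j) (coboundaries 𝒜 σ n j) ⟨f, hf⟩

end Hochschild

/-! ## Minimal `A_∞`-structures and gauge equivalences -/

section AInfinity

variable {S A : Type*} [CommRing S] [Ring A] [Algebra S A]

/-- `∑_{r + s + t = n} (-1)^{r + st} g_{r + 1 + t} (1^{⊗ r} ⊗ m_s ⊗ 1^{⊗ t})` evaluated on
`a₀, …, a_{n-1}`. As `m_s` has homological degree `2 - s`, the Koszul sign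
`(-1)^{s (|a₀| + … + |a_{r-1}|)}` appears; it is produced by `σ^s`. -/
def insertSum (σ : A →ₗ[S] A) (g m : (n : ℕ) → MultilinearMap S (fun _ : Fin n => A) A)
    (n : ℕ) (a : ℕ → A) : A :=
  ∑ p ∈ Finset.HasAntidiagonal.antidiagonal n,
    ∑ q ∈ Finset.HasAntidiagonal.antidiagonal p.2,
    (-1 : S) ^ (p.1 + q.1 * q.2) •
      g (p.1 + 1 + q.2) (fun i =>
        if i.val < p.1 then (σ ^ q.1) (a i.val)
        else if i.val = p.1 then m q.1 (fun l => a (p.1 + l.val))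
        else a (i.val - 1 + q.1))

/-- `∑ (-1)^ε m_k (f_{i₁} ⊗ … ⊗ f_{i_k})` evaluated on `a₀, …, a_{n-1}`, the sum being over all
`i₁ + … + i_k = n` with `i_p ≥ 1`, where `ε = ∑_p (k - p) (i_p - 1)`. As `f_i` has homological
degree `1 - i`, the Koszul sign rule multiplies an argument `a` of the `p`-th block by
`(-1)^{|a| ∑_{q > p} (i_q - 1)}`. -/
def composeSum (σ : A →ₗ[S] A) (m f : (n : ℕ) → MultilinearMap S (fun _ : Fin n => A) A)
    (n : ℕ) (a : ℕ → A) : A :=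
  ∑ c : Composition n,
    (-1 : S) ^ (∑ p : Fin c.length, (c.length - 1 - p.val) * (c.blocksFun p - 1)) •
      m c.length (fun p => f (c.blocksFun p) (fun l =>
        (σ ^ (∑ q ∈ Finset.Ioi p, (c.blocksFun q - 1))) (a (c.embedding p l).val)))

/-- A minimal, strictly unital, `S`-linear `A_∞`-structure on the bigraded algebra `A`, extending
the given product `m₂`: the operations `m_n`, `n ≥ 3`, vanish if one argument is the unit, have
homological degree `2 - n` and preserve the internal grading. -/
structure MinimalAInf (𝒜 : ℤ → ℤ → Submodule S A) (σ : A →ₗ[S] A) where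
  m : (n : ℕ) → MultilinearMap S (fun _ : Fin n => A) A
  m_zero : m 0 = 0
  m_one : m 1 = 0
  m_two : ∀ a, m 2 a = a 0 * a 1
  m_mem : ∀ n, 3 ≤ n → m n ∈ cochains 𝒜 n (2 - n)
  relation : ∀ (n : ℕ) (a : ℕ → A), insertSum σ m m n a = 0

/-- Gauge equivalence of minimal `A_∞`-structures: the existence of a strictly unital
`A_∞`-morphism `f` between them, preserving the internal grading, with `f₁ = id`. -/
def GaugeEquiv {𝒜 : ℤ → ℤ → Submodule S A} {σ : A →ₗ[S] A} (μ ν : MinimalAInf 𝒜 σ) : Prop :=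
  ∃ f : (n : ℕ) → MultilinearMap S (fun _ : Fin n => A) A,
    f 0 = 0 ∧ (∀ a, f 1 a = a 0) ∧ (∀ n, 2 ≤ n → f n ∈ cochains 𝒜 n (1 - n)) ∧
    ∀ (n : ℕ) (a : ℕ → A), insertSum σ f μ.m n a = composeSum σ ν.m f n a

end AInfinity

/-! ## The algebra `A(B, M, d)` -/

section SquareZero

variable {S B M : Type*} [CommRing S] [Ring B] [Algebra S B] [AddCommGroup M] [Module S M]
  [Module B M] [Module Bᵐᵒᵖ M] [SMulCommClass B Bᵐᵒᵖ M] [IsScalarTower S B M]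
  [IsScalarTower S Bᵐᵒᵖ M]

/-- The grading of `B`, extended by zero to negative degrees. -/
def extendZ (𝓑 : ℕ → Submodule S B) : ℤ → Submodule S B
  | Int.ofNat n => 𝓑 n
  | Int.negSucc _ => ⊥

variable (S B M) in
/-- The inclusion of `M` into `B ⊕ M`. -/
def inrS : M →ₗ[S] TrivSqZeroExt B M where
  toFun := TrivSqZeroExt.inr
  map_add' := TrivSqZeroExt.inr_add B
  map_smul' c x := TrivSqZeroExt.inr_smul B c x

variable (S B M) in
/-- The inclusion of `B` into `B ⊕ M`. -/
def inlS : B →ₗ[S] TrivSqZeroExt B M := (TrivSqZeroExt.inlAlgHom S B M).toLinearMap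

/-- The bigrading of the square-zero extension `A(B, M, d) = B ⊕ M`: its part of homological
degree `h` and internal degree `k` consists of all `b + x` with `b ∈ B_k` if `h = 0` and `b = 0`
otherwise, `x ∈ M_k` if `h = d` and `x = 0` otherwise. -/
def bigrading (𝓑 : ℕ → Submodule S B) (𝓜 : ℤ → Submodule S M) (d : ℕ) (h k : ℤ) :
    Submodule S (TrivSqZeroExt B M) where
  carrier := {a | a.fst ∈ (if h = 0 then extendZ 𝓑 k else ⊥) ∧
    a.snd ∈ (if h = (d : ℤ) then 𝓜 k else ⊥)}
  add_mem' ha hb := ⟨Submodule.add_mem _ ha.1 hb.1, Submodule.add_mem _ ha.2 hb.2⟩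
  zero_mem' := ⟨Submodule.zero_mem _, Submodule.zero_mem _⟩
  smul_mem' c _ ha := ⟨Submodule.smul_mem _ c ha.1, Submodule.smul_mem _ c ha.2⟩

variable (S B M) in
/-- The involution of `A(B, M, d)` which is `(-1)^h` on the part of homological degree `h`. -/
def signInv (d : ℕ) : TrivSqZeroExt B M →ₗ[S] TrivSqZeroExt B M where
  toFun a := TrivSqZeroExt.inl a.fst + TrivSqZeroExt.inr ((-1 : S) ^ d • a.snd)
  map_add' a b := by ext <;> simp
  map_smul' c a := by ext <;> simp [smul_comm c]

theorem signInv_apply (𝓑 : ℕ → Submodule S B) (𝓜 : ℤ → Submodule S M) (d : ℕ) (h k : ℤ)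
    (a : TrivSqZeroExt B M) (ha : a ∈ bigrading 𝓑 𝓜 d h k) :
    signInv S B M d a = (-1 : S) ^ h.natAbs • a := by
  obtain ⟨h1, h2⟩ := ha
  have e1 : a.fst = (-1 : S) ^ h.natAbs • a.fst := by
    split_ifs at h1 with h0
    · simp [h0]
    · rw [(Submodule.mem_bot S).1 h1, smul_zero]
  have e2 : (-1 : S) ^ d • a.snd = (-1 : S) ^ h.natAbs • a.snd := by
    split_ifs at h2 with h0
    · simp [h0]
    · rw [(Submodule.mem_bot S).1 h2, smul_zero, smul_zero]
  ext
  · simpa [signInv] using e1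
  · simpa [signInv] using e2

/-- `Hoch` for the algebra `A(B, M, d)`: the group `HH^{n + j}_j(A)`. -/
abbrev HH (𝓑 : ℕ → Submodule S B) (𝓜 : ℤ → Submodule S M) (d n : ℕ) (j : ℤ) : Type _ :=
  Hoch (bigrading 𝓑 𝓜 d) (signInv S B M d) n j

/-- Minimal `A_∞`-structures on `A(B, M, d)` with the given `m₂`. -/
abbrev AInf (𝓑 : ℕ → Submodule S B) (𝓜 : ℤ → Submodule S M) (d : ℕ) : Type _ :=
  MinimalAInf (bigrading 𝓑 𝓜 d) (signInv S B M d)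

variable (M) in
/-- The evaluation of a cochain `f` on `M ⊗ T^n(B₊)`:
`x ⊗ b₁ ⊗ … ⊗ b_n ↦ f(x, b₁, …, b_n)`. -/
def evalBar (𝓑 : ℕ → Submodule S B) [GradedAlgebra 𝓑] {n : ℕ}
    (f : MultilinearMap S (fun _ : Fin (n + 1) => TrivSqZeroExt B M) (TrivSqZeroExt B M)) :
    BarTerm S (plus 𝓑) M n →ₗ[S] TrivSqZeroExt B M :=
  TensorProduct.lift
    ((PiTensorProduct.lift (R := S) (s := fun _ : Fin n => plus 𝓑)
        (E := TrivSqZeroExt B M)).toLinearMap ∘ₗ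
      MultilinearMap.compLinearMapₗ (fun _ : Fin n => inlS S B M ∘ₗ (plus 𝓑).subtype) ∘ₗ
      f.curryLeft ∘ₗ inrS S B M)

theorem evalBar_tmul (𝓑 : ℕ → Submodule S B) [GradedAlgebra 𝓑] {n : ℕ}
    (f : MultilinearMap S (fun _ : Fin (n + 1) => TrivSqZeroExt B M) (TrivSqZeroExt B M))
    (x : M) (b : Fin n → plus 𝓑) :
    evalBar M 𝓑 f (x ⊗ₜ PiTensorProduct.tprod S b) =
      f (Fin.cons (TrivSqZeroExt.inr x) (fun i => TrivSqZeroExt.inl (b i : B))) := by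
  simp [evalBar]
  rfl

/-- An embedding `P^r = Tor^B_N(M, S) → M ⊗ T^N(B₊)`, of internal degree `0`, inducing the
identification of `P^r` with the homology of the bar complex: it sends a class to a cycle of
internal degree `0` representing it. -/
def IsCycleLift (𝓑 : ℕ → Submodule S B) [GradedAlgebra 𝓑] (𝓜 : ℤ → Submodule S M) (N : ℕ)
    (φ : TorRight M 𝓑 N →ₗ[S] BarTerm S (plus 𝓑) M N) : Prop :=
  ∀ p, φ p ∈ barDegree (plusDegree 𝓑) 𝓜 N 0 ∧
    ∃ h : φ p ∈ barCycles (plusMul 𝓑) (plusRight M 𝓑) N,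
      Subquot.mk _ (barBoundaries (plusMul 𝓑) (plusRight M 𝓑) N) ⟨φ p, h⟩ = p

/-! ### Triple products with coefficients in an invertible module -/

variable {L Q : Type*} [AddCommGroup L] [Module S L] [AddCommGroup Q] [Module S Q]

variable (S B M L) in
/-- `(x ⊗ l) ⊗ (b ⊗ λ) ↦ λ(l) x ⊗ b`. -/
def contractL : (M ⊗[S] L) ⊗[S] (B ⊗[S] Module.Dual S L) →ₗ[S] M ⊗[S] B :=
  (TensorProduct.rid S (M ⊗[S] B)).toLinearMap ∘ₗ
    LinearMap.lTensor (M ⊗[S] B) (contractRight S L) ∘ₗ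
    (TensorProduct.tensorTensorTensorComm S M L B (Module.Dual S L)).toLinearMap

/-- The linear map `q ↦ γ ⊗ β(q)` from `Q^∨` to `M ⊗ B`, the factors `L` and `L^{-1}` being
contracted. -/
def gammaBeta (𝓑 : ℕ → Submodule S B) (𝓜 : ℤ → Submodule S M) {n₂ : ℕ} {e : ℤ}
    (γ : 𝓜 e ⊗[S] L) (β : Module.Dual S Q →ₗ[S] 𝓑 n₂ ⊗[S] Module.Dual S L) :
    Module.Dual S Q →ₗ[S] M ⊗[S] B :=
  contractL S B M L ∘ₗ
    TensorProduct.mk S (M ⊗[S] L) (B ⊗[S] Module.Dual S L) (LinearMap.rTensor L (𝓜 e).subtype γ) ∘ₗ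
    LinearMap.rTensor (Module.Dual S L) (𝓑 n₂).subtype ∘ₗ β

/-- `m₂(β ⊗ α) : Q^∨ ⊗ Q → B ⊗ L^{-1}`. -/
def m₂BetaAlpha (𝓑 : ℕ → Submodule S B) {n₁ n₂ : ℕ}
    (β : Module.Dual S Q →ₗ[S] 𝓑 n₂ ⊗[S] Module.Dual S L) (α : Q →ₗ[S] 𝓑 n₁) :
    Module.Dual S Q ⊗[S] Q →ₗ[S] B ⊗[S] Module.Dual S L :=
  LinearMap.rTensor (Module.Dual S L) (LinearMap.mul' S B) ∘ₗ
    (TensorProduct.rightComm S B (Module.Dual S L) B).toLinearMap ∘ₗ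
    TensorProduct.map (LinearMap.rTensor (Module.Dual S L) (𝓑 n₂).subtype ∘ₗ β)
      ((𝓑 n₁).subtype ∘ₗ α)

/-- `m₂(γ ⊗ β) : Q^∨ → M`. -/
def m₂GammaBeta (𝓑 : ℕ → Submodule S B) (𝓜 : ℤ → Submodule S M) {n₂ : ℕ} {e : ℤ}
    (γ : 𝓜 e ⊗[S] L) (β : Module.Dual S Q →ₗ[S] 𝓑 n₂ ⊗[S] Module.Dual S L) :
    Module.Dual S Q →ₗ[S] M :=
  TensorProduct.lift (rightAct S B M) ∘ₗ gammaBeta 𝓑 𝓜 γ β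

/-- `(x ⊗ b) ⊗ b' ↦ f(x, b, b')` for a cochain `f` with three arguments. -/
def evalTriple
    (f : MultilinearMap S (fun _ : Fin 3 => TrivSqZeroExt B M) (TrivSqZeroExt B M)) :
    (M ⊗[S] B) ⊗[S] B →ₗ[S] TrivSqZeroExt B M :=
  TensorProduct.lift (TensorProduct.lift
    (LinearMap.compl₁₂
      (((LinearMap.lcomp S (TrivSqZeroExt B M) (inlS S B M)) ∘ₗ
        (LinearMap.compRight S (MultilinearMap.constLinearEquivOfIsEmpty (R := S) (S := S)
          (M₁ := fun _ : Fin 0 => TrivSqZeroExt B M) (M₂ := TrivSqZeroExt B M)).symm.toLinearMap) ∘ₗ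
        (multilinearCurryLeftEquiv S (fun _ : Fin 1 => TrivSqZeroExt B M)
          (TrivSqZeroExt B M)).toLinearMap).compRight S ∘ₗ
        (multilinearCurryLeftEquiv S (fun _ : Fin 2 => TrivSqZeroExt B M)
          (TrivSqZeroExt B M)).toLinearMap ∘ₗ f.curryLeft)
      (inrS S B M) (inlS S B M)))

theorem evalTriple_tmul
    (f : MultilinearMap S (fun _ : Fin 3 => TrivSqZeroExt B M) (TrivSqZeroExt B M))
    (x : M) (b b' : B) :
    evalTriple f ((x ⊗ₜ b) ⊗ₜ b') =
      f ![TrivSqZeroExt.inr x, TrivSqZeroExt.inl b, TrivSqZeroExt.inl b'] := by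
  simp only [evalTriple, TensorProduct.lift.tmul]
  change f _ = f _
  congr 1
  funext i
  fin_cases i <;> rfl

variable (S B M L) in
theorem contractL_tmul (x : M) (l : L) (b : B) (ξ : Module.Dual S L) :
    contractL S B M L ((x ⊗ₜ l) ⊗ₜ (b ⊗ₜ ξ)) = ξ l • (x ⊗ₜ b) := by
  simp [contractL]

/-- `(γ ⊗ β ⊗ α) : Q^∨ ⊗ Q → M ⊗ B ⊗ B`, the factors `L` and `L^{-1}` being contracted. -/
def gammaBetaAlpha (𝓑 : ℕ → Submodule S B) (𝓜 : ℤ → Submodule S M) {n₁ n₂ : ℕ} {e : ℤ}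
    (γ : 𝓜 e ⊗[S] L) (β : Module.Dual S Q →ₗ[S] 𝓑 n₂ ⊗[S] Module.Dual S L)
    (α : Q →ₗ[S] 𝓑 n₁) : Module.Dual S Q ⊗[S] Q →ₗ[S] (M ⊗[S] B) ⊗[S] B :=
  TensorProduct.map (gammaBeta 𝓑 𝓜 γ β) ((𝓑 n₁).subtype ∘ₗ α)

end SquareZero

end SqZero

end

open scoped TensorProduct

noncomputable section

namespace SqZero

set_option linter.unusedSectionVars false


/-! ## Calculus of functions on words -/

section Words

variable {S A X Y : Type*} [CommRing S] [AddCommGroup A] [Module S A] [AddCommGroup X] [Module S X]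
  [AddCommGroup Y] [Module S Y]

/-! On the suspended words in `A`, an `A_∞`-structure is an odd coderivation of square zero, and an
`A_∞`-morphism is a coalgebra map that intertwines two such coderivations. The proof works with
functions `G` on words: `ins θ c G` is `G` composed with the coderivation with components `c`, and
`pull f G` is `G` composed with the coalgebra map with components `f`. After the letters are twisted
by powers of `σ` (`bar`), all Koszul signs reduce to applying `θ = -σ` to the letters left of an
insertion (`insertSum_eq_ins`, `composeSum_eq_pull`).

Part (3) is obstruction theory. If the relations hold up to `m_N`, the lowest component of the
defect is a normalized Hochschild cocycle with `N + 2` arguments and degree `1 - N`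
(`obstruction_mem_cocycles`); if it is a coboundary, an operation `m_{N+1}` can be added. Morphisms
behave in the same way, in degree `-N` (`morDefect_mem_cocycles`). Since `A` lives in the
homological degrees `0` and `d`, there are no cochains of degree `-r` unless `d` divides `r`. The
obstructions beyond degree `-d` therefore lie in `HH^2_{-md}` and `HH^3_{-md}` with `m ≥ 2`, which
vanish by (1). What remains is the cocycle `m_{d+2}`, which is arbitrary and matters only up to
coboundaries (`classification`).

For (1), a cochain of degree `-md` lives on words with `m` letters from `M` (values in `B`) or `m +
1` of them (values in `M`). Words with `m` letters from `M` that start with such a letter form, up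
to terms merging neighbouring blocks, the `m`-fold power of the bar complex `M ⊗ T(B₊)`. This is a
complex of projectives with projective homology, so it splits: there is a homotopy `s` between the
identity and a projection `π`, and `π` can be arranged to be non-zero only in length `d + 2` (the
letter from `M` included) and internal degree `0` (`exists_isBarSplitting`). A Künneth argument
contracts the `m`-fold power below length `m (d + 2)`: the tensor product homotopy has an error,
caused by a letter at the end of a block acting on the first letter of the next one; the error is
nilpotent for a filtration by block length and degree, and a geometric series removes it
(`exists_isContraction`).

A cocycle `f` is made to vanish by adding coboundaries `δ(f ∘ s)`. A word is written as `p u w` with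
`p` in `B`, `u` starting with the first of its `m` letters from `M`, and `w` either empty or
starting with the last letter from `M`; `s` acts on `u`. A weight is chosen such that every term of
`δ` other than the bar differential of `u` leads to smaller weight or to fewer letters from `M`
(`Vanish.hochD`). For empty `w` it is the length of `p` plus the internal degree; otherwise it is
the length of `p`, plus the number of letters of `w` after the first, plus `n₀` minus the degree of
that first letter. Negative weights are harmless because `B` is non-negatively graded and `M` is
bounded above (`vanish_zero`). One correction raises the weight below which `f` vanishes by one
(`Vanish.step`), and the infinite sum of corrections is locally finite (`exists_vanish`).

For (2) the same process with `m = 1` and `d + 2` arguments leaves only the values of the cocycle on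
`π u`, so a cocycle that vanishes on all bar cycles of degree `0` is a coboundary
(`mem_coboundaries_of_evalBar`). Its values on such cycles lie in `B_0 = S` and depend only on the
two classes (`exists_evaluation`). In (4) the conditions on `α`, `β`, `γ` say that the triple tensor
is a bar cycle. If the value `1` is attained at its class, evaluation there is a surjection from the
dual of the invertible module `P^r` onto `S`, hence an isomorphism. -/

/-- The sum of `H v r` over all ways to write `l = v ++ r`. -/
def splitSum (H : List A → List A → X) (l : List A) : X :=
  ∑ i ∈ Finset.range (l.length + 1), H (l.take i) (l.drop i)

@[simp] theorem splitSum_nil (H : List A → List A → X) : splitSum H [] = H [] [] := by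
  simp [splitSum]

theorem splitSum_cons (H : List A → List A → X) (a : A) (w : List A) :
    splitSum H (a :: w) = H [] (a :: w) + splitSum (fun v r => H (a :: v) r) w := by
  simp only [splitSum, List.length_cons]
  rw [Finset.sum_range_succ', add_comm]
  simp

theorem splitSum_congr {H K : List A → List A → X} {l : List A}
    (h : ∀ v r, v ++ r = l → H v r = K v r) : splitSum H l = splitSum K l :=
  Finset.sum_congr rfl fun i _ => h _ _ (List.take_append_drop i l)

theorem splitSum_add (H K : List A → List A → X) (l : List A) :
    splitSum (fun v r => H v r + K v r) l = splitSum H l + splitSum K l :=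
  Finset.sum_add_distrib

theorem splitSum_eq_zero {H : List A → List A → X} {l : List A}
    (h : ∀ v r, v ++ r = l → H v r = 0) : splitSum H l = 0 :=
  Finset.sum_eq_zero fun i _ => h _ _ (List.take_append_drop i l)

theorem map_splitSum {F : Type*} [FunLike F X Y] [AddMonoidHomClass F X Y] (φ : F)
    (H : List A → List A → X) (l : List A) :
    φ (splitSum H l) = splitSum (fun v r => φ (H v r)) l :=
  map_sum φ _ _

/-- Coassociativity of deconcatenation: both sides run over the factorizations of `l` into three
words. -/
theorem splitSum_assoc (K : List A → List A → List A → X) (l : List A) :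
    splitSum (fun v r => splitSum (fun v₁ v₂ => K v₁ v₂ r) v) l =
      splitSum (fun v₁ r => splitSum (fun v₂ r' => K v₁ v₂ r') r) l := by
  induction l generalizing K with
  | nil => simp
  | cons a w ih =>
    rw [splitSum_cons, splitSum_cons]
    simp only [splitSum_cons, splitSum_nil, splitSum_add]
    rw [ih (fun v₁ v₂ r => K (a :: v₁) v₂ r), add_assoc]

variable (S) in
/-- Functions on words which are linear in every letter. -/
structure IsML (G : List A → X) : Prop where
  add : ∀ u x y r, G (u ++ (x + y) :: r) = G (u ++ x :: r) + G (u ++ y :: r)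
  smul : ∀ u (c : S) x r, G (u ++ (c • x) :: r) = c • G (u ++ x :: r)

namespace IsML

variable {G : List A → X}

theorem zero_mid (hG : IsML S G) (u r : List A) : G (u ++ 0 :: r) = 0 := by
  have := hG.smul u 0 0 r
  simpa using this

theorem neg_mid (hG : IsML S G) (u : List A) (x : A) (r : List A) :
    G (u ++ (-x) :: r) = - G (u ++ x :: r) := by
  have := hG.smul u (-1) x r
  simpa using this

/-- Fixing the first letters of the argument. -/
theorem append_left (hG : IsML S G) (v : List A) : IsML S (fun l => G (v ++ l)) :=
  ⟨fun u x y r => by simpa using hG.add (v ++ u) x y r,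
    fun u c x r => by simpa using hG.smul (v ++ u) c x r⟩

theorem cons (hG : IsML S G) (a : A) : IsML S (fun l => G (a :: l)) := hG.append_left [a]

/-- The linear dependence on the first letter. -/
def headLin (hG : IsML S G) (r : List A) : A →ₗ[S] X where
  toFun x := G (x :: r)
  map_add' x y := hG.add [] x y r
  map_smul' c x := hG.smul [] c x r

theorem zero_head (hG : IsML S G) (r : List A) : G (0 :: r) = 0 := hG.zero_mid [] r

theorem neg_head (hG : IsML S G) (x : A) (r : List A) : G ((-x) :: r) = - G (x :: r) :=
  hG.neg_mid [] x r

end IsML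

/-- `(a₀, …, a_{n-1}) ↦ ∑ G (θ u, c v, w)` over all ways to write the word as `u ++ v ++ w`. -/
def ins (θ : A → A) (c : List A → A) : (List A → X) → List A → X
  | _, [] => 0
  | G, a :: w => splitSum (fun v r => G (c v :: r)) (a :: w) + ins θ c (fun l => G (θ a :: l)) w

variable (θ : A → A) (c : List A → A)

@[simp] theorem ins_nil (G : List A → X) : ins θ c G [] = 0 := by simp [ins]

theorem ins_cons (G : List A → X) (a : A) (w : List A) :
    ins θ c G (a :: w) =
      splitSum (fun v r => G (c v :: r)) (a :: w) + ins θ c (fun l => G (θ a :: l)) w := by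
  rw [ins]

/-- The hypothesis only concerns the words that actually occur, so that constraints on the lengths
of `u`, `v`, `w` are available when it is checked. -/
theorem ins_congr' {G G' : List A → X} {l : List A}
    (h : ∀ u v w, u ++ v ++ w = l → G (u.map θ ++ c v :: w) = G' (u.map θ ++ c v :: w)) :
    ins θ c G l = ins θ c G' l := by
  induction l generalizing G G' with
  | nil => simp
  | cons a w ih =>
    rw [ins_cons, ins_cons]
    congr 1
    · exact splitSum_congr fun v r hvr => by simpa using h [] v r (by simpa using hvr)
    · exact ih fun u v r hl => by simpa using h (a :: u) v r (by simpa using hl)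

theorem ins_congr {G G' : List A → X} (h : ∀ l, l ≠ [] → G l = G' l) (l : List A) :
    ins θ c G l = ins θ c G' l :=
  ins_congr' θ c fun _ _ _ _ => h _ (by simp)

theorem ins_eq_zero {G : List A → X} {l : List A}
    (h : ∀ u v w, u ++ v ++ w = l → G (u.map θ ++ c v :: w) = 0) :
    ins θ c G l = 0 := by
  induction l generalizing G with
  | nil => simp
  | cons a w ih =>
    rw [ins_cons, splitSum_eq_zero, ih, add_zero]
    · exact fun u v r hl => by simpa using h (a :: u) v r (by simpa using hl)
    · exact fun v r hvr => by simpa using h [] v r (by simpa using hvr)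

theorem ins_add (G G' : List A → X) (l : List A) :
    ins θ c (fun l => G l + G' l) l = ins θ c G l + ins θ c G' l := by
  induction l generalizing G G' with
  | nil => simp
  | cons a w ih => simp only [ins_cons, ih, splitSum_add]; abel

theorem map_ins {F : Type*} [FunLike F X Y] [AddMonoidHomClass F X Y] (φ : F) (G : List A → X)
    (l : List A) : φ (ins θ c G l) = ins θ c (fun l => φ (G l)) l := by
  induction l generalizing G with
  | nil => simp
  | cons a w ih => simp only [ins_cons, map_add, map_splitSum, ih]

theorem ins_neg (G : List A → X) (l : List A) :
    ins θ c (fun l => - G l) l = - ins θ c G l :=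
  (map_ins θ c (-AddMonoidHom.id X) G l).symm

theorem ins_sub (G G' : List A → X) (l : List A) :
    ins θ c (fun l => G l - G' l) l = ins θ c G l - ins θ c G' l := by
  simp only [sub_eq_add_neg, ins_add, ins_neg]

/-- `ins` is a coderivation. -/
theorem ins_splitSum (hc : c [] = 0) (H : List A → List A → X)
    (hH : ∀ u v r, H (u ++ 0 :: v) r = 0) (l : List A) :
    ins θ c (splitSum H) l = splitSum (fun v r => ins θ c (fun v' => H v' r) v +
      ins θ c (fun r' => H (v.map θ) r') r) l := by
  induction l generalizing H with
  | nil => simp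
  | cons a w ih =>
    -- Inserting at the head and then cutting is compared with cutting and then inserting at the
    -- head of the left piece. They differ by an empty left piece, whose term vanishes because of `c
    -- [] = 0`.
    have key := splitSum_assoc (fun v₁ v₂ r => H (c v₁ :: v₂) r) (a :: w)
    rw [splitSum_cons, splitSum_nil, hc, show H [0] (a :: w) = 0 from hH [] [] _, zero_add] at key
    have e1 : splitSum (fun v r => splitSum H (c v :: r)) (a :: w) =
        splitSum (fun v r => H [] (c v :: r)) (a :: w) +
          splitSum (fun v r => splitSum (fun v₂ r' => H (c v :: v₂) r') r) (a :: w) := by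
      rw [← splitSum_add]; exact splitSum_congr fun v r _ => splitSum_cons _ _ _
    have e2 : ins θ c (fun l => splitSum H (θ a :: l)) w =
        ins θ c (fun l => H [] (θ a :: l)) w +
          ins θ c (splitSum (fun v r => H (θ a :: v) r)) w := by
      rw [← ins_add]; exact ins_congr' _ _ fun _ _ _ _ => splitSum_cons _ _ _
    rw [ins_cons, splitSum_cons (fun v r => ins θ c (fun v' => H v' r) v +
      ins θ c (fun r' => H (v.map θ) r') r), ins_nil, zero_add, e1, e2, ← key,
      ih (fun v r => H (θ a :: v) r) (fun u v r => hH (θ a :: u) v r), List.map_nil, ins_cons]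
    simp only [ins_cons, List.map_cons, splitSum_add]
    abel

/-- By the coderivation rule, the first insertion takes place either inside the piece that the
second `c` consumes, or to the right of it. In the latter case the consumed piece carries `θ`, and
`c (v.map θ) = - θ (c v)` makes these terms cancel against the second summand. -/
theorem ins_ins_aux {θ : A → A} {c : List A → A} (hc : c [] = 0) (hcl : IsML S c)
    (hθc : ∀ l, c (l.map θ) = - θ (c l)) {G : List A → X} (hG : IsML S G) (l : List A) :
    ins θ c (fun l => splitSum (fun v r => G (c v :: r)) l) l +
      splitSum (fun v r => ins θ c (fun r' => G (θ (c v) :: r')) r) l =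
      splitSum (fun v r => G (ins θ c c v :: r)) l := by
  have := ins_splitSum θ c hc (fun v r => G (c v :: r))
    (fun u v r => by simp only [hcl.zero_mid, hG.zero_head]) l
  rw [show (fun l => splitSum (fun v r => G (c v :: r)) l) =
    splitSum (fun v r => G (c v :: r)) from rfl, this, ← splitSum_add]
  refine splitSum_congr fun v r _ => ?_
  have h1 : ins θ c (fun v' => G (c v' :: r)) v = G (ins θ c c v :: r) :=
    (map_ins θ c (hG.headLin r) c v).symm
  have h2 : ins θ c (fun r' => G (c (v.map θ) :: r')) r =
      - ins θ c (fun r' => G (θ (c v) :: r')) r := by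
    rw [← ins_neg]; exact ins_congr' _ _ fun _ _ _ _ => by rw [hθc, hG.neg_head]
  rw [h1, h2]; abel

/-- The square of the coderivation with components `c` has the components `ins θ c c`. -/
theorem ins_ins {θ : A → A} {c : List A → A} (hθ : ∀ a, θ (θ a) = a) (hc : c [] = 0)
    (hcl : IsML S c) (hθc : ∀ l, c (l.map θ) = - θ (c l)) {G : List A → X} (hG : IsML S G)
    (l : List A) :
    ins θ c (ins θ c G) l = ins id (ins θ c c) G l := by
  induction l generalizing G with
  | nil => simp
  | cons a w ih =>
    have key := ins_ins_aux hc hcl hθc hG (a :: w)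
    rw [ins_cons] at key
    rw [ins_cons, ins_cons id, ← key, id_eq, ← ih (hG.cons a)]
    have e1 : splitSum (fun v r => ins θ c G (c v :: r)) (a :: w) =
        splitSum (fun v r => splitSum (fun v r => G (c v :: r)) (c v :: r)) (a :: w) +
          splitSum (fun v r => ins θ c (fun r' => G (θ (c v) :: r')) r) (a :: w) := by
      rw [← splitSum_add]; exact splitSum_congr fun v r _ => ins_cons _ _ _ _ _
    -- The letter `a` is passed by both insertions and picks up `θ` twice, whence the untwisted `id`
    -- in the result.
    have e2 : ins θ c (fun l => ins θ c G (θ a :: l)) w =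
        ins θ c (fun l => splitSum (fun v r => G (c v :: r)) (θ a :: l)) w +
          ins θ c (fun l => ins θ c (fun r => G (a :: r)) l) w := by
      rw [← ins_add]; exact ins_congr' _ _ fun _ _ _ _ => by rw [ins_cons, hθ]
    rw [e1, e2]
    abel

/-! ### Morphisms -/

/-- `(a₀, …, a_{n-1}) ↦ ∑ G (f v₁, …, f v_k)` over all ways to write the word as
`v₁ ++ … ++ v_k` with non-empty `v_i`. -/
def pull (f : List A → A) : (List A → X) → List A → X
  | G, [] => G []
  | G, a :: w => ∑ i ∈ Finset.range (w.length + 1),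
      pull f (fun l => G (f (a :: w.take i) :: l)) (w.drop i)
termination_by _ l => l.length
decreasing_by simp

/-- `(a₀, …, a_{n-1}) ↦ ∑ G (θ (f v₁), …, θ (f v_{i-1}), e v_i, f v_{i+1}, …, f v_k)` over all `i`
and all ways to write the word as `v₁ ++ … ++ v_k` with non-empty `v_i`. -/
def pullDer (θ : A → A) (f e : List A → A) : (List A → X) → List A → X
  | _, [] => 0
  | G, a :: w => ∑ i ∈ Finset.range (w.length + 1),
      (pull f (fun l => G (e (a :: w.take i) :: l)) (w.drop i) +
        pullDer θ f e (fun l => G (θ (f (a :: w.take i)) :: l)) (w.drop i))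
termination_by _ l => l.length
decreasing_by simp

variable (f e : List A → A)

@[simp] theorem pull_nil (G : List A → X) : pull f G [] = G [] := by rw [pull]

theorem pull_cons (G : List A → X) (a : A) (w : List A) :
    pull f G (a :: w) = splitSum (fun v r => pull f (fun l => G (f (a :: v) :: l)) r) w := by
  rw [pull, splitSum]

@[simp] theorem pullDer_nil (G : List A → X) : pullDer θ f e G [] = 0 := by rw [pullDer]

theorem pullDer_cons (G : List A → X) (a : A) (w : List A) :
    pullDer θ f e G (a :: w) = splitSum (fun v r => pull f (fun l => G (e (a :: v) :: l)) r +
      pullDer θ f e (fun l => G (θ (f (a :: v)) :: l)) r) w := by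
  rw [pullDer, splitSum]

theorem length_le_of_append {v r w : List A} (h : v ++ r = w) : r.length ≤ w.length := by
  subst h; simp

theorem pull_congr {G G' : List A → X} (h : ∀ l, G l = G' l) (l : List A) :
    pull f G l = pull f G' l := by
  rw [funext h]

theorem map_pull {F : Type*} [FunLike F X Y] [AddMonoidHomClass F X Y] (φ : F) (G : List A → X)
    (l : List A) : φ (pull f G l) = pull f (fun l => φ (G l)) l := by
  induction hn : l.length using Nat.strong_induction_on generalizing G l with
  | _ n ih =>
    cases l with
    | nil => simp
    | cons a w =>
      rw [pull_cons, pull_cons, map_splitSum]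
      exact splitSum_congr fun v r hvr => ih r.length
        (by have := length_le_of_append hvr; simp at hn; omega) _ _ rfl

/-- Additivity is a consequence of naturality in the target: apply `map_pull` to the two projections
of `X × X` and to their sum. -/
theorem pull_add (G G' : List A → X) (l : List A) :
    pull f (fun l => G l + G' l) l = pull f G l + pull f G' l := by
  have h := map_pull f (AddMonoidHom.fst X X + AddMonoidHom.snd X X) (fun l => (G l, G' l)) l
  have h1 := map_pull f (AddMonoidHom.fst X X) (fun l => (G l, G' l)) l
  have h2 := map_pull f (AddMonoidHom.snd X X) (fun l => (G l, G' l)) l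
  simp only [AddMonoidHom.add_apply, AddMonoidHom.coe_fst, AddMonoidHom.coe_snd] at h h1 h2
  rw [← h, h1, h2]

theorem pull_zero (l : List A) : pull f (fun _ => (0 : X)) l = 0 := by
  simpa using (map_pull f (0 : X →+ X) (fun _ => (0 : X)) l).symm

/-- The empty first block may be admitted because its contribution contains the letter `f [] = 0`.
In this form `pull` is a sum over cuts, to which the coderivation rule applies. -/
theorem pull_eq_splitSum {f : List A → A} (hf : f [] = 0) {G : List A → X}
    (hG : ∀ r, G (0 :: r) = 0) {l : List A} (hl : l ≠ []) :
    pull f G l = splitSum (fun v r => pull f (fun l => G (f v :: l)) r) l := by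
  cases l with
  | nil => exact absurd rfl hl
  | cons a w => rw [splitSum_cons, pull_cons, hf, pull_congr f hG, pull_zero, zero_add]

/-- `pull` is a morphism of coalgebras. -/
theorem pull_splitSum (H : List A → List A → X) (l : List A) :
    pull f (splitSum H) l =
      splitSum (fun v r => pull f (fun v' => pull f (fun r' => H v' r') r) v) l := by
  induction hn : l.length using Nat.strong_induction_on generalizing H l with
  | _ n ih =>
    cases l with
    | nil => simp
    | cons a w =>
      rw [pull_cons, splitSum_cons, pull_nil, pull_cons]
      simp only [pull_cons]
      rw [splitSum_assoc (fun v₀ v₁ r =>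
        pull f (fun v' => pull f (fun r' => H (f (a :: v₀) :: v') r') r) v₁), ← splitSum_add]
      refine splitSum_congr fun v r hvr => ?_
      rw [← ih r.length (by have := length_le_of_append hvr; simp at hn; omega)
        (fun v' r' => H (f (a :: v) :: v') r') r rfl, ← pull_add]
      exact pull_congr _ (fun l => splitSum_cons _ _ _) _

/-- The linear dependence of `pull f G` on an additional first letter. -/
def pullHead {G : List A → X} (hG : IsML S G) (r : List A) : A →ₗ[S] X where
  toFun x := pull f (fun l => G (x :: l)) r
  map_add' x y := by
    rw [← pull_add]; exact pull_congr _ (fun l => hG.add [] x y l) _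
  map_smul' c x := by
    have := map_pull f (LinearMap.lsmul S X c) (fun l => G (x :: l)) r
    simp only [LinearMap.lsmul_apply] at this
    rw [RingHom.id_apply, this]
    exact pull_congr _ (fun l => hG.smul [] c x l) _

/-- The failure of `pull f` to intertwine the coderivations with components `μ` and `ν`. -/
theorem ins_pull {θ : A → A} {f μ ν : List A → A} (hμ : μ [] = 0) (hf : f [] = 0) (hfl : IsML S f)
    (hθf : ∀ l, f (l.map θ) = θ (f l)) (hν : ν [] = 0)
    {G : List A → X} (hG : IsML S G) (l : List A) :
    ins θ μ (pull f G) l = pull f (ins θ ν G) l +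
      pullDer θ f (fun l => ins θ μ f l - pull f ν l) G l := by
  induction hn : l.length using Nat.strong_induction_on generalizing G l with
  | _ n ih =>
    cases l with
    | nil => simp
    | cons a w =>
      have e0 : ins θ μ (pull f G) (a :: w) =
          ins θ μ (splitSum fun v r => pull f (fun l => G (f v :: l)) r) (a :: w) :=
        ins_congr _ _ (fun l hl => pull_eq_splitSum hf hG.zero_head hl) _
      have e1 : pull f (fun l => splitSum (fun v r => G (ν v :: r)) l) (a :: w) =
          splitSum (fun v r => pull f (fun l => G (pull f ν (a :: v) :: l)) r) w := by
        have e1 := pull_splitSum f (fun v r => G (ν v :: r)) (a :: w)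
        rw [splitSum_cons, pull_nil, hν, pull_congr f hG.zero_head, pull_zero, zero_add] at e1
        exact e1.trans (splitSum_congr fun v r _ => (map_pull f (pullHead f hG r) ν (a :: v)).symm)
      rw [e0, ins_splitSum _ _ hμ, splitSum_cons, List.map_nil, hf]
      · have z : ∀ l, pull f (fun l => G (0 :: l)) l = 0 := fun l => by
          rw [pull_congr f hG.zero_head, pull_zero]
        rw [ins_nil, zero_add, ins_eq_zero _ _ (fun u v w _ => z _), zero_add, pull_cons,
          pullDer_cons]
        rw [pull_cons] at e1
        have e2 : splitSum (fun v r => pull f (fun l => ins θ ν G (f (a :: v) :: l)) r) w =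
            splitSum (fun v r => pull f (fun l => G (pull f ν (a :: v) :: l)) r +
              pull f (fun l => ins θ ν (fun l => G (θ (f (a :: v)) :: l)) l) r) w := by
          rw [splitSum_add, ← e1, ← splitSum_add]
          refine splitSum_congr fun v r _ => ?_
          rw [← pull_add]
          exact pull_congr _ (fun l => ins_cons _ _ _ _ _) _
        rw [e2, ← splitSum_add]
        refine splitSum_congr fun v r hvr => ?_
        have h1 : ins θ μ (fun v' => pull f (fun l => G (f v' :: l)) r) (a :: v) =
            pull f (fun l => G (ins θ μ f (a :: v) :: l)) r :=
          (map_ins θ μ (pullHead f hG r) f (a :: v)).symm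
        -- Here the insertion takes place to the right of the first block, which only leaves the
        -- fixed letter `θ (f (a :: v))` in front.
        have h2 := ih r.length (by have := length_le_of_append hvr; simp at hn; omega)
          (hG.cons (θ (f (a :: v)))) r rfl
        have h3 : pull f (fun l => G ((ins θ μ f (a :: v) - pull f ν (a :: v)) :: l)) r =
          pull f (fun l => G (ins θ μ f (a :: v) :: l)) r -
            pull f (fun l => G (pull f ν (a :: v) :: l)) r := map_sub (pullHead f hG r) _ _
        rw [h1, hθf, h2, h3]
        abel
      · intro u v r
        rw [hfl.zero_mid, pull_congr f hG.zero_head, pull_zero]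

end Words


/-! ### Closed formulas: insertions as sums over antidiagonals, `pull` as a sum over compositions.
-/

section ClosedForms

variable {S A X : Type*} [CommRing S] [AddCommGroup A] [Module S A] [AddCommGroup X] [Module S X]

theorem splitSum_eq_antidiagonal (H : List A → List A → X) (l : List A) (n : ℕ)
    (hn : l.length = n) :
    splitSum H l = ∑ q ∈ Finset.HasAntidiagonal.antidiagonal n, H (l.take q.1) (l.drop q.1) := by
  rw [splitSum, hn, Finset.Nat.sum_antidiagonal_eq_sum_range_succ_mk]

/-- The recursion for `ins` omits the insertion of the empty word at the very end, which the
antidiagonal includes. The hypotheses on `c []` and on `G (u ++ [0])` make that term zero. -/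
theorem ins_eq_sum {θ : A → A} {c : List A → A} (hc : c [] = 0) {G : List A → X}
    (hG : ∀ u, G (u ++ [0]) = 0) (l : List A) (n : ℕ) (hn : l.length = n) :
    ins θ c G l = ∑ p ∈ Finset.HasAntidiagonal.antidiagonal n, ∑ q ∈ Finset.HasAntidiagonal.antidiagonal p.2,
      G ((l.take p.1).map θ ++ c ((l.drop p.1).take q.1) :: (l.drop p.1).drop q.1) := by
  induction l generalizing G n with
  | nil => subst hn; simpa [hc] using (hG []).symm
  | cons a w ih =>
    subst hn
    rw [ins_cons, List.length_cons, Finset.Nat.antidiagonal_succ, Finset.sum_cons, Finset.sum_map,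
      splitSum_eq_antidiagonal _ _ _ rfl, ih (fun u => hG (θ a :: u)) _ rfl]
    simp

/-- Prepending a block to a composition. -/
def consComp {n : ℕ} (x : Σ i : Fin (n + 1), Composition (n - i)) : Composition (n + 1) where
  blocks := (x.1 + 1) :: x.2.blocks
  blocks_pos := by
    intro i hi
    rcases List.mem_cons.1 hi with rfl | hi
    · omega
    · exact x.2.blocks_pos hi
  blocks_sum := by
    have := x.1.2
    rw [List.sum_cons, x.2.blocks_sum]; omega

theorem consComp_bijective (n : ℕ) : Function.Bijective (consComp (n := n)) := by
  constructor
  · rintro ⟨i, c⟩ ⟨j, c'⟩ h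
    have h := congrArg Composition.blocks h
    simp only [consComp, List.cons.injEq, Nat.add_right_cancel_iff] at h
    obtain rfl : i = j := Fin.ext h.1
    obtain rfl : c = c' := Composition.ext h.2
    rfl
  · intro c
    rcases hb : c.blocks with _ | ⟨b, bs⟩
    · have := c.blocks_eq_nil.1 hb; omega
    · have hs := c.blocks_sum
      rw [hb, List.sum_cons] at hs
      have hp : 0 < b := c.blocks_pos (by simp [hb])
      refine ⟨⟨⟨b - 1, by omega⟩, ⟨bs, fun hi => c.blocks_pos (by simp [hb, hi]), ?_⟩⟩, ?_⟩
      · simp only; omega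
      · refine Composition.ext ?_
        simp only [consComp, hb, List.cons.injEq, and_true]
        omega

theorem pull_eq_sum (f : List A → A) (G : List A → X) (l : List A) (n : ℕ) (hn : l.length = n) :
    pull f G l = ∑ c : Composition n, G ((l.splitWrtComposition c).map f) := by
  induction n using Nat.strong_induction_on generalizing G l with
  | _ n ih =>
    cases l with
    | nil =>
      subst hn
      have h : ∀ c : Composition ([] : List A).length, c = Composition.ones 0 := fun c =>
        Composition.ext (by rw [c.blocks_eq_nil.2 rfl]; rfl)
      rw [pull_nil]
      have := Fintype.sum_eq_single (f := fun c : Composition ([] : List A).length =>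
        G ((([] : List A).splitWrtComposition c).map f)) (Composition.ones 0)
        (fun c hc => absurd (h c) hc)
      exact this.symm
    | cons a w =>
      subst hn
      rw [List.length_cons, ← (consComp_bijective w.length).sum_comp, Fintype.sum_sigma, pull,
        Finset.sum_range]
      refine Finset.sum_congr rfl fun i _ => ?_
      rw [ih (w.length - i) (by simp) _ (w.drop i) (by simp)]
      refine Finset.sum_congr rfl fun c _ => ?_
      simp [List.splitWrtComposition, consComp, List.splitWrtCompositionAux_cons]

end ClosedForms

/-! ### Suspension: the signs of the `A_∞`-relations absorbed into twisted words. -/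

section BarForm

variable {S A : Type*} [CommRing S] [Ring A] [Algebra S A] {σ : A →ₗ[S] A}

theorem sigma_pow_congr (hσ : ∀ a, σ (σ a) = a) {i j : ℕ} (h : i % 2 = j % 2) : σ ^ i = σ ^ j := by
  have h2 : σ ^ 2 = 1 := by ext a; simp [pow_two, hσ]
  rw [← Nat.div_add_mod i 2, ← Nat.div_add_mod j 2, pow_add, pow_add, pow_mul, pow_mul, h2, h,
    one_pow, one_pow]

theorem sigma_pow_sigma_pow (hσ : ∀ a, σ (σ a) = a) {i j k : ℕ} (h : (i + j) % 2 = k % 2) (a : A) :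
    (σ ^ i) ((σ ^ j) a) = (σ ^ k) a := by
  rw [← Module.End.mul_apply, ← pow_add, sigma_pow_congr hσ h]

/-- The components of the coderivation or coalgebra morphism attached to a family of multilinear
maps, as a function on words: the suspension is taken into account by powers of `σ`. -/
def bar (σ : A →ₗ[S] A) (m : (n : ℕ) → MultilinearMap S (fun _ : Fin n => A) A) (l : List A) : A :=
  m l.length (fun i => (σ ^ (l.length - 1 - i.val)) (l.getD i.val 0))

/-- The word `(σ^{n-1} a₀, σ^{n-2} a₁, …, a_{n-1})`. -/
def twist (σ : A →ₗ[S] A) (n : ℕ) (a : ℕ → A) : List A :=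
  List.ofFn (fun i : Fin n => (σ ^ (n - 1 - i.val)) (a i.val))

@[simp] theorem length_twist (n : ℕ) (a : ℕ → A) : (twist σ n a).length = n := by simp [twist]

theorem getD_twist {n : ℕ} (a : ℕ → A) {i : ℕ} (hi : i < n) :
    (twist σ n a).getD i 0 = (σ ^ (n - 1 - i)) (a i) := by
  rw [List.getD_eq_getElem _ _ (by simpa using hi)]
  simp [twist]

theorem bar_eq (m : (n : ℕ) → MultilinearMap S (fun _ : Fin n => A) A) (l : List A) (n : ℕ)
    (hn : l.length = n) :
    bar σ m l = m n (fun i => (σ ^ (n - 1 - i.val)) (l.getD i.val 0)) := by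
  subst hn; rfl

theorem bar_twist (hσ : ∀ a, σ (σ a) = a) (m : (n : ℕ) → MultilinearMap S (fun _ : Fin n => A) A)
    (n : ℕ) (a : ℕ → A) : bar σ m (twist σ n a) = m n (fun i => a i.val) := by
  rw [bar_eq m _ n (by simp)]
  congr 1
  funext i
  rw [getD_twist a i.2, sigma_pow_sigma_pow hσ (k := 0) (by omega)]
  simp

theorem isML_bar (m : (n : ℕ) → MultilinearMap S (fun _ : Fin n => A) A) : IsML S (bar σ m) := by
  have key : ∀ (u : List A) (x : A) (r : List A), bar σ m (u ++ x :: r) =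
      m (u.length + 1 + r.length) (Function.update (fun i => (σ ^ (u.length + r.length - i.val))
        ((u ++ 0 :: r).getD i.val 0)) ⟨u.length, by omega⟩ ((σ ^ r.length) x)) := by
    intro u x r
    rw [bar_eq m _ (u.length + 1 + r.length) (by simp; omega)]
    congr 1
    funext i
    by_cases hi : i = ⟨u.length, by omega⟩
    · subst hi
      rw [Function.update_self]
      rw [List.getD_append_right _ _ _ _ le_rfl, Nat.sub_self, List.getD_cons_zero]
      congr 2; show _ - 1 - u.length = _; omega
    · rw [Function.update_of_ne hi]
      have hi' : i.val ≠ u.length := fun h => hi (Fin.ext h)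
      rw [show u.length + 1 + r.length - 1 - i.val = u.length + r.length - i.val by omega]
      congr 1
      · rcases lt_or_gt_of_ne hi' with h | h
        · rw [List.getD_append _ _ _ _ h, List.getD_append _ _ _ _ h]
        · rw [List.getD_append_right _ _ _ _ h.le, List.getD_append_right _ _ _ _ h.le]
          obtain ⟨k, hk⟩ : ∃ k, i.val - u.length = k + 1 := ⟨i.val - u.length - 1, by omega⟩
          rw [hk, List.getD_cons_succ, List.getD_cons_succ]
  constructor
  · intro u x y r
    rw [key, key, key, map_add, MultilinearMap.map_update_add]
  · intro u c x r
    rw [key, key, map_smul, MultilinearMap.map_update_smul]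

theorem sigma_pow_apply {m : (n : ℕ) → MultilinearMap S (fun _ : Fin n => A) A} {n e : ℕ}
    (hm : ∀ a, σ (m n a) = (-1 : S) ^ e • m n (fun i => σ (a i))) (t : ℕ) (a : Fin n → A) :
    (σ ^ t) (m n a) = (-1 : S) ^ (t * e) • m n (fun i => (σ ^ t) (a i)) := by
  induction t generalizing a with
  | zero => simp
  | succ t ih =>
    rw [pow_succ, Module.End.mul_apply, hm, map_smul, ih, smul_smul, ← pow_add]
    simp only [Module.End.mul_apply]
    congr 2; ring

/-- The `r` letters on the left carry `-σ`; together with the twists before and after the insertion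
this gives `(-1)^r` and, modulo `σ² = 1`, the Koszul factor `σ^s`. The inserted value is twisted by
`σ^t`, and moving `σ^t` through `m_s` produces `(-1)^{st}` and undoes the twist of its arguments.
The letters on the right keep their twist. -/
theorem insertSum_eq_ins (hσ : ∀ a, σ (σ a) = a)
    {g m : (n : ℕ) → MultilinearMap S (fun _ : Fin n => A) A}
    (hm0 : m 0 = 0) (hm : ∀ n a, σ (m n a) = (-1 : S) ^ n • m n (fun i => σ (a i)))
    (n : ℕ) (a : ℕ → A) :
    insertSum σ g m n a = ins (fun x => - σ x) (bar σ m) (bar σ g) (twist σ n a) := by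
  rw [ins_eq_sum (by simp [bar_eq m [] 0 rfl, hm0]) (fun u => (isML_bar g).zero_mid u []) _ n (by simp), insertSum]
  refine Finset.sum_congr rfl fun p hp => Finset.sum_congr rfl fun q hq => ?_
  obtain ⟨r, k⟩ := p
  obtain ⟨s, t⟩ := q
  simp only [Finset.HasAntidiagonal.mem_antidiagonal] at hp hq
  subst hq
  subst hp
  simp only
  rw [bar_eq g _ (r + 1 + t) (by simp; omega)]
  have hb : bar σ m (List.take s (List.drop r (twist σ (r + (s + t)) a))) =
      m s (fun l => (σ ^ t) (a (r + l.val))) := by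
    rw [bar_eq m _ s (by simp)]
    congr 1
    funext l
    have : (List.take s (List.drop r (twist σ (r + (s + t)) a))).getD l.val 0 =
        (twist σ (r + (s + t)) a).getD (r + l.val) 0 := by
      simp only [List.getD_eq_getElem?_getD, List.getElem?_take, List.getElem?_drop, l.2, if_true]
    rw [this, getD_twist a (by omega), sigma_pow_sigma_pow hσ (k := t) (by omega)]
  have key : (fun i : Fin (r + 1 + t) => (σ ^ (r + 1 + t - 1 - i.val))
      ((List.map (fun x => -σ x) (List.take r (twist σ (r + (s + t)) a)) ++
        bar σ m (List.take s (List.drop r (twist σ (r + (s + t)) a))) ::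
          List.drop s (List.drop r (twist σ (r + (s + t)) a))).getD i.val 0)) =
      fun i => (if i.val < r then (-1 : S) else if i.val = r then (-1) ^ (s * t) else 1) •
        (if i.val < r then (σ ^ s) (a i.val)
        else if i.val = r then m s (fun l => a (r + l.val))
        else a (i.val - 1 + s)) := by
    funext i
    obtain ⟨i, hi⟩ := i
    simp only
    split_ifs with h1 h2
    · have : (List.map (fun x => -σ x) (List.take r (twist σ (r + (s + t)) a)) ++
        bar σ m (List.take s (List.drop r (twist σ (r + (s + t)) a))) ::
          List.drop s (List.drop r (twist σ (r + (s + t)) a))).getD i 0 =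
          - σ ((twist σ (r + (s + t)) a).getD i 0) := by
        rw [List.getD_append _ _ _ _ (by simp; omega)]
        simp only [List.getD_eq_getElem?_getD, List.getElem?_map, List.getElem?_take, h1, if_true]
        rw [List.getElem?_eq_getElem (by simp; omega)]
        simp
      rw [this, getD_twist a (by omega), map_neg, neg_one_smul]
      rw [← Module.End.mul_apply, ← Module.End.mul_apply, ← pow_succ, ← pow_add,
        sigma_pow_congr hσ (j := s) (by omega)]
    · subst h2
      rw [List.getD_append_right _ _ _ _ (by simp), hb]
      have : i - (List.map (fun x => -σ x) (List.take i (twist σ (i + (s + t)) a))).length = 0 := by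
        simp
      rw [this, List.getD_cons_zero, sigma_pow_apply (hm s)]
      have h3 : i + 1 + t - 1 - i = t := by omega
      rw [h3, mul_comm s t]
      congr 2
      funext l
      rw [sigma_pow_sigma_pow hσ (k := 0) (by omega)]; simp
    · rw [List.getD_append_right _ _ _ _ (by simp; omega)]
      have : i - (List.map (fun x => -σ x) (List.take r (twist σ (r + (s + t)) a))).length =
          (i - r - 1) + 1 := by
        simp; omega
      rw [this, List.getD_cons_succ]
      have h4 : (List.drop s (List.drop r (twist σ (r + (s + t)) a))).getD (i - r - 1) 0 =
          (twist σ (r + (s + t)) a).getD (i - 1 + s) 0 := by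
        simp only [List.getD_eq_getElem?_getD, List.getElem?_drop]
        congr 2; omega
      rw [h4, getD_twist a (by omega), sigma_pow_sigma_pow hσ (k := 0) (by omega)]
      simp
  rw [key, MultilinearMap.map_smul_univ]
  congr 1
  rw [pow_add]
  have hp : ∀ (r t : ℕ) (z : S), (∏ i : Fin (r + 1 + t),
      (if i.val < r then (-1 : S) else if i.val = r then z else 1)) = (-1) ^ r * z := by
    intro r t z
    rw [Fin.prod_univ_add, Fin.prod_univ_castSucc]
    have h : ∀ x : Fin t, ¬ (r + 1 + x.val < r) ∧ ¬ (r + 1 + x.val = r) := fun x => by omega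
    simp [h]
  rw [hp]

theorem sum_blocksFun_Ioi {n : ℕ} (c : Composition n) (p : Fin c.length) :
    c.sizeUpTo p + c.blocksFun p + ∑ q ∈ Finset.Ioi p, c.blocksFun q = n := by
  have h : ∀ i ≤ c.length, c.sizeUpTo i = ∑ q : Fin c.length, if q.val < i then c.blocksFun q else 0 := by
    intro i hi
    induction i with
    | zero => simp
    | succ i ih =>
      rw [c.sizeUpTo_succ (by omega), ih (by omega), show c.blocks[i]'(by rw [c.blocks_length]; omega) =
        ∑ q : Fin c.length, if q = ⟨i, by omega⟩ then c.blocksFun q else 0 by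
          rw [Finset.sum_ite_eq' Finset.univ]; simp [Composition.blocksFun],
        ← Finset.sum_add_distrib]
      refine Finset.sum_congr rfl fun q _ => ?_
      rcases lt_trichotomy q.val i with h | h | h
      · simp [Fin.ext_iff, h, h.ne, Nat.lt_succ_of_lt h]
      · simp [Fin.ext_iff, h]
      · simp [Fin.ext_iff, h.ne', not_lt.2 h.le, show ¬ q.val < i + 1 by omega]
  have h1 := c.sizeUpTo_succ' p
  have h2 : ∑ q ∈ Finset.Ioi p, c.blocksFun q =
      ∑ q : Fin c.length, if q.val < p.val + 1 then 0 else c.blocksFun q := by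
    rw [← Finset.sum_subset (Finset.subset_univ (Finset.Ioi p))]
    · refine Finset.sum_congr rfl fun q hq => ?_
      have : p < q := Finset.mem_Ioi.1 hq
      have := Fin.lt_def.1 this
      rw [if_neg (by omega)]
    · intro q _ hq
      have : ¬ p.val < q.val := fun h => hq (Finset.mem_Ioi.2 h)
      rw [if_pos (by omega)]
  rw [← h1, h _ p.2, h2, ← Finset.sum_add_distrib]
  refine Eq.trans (Finset.sum_congr rfl fun q _ => ?_) c.sum_blocksFun
  split_ifs <;> simp

/-- After suspension a morphism has degree zero, so `pull` needs no signs. Moving the twist of the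
`p`-th block through `f_{i_p}` yields the sign `(-1)^{(k-p)(i_p-1)}`, and the powers of `σ` left on
the letters of that block have the parity of the sum of `i_q - 1` over the later blocks. -/
theorem composeSum_eq_pull (hσ : ∀ a, σ (σ a) = a)
    {m f : (n : ℕ) → MultilinearMap S (fun _ : Fin n => A) A}
    (hf : ∀ n a, σ (f n a) = (-1 : S) ^ (n + 1) • f n (fun i => σ (a i))) (n : ℕ) (a : ℕ → A) :
    composeSum σ m f n a = pull (bar σ f) (bar σ m) (twist σ n a) := by
  rw [pull_eq_sum _ _ _ n (by simp), composeSum]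
  refine Finset.sum_congr rfl fun c _ => ?_
  rw [bar_eq m _ c.length (by simp)]
  have key : (fun p : Fin c.length => (σ ^ (c.length - 1 - p.val))
      ((List.map (bar σ f) ((twist σ n a).splitWrtComposition c)).getD p.val 0)) =
      fun p => ((-1 : S) ^ ((c.length - 1 - p.val) * (c.blocksFun p - 1))) •
        f (c.blocksFun p) (fun l =>
          (σ ^ (∑ q ∈ Finset.Ioi p, (c.blocksFun q - 1))) (a (c.embedding p l).val)) := by
    funext p
    have hs := sum_blocksFun_Ioi c p
    have h1 := c.one_le_blocksFun p
    have hq : ∑ q ∈ Finset.Ioi p, c.blocksFun q =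
        ∑ q ∈ Finset.Ioi p, (c.blocksFun q - 1) + (c.length - 1 - p.val) := by
      have : c.length - 1 - p.val = ∑ q ∈ Finset.Ioi p, 1 := by simp
      rw [this, ← Finset.sum_add_distrib]
      refine Finset.sum_congr rfl fun q _ => ?_
      have := c.one_le_blocksFun q
      omega
    have hlen : (((twist σ n a).splitWrtComposition c)[p.val]'(by simp)).length = c.blocksFun p := by
      rw [List.getElem_splitWrtComposition]
      have := c.sizeUpTo_succ' p
      have := c.sizeUpTo_le (p.val + 1)
      simp
      omega
    rw [List.getD_eq_getElem _ _ (by simp), List.getElem_map, bar_eq f _ _ hlen,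
      sigma_pow_apply (hf _)]
    congr 1
    · have h2 : ((c.length - 1 - p.val) * (c.blocksFun p + 1)) =
        ((c.length - 1 - p.val) * (c.blocksFun p - 1)) + 2 * (c.length - 1 - p.val) := by
        obtain ⟨k, hk⟩ : ∃ k, c.blocksFun p = k + 1 := ⟨_, (Nat.sub_add_cancel h1).symm⟩
        rw [hk, Nat.add_sub_cancel]; ring
      rw [h2, pow_add, pow_mul (-1 : S) 2]; simp
    · congr 1
      funext l
      have h3 : (((twist σ n a).splitWrtComposition c)[p.val]'(by simp)).getD l.val 0 =
          (twist σ n a).getD (c.sizeUpTo p + l.val) 0 := by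
        rw [List.getElem_splitWrtComposition]
        have h4 := c.sizeUpTo_succ' p
        have := l.2
        simp only [List.getD_eq_getElem?_getD, List.getElem?_drop, List.getElem?_take]
        rw [if_pos]
        omega
      rw [h3, getD_twist a (by omega), sigma_pow_sigma_pow hσ rfl, sigma_pow_sigma_pow hσ
        (k := ∑ q ∈ Finset.Ioi p, (c.blocksFun q - 1)) (by omega), Composition.coe_embedding]
  rw [key, MultilinearMap.map_smul_univ, Finset.prod_pow_eq_pow_sum]

end BarForm


/-! ### Homogeneity: the involution `σ` as a sign rule, and degrees of functions on words. -/

section Graded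

variable {S A : Type*} [CommRing S] [Ring A] [Algebra S A]

/-- The arguments are released from the spanning set one at a time. -/
theorem multilinear_eq_of_span {R V W : Type*} [CommRing R] [AddCommGroup V] [Module R V]
    [AddCommGroup W] [Module R W] {n : ℕ} {f g : MultilinearMap R (fun _ : Fin n => V) W} {X : Set V}
    (hX : Submodule.span R X = ⊤) (h : ∀ a : Fin n → V, (∀ i, a i ∈ X) → f a = g a) : f = g := by
  have key : ∀ (s : Finset (Fin n)) (a : Fin n → V), (∀ i ∉ s, a i ∈ X) → f a = g a := by
    intro s
    induction s using Finset.induction_on with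
    | empty => exact fun a ha => h a fun i => ha i (by simp)
    | insert i s hi ih =>
      intro a ha
      have : ∀ v ∈ Submodule.span R X, f (Function.update a i v) = g (Function.update a i v) := by
        intro v hv
        induction hv using Submodule.span_induction with
        | mem x hx =>
          refine ih _ fun j hj => ?_
          by_cases hji : j = i
          · subst hji; simpa using hx
          · simpa [hji] using ha j (by simp [hji, hj])
        | zero => simp
        | add x y _ _ hx hy => rw [f.map_update_add, g.map_update_add, hx, hy]
        | smul c x _ hx => rw [f.map_update_smul, g.map_update_smul, hx]
      simpa using this (a i) (by rw [hX]; trivial)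
  ext a
  exact key Finset.univ a (by simp)

/-- A bigrading of an algebra by submodules which span it, with the involution `σ` given by the
parity of the first degree. -/
structure IsSignedBigrading (𝒜 : ℤ → ℤ → Submodule S A) (σ : A →ₗ[S] A) : Prop where
  span : Submodule.span S {a | ∃ h k, a ∈ 𝒜 h k} = ⊤
  sign : ∀ h k, ∀ a ∈ 𝒜 h k, σ a = (-1 : S) ^ h.natAbs • a
  mul_mem : ∀ h k h' k', ∀ a ∈ 𝒜 h k, ∀ b ∈ 𝒜 h' k', a * b ∈ 𝒜 (h + h') (k + k')
  one_mem : (1 : A) ∈ 𝒜 0 0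

theorem neg_one_pow_natAbs_congr {R : Type*} [CommRing R] {x y : ℤ} (h : (2 : ℤ) ∣ x - y) :
    (-1 : R) ^ x.natAbs = (-1) ^ y.natAbs := by
  rcases Nat.even_or_odd x.natAbs with hx | hx
  · have : Even y.natAbs := by
      rw [Int.natAbs_even] at hx ⊢; rcases hx with ⟨k, hk⟩; rcases h with ⟨m, hm⟩
      exact ⟨k - m, by omega⟩
    rw [hx.neg_one_pow, this.neg_one_pow]
  · have : Odd y.natAbs := by
      rw [Int.natAbs_odd] at hx ⊢; rcases hx with ⟨k, hk⟩; rcases h with ⟨m, hm⟩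
      exact ⟨k - m, by omega⟩
    rw [hx.neg_one_pow, this.neg_one_pow]

theorem neg_one_pow_natAbs_add {R : Type*} [CommRing R] (x y : ℤ) :
    (-1 : R) ^ (x + y).natAbs = (-1) ^ x.natAbs * (-1) ^ y.natAbs := by
  rw [← pow_add]
  exact neg_one_pow_natAbs_congr (R := R) (x := x + y) (y := (x.natAbs + y.natAbs : ℕ)) (by omega)

theorem prod_neg_one_pow_natAbs {R : Type*} [CommRing R] {n : ℕ} (h : Fin n → ℤ) :
    ∏ i, (-1 : R) ^ (h i).natAbs = (-1) ^ (∑ i, h i).natAbs := by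
  induction n with
  | zero => simp
  | succ n ih => rw [Fin.prod_univ_succ, Fin.sum_univ_succ, ih, neg_one_pow_natAbs_add]

/-- Multilinear maps of homological degree `j` and internal degree `0`. -/
def IsHomogeneous (𝒜 : ℤ → ℤ → Submodule S A) {n : ℕ} (f : MultilinearMap S (fun _ : Fin n => A) A)
    (j : ℤ) : Prop :=
  ∀ (h k : Fin n → ℤ) (a : Fin n → A), (∀ i, a i ∈ 𝒜 (h i) (k i)) →
    f a ∈ 𝒜 (∑ i, h i + j) (∑ i, k i)

variable {𝒜 : ℤ → ℤ → Submodule S A} {σ : A →ₗ[S] A}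

namespace IsSignedBigrading

theorem sigma_sigma (H : IsSignedBigrading 𝒜 σ) (a : A) : σ (σ a) = a := by
  have : σ ∘ₗ σ = LinearMap.id := LinearMap.ext_on H.span (by
    rintro x ⟨h, k, hx⟩
    simp [H.sign h k x hx, smul_smul, ← mul_pow])
  exact LinearMap.congr_fun this a

theorem sigma_one (H : IsSignedBigrading 𝒜 σ) : σ 1 = 1 := by
  simpa using H.sign 0 0 1 H.one_mem

theorem sigma_mem (H : IsSignedBigrading 𝒜 σ) {h k : ℤ} {a : A} (ha : a ∈ 𝒜 h k) :
    σ a ∈ 𝒜 h k := by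
  rw [H.sign h k a ha]; exact Submodule.smul_mem _ _ ha

theorem sigma_pow_mem (H : IsSignedBigrading 𝒜 σ) {h k : ℤ} {a : A} (ha : a ∈ 𝒜 h k) (i : ℕ) :
    (σ ^ i) a ∈ 𝒜 h k := by
  induction i with
  | zero => simpa
  | succ i ih => rw [pow_succ', Module.End.mul_apply]; exact H.sigma_mem ih

theorem sigma_pow_one (H : IsSignedBigrading 𝒜 σ) (i : ℕ) : (σ ^ i) 1 = 1 := by
  induction i with
  | zero => simp
  | succ i ih => rw [pow_succ', Module.End.mul_apply, ih, H.sigma_one]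

theorem sigma_apply (H : IsSignedBigrading 𝒜 σ) {n : ℕ} {j : ℤ}
    {f : MultilinearMap S (fun _ : Fin n => A) A} (hf : IsHomogeneous 𝒜 f j) (a : Fin n → A) :
    σ (f a) = (-1 : S) ^ j.natAbs • f (fun i => σ (a i)) := by
  have : σ.compMultilinearMap f = (-1 : S) ^ j.natAbs • f.compLinearMap (fun _ => σ) := by
    refine multilinear_eq_of_span H.span fun a ha => ?_
    choose h k hk using ha
    have : (fun i => σ (a i)) = fun i => (-1 : S) ^ (h i).natAbs • a i :=
      funext fun i => H.sign _ _ _ (hk i)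
    simp only [LinearMap.compMultilinearMap_apply, smul_apply,
      MultilinearMap.compLinearMap_apply]
    rw [this, f.map_smul_univ, prod_neg_one_pow_natAbs, H.sign _ _ _ (hf h k a hk),
      neg_one_pow_natAbs_add, smul_smul, mul_comm]
  simpa using congrArg (fun g => g a) this

end IsSignedBigrading

/-! ### Homogeneous functions on words -/

/-- A function on words which raises the suspended homological degree by `e`. -/
def HasDeg (𝒜 : ℤ → ℤ → Submodule S A) (G : List A → A) (e e' : ℤ) : Prop :=
  ∀ L : List (A × ℤ × ℤ), (∀ t ∈ L, t.1 ∈ 𝒜 (t.2.1 + 1) t.2.2) →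
    G (L.map Prod.fst) ∈ 𝒜 ((L.map (fun t => t.2.1)).sum + e + 1) ((L.map (fun t => t.2.2)).sum + e')

theorem splitSum_mem {V X : Type*} [AddCommGroup X] [Module S X] (p : Submodule S X)
    {H : List V → List V → X} {l : List V} (h : ∀ v r, v ++ r = l → H v r ∈ p) :
    splitSum H l ∈ p :=
  Submodule.sum_mem _ fun i _ => h _ _ (List.take_append_drop i l)

theorem ins_mem {V X : Type*} [AddCommGroup V] [AddCommGroup X] [Module S X] (p : Submodule S X)
    (θ : V → V) (c : List V → V) {G : List V → X} {l : List V}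
    (h : ∀ u v w, u ++ v ++ w = l → G (u.map θ ++ c v :: w) ∈ p) : ins θ c G l ∈ p := by
  induction l generalizing G with
  | nil => simp
  | cons a w ih =>
    rw [ins_cons]
    refine p.add_mem (splitSum_mem p fun v r hvr => ?_) (ih fun u v r hl => ?_)
    · simpa using h [] v r (by simpa using hvr)
    · simpa using h (a :: u) v r (by simpa using hl)

theorem HasDeg.ins {θ : A → A} {c G : List A → A} {e₁ e₂ : ℤ}
    (hθ : ∀ h k, ∀ a ∈ 𝒜 h k, θ a ∈ 𝒜 h k)
    (hc : HasDeg 𝒜 c e₁ 0) (hG : HasDeg 𝒜 G e₂ 0) : HasDeg 𝒜 (ins θ c G) (e₁ + e₂) 0 := by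
  intro L hL
  refine ins_mem _ _ _ fun u v w h => ?_
  -- The factorization of the underlying word is lifted to the word decorated with its degrees.
  obtain ⟨L', W, rfl, h', rfl⟩ := List.map_eq_append_iff.1 h.symm
  obtain ⟨U, V, rfl, rfl, rfl⟩ := List.map_eq_append_iff.1 h'
  have h1 := hc V fun t ht => hL t (by simp [ht])
  have h2 := hG (U.map (fun t => (θ t.1, t.2)) ++
    (c (V.map Prod.fst), (V.map (fun t => t.2.1)).sum + e₁, (V.map (fun t => t.2.2)).sum) :: W) (by
      intro t ht
      simp only [List.mem_append, List.mem_map, List.mem_cons] at ht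
      rcases ht with ⟨s, hs, rfl⟩ | rfl | ht
      · exact hθ _ _ _ (hL s (by simp [hs]))
      · simpa using h1
      · exact hL t (by simp [ht]))
  simp only [List.map_append, List.map_map, List.map_cons, List.sum_append, List.sum_cons] at h2 ⊢
  convert h2 using 2
  · simp only [Function.comp_def]; ring
  · simp only [Function.comp_def]; ring
  · rfl

theorem HasDeg.pull {f G : List A → A} {e e' : ℤ} (hf : HasDeg 𝒜 f 0 0) (hG : HasDeg 𝒜 G e e') :
    HasDeg 𝒜 (pull f G) e e' := by
  intro L
  induction hn : L.length using Nat.strong_induction_on generalizing G e e' L with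
  | _ n ih =>
    intro hL
    cases L with
    | nil => simpa using hG []
    | cons t L =>
      rw [List.map_cons (f := Prod.fst), pull_cons]
      refine splitSum_mem _ fun v r h => ?_
      obtain ⟨V, R, rfl, rfl, rfl⟩ := List.map_eq_append_iff.1 h.symm
      have h1 := hf (t :: V) fun t ht => hL t (by simp at ht ⊢; tauto)
      have h2 : HasDeg 𝒜 (fun l => G (f (t.1 :: V.map Prod.fst) :: l))
          (t.2.1 + (V.map (fun t => t.2.1)).sum + e) (t.2.2 + (V.map (fun t => t.2.2)).sum + e') := by
        intro L' hL'
        have := hG ((f (t.1 :: V.map Prod.fst), t.2.1 + (V.map (fun t => t.2.1)).sum,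
          t.2.2 + (V.map (fun t => t.2.2)).sum) :: L') (by
            intro s hs
            rcases List.mem_cons.1 hs with rfl | hs
            · simpa using h1
            · exact hL' s hs)
        simp only [List.map_cons, List.sum_cons] at this
        convert this using 2 <;> ring
      have h3 := ih R.length (by simp at hn; omega) h2 R rfl (fun t ht => hL t (by simp [ht]))
      simp only [List.map_cons, List.sum_cons, List.map_append, List.sum_append]
      convert h3 using 2 <;> ring

theorem hasDeg_bar (H : IsSignedBigrading 𝒜 σ)
    {m : (n : ℕ) → MultilinearMap S (fun _ : Fin n => A) A} {e : ℤ}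
    (hm : ∀ n, IsHomogeneous 𝒜 (m n) (e + 1 - n)) : HasDeg 𝒜 (bar σ m) e 0 := by
  intro L hL
  rw [bar_eq m _ L.length (by simp)]
  have := hm L.length (fun i => (L[i.val]).2.1 + 1) (fun i => (L[i.val]).2.2)
    (fun i => (σ ^ (L.length - 1 - i.val)) ((L.map Prod.fst).getD i.val 0)) (fun i => by
      rw [List.getD_eq_getElem _ _ (by simp), List.getElem_map]
      exact H.sigma_pow_mem (hL _ (by simp)) _)
  convert this using 2
  · rw [Finset.sum_add_distrib]
    simp only [Finset.sum_const, Finset.card_univ, Fintype.card_fin, nsmul_eq_mul, mul_one]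
    rw [← List.sum_ofFn]
    rw [List.ofFn_getElem_eq_map L (fun t => t.2.1)]; ring
  · rw [← List.sum_ofFn, add_zero]
    congr 1
    exact (List.ofFn_getElem_eq_map L (fun t => t.2.2)).symm

theorem ofFn_update {V : Type*} {n : ℕ} (a : Fin n → V) (i : Fin n) (x : V) :
    List.ofFn (Function.update a i x) =
      (List.ofFn a).take i ++ x :: (List.ofFn a).drop (i + 1) := by
  have : List.ofFn (Function.update a i x) = (List.ofFn a).set i x := by
    apply List.ext_getElem
    · simp
    · intro j h1 h2
      simp only [List.getElem_ofFn, List.getElem_set, Function.update_apply, Fin.ext_iff,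
        eq_comm (a := j)]
  rw [this, List.set_eq_take_append_cons_drop, if_pos (by simp)]

/-- The multilinear maps which are the components of a function on words. -/
def unbar (σ : A →ₗ[S] A) {c : List A → A} (hc : IsML S c) (n : ℕ) :
    MultilinearMap S (fun _ : Fin n => A) A :=
  MultilinearMap.compLinearMap (MultilinearMap.mk' (fun a => c (List.ofFn a))
    (fun a i x y => by simp only [ofFn_update, hc.add])
    (fun a i r x => by simp only [ofFn_update, hc.smul]))
    (fun i : Fin n => σ ^ (n - 1 - i.val))

theorem unbar_apply {c : List A → A} (hc : IsML S c) (n : ℕ) (a : ℕ → A) :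
    unbar σ hc n (fun i => a i.val) = c (twist σ n a) := rfl

theorem unbar_isHomogeneous (H : IsSignedBigrading 𝒜 σ) {c : List A → A} (hc : IsML S c) {e : ℤ}
    (hd : HasDeg 𝒜 c e 0) (n : ℕ) : IsHomogeneous 𝒜 (unbar σ hc n) (e + 1 - n) := by
  intro h k a ha
  have := hd (List.ofFn fun i : Fin n => ((σ ^ (n - 1 - i.val)) (a i), h i - 1, k i)) (by
    intro t ht
    rw [List.mem_ofFn] at ht
    obtain ⟨i, rfl⟩ := ht
    simpa using H.sigma_pow_mem (ha i) _)
  rw [List.map_ofFn, List.map_ofFn, List.map_ofFn, List.sum_ofFn, List.sum_ofFn] at this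
  convert this using 2
  · simp; ring
  · simp
  · rfl

end Graded


/-! ### Termwise comparison of insertions. -/

section InsLemmas

variable {A X : Type*} [AddCommGroup A] [AddCommGroup X]

theorem ins_congr₂ {θ : A → A} {c c' : List A → A} {G G' : List A → X} {l : List A}
    (h : ∀ u v w, u ++ v ++ w = l → G (u.map θ ++ c v :: w) = G' (u.map θ ++ c' v :: w)) :
    ins θ c G l = ins θ c' G' l := by
  induction l generalizing G G' with
  | nil => simp
  | cons a w ih =>
    rw [ins_cons, ins_cons]
    congr 1
    · exact splitSum_congr fun v r hvr => by simpa using h [] v r (by simpa using hvr)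
    · exact ih fun u v r hl => by simpa using h (a :: u) v r (by simpa using hl)

/-- The inserted and the outer function change at the same time, and bilinearity alone would produce
further mixed terms; comparing term by term makes it possible to discard those that are impossible
for reasons of length. -/
theorem ins_add₃ {θ : A → A} {c c₁ c₂ c₃ : List A → A} {G G₁ G₂ G₃ : List A → X} {l : List A}
    (h : ∀ u v w, u ++ v ++ w = l → G (u.map θ ++ c v :: w) = G₁ (u.map θ ++ c₁ v :: w) +
      G₂ (u.map θ ++ c₂ v :: w) + G₃ (u.map θ ++ c₃ v :: w)) :
    ins θ c G l = ins θ c₁ G₁ l + ins θ c₂ G₂ l + ins θ c₃ G₃ l := by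
  induction l generalizing G G₁ G₂ G₃ with
  | nil => simp
  | cons a w ih =>
    rw [ins_cons, ins_cons, ins_cons, ins_cons,
      ih (G₁ := fun l => G₁ (θ a :: l)) (G₂ := fun l => G₂ (θ a :: l)) (G₃ := fun l => G₃ (θ a :: l))
        fun u v r hl => by simpa using h (a :: u) v r (by simpa using hl),
      splitSum_congr (K := fun v r => G₁ (c₁ v :: r) + G₂ (c₂ v :: r) + G₃ (c₃ v :: r))
        fun v r hvr => by simpa using h [] v r (by simpa using hvr), splitSum_add, splitSum_add]
    abel

theorem splitSum_eq_single {H : List A → List A → X} {l v₀ r₀ : List A} (hl : v₀ ++ r₀ = l)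
    (h : ∀ v r, v ++ r = l → v.length ≠ v₀.length → H v r = 0) : splitSum H l = H v₀ r₀ := by
  subst hl
  rw [splitSum, Finset.sum_eq_single v₀.length]
  · simp
  · intro i hi hi'
    refine h _ _ (List.take_append_drop _ _) ?_
    simp only [List.length_append, Finset.mem_range] at hi
    simp only [List.length_take, List.length_append]
    omega
  · intro h'; simp at h'

end InsLemmas

/-! ### The Hochschild differential as a commutator with the product. -/

section Hochschild

variable {S A : Type*} [CommRing S] [Ring A] [Algebra S A]
  {𝒜 : ℤ → ℤ → Submodule S A} {σ : A →ₗ[S] A}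

theorem bar_single_of_ne {n : ℕ} (h : MultilinearMap S (fun _ : Fin n => A) A) {l : List A}
    (hl : l.length ≠ n) : bar σ (Pi.single n h) l = 0 := by
  rw [bar, Pi.single_eq_of_ne hl]; rfl

theorem bar_single {n : ℕ} (h : MultilinearMap S (fun _ : Fin n => A) A) {l : List A}
    (hl : l.length = n) :
    bar σ (Pi.single n h) l = h (fun i => (σ ^ (n - 1 - i.val)) (l.getD i.val 0)) := by
  rw [bar_eq _ l n hl, Pi.single_eq_same]

theorem bar_single_twist (hσ : ∀ a, σ (σ a) = a) {n : ℕ}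
    (h : MultilinearMap S (fun _ : Fin n => A) A) (a : ℕ → A) :
    bar σ (Pi.single n h) (twist σ n a) = h (fun i => a i.val) := by
  rw [bar_twist hσ, Pi.single_eq_same]

variable (S A) in
/-- The product as a multilinear map. -/
abbrev mulMap : MultilinearMap S (fun _ : Fin 2 => A) A := MultilinearMap.mkPiAlgebraFin S 2 A

/-- The product, as a function on words. -/
def barMul (σ : A →ₗ[S] A) : List A → A := bar σ (Pi.single 2 (mulMap S A))

theorem isML_barMul : IsML S (barMul σ) := isML_bar _

theorem barMul_pair (x y : A) : barMul σ [x, y] = σ x * y := by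
  rw [barMul, bar_single (n := 2) _ rfl]
  simp [List.ofFn_succ]

theorem barMul_of_ne {l : List A} (hl : l.length ≠ 2) : barMul σ l = 0 := bar_single_of_ne _ hl

theorem isHomogeneous_mulMap (H : IsSignedBigrading 𝒜 σ) : IsHomogeneous 𝒜 (mulMap S A) 0 := by
  intro h k a ha
  have := H.mul_mem _ _ _ _ _ (ha 0) _ (ha 1)
  simpa [List.ofFn_succ, Fin.sum_univ_two] using this

theorem sigma_mul (H : IsSignedBigrading 𝒜 σ) (a b : A) : σ (a * b) = σ a * σ b := by
  have := H.sigma_apply (isHomogeneous_mulMap H) ![a, b]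
  simpa [List.ofFn_succ] using this

theorem single_apply_eq {n k : ℕ} (hk : k = n) (h : MultilinearMap S (fun _ : Fin n => A) A)
    (F : ℕ → A) :
    (Pi.single n h : (k : ℕ) → MultilinearMap S (fun _ : Fin k => A) A) k (fun i => F i.val) =
      h (fun i => F i.val) := by
  subst hk; rw [Pi.single_eq_same]

/-- These are the inner terms of the Hochschild differential. Only `s = 2` contributes to the
insertion formula; there the sign `(-1)^{r+2t}` is `(-1)^r` and the Koszul factor `σ²` is the
identity. -/
theorem ins_barMul_single (H : IsSignedBigrading 𝒜 σ) {n : ℕ}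
    (h : MultilinearMap S (fun _ : Fin n => A) A) (a : ℕ → A) :
    ins (fun x => - σ x) (barMul σ) (bar σ (Pi.single n h)) (twist σ (n + 1) a) =
      ∑ i : Fin n, (-1 : S) ^ i.val • h (mergeAt (LinearMap.mul S A) i (fun j => a j.val)) := by
  have hm : ∀ k a, σ ((Pi.single 2 (mulMap S A) : (k : ℕ) → MultilinearMap S (fun _ : Fin k => A) A)
      k a) = (-1 : S) ^ k • (Pi.single 2 (mulMap S A) : (k : ℕ) → MultilinearMap S (fun _ : Fin k => A) A)
        k (fun i => σ (a i)) := by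
    intro k a
    by_cases hk : k = 2
    · subst hk
      rw [Pi.single_eq_same, H.sigma_apply (isHomogeneous_mulMap H)]
      simp
    · rw [Pi.single_eq_of_ne hk]; simp
  rw [barMul, ← insertSum_eq_ins H.sigma_sigma (by simp) hm, insertSum,
    Finset.Nat.sum_antidiagonal_eq_sum_range_succ_mk, Finset.sum_range_succ, Finset.sum_range_succ]
  have hz : ∀ p q : ℕ × ℕ, q.1 ≠ 2 → (-1 : S) ^ (p.1 + q.1 * q.2) •
      (Pi.single n h : (k : ℕ) → MultilinearMap S (fun _ : Fin k => A) A) (p.1 + 1 + q.2) (fun i =>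
        if i.val < p.1 then (σ ^ q.1) (a i.val)
        else if i.val = p.1 then (Pi.single 2 (mulMap S A) :
          (k : ℕ) → MultilinearMap S (fun _ : Fin k => A) A) q.1 (fun l => a (p.1 + l.val))
        else a (i.val - 1 + q.1)) = 0 := by
    intro p q hq
    rw [MultilinearMap.map_coord_zero _ ⟨p.1, by omega⟩, smul_zero]
    simp [Pi.single_eq_of_ne hq]
  have h1 : ∀ r, n ≤ r → r ≤ n + 1 → ∑ q ∈ Finset.HasAntidiagonal.antidiagonal (n + 1 - r),
      (-1 : S) ^ (r + q.1 * q.2) •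
      (Pi.single n h : (k : ℕ) → MultilinearMap S (fun _ : Fin k => A) A) (r + 1 + q.2) (fun i =>
        if i.val < r then (σ ^ q.1) (a i.val)
        else if i.val = r then (Pi.single 2 (mulMap S A) :
          (k : ℕ) → MultilinearMap S (fun _ : Fin k => A) A) q.1 (fun l => a (r + l.val))
        else a (i.val - 1 + q.1)) = 0 := by
    intro r hr hr'
    refine Finset.sum_eq_zero fun q hq => hz (r, 0) q ?_
    rw [Finset.HasAntidiagonal.mem_antidiagonal] at hq
    omega
  rw [h1 n le_rfl (by omega), h1 (n + 1) (by omega) le_rfl, add_zero, add_zero, Finset.sum_range]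
  refine Finset.sum_congr rfl fun r _ => ?_
  rw [Finset.sum_eq_single (2, n - 1 - r.val)]
  · rw [show r.val + (2, n - 1 - r.val).1 * (2, n - 1 - r.val).2 = r.val + 2 * (n - 1 - r.val) from rfl,
      pow_add, pow_mul, neg_one_sq, one_pow, mul_one]
    congr 1
    simp only
    rw [single_apply_eq (by omega) h (fun i => if i < r.val then (σ ^ 2) (a i) else if i = r.val then
      (Pi.single 2 (mulMap S A) :
          (k : ℕ) → MultilinearMap S (fun _ : Fin k => A) A) 2 (fun l => a (r.val + l.val))
        else a (i - 1 + 2))]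
    congr 1
    funext i
    simp only [mergeAt, Fin.lt_def, Fin.ext_iff, Pi.single_eq_same]
    split_ifs with h1 h2
    · simp [pow_two, H.sigma_sigma]
    · simp [List.ofFn_succ, h2]
    · congr 1; simp; omega
  · rintro q hq hq'
    refine hz (r.val, 0) q ?_
    rw [Finset.HasAntidiagonal.mem_antidiagonal] at hq
    intro h2
    exact hq' (Prod.ext h2 (by simp only; omega))
  · intro h'
    exfalso; apply h'
    rw [Finset.HasAntidiagonal.mem_antidiagonal]; simp only; omega

/-- The outer product accepts words of length two only, so the inserted function must consume
everything except the last letter or everything except the first one. This yields the two outer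
terms of the Hochschild differential. -/
theorem ins_barMul {θ : A → A} {c : List A → A} {a x : A} {v w : List A}
    (h : a :: w = v ++ [x]) (hw : 1 ≤ w.length) :
    ins θ c (barMul σ) (a :: w) = σ (c v) * x + σ (θ a) * c w := by
  rw [ins_cons, splitSum_eq_single h.symm]
  · congr 1
    · exact barMul_pair _ _
    · cases w with
      | nil => simp at hw
      | cons y w =>
        rw [ins_cons, splitSum_eq_single (List.append_nil (y :: w))]
        · rw [barMul_pair, ins_eq_zero, add_zero]
          exact fun _ _ _ _ => barMul_of_ne (by simp)
        · intro v' r hvr hne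
          have := congrArg List.length hvr
          simp only [List.length_append, List.length_cons] at this hne
          exact barMul_of_ne (by simp; intro h; simp [h] at this; omega)
  · intro v' r hvr hne
    have := congrArg List.length (hvr.trans h)
    simp only [List.length_append, List.length_cons, List.length_nil] at this
    exact barMul_of_ne (by simp only [List.length_cons]; omega)

theorem twist_cons (n : ℕ) (a : ℕ → A) :
    twist σ (n + 1) a = (σ ^ n) (a 0) :: twist σ n (fun i => a (i + 1)) := by
  rw [twist, List.ofFn_succ, twist]
  congr 2
  funext i
  simp only [Fin.val_succ]
  congr 2; omega

theorem twist_concat (n : ℕ) (a : ℕ → A) :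
    twist σ (n + 1) a = twist σ n (fun i => σ (a i)) ++ [a n] := by
  rw [twist, List.ofFn_succ_last, twist]
  congr 2
  · funext i
    rw [← Module.End.mul_apply, ← pow_succ]
    congr 2
    simp only [Fin.val_castSucc]; omega
  · simp

/-- The Hochschild differential in terms of words, when the degree and the number of arguments have
the same parity. -/
theorem hochD_eq_ins_even (H : IsSignedBigrading 𝒜 σ) {n : ℕ} (hn : 1 ≤ n) {j : ℤ}
    (hj : (2 : ℤ) ∣ j - n) {h : MultilinearMap S (fun _ : Fin n => A) A} (hh : IsHomogeneous 𝒜 h j)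
    (a : ℕ → A) :
    ins (fun x => - σ x) (barMul σ) (bar σ (Pi.single n h)) (twist σ (n + 1) a) +
      ins (fun x => - σ x) (bar σ (Pi.single n h)) (barMul σ) (twist σ (n + 1) a) =
      - hochD σ n j h (fun i => a i.val) := by
  have hs : (-1 : S) ^ j.natAbs = (-1) ^ n := by
    simpa using neg_one_pow_natAbs_congr (R := S) hj
  have hpow : σ ^ j.natAbs = σ ^ n := sigma_pow_congr H.sigma_sigma (by omega)
  rw [ins_barMul_single H, hochD_apply]
  have e := ins_barMul (σ := σ) (θ := fun x => - σ x) (c := bar σ (Pi.single n h))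
    ((twist_cons (σ := σ) n a).symm.trans (twist_concat n a)) (by simpa using hn)
  rw [← twist_cons, bar_single_twist H.sigma_sigma, bar_single_twist H.sigma_sigma, H.sigma_apply hh,
    map_neg, H.sigma_sigma, hs] at e
  simp only [H.sigma_sigma] at e
  rw [e, hpow]
  have e1 : (Fin.tail fun i : Fin (n + 1) => a i.val) = fun i : Fin n => a (i.val + 1) := by
    funext i; simp [Fin.tail]
  have e2 : (Fin.init fun i : Fin (n + 1) => a i.val) = fun i : Fin n => a i.val := by
    funext i; simp [Fin.init]
  rw [e1, e2]
  simp only [pow_succ, mul_neg, mul_one, neg_smul, Finset.sum_neg_distrib, Fin.val_zero, Fin.val_last,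
    smul_mul_assoc, neg_mul]
  abel

/-- The Hochschild differential in terms of words, when the degree and the number of arguments have
different parity. -/
theorem hochD_eq_ins_odd (H : IsSignedBigrading 𝒜 σ) {n : ℕ} (hn : 1 ≤ n) {j : ℤ}
    (hj : (2 : ℤ) ∣ j - n - 1) {h : MultilinearMap S (fun _ : Fin n => A) A}
    (hh : IsHomogeneous 𝒜 h j) (a : ℕ → A) :
    ins (fun x => - σ x) (barMul σ) (bar σ (Pi.single n h)) (twist σ (n + 1) a) -
      ins id (bar σ (Pi.single n h)) (barMul σ) (twist σ (n + 1) a) =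
      - hochD σ n j h (fun i => a i.val) := by
  have hs : (-1 : S) ^ j.natAbs = (-1) ^ (n + 1) := by
    exact neg_one_pow_natAbs_congr (R := S) (x := j) (y := (n + 1 : ℕ)) (by push_cast; omega)
  have hpow : σ ^ j.natAbs = σ ^ (n + 1) := sigma_pow_congr H.sigma_sigma (by omega)
  rw [ins_barMul_single H, hochD_apply]
  have e := ins_barMul (σ := σ) (θ := id) (c := bar σ (Pi.single n h))
    ((twist_cons (σ := σ) n a).symm.trans (twist_concat n a)) (by simpa using hn)
  rw [← twist_cons, bar_single_twist H.sigma_sigma, bar_single_twist H.sigma_sigma, H.sigma_apply hh,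
    id_eq, hs, ← Module.End.mul_apply σ, ← pow_succ'] at e
  simp only [H.sigma_sigma] at e
  rw [e, hpow]
  have e1 : (Fin.tail fun i : Fin (n + 1) => a i.val) = fun i : Fin n => a (i.val + 1) := by
    funext i; simp [Fin.tail]
  have e2 : (Fin.init fun i : Fin (n + 1) => a i.val) = fun i : Fin n => a i.val := by
    funext i; simp [Fin.init]
  rw [e1, e2]
  simp only [pow_succ (-1 : S), mul_neg, mul_one, neg_smul, Finset.sum_neg_distrib, Fin.val_zero,
    Fin.val_last, smul_mul_assoc, neg_mul]
  abel

end Hochschild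


/-! ### Multilinearity of `ins` and `pull`. -/

section Multilinearity

variable {S A X : Type*} [CommRing S] [AddCommGroup A] [Module S A] [AddCommGroup X] [Module S X]

theorem splitSum_append_cons (H : List A → List A → X) (u : List A) (z : A) (r : List A) :
    splitSum H (u ++ z :: r) = splitSum (fun v r' => H v (r' ++ z :: r)) u +
      splitSum (fun v r' => H (u ++ z :: v) r') r := by
  induction u generalizing H with
  | nil => simp [splitSum_cons]
  | cons a u ih => rw [List.cons_append, splitSum_cons, ih, splitSum_cons]; simp [add_assoc]

theorem splitSum_smul (c : S) (H : List A → List A → X) (l : List A) :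
    splitSum (fun v r => c • H v r) l = c • splitSum H l :=
  (map_splitSum (LinearMap.lsmul S X c) H l).symm

theorem ins_smul (θ : A → A) (b : List A → A) (c : S) (G : List A → X) (l : List A) :
    ins θ b (fun l => c • G l) l = c • ins θ b G l :=
  (map_ins θ b (LinearMap.lsmul S X c) G l).symm

theorem IsML.ins {θ : A →ₗ[S] A} {c : List A → A} {G : List A → X} (hc : IsML S c)
    (hG : IsML S G) : IsML S (ins θ c G) := by
  constructor
  · intro u x y r
    induction u generalizing G with
    | nil =>
      simp only [List.nil_append, ins_cons, splitSum_cons]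
      have h1 : splitSum (fun v r => G (c ((x + y) :: v) :: r)) r =
          splitSum (fun v r => G (c (x :: v) :: r)) r + splitSum (fun v r => G (c (y :: v) :: r)) r := by
        rw [← splitSum_add]
        exact splitSum_congr fun v r _ => by
          rw [show c ((x + y) :: v) = _ from hc.add [] x y v]; exact hG.add [] _ _ _
      have h2 : SqZero.ins θ c (fun l => G (θ (x + y) :: l)) r =
          SqZero.ins θ c (fun l => G (θ x :: l)) r + SqZero.ins θ c (fun l => G (θ y :: l)) r := by
        rw [← ins_add]
        exact ins_congr' _ _ fun _ _ _ _ => by rw [map_add]; exact hG.add [] _ _ _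
      have h3 := hG.add [c []] x y r
      simp only [List.cons_append, List.nil_append] at h3
      rw [h1, h2, h3]; abel
    | cons a u ih =>
      simp only [List.cons_append, ins_cons]
      rw [ih (hG.cons (θ a)), ← List.cons_append, splitSum_append_cons,
        ← List.cons_append, splitSum_append_cons, ← List.cons_append, splitSum_append_cons]
      have h1 : splitSum (fun v r' => G (c v :: (r' ++ (x + y) :: r))) (a :: u) =
          splitSum (fun v r' => G (c v :: (r' ++ x :: r))) (a :: u) +
            splitSum (fun v r' => G (c v :: (r' ++ y :: r))) (a :: u) := by
        rw [← splitSum_add]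
        exact splitSum_congr fun v r' _ => hG.add (c v :: r') x y r
      have h2 : splitSum (fun v r' => G (c (a :: u ++ (x + y) :: v) :: r')) r =
          splitSum (fun v r' => G (c (a :: u ++ x :: v) :: r')) r +
            splitSum (fun v r' => G (c (a :: u ++ y :: v) :: r')) r := by
        rw [← splitSum_add]
        exact splitSum_congr fun v r' _ => by rw [hc.add (a :: u)]; exact hG.add [] _ _ _
      rw [h1, h2]; abel
  · intro u s x r
    induction u generalizing G with
    | nil =>
      simp only [List.nil_append, ins_cons, splitSum_cons]
      have h1 : splitSum (fun v r => G (c ((s • x) :: v) :: r)) r =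
          s • splitSum (fun v r => G (c (x :: v) :: r)) r := by
        rw [← splitSum_smul]
        exact splitSum_congr fun v r _ => by
          rw [show c ((s • x) :: v) = _ from hc.smul [] s x v]; exact hG.smul [] _ _ _
      have h2 : SqZero.ins θ c (fun l => G (θ (s • x) :: l)) r =
          s • SqZero.ins θ c (fun l => G (θ x :: l)) r := by
        rw [← ins_smul]
        exact ins_congr' _ _ fun _ _ _ _ => by rw [map_smul]; exact hG.smul [] _ _ _
      have h3 := hG.smul [c []] s x r
      simp only [List.cons_append, List.nil_append] at h3
      rw [h1, h2, h3]; simp only [smul_add]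
    | cons a u ih =>
      simp only [List.cons_append, ins_cons]
      rw [ih (hG.cons (θ a)), ← List.cons_append, splitSum_append_cons,
        ← List.cons_append, splitSum_append_cons]
      have h1 : splitSum (fun v r' => G (c v :: (r' ++ (s • x) :: r))) (a :: u) =
          s • splitSum (fun v r' => G (c v :: (r' ++ x :: r))) (a :: u) := by
        rw [← splitSum_smul]
        exact splitSum_congr fun v r' _ => hG.smul (c v :: r') s x r
      have h2 : splitSum (fun v r' => G (c (a :: u ++ (s • x) :: v) :: r')) r =
          s • splitSum (fun v r' => G (c (a :: u ++ x :: v) :: r')) r := by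
        rw [← splitSum_smul]
        exact splitSum_congr fun v r' _ => by rw [hc.smul (a :: u)]; exact hG.smul [] _ _ _
      rw [h1, h2]; simp only [smul_add]

theorem IsML.pull {f : List A → A} {G : List A → X} (hf : IsML S f) (hG : IsML S G) :
    IsML S (pull f G) := by
  constructor
  · intro u x y r
    induction hn : u.length using Nat.strong_induction_on generalizing G u with
    | _ n ih =>
      cases u with
      | nil =>
        simp only [List.nil_append, pull_cons, ← splitSum_add]
        refine splitSum_congr fun v r' _ => ?_
        have := map_add (pullHead f hG r') (f (x :: v)) (f (y :: v))
        rw [← show f ((x + y) :: v) = f (x :: v) + f (y :: v) from hf.add [] x y v] at this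
        exact this
      | cons a u =>
        simp only [List.cons_append, pull_cons, splitSum_append_cons]
        have h1 : splitSum (fun v r' => SqZero.pull f (fun l => G (f (a :: v) :: l))
            (r' ++ (x + y) :: r)) u = splitSum (fun v r' => SqZero.pull f
              (fun l => G (f (a :: v) :: l)) (r' ++ x :: r)) u +
            splitSum (fun v r' => SqZero.pull f
              (fun l => G (f (a :: v) :: l)) (r' ++ y :: r)) u := by
          rw [← splitSum_add]
          exact splitSum_congr fun v r' h => ih r'.length
            (by have := length_le_of_append h; simp at hn; omega) (hG.cons _) r' rfl
        have h2 : splitSum (fun v r' => SqZero.pull f (fun l => G (f (a :: (u ++ (x + y) :: v)) :: l))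
            r') r = splitSum (fun v r' => SqZero.pull f
              (fun l => G (f (a :: (u ++ x :: v)) :: l)) r') r +
            splitSum (fun v r' => SqZero.pull f
              (fun l => G (f (a :: (u ++ y :: v)) :: l)) r') r := by
          rw [← splitSum_add]
          refine splitSum_congr fun v r' h => ?_
          have := map_add (pullHead f hG r') (f (a :: u ++ x :: v)) (f (a :: u ++ y :: v))
          rw [← hf.add (a :: u) x y v] at this
          exact this
        rw [h1, h2]; abel
  · intro u s x r
    induction hn : u.length using Nat.strong_induction_on generalizing G u with
    | _ n ih =>
      cases u with
      | nil =>
        simp only [List.nil_append, pull_cons, ← splitSum_smul]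
        refine splitSum_congr fun v r' _ => ?_
        have := map_smul (pullHead f hG r') s (f (x :: v))
        rw [← show f ((s • x) :: v) = s • f (x :: v) from hf.smul [] s x v] at this
        exact this
      | cons a u =>
        simp only [List.cons_append, pull_cons, splitSum_append_cons, smul_add]
        congr 1
        · rw [← splitSum_smul]
          exact splitSum_congr fun v r' h => ih r'.length
            (by have := length_le_of_append h; simp at hn; omega) (hG.cons _) r' rfl
        · rw [← splitSum_smul]
          refine splitSum_congr fun v r' h => ?_
          have := map_smul (pullHead f hG r') s (f (a :: u ++ x :: v))
          rw [← hf.smul (a :: u) s x v] at this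
          exact this

theorem IsML.sub {G G' : List A → X} (hG : IsML S G) (hG' : IsML S G') :
    IsML S (fun l => G l - G' l) :=
  ⟨fun u x y r => by simp only [hG.add, hG'.add]; abel,
    fun u c x r => by simp only [hG.smul, hG'.smul, smul_sub]⟩

end Multilinearity

/-! ### Strict unitality: the defects of the relations are normalized. -/

section Normalization

variable {S A : Type*} [CommRing S] [Ring A] [Algebra S A] {σ : A →ₗ[S] A}

/-- The properties of the operations of a minimal strictly unital structure, as a function on
words. -/
structure IsUnitalBar (σ : A →ₗ[S] A) (b : List A → A) : Prop where
  ml : IsML S b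
  nil : b [] = 0
  single : ∀ x, b [x] = 0
  pair : ∀ x y, b [x, y] = σ x * y
  kill : ∀ l, (1 : A) ∈ l → 3 ≤ l.length → b l = 0

variable {b : List A → A}

theorem IsUnitalBar.of_length_le_one (hb : IsUnitalBar σ b) {l : List A} (hl : l.length ≤ 1) :
    b l = 0 := by
  match l, hl with
  | [], _ => exact hb.nil
  | [x], _ => exact hb.single x

theorem IsUnitalBar.eq_barMul (hb : IsUnitalBar σ b) {l : List A} (hl : l.length = 2) :
    b l = barMul σ l := by
  match l, hl with
  | [x, y], _ => rw [hb.pair, barMul_pair]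

/-- Only the insertion of `b [1, y] = y` survives: other pieces containing the unit are killed by
`b`, and if the unit is passed it remains in front of `G`. -/
theorem ins_one_cons (hb : IsUnitalBar σ b) (h1 : σ 1 = 1) {G : List A → A} (hG : IsML S G)
    (hk : ∀ l, l ≠ [] → G (1 :: l) = 0) {w : List A} (hw : w ≠ []) :
    ins (fun x => - σ x) b G (1 :: w) = G w := by
  cases w with
  | nil => exact absurd rfl hw
  | cons y w =>
    rw [ins_cons, splitSum_eq_single (show [1, y] ++ w = 1 :: y :: w from rfl), hb.pair, h1, one_mul,
      ins_eq_zero, add_zero]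
    · intro u v w _
      rw [hG.neg_head, hk _ (by simp), neg_zero]
    · intro v r hvr hne
      have : b v = 0 := by
        by_cases hv : v.length ≤ 1
        · exact hb.of_length_le_one hv
        · refine hb.kill v ?_ (by simp at hne; omega)
          cases v with
          | nil => simp at hv
          | cons a v => simp at hvr; simp [hvr.1]
      rw [this, hG.zero_head]

/-- At a unit in the interior, between `x` and `y`, the insertions of `b [x, 1] = σ x` and of `b [1,
y] = y` cancel, since in the second one the letter `x` has been passed and became `-σ x`. If the
unit is the last letter, only the first insertion exists. -/
theorem ins_append_one_cons (hb : IsUnitalBar σ b) (h1 : σ 1 = 1) {G : List A → A} (hG : IsML S G)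
    (hk : ∀ l, (1 : A) ∈ l → 2 ≤ l.length → G l = 0) {u w : List A} (hu : u ≠ []) :
    ins (fun x => - σ x) b G (u ++ 1 :: w) =
      (if w = [] then - G (u.map (fun x => - σ x)) else 0) := by
  induction u generalizing G with
  | nil => exact absurd rfl hu
  | cons x u ih =>
    by_cases hu' : u = []
    · subst hu'
      rw [List.cons_append, List.nil_append, ins_cons,
        splitSum_eq_single (show [x, 1] ++ w = x :: 1 :: w from rfl), hb.pair, mul_one]
      · by_cases hw : w = []
        · subst hw
          rw [if_pos rfl, ins_cons, splitSum_eq_zero, ins_nil]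
          · simp only [List.map_cons, List.map_nil, hG.neg_head]; simp
          · intro v r hvr
            rw [hb.of_length_le_one (l := v) (by have := congrArg List.length hvr; simp at this; omega)]
            exact hG.zero_mid [-σ x] r
        · rw [if_neg hw, ins_one_cons hb h1 (hG.cons _) (fun l hl => hk _ (by simp) (by simp)) hw,
            hG.neg_head]
          simp
      · intro v r hvr hne
        have : b v = 0 := by
          by_cases hv : v.length ≤ 1
          · exact hb.of_length_le_one hv
          · refine hb.kill v ?_ (by simp at hne; omega)
            match v, hv with
            | [], hv => simp at hv
            | [a], hv => simp at hv
            | a :: a' :: v, _ => simp at hvr; simp [hvr.2.1]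
        rw [this, hG.zero_head]
    · rw [List.cons_append, ins_cons, splitSum_eq_zero, zero_add,
        ih (hG.cons _) (fun l hl hl2 => hk _ (by simp [hl]) (by simp; omega)) hu']
      · simp
      · intro v r hvr
        have hm : (1 : A) ∈ v ++ r := by rw [hvr]; simp
        rcases List.mem_append.1 hm with hv | hr
        · by_cases hr : (1 : A) ∈ r
          · exact hk _ (by simp [hr]) (by
              have := List.length_pos_of_mem hr; simp only [List.length_cons]; omega)
          · have hl : 3 ≤ v.length := by
              by_contra hlt
              have hu1 : 1 ≤ u.length := List.length_pos_iff.2 hu'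
              apply hr
              have hd : r = (x :: (u ++ 1 :: w)).drop v.length := by rw [← hvr]; simp
              have h2 : r = ((x :: u).drop v.length) ++ 1 :: w := by
                rw [hd, ← List.cons_append, List.drop_append_of_le_length (by simp; omega)]
              rw [h2]; simp
            rw [hb.kill v hv hl, hG.zero_head]
        · exact hk _ (by simp [hr]) (by
            have := List.length_pos_of_mem hr; simp only [List.length_cons]; omega)

/-- The defect of the `A_∞`-relations vanishes if one argument is the unit. -/
theorem ins_self_kill (hb : IsUnitalBar σ b) (h1 : σ 1 = 1)
    (hτ : ∀ l, b (l.map (fun x => - σ x)) = σ (b l)) {l : List A} (hl : (1 : A) ∈ l)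
    (hlen : 4 ≤ l.length) : ins (fun x => - σ x) b b l = 0 := by
  -- The product is split off from the outer `b`. The remainder dies on every word of length at
  -- least two containing the unit, so that the insertion lemmas for units apply to it; the product
  -- part consists of two explicit terms which cancel against what is left.
  have e : ins (fun x => - σ x) b b l = ins (fun x => - σ x) b (barMul σ) l +
      ins (fun x => - σ x) b (fun l => b l - barMul σ l) l := by
    rw [← ins_add]; simp
  have hG : IsML S (fun l => b l - barMul σ l) := hb.ml.sub isML_barMul
  have hk : ∀ l, (1 : A) ∈ l → 2 ≤ l.length → b l - barMul σ l = 0 := by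
    intro l h h'
    rcases h'.eq_or_lt with h' | h'
    · rw [hb.eq_barMul h'.symm, sub_self]
    · rw [hb.kill l h h', barMul_of_ne (by omega), sub_zero]
  obtain ⟨u, w, rfl⟩ := List.append_of_mem hl
  rw [e]
  cases u with
  | nil =>
    have hlen' : 3 ≤ w.length := by simpa using hlen
    have hw : w ≠ [] := by rintro rfl; simp at hlen'
    obtain ⟨v, x, rfl⟩ := List.eq_nil_or_concat w |>.resolve_left hw
    rw [List.concat_eq_append] at *
    rw [List.nil_append, ins_one_cons hb h1 hG (fun l hl => hk _ (by simp)
      (by have := List.length_pos_iff.2 hl; simp; omega)) hw,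
      ins_barMul (v := 1 :: v) (x := x) (by simp) (by omega), hb.kill (1 :: v) (by simp)
        (by simp at hlen' ⊢; omega), barMul_of_ne (by omega)]
    simp [h1]
  | cons a u =>
    rw [ins_append_one_cons hb h1 hG hk (by simp)]
    by_cases hw : w = []
    · subst hw
      rw [if_pos rfl, List.cons_append, ins_barMul (v := a :: u) (x := 1) (by simp) (by simp),
        hb.kill (u ++ [1]) (by simp) (by simp at hlen ⊢; omega), hτ, barMul_of_ne (by simp at hlen ⊢; omega)]
      simp
    · obtain ⟨v, x, rfl⟩ := List.eq_nil_or_concat w |>.resolve_left hw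
      rw [List.concat_eq_append] at *
      rw [if_neg hw, List.cons_append, ins_barMul (v := a :: (u ++ 1 :: v)) (x := x) (by simp) (by simp; omega),
        hb.kill _ (by simp) (by simp at hlen ⊢; omega), hb.kill _ (by simp) (by simp at hlen ⊢; omega)]
      simp

variable {f : List A → A}

theorem pull_kill (hfk : ∀ l, (1 : A) ∈ l → 2 ≤ l.length → f l = 0) (hf1 : f [1] = 1)
    {G : List A → A} (hG : IsML S G) (hk : ∀ l, (1 : A) ∈ l → G l = 0) {l : List A}
    (hl : (1 : A) ∈ l) : pull f G l = 0 := by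
  induction hn : l.length using Nat.strong_induction_on generalizing G l with
  | _ n ih =>
    cases l with
    | nil => simp at hl
    | cons a w =>
      rw [pull_cons]
      refine splitSum_eq_zero fun v r hvr => ?_
      by_cases hav : (1 : A) ∈ a :: v
      · cases v with
        | nil =>
          have : a = 1 := by simpa [eq_comm] using hav
          rw [this, hf1, pull_congr f (fun l => hk (1 :: l) (by simp)), pull_zero]
        | cons y v =>
          rw [hfk _ hav (by simp), pull_congr f (hG.zero_head), pull_zero]
      · have hr : (1 : A) ∈ r := by
          have : (1 : A) ∈ (a :: v) ++ r := by rw [List.cons_append, hvr]; exact hl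
          exact (List.mem_append.1 this).resolve_left hav
        exact ih r.length (by have := length_le_of_append hvr; simp at hn; omega) (hG.cons _)
          (fun l hl => hk _ (by simp [hl])) hr rfl

theorem pull_eq_zero_of_ne_nil {G : List A → A} (hG : ∀ l, l ≠ [] → G l = 0) {l : List A}
    (hl : l ≠ []) : pull f G l = 0 := by
  cases l with
  | nil => exact absurd rfl hl
  | cons a w =>
    rw [pull_cons]
    exact splitSum_eq_zero fun v r _ => by
      rw [pull_congr f (fun l => hG _ (by simp)), pull_zero]

theorem pull_kill_of_two_le (hfk : ∀ l, (1 : A) ∈ l → 2 ≤ l.length → f l = 0) (hf1 : f [1] = 1)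
    {G : List A → A} (hG : IsML S G) (hk : ∀ l, (1 : A) ∈ l → 2 ≤ l.length → G l = 0) {l : List A}
    (hl : (1 : A) ∈ l) (hlen : 2 ≤ l.length) : pull f G l = 0 := by
  cases l with
  | nil => simp at hl
  | cons a w =>
    rw [pull_cons]
    refine splitSum_eq_zero fun v r hvr => ?_
    by_cases hav : (1 : A) ∈ a :: v
    · cases v with
      | nil =>
        have : a = 1 := by simpa [eq_comm] using hav
        obtain rfl : r = w := by simpa using hvr
        rw [this, hf1]
        exact pull_eq_zero_of_ne_nil (fun l hl => hk _ (by simp)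
          (by have := List.length_pos_iff.2 hl; simp; omega)) (by rintro rfl; simp at hlen)
      | cons y v =>
        rw [hfk _ hav (by simp), pull_congr f (hG.zero_head), pull_zero]
    · have hr : (1 : A) ∈ r := by
        have : (1 : A) ∈ (a :: v) ++ r := by rw [List.cons_append, hvr]; exact hl
        exact (List.mem_append.1 this).resolve_left hav
      exact pull_kill hfk hf1 (hG.cons _) (fun l hl => hk _ (by simp [hl])
        (by have := List.length_pos_of_mem hl; simp; omega)) hr

theorem pull_of_length_one {G : List A → A}
    (hk : ∀ l : List A, 2 ≤ l.length → G l = 0) {l : List A} (hl : l ≠ []) :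
    pull f G l = G [f l] := by
  cases l with
  | nil => exact absurd rfl hl
  | cons a w =>
    rw [pull_cons, splitSum_eq_single (List.append_nil w), pull_nil]
    intro v r hvr hne
    refine pull_eq_zero_of_ne_nil (fun l hl => hk _ ?_) ?_
    · have := List.length_pos_iff.2 hl; simp; omega
    · rintro rfl; simp at hvr; exact hne (by rw [hvr])

/-- The defect of the relations of an `A_∞`-morphism vanishes if one argument is the unit. -/
theorem ins_sub_pull_kill (hb : IsUnitalBar σ b) {b' : List A → A} (hb' : IsUnitalBar σ b')
    (h1 : σ 1 = 1) (hf : IsML S f) (hfk : ∀ l, (1 : A) ∈ l → 2 ≤ l.length → f l = 0)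
    (hf1 : f [1] = 1) (hτ : ∀ l, f (l.map (fun x => - σ x)) = - σ (f l))
    {l : List A} (hl : (1 : A) ∈ l) (hlen : 3 ≤ l.length) :
    ins (fun x => - σ x) b f l - pull f b' l = 0 := by
  obtain ⟨u, w, rfl⟩ := List.append_of_mem hl
  cases u with
  | nil =>
    have hlen' : 2 ≤ w.length := by simpa using hlen
    have hw : w ≠ [] := by rintro rfl; simp at hlen'
    rw [List.nil_append, ins_one_cons hb h1 hf (fun l hl => hfk _ (by simp)
      (by have := List.length_pos_iff.2 hl; simp; omega)) hw, pull_cons,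
      splitSum_eq_single (List.nil_append w), hf1, pull_of_length_one
        (fun l hl => hb'.kill _ (by simp) (by simp; omega)) hw, hb'.pair, h1, one_mul, sub_self]
    intro v r hvr hne
    rw [hfk (1 :: v) (by simp) (by simp at hne ⊢; exact List.length_pos_iff.2 hne),
      pull_congr f (hb'.ml.zero_head), pull_zero]
  | cons a u =>
    rw [ins_append_one_cons hb h1 hf hfk (by simp), List.cons_append, pull_cons]
    -- A unit in the first block kills that block. Otherwise it lies in the remainder, and the term
    -- vanishes unless the remainder is just the unit, for only then is `b'` applied to two letters.
    have hterm : ∀ v r, v ++ r = u ++ 1 :: w → (1 : A) ∈ v ∨ r ≠ [1] →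
        pull f (fun l => b' (f (a :: v) :: l)) r = 0 := by
      intro v r hvr hr
      by_cases hv : (1 : A) ∈ v
      · rw [hfk (a :: v) (by simp [hv]) (by have := List.length_pos_of_mem hv; simp; omega),
          pull_congr f (hb'.ml.zero_head), pull_zero]
      · have hmr : (1 : A) ∈ r := by
          have : (1 : A) ∈ v ++ r := by rw [hvr]; simp
          exact (List.mem_append.1 this).resolve_left hv
        refine pull_kill_of_two_le hfk hf1 (hb'.ml.cons _) (fun l hl h2 => hb'.kill _ (by simp [hl])
          (by simp; omega)) hmr ?_
        match r, hmr, hr.resolve_left hv with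
        | [x], hm, hr => simp at hm; exact absurd (by rw [hm]) hr
        | _ :: _ :: _, _, _ => simp
    by_cases hw : w = []
    · subst hw
      rw [if_pos rfl, splitSum_eq_single (show u ++ [1] = u ++ [1] from rfl), pull_cons, splitSum_nil,
        pull_nil, hf1, hb'.pair, hτ, mul_one]
      · simp
      · intro v r hvr hne
        refine hterm v r hvr (Or.inr ?_)
        rintro rfl
        exact hne (by have := congrArg List.length hvr; simpa using this)
    · rw [if_neg hw, splitSum_eq_zero, sub_zero]
      intro v r hvr
      refine hterm v r hvr ?_
      by_cases hr : r = [1]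
      · left
        subst hr
        obtain ⟨w', x, rfl⟩ := List.eq_nil_or_concat w |>.resolve_left hw
        rw [List.concat_eq_append, ← List.cons_append, ← List.append_assoc] at hvr
        rw [(List.append_inj' hvr rfl).1]
        simp
      · exact Or.inr hr

end Normalization


/-! ### Obstruction theory for operations. -/

section Obstruction

variable {S A : Type*} [CommRing S] [Ring A] [Algebra S A]
  {𝒜 : ℤ → ℤ → Submodule S A} {σ : A →ₗ[S] A}

theorem exists_twist (hσ : ∀ a, σ (σ a) = a) (l : List A) : ∃ a : ℕ → A, twist σ l.length a = l := by
  refine ⟨fun i => (σ ^ (l.length - 1 - i)) (l.getD i 0), ?_⟩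
  apply List.ext_getElem
  · simp
  · intro i h1 h2
    rw [← List.getD_eq_getElem _ 0, getD_twist _ h2, sigma_pow_sigma_pow hσ (k := 0) (by omega),
      List.getD_eq_getElem _ 0 h2]
    simp

theorem bar_map_neg_sigma {m : (n : ℕ) → MultilinearMap S (fun _ : Fin n => A) A} {e : ℕ}
    (hm : ∀ n a, σ (m n a) = (-1 : S) ^ (n + e) • m n (fun i => σ (a i))) (l : List A) :
    bar σ m (l.map (fun x => - σ x)) = (-1 : S) ^ e • σ (bar σ m l) := by
  rw [bar_eq m _ l.length (by simp), bar_eq m l l.length rfl, hm, smul_smul, ← pow_add]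
  have : (fun i : Fin l.length => (σ ^ (l.length - 1 - i.val)) ((l.map (fun x => - σ x)).getD i.val 0)) =
      fun i => (-1 : S) • σ ((σ ^ (l.length - 1 - i.val)) (l.getD i.val 0)) := by
    funext i
    have h : (l.map (fun x => - σ x)).getD i.val 0 = - σ (l.getD i.val 0) := by
      rw [List.getD_eq_getElem _ _ (by simp), List.getElem_map, List.getD_eq_getElem _ _ (by simp)]
    rw [h, map_neg, neg_one_smul, ← Module.End.mul_apply, ← Module.End.mul_apply, pow_mul_comm']
  rw [this, MultilinearMap.map_smul_univ]
  simp only [Finset.prod_const, Finset.card_univ, Fintype.card_fin]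
  congr 1
  rw [show e + (l.length + e) = l.length + 2 * e by ring, pow_add, pow_mul]; simp

theorem bar_kill (H : IsSignedBigrading 𝒜 σ) {m : (n : ℕ) → MultilinearMap S (fun _ : Fin n => A) A}
    {l : List A} {j : ℤ} (hm : m l.length ∈ cochains 𝒜 l.length j) (hl : (1 : A) ∈ l) :
    bar σ m l = 0 := by
  obtain ⟨i, hi, h⟩ := List.getElem_of_mem hl
  refine hm.1 _ ⟨⟨i, hi⟩, ?_⟩
  simp only
  rw [List.getD_eq_getElem _ _ hi, h, H.sigma_pow_one]

/-- The components of functions on words which are normalized and homogeneous are cochains. -/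
theorem unbar_mem_cochains (H : IsSignedBigrading 𝒜 σ) {c : List A → A} (hc : IsML S c) {e : ℤ}
    (hd : HasDeg 𝒜 c e 0) {n : ℕ} (hk : ∀ l, (1 : A) ∈ l → l.length = n → c l = 0) {j : ℤ}
    (hj : j = e + 1 - n) : unbar σ hc n ∈ cochains 𝒜 n j := by
  subst hj
  refine ⟨?_, unbar_isHomogeneous H hc hd n⟩
  rintro a ⟨i, hi⟩
  refine hk _ ?_ (by simp)
  rw [List.mem_ofFn]
  exact ⟨i, by rw [hi, H.sigma_pow_one]⟩

theorem bar_single_unbar (hσ : ∀ a, σ (σ a) = a) {c : List A → A} (hc : IsML S c) {n : ℕ} {l : List A}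
    (hl : l.length = n) : bar σ (Pi.single n (unbar σ hc n)) l = c l := by
  subst hl
  obtain ⟨a, ha⟩ := exists_twist hσ l
  rw [← ha, length_twist, bar_single_twist hσ, unbar_apply, ← ha, length_twist]

theorem isHomogeneous_zero {n : ℕ} {j : ℤ} :
    IsHomogeneous 𝒜 (0 : MultilinearMap S (fun _ : Fin n => A) A) j :=
  fun _ _ _ _ => Submodule.zero_mem _

/-- A minimal `A_∞`-structure up to `m_N`. -/
structure IsPreAInf (𝒜 : ℤ → ℤ → Submodule S A) (σ : A →ₗ[S] A)
    (m : (n : ℕ) → MultilinearMap S (fun _ : Fin n => A) A) (N : ℕ) : Prop where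
  zero : m 0 = 0
  one : m 1 = 0
  two : m 2 = mulMap S A
  mem : ∀ n, 3 ≤ n → m n ∈ cochains 𝒜 n (2 - n)
  big : ∀ n, N < n → m n = 0
  rel : ∀ l : List A, l.length ≤ N + 1 → ins (fun x => - σ x) (bar σ m) (bar σ m) l = 0

section Unital

variable {m : (n : ℕ) → MultilinearMap S (fun _ : Fin n => A) A}

theorem isHomogeneous_of_unital (H : IsSignedBigrading 𝒜 σ) (h0 : m 0 = 0) (h1 : m 1 = 0)
    (h2 : m 2 = mulMap S A) (hm : ∀ n, 3 ≤ n → m n ∈ cochains 𝒜 n (2 - n)) (n : ℕ) :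
    IsHomogeneous 𝒜 (m n) (1 + 1 - n) := by
  match n with
  | 0 => rw [h0]; exact isHomogeneous_zero
  | 1 => rw [h1]; exact isHomogeneous_zero
  | 2 => rw [h2]; exact isHomogeneous_mulMap H
  | n + 3 => exact (hm (n + 3) (by omega)).2

theorem isUnitalBar (H : IsSignedBigrading 𝒜 σ) (h0 : m 0 = 0) (h1 : m 1 = 0)
    (h2 : m 2 = mulMap S A) (hm : ∀ n, 3 ≤ n → m n ∈ cochains 𝒜 n (2 - n)) :
    IsUnitalBar σ (bar σ m) where
  ml := isML_bar m
  nil := by rw [bar_eq m [] 0 rfl, h0]; rfl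
  single x := by rw [bar_eq m [x] 1 rfl, h1]; rfl
  pair x y := by
    rw [← barMul_pair, barMul, bar_eq m [x, y] 2 rfl, bar_eq _ [x, y] 2 rfl, h2, Pi.single_eq_same]
  kill l hl h3 := bar_kill H (hm _ h3) hl

theorem sigma_apply_of_isHomogeneous (H : IsSignedBigrading 𝒜 σ) {e : ℕ}
    (hm : ∀ n, IsHomogeneous 𝒜 (m n) (e - n)) (n : ℕ) (a : Fin n → A) :
    σ (m n a) = (-1 : S) ^ (n + e) • m n (fun i => σ (a i)) := by
  rw [H.sigma_apply (hm n)]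
  congr 1
  exact neg_one_pow_natAbs_congr (x := e - n) (y := (n + e : ℕ)) (by push_cast; omega)

theorem sigma_apply_of_unital (H : IsSignedBigrading 𝒜 σ)
    (hm : ∀ n, IsHomogeneous 𝒜 (m n) (1 + 1 - n)) (n : ℕ) (a : Fin n → A) :
    σ (m n a) = (-1 : S) ^ n • m n (fun i => σ (a i)) := by
  rw [sigma_apply_of_isHomogeneous H (e := 2) hm, pow_add]; simp

theorem bar_map_of_unital (H : IsSignedBigrading 𝒜 σ)
    (hm : ∀ n, IsHomogeneous 𝒜 (m n) (1 + 1 - n)) (l : List A) :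
    bar σ m (l.map (fun x => - σ x)) = σ (bar σ m l) := by
  rw [bar_map_neg_sigma (e := 0) (sigma_apply_of_unital H hm)]; simp

end Unital

/-- The words that contribute to the Hochschild differential of the lowest component `E` of a
defect. -/
theorem ins_eq_ins_barMul {b E : List A → A} (hb : IsUnitalBar σ b) (hE : IsML S E) {n : ℕ}
    (hEz : ∀ l : List A, l.length < n → E l = 0) (e : MultilinearMap S (fun _ : Fin n => A) A)
    (he : ∀ l : List A, l.length = n → bar σ (Pi.single n e) l = E l) {l : List A}
    (hl : l.length = n + 1) :
    ins (fun x => - σ x) b E l = ins (fun x => - σ x) (barMul σ) (bar σ (Pi.single n e)) l := by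
  refine ins_congr₂ fun u v w h => ?_
  have hlen := congrArg List.length h
  simp only [List.length_append, hl] at hlen
  rcases Nat.lt_trichotomy v.length 2 with hv | hv | hv
  · rw [hb.of_length_le_one (by omega), barMul_of_ne (by omega), hE.zero_mid, (isML_bar _).zero_mid]
  · rw [hb.eq_barMul hv, he _ (by simp; omega)]
  · rw [hEz _ (by simp; omega), bar_single_of_ne _ (by simp; omega)]

/-- Mirror image of `ins_eq_ins_barMul`: now the defect is inserted, at most two letters are left
outside, and of `b` only the product is seen. -/
theorem ins_defect_eq {θ : A → A} {b E : List A → A} (hb : IsUnitalBar σ b) {n : ℕ}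
    (hEz : ∀ l : List A, l.length < n → E l = 0) (e : MultilinearMap S (fun _ : Fin n => A) A)
    (he : ∀ l : List A, l.length = n → bar σ (Pi.single n e) l = E l) {l : List A}
    (hl : l.length = n + 1) :
    ins θ E b l = ins θ (bar σ (Pi.single n e)) (barMul σ) l := by
  refine ins_congr₂ fun u v w h => ?_
  have hlen := congrArg List.length h
  simp only [List.length_append, hl] at hlen
  rcases Nat.lt_trichotomy v.length n with hv | hv | hv
  · rw [hEz v hv, bar_single_of_ne _ (by omega), hb.ml.zero_mid, isML_barMul.zero_mid]
  · rw [he v hv, hb.eq_barMul (by simp; omega)]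
  · rw [hb.of_length_le_one (by simp; omega), barMul_of_ne (by simp; omega)]

theorem neg_sigma_mem (H : IsSignedBigrading 𝒜 σ) (h k : ℤ) (a : A) (ha : a ∈ 𝒜 h k) :
    - σ a ∈ 𝒜 h k := Submodule.neg_mem _ (H.sigma_mem ha)

/-- The defect of the `A_∞`-relations. -/
theorem isML_defect {m : (n : ℕ) → MultilinearMap S (fun _ : Fin n => A) A} :
    IsML S (ins (fun x => - σ x) (bar σ m) (bar σ m)) :=
  IsML.ins (θ := -σ) (isML_bar m) (isML_bar m)

/-- The defect is the family of components of the squared coderivation, and a coderivation commutes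
with its square: inserting `b` into the defect gives the same as inserting the defect into `b`
(`ins_ins`). The defect vanishes on words shorter than `N + 2`, so on words of length `N + 3` only
the product part of `b` enters on either side, and the identity becomes the cocycle condition. -/
theorem obstruction_mem_cocycles (H : IsSignedBigrading 𝒜 σ)
    {m : (n : ℕ) → MultilinearMap S (fun _ : Fin n => A) A} {N : ℕ} (hN : 2 ≤ N)
    (hm : IsPreAInf 𝒜 σ m N) :
    unbar σ (isML_defect (σ := σ) (m := m)) (N + 2) ∈ cocycles 𝒜 σ (N + 2) (1 - N) := by
  have hh := isHomogeneous_of_unital H hm.zero hm.one hm.two hm.mem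
  have hu := isUnitalBar H hm.zero hm.one hm.two hm.mem
  have hτ := bar_map_of_unital H hh
  have hmem : unbar σ (isML_defect (σ := σ) (m := m)) (N + 2) ∈ cochains 𝒜 (N + 2) (1 - N) :=
    unbar_mem_cochains H _ (HasDeg.ins (neg_sigma_mem H) (hasDeg_bar H hh) (hasDeg_bar H hh))
      (fun l hl hlen => ins_self_kill hu H.sigma_one hτ hl (by omega)) (by push_cast; ring)
  refine ⟨hmem, LinearMap.mem_ker.2 ?_⟩
  have key : ∀ a : ℕ → A, hochD σ (N + 2) (1 - N) (unbar σ (isML_defect (σ := σ) (m := m)) (N + 2))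
      (fun i => a i.val) = 0 := by
    intro a
    have h1 := hochD_eq_ins_odd H (n := N + 2) (by omega) (j := 1 - N) (by push_cast; omega) hmem.2 a
    have hz : ∀ l : List A, l.length < N + 2 → ins (fun x => - σ x) (bar σ m) (bar σ m) l = 0 :=
      fun l hl => hm.rel l (by omega)
    rw [← ins_eq_ins_barMul hu isML_defect hz _ (fun l hl => bar_single_unbar H.sigma_sigma _ hl)
      (by simp), ← ins_defect_eq hu hz _ (fun l hl => bar_single_unbar H.sigma_sigma _ hl)
      (by simp), ins_ins (θ := fun x => - σ x) (by simp [H.sigma_sigma]) hu.nil hu.ml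
        (by simpa using hτ) hu.ml, sub_self] at h1
    exact neg_eq_zero.1 h1.symm
  ext a
  have := key (fun i => if h : i < N + 3 then a ⟨i, h⟩ else 0)
  simpa using this

/-- Adding an operation `m_{N+1}` with the right Hochschild differential. -/
theorem IsPreAInf.update (H : IsSignedBigrading 𝒜 σ)
    {m : (n : ℕ) → MultilinearMap S (fun _ : Fin n => A) A} {N : ℕ} (hN : 2 ≤ N)
    (hm : IsPreAInf 𝒜 σ m N) {h : MultilinearMap S (fun _ : Fin (N + 1) => A) A}
    (hh : h ∈ cochains 𝒜 (N + 1) (1 - N))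
    (hob : hochD σ (N + 1) (1 - N) h = unbar σ (isML_defect (σ := σ) (m := m)) (N + 2)) :
    IsPreAInf 𝒜 σ (m + Pi.single (N + 1) h) (N + 1) := by
  have hu := isUnitalBar H hm.zero hm.one hm.two hm.mem
  have hadd : ∀ l, bar σ (m + Pi.single (N + 1) h) l = bar σ m l + bar σ (Pi.single (N + 1) h) l :=
    fun l => rfl
  have hml := isML_bar (σ := σ) (m + Pi.single (N + 1) h)
  have hmz : ∀ l : List A, l.length = N + 1 → bar σ m l = 0 := fun l hl => by
    rw [bar_eq m l _ hl, hm.big _ (by omega)]; rfl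
  refine ⟨?_, ?_, ?_, ?_, ?_, ?_⟩
  · simp [hm.zero]
  · rw [Pi.add_apply, Pi.single_eq_of_ne (by omega), hm.one, add_zero]
  · rw [Pi.add_apply, Pi.single_eq_of_ne (by omega), hm.two, add_zero]
  · intro n hn
    by_cases hnN : n = N + 1
    · subst hnN
      rw [Pi.add_apply, Pi.single_eq_same, hm.big _ (by omega), zero_add]
      convert hh using 2; push_cast; ring
    · rw [Pi.add_apply, Pi.single_eq_of_ne hnN, add_zero]
      exact hm.mem n hn
  · intro n hn
    rw [Pi.add_apply, Pi.single_eq_of_ne (by omega), hm.big n (by omega), add_zero]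
  · intro l hl
    rcases hl.lt_or_eq with hl | hl
    · rw [← hm.rel l (by omega)]
      refine ins_congr₂ fun u v w huvw => ?_
      have hlen := congrArg List.length huvw
      simp only [List.length_append] at hlen
      rw [hadd v]
      by_cases hv1 : v.length ≤ 1
      · rw [hu.of_length_le_one hv1, bar_single_of_ne _ (by omega), add_zero, hml.zero_mid,
          hu.ml.zero_mid]
      · by_cases hv : v.length = N + 1
        · rw [hadd, hu.of_length_le_one (l := _ ++ _) (by simp; omega),
            hu.of_length_le_one (l := _ ++ _) (by simp; omega), bar_single_of_ne _ (by simp; omega),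
            add_zero]
        · rw [bar_single_of_ne h hv, add_zero, hadd, bar_single_of_ne _ (by simp; omega), add_zero]
    -- On words of length `N + 2` the new relation differs from the old one by the two terms linear
    -- in `h`. A term quadratic in `h` would need `2 N + 1 > N + 2` letters.
    · have key : ins (fun x => - σ x) (bar σ (m + Pi.single (N + 1) h))
          (bar σ (m + Pi.single (N + 1) h)) l =
          ins (fun x => - σ x) (bar σ m) (bar σ m) l +
          ins (fun x => - σ x) (barMul σ) (bar σ (Pi.single (N + 1) h)) l +
          ins (fun x => - σ x) (bar σ (Pi.single (N + 1) h)) (barMul σ) l := by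
        refine ins_add₃ fun u v w huvw => ?_
        have hlen := congrArg List.length huvw
        simp only [List.length_append] at hlen
        by_cases hv1 : v.length ≤ 1
        · rw [hadd v, hu.of_length_le_one hv1, bar_single_of_ne _ (by omega), add_zero,
            barMul_of_ne (by omega), hml.zero_mid, hu.ml.zero_mid, (isML_bar _).zero_mid,
            isML_barMul.zero_mid]; simp
        by_cases hv : v.length = N + 1
        · rw [hadd v, hmz v hv, zero_add, hu.ml.zero_mid, barMul_of_ne (by omega : v.length ≠ 2),
            (isML_bar (σ := σ) (Pi.single (N + 1) h)).zero_mid, hadd,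
            bar_single_of_ne _ (l := _ ++ _) (by simp; omega), hu.eq_barMul (by simp; omega)]
          simp
        · rw [hadd v, bar_single_of_ne h hv, add_zero, hadd, isML_barMul.zero_mid, add_zero]
          by_cases hv2 : v.length = 2
          · rw [hu.eq_barMul hv2]
          · rw [bar_single_of_ne _ (by simp; omega), bar_single_of_ne _ (by simp; omega)]
      obtain ⟨a, ha⟩ := exists_twist H.sigma_sigma l
      rw [show l.length = N + 2 from hl] at ha
      rw [key, add_assoc, ← ha, hochD_eq_ins_even H (by omega) (j := 1 - N) (by push_cast; omega) hh.2,
        hob, unbar_apply, add_neg_cancel]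

end Obstruction


/-! ### Obstruction theory for morphisms. -/

section Morphisms

variable {S A : Type*} [CommRing S] [Ring A] [Algebra S A]
  {𝒜 : ℤ → ℤ → Submodule S A} {σ : A →ₗ[S] A}

theorem pull_congr_left {X : Type*} [AddCommGroup X] {F F' : List A → A} {G : List A → X} {l : List A}
    (h : ∀ v : List A, v ≠ [] → v.length ≤ l.length → F v = F' v) : pull F G l = pull F' G l := by
  induction hn : l.length using Nat.strong_induction_on generalizing G l with
  | _ n ih =>
    cases l with
    | nil => simp
    | cons a w =>
      rw [pull_cons, pull_cons]
      refine splitSum_congr fun v r hvr => ?_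
      have hlen := congrArg List.length hvr
      simp only [List.length_append] at hlen
      simp only [List.length_cons] at h hn
      rw [h (a :: v) (by simp) (by simp; omega)]
      exact ih r.length (by omega) (fun v' h1 h2 => h v' h1 (by omega)) rfl

/-- The properties of the components of a strictly unital morphism with identity linear part. -/
structure IsUnitalMor (F : List A → A) : Prop where
  nil : F [] = 0
  single : ∀ x, F [x] = x
  kill : ∀ l, (1 : A) ∈ l → 2 ≤ l.length → F l = 0

theorem isUnitalBar_barMul : IsUnitalBar σ (barMul σ) where
  ml := isML_barMul
  nil := barMul_of_ne (by simp)
  single x := barMul_of_ne (by simp)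
  pair := barMul_pair
  kill l _ h := barMul_of_ne (by omega)

/-- A word of length `n` has room for the new component only as a single block covering everything.
-/
theorem pull_add_single_of_eq {F Hf : List A → A} {n : ℕ} (hn : 2 ≤ n)
    (hH : ∀ l : List A, l.length ≠ n → Hf l = 0) {G : List A → A} (hG : IsML S G) {l : List A}
    (hl : l.length = n) :
    pull (fun l => F l + Hf l) G l = pull F G l + G [Hf l] := by
  cases l with
  | nil => simp at hl; omega
  | cons a w =>
    rw [pull_cons, pull_cons]
    have e : G [Hf (a :: w)] = splitSum (fun v r => if v.length = w.length then
        G [Hf (a :: w)] else 0) w := by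
      rw [splitSum_eq_single (List.append_nil w)]
      · simp
      · intro v r _ h; rw [if_neg h]
    rw [e, ← splitSum_add]
    refine splitSum_congr fun v r hvr => ?_
    have hlen := congrArg List.length hvr
    simp only [List.length_append] at hlen
    simp only [List.length_cons] at hl
    by_cases hv : v.length = w.length
    · obtain rfl : r = [] := List.length_eq_zero_iff.1 (by omega)
      obtain rfl : v = w := by simpa using hvr
      rw [if_pos rfl, pull_nil, pull_nil]
      exact hG.add [] _ _ []
    · rw [if_neg hv, hH (a :: v) (by simp; omega), add_zero, add_zero]
      refine pull_congr_left fun v' _ h => ?_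
      rw [hH v' (by omega), add_zero]

/-- The effect of changing one component of a morphism, on words which are longer by one. -/
theorem pull_add_single_of_eq_succ {F Hf : List A → A} (hF : ∀ x, F [x] = x) {n : ℕ} (hn : 2 ≤ n)
    (hH : ∀ l : List A, l.length ≠ n → Hf l = 0) {G : List A → A} (hG : IsUnitalBar σ G) {l : List A}
    (hl : l.length = n + 1) :
    pull (fun l => F l + Hf l) G l = pull F G l + ins id Hf (barMul σ) l := by
  cases l with
  | nil => simp at hl
  | cons a w =>
    obtain ⟨w', x, hw'⟩ := List.eq_nil_or_concat (a :: w) |>.resolve_left (by simp)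
    rw [List.concat_eq_append] at hw'
    simp only [List.length_cons] at hl
    rw [ins_barMul hw' (by omega), pull_cons, pull_cons, add_comm (σ (Hf w') * x)]
    obtain ⟨w₀, rfl⟩ : ∃ w₀, w' = a :: w₀ := by
      cases w' with
      | nil => simp at hw'; simp [hw'.2] at hl; omega
      | cons b w' => simp at hw'; exact ⟨w', by rw [hw'.1]⟩
    simp only [List.cons_append, List.cons.injEq, true_and] at hw'
    have e₁ : σ (id a) * Hf w = splitSum (fun v r => if v.length = ([] : List A).length then
        σ (id a) * Hf w else 0) w := by
      rw [splitSum_eq_single (List.nil_append w)]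
      · simp
      · intro v r _ h; rw [if_neg h]
    have e₂ : σ (Hf (a :: w₀)) * x = splitSum (fun v r => if v.length = w₀.length then
        σ (Hf (a :: w₀)) * x else 0) w := by
      rw [splitSum_eq_single hw'.symm]
      · simp
      · intro v r _ h; rw [if_neg h]
    rw [e₁, e₂, ← splitSum_add, ← splitSum_add]
    refine splitSum_congr fun v r hvr => ?_
    have hlen := congrArg List.length hvr
    have hlen' := congrArg List.length hw'
    simp only [List.length_append, List.length_singleton] at hlen hlen'
    by_cases hv : v.length = 0
    · obtain rfl : v = [] := List.length_eq_zero_iff.1 hv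
      obtain rfl : r = w := by simpa using hvr
      rw [if_pos rfl, if_neg (by simp; omega), hH [a] (by simp; omega), add_zero, add_zero, hF,
        pull_add_single_of_eq hn hH (hG.ml.cons a) (by omega), hG.pair]
      rfl
    · rw [if_neg (by simpa using hv), zero_add]
      by_cases hv' : v.length = w₀.length
      · obtain ⟨rfl, rfl⟩ := List.append_inj (hvr.trans hw') hv'
        rw [if_pos rfl, pull_cons, pull_cons, splitSum_nil, splitSum_nil, pull_nil, pull_nil, hF,
          hH [x] (by simp; omega), add_zero, ← hG.pair]
        exact hG.ml.add [] _ _ _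
      · rw [if_neg hv', hH (a :: v) (by simp; omega), add_zero, add_zero]
        refine pull_congr_left fun v' _ h => ?_
        rw [hH v' (by omega), add_zero]

/-- On words of length `n + 1` the function `E` uses all letters, and then a single letter is left,
which `G` kills; or it uses all but the first or all but the last letter, and then `G` acts through
the product. -/
theorem pullDer_eq_ins {F E G : List A → A} (hF : ∀ x, F [x] = x)
    (hG : IsUnitalBar σ G) {θ : A → A} {n : ℕ} (hn : 2 ≤ n)
    (hE : ∀ l : List A, l.length < n → E l = 0)
    {l : List A} (hl : l.length = n + 1) : pullDer θ F E G l = ins θ E (barMul σ) l := by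
  have key : ∀ {G : List A → A} (hG : IsML S G) {l : List A} (hl : l.length ≤ n),
      pullDer θ F E G l = if l.length = n then G [E l] else 0 := by
    intro G hG l hl
    induction hk : l.length using Nat.strong_induction_on generalizing G l with
    | _ k ih =>
      cases l with
      | nil => simp at hk; subst hk; rw [pullDer_nil, if_neg (by omega)]
      | cons a w =>
        simp only [List.length_cons] at hl hk
        rw [pullDer_cons, splitSum_eq_single (List.append_nil w), pull_nil, pullDer_nil, add_zero]
        · split_ifs with h
          · rfl
          · rw [hE _ (by simp; omega)]; exact hG.zero_head []
        · intro v r hvr hne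
          have hlen := congrArg List.length hvr
          simp only [List.length_append] at hlen
          rw [hE _ (by simp; omega), pull_congr F hG.zero_head, pull_zero, zero_add,
            ih r.length (by omega) (hG.cons _) (by omega) rfl, if_neg (by omega)]
  cases l with
  | nil => simp at hl
  | cons a w =>
    obtain ⟨w', x, hw'⟩ := List.eq_nil_or_concat (a :: w) |>.resolve_left (by simp)
    rw [List.concat_eq_append] at hw'
    simp only [List.length_cons] at hl
    rw [ins_barMul hw' (by omega), pullDer_cons, splitSum_add]
    obtain ⟨w₀, rfl⟩ : ∃ w₀, w' = a :: w₀ := by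
      cases w' with
      | nil => simp at hw'; simp [hw'.2] at hl; omega
      | cons b w' => simp at hw'; exact ⟨w', by rw [hw'.1]⟩
    simp only [List.cons_append, List.cons.injEq, true_and] at hw'
    have hlen' := congrArg List.length hw'
    simp only [List.length_append, List.length_singleton] at hlen'
    rw [splitSum_eq_single hw'.symm, splitSum_eq_single (List.nil_append w), pull_cons, splitSum_nil,
      pull_nil, hF, hG.pair, key (hG.ml.cons _) (by omega), if_pos (by omega), hG.pair, hF]
    · intro v r hvr hne
      have hlen := congrArg List.length hvr
      simp only [List.length_append, List.length_nil] at hlen hne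
      rw [key (hG.ml.cons _) (by omega), if_neg (by omega)]
    · intro v r hvr hne
      have hlen := congrArg List.length hvr
      simp only [List.length_append] at hlen
      rcases Nat.lt_or_ge v.length w₀.length with h | h
      · rw [hE _ (by simp; omega), pull_congr F hG.ml.zero_head, pull_zero]
      · obtain rfl : r = [] := List.length_eq_zero_iff.1 (by omega)
        rw [pull_nil, hG.single]

/-- A strictly unital morphism with identity linear part, up to its `N`-th component. -/
structure IsPreMor (𝒜 : ℤ → ℤ → Submodule S A) (σ : A →ₗ[S] A)
    (μ ν f : (n : ℕ) → MultilinearMap S (fun _ : Fin n => A) A) (N : ℕ) : Prop where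
  zero : f 0 = 0
  one : ∀ a, f 1 a = a 0
  mem : ∀ n, 2 ≤ n → f n ∈ cochains 𝒜 n (1 - n)
  big : ∀ n, N < n → f n = 0
  rel : ∀ l : List A, l.length ≤ N + 1 →
    ins (fun x => - σ x) (bar σ μ) (bar σ f) l - pull (bar σ f) (bar σ ν) l = 0

variable {μ ν f : (n : ℕ) → MultilinearMap S (fun _ : Fin n => A) A}

theorem isHomogeneous_of_unitalMor (h0 : f 0 = 0) (h1 : ∀ a, f 1 a = a 0)
    (hf : ∀ n, 2 ≤ n → f n ∈ cochains 𝒜 n (1 - n)) (n : ℕ) :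
    IsHomogeneous 𝒜 (f n) (0 + 1 - n) := by
  match n with
  | 0 => rw [h0]; exact isHomogeneous_zero
  | 1 => intro h k a ha; rw [h1]; simpa using ha 0
  | n + 2 => rw [zero_add]; exact (hf (n + 2) (by omega)).2

theorem isUnitalMor_bar (H : IsSignedBigrading 𝒜 σ) (h0 : f 0 = 0) (h1 : ∀ a, f 1 a = a 0)
    (hf : ∀ n, 2 ≤ n → f n ∈ cochains 𝒜 n (1 - n)) : IsUnitalMor (bar σ f) where
  nil := by rw [bar_eq f [] 0 rfl, h0]; rfl
  single x := by rw [bar_eq f [x] 1 rfl, h1]; rfl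
  kill l hl h2 := bar_kill H (hf _ h2) hl

theorem sigma_apply_of_unitalMor (H : IsSignedBigrading 𝒜 σ)
    (hf : ∀ n, IsHomogeneous 𝒜 (f n) (0 + 1 - n)) (n : ℕ) (a : Fin n → A) :
    σ (f n a) = (-1 : S) ^ (n + 1) • f n (fun i => σ (a i)) :=
  sigma_apply_of_isHomogeneous H (e := 1) (fun n => by simpa using hf n) n a

theorem bar_map_of_unitalMor (H : IsSignedBigrading 𝒜 σ)
    (hf : ∀ n, IsHomogeneous 𝒜 (f n) (0 + 1 - n)) (l : List A) :
    bar σ f (l.map (fun x => - σ x)) = - σ (bar σ f l) := by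
  rw [bar_map_neg_sigma (e := 1) (sigma_apply_of_unitalMor H hf)]; simp

/-- The defect of the relations of a morphism. -/
theorem isML_morDefect :
    IsML S (fun l => ins (fun x => - σ x) (bar σ μ) (bar σ f) l - pull (bar σ f) (bar σ ν) l) :=
  (IsML.ins (θ := -σ) (isML_bar μ) (isML_bar f)).sub (IsML.pull (isML_bar f) (isML_bar ν))

theorem HasDeg.sub {G G' : List A → A} {e e' : ℤ} (hG : HasDeg 𝒜 G e e') (hG' : HasDeg 𝒜 G' e e') :
    HasDeg 𝒜 (fun l => G l - G' l) e e' :=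
  fun L hL => Submodule.sub_mem _ (hG L hL) (hG' L hL)

/-- All relations of a minimal `A_∞`-structure, in terms of words. -/
structure IsAInf (𝒜 : ℤ → ℤ → Submodule S A) (σ : A →ₗ[S] A)
    (m : (n : ℕ) → MultilinearMap S (fun _ : Fin n => A) A) : Prop where
  zero : m 0 = 0
  one : m 1 = 0
  two : m 2 = mulMap S A
  mem : ∀ n, 3 ≤ n → m n ∈ cochains 𝒜 n (2 - n)
  rel : ∀ l : List A, ins (fun x => - σ x) (bar σ m) (bar σ m) l = 0

theorem IsAInf.isHomogeneous (H : IsSignedBigrading 𝒜 σ) (hμ : IsAInf 𝒜 σ μ) (n : ℕ) :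
    IsHomogeneous 𝒜 (μ n) (1 + 1 - n) :=
  isHomogeneous_of_unital H hμ.zero hμ.one hμ.two hμ.mem n

theorem IsAInf.isUnitalBar (H : IsSignedBigrading 𝒜 σ) (hμ : IsAInf 𝒜 σ μ) :
    IsUnitalBar σ (bar σ μ) := SqZero.isUnitalBar H hμ.zero hμ.one hμ.two hμ.mem

/-- Write `F`, `D_μ`, `D_ν` for the coalgebra map and the two coderivations. The defect gives the
components of `F D_μ - D_ν F`, and `D_ν (F D_μ - D_ν F) + (F D_μ - D_ν F) D_μ = 0` because both
coderivations have square zero (`ins_ins`, `ins_pull`). In the lowest length in which this is not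
trivial, only the products contribute, which is the cocycle condition. -/
theorem morDefect_mem_cocycles (H : IsSignedBigrading 𝒜 σ) {N : ℕ} (hN : 1 ≤ N)
    (hμ : IsAInf 𝒜 σ μ) (hν : IsAInf 𝒜 σ ν) (hf : IsPreMor 𝒜 σ μ ν f N) :
    unbar σ (isML_morDefect (σ := σ) (μ := μ) (ν := ν) (f := f)) (N + 2) ∈
      cocycles 𝒜 σ (N + 2) (-N) := by
  have hfh := isHomogeneous_of_unitalMor hf.zero hf.one hf.mem
  have hfu := isUnitalMor_bar H hf.zero hf.one hf.mem
  have hμu := hμ.isUnitalBar H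
  have hνu := hν.isUnitalBar H
  have hτ := bar_map_of_unital H (hμ.isHomogeneous H)
  have hτf := bar_map_of_unitalMor H hfh
  have hd : HasDeg 𝒜 (fun l => ins (fun x => - σ x) (bar σ μ) (bar σ f) l -
      pull (bar σ f) (bar σ ν) l) 1 0 := by
    refine HasDeg.sub ?_ (HasDeg.pull (hasDeg_bar H hfh) (hasDeg_bar H (hν.isHomogeneous H)))
    have := HasDeg.ins (neg_sigma_mem H) (hasDeg_bar H (hμ.isHomogeneous H)) (hasDeg_bar H hfh)
    rwa [add_zero] at this
  have hmem : unbar σ (isML_morDefect (σ := σ) (μ := μ) (ν := ν) (f := f)) (N + 2) ∈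
      cochains 𝒜 (N + 2) (-N) :=
    unbar_mem_cochains H _ hd
      (fun l hl hlen => ins_sub_pull_kill hμu hνu H.sigma_one (isML_bar f) hfu.kill (hfu.single 1)
        hτf hl (by omega)) (by push_cast; ring)
  refine ⟨hmem, LinearMap.mem_ker.2 ?_⟩
  have key : ∀ a : ℕ → A, hochD σ (N + 2) (-N)
      (unbar σ (isML_morDefect (σ := σ) (μ := μ) (ν := ν) (f := f)) (N + 2))
      (fun i => a i.val) = 0 := by
    intro a
    have h1 := hochD_eq_ins_even H (n := N + 2) (by omega) (j := -N) (by push_cast; omega) hmem.2 a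
    have hz : ∀ l : List A, l.length < N + 2 → ins (fun x => - σ x) (bar σ μ) (bar σ f) l -
      pull (bar σ f) (bar σ ν) l = 0 := fun l hl => hf.rel l (by omega)
    rw [← ins_eq_ins_barMul hμu isML_morDefect hz _ (fun l hl => bar_single_unbar H.sigma_sigma _ hl)
      (by simp), ins_sub, ins_ins (θ := fun x => - σ x) (by simp [H.sigma_sigma]) hμu.nil hμu.ml
        (by simpa using hτ) (isML_bar f), ins_pull hμu.nil hfu.nil (isML_bar f) hτf hνu.nil (isML_bar ν),
      pull_congr _ hν.rel, pull_zero,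
      pullDer_eq_ins hfu.single hνu (by omega) hz (by simp : _ = (N + 2) + 1),
      ins_defect_eq isUnitalBar_barMul hz _
        (fun l hl => bar_single_unbar H.sigma_sigma isML_morDefect hl) (by simp),
      ins_eq_zero] at h1
    · simpa using h1
    · intro u v w _
      rw [hμ.rel]; exact (isML_bar f).zero_mid _ _
  ext a
  have := key (fun i => if h : i < N + 3 then a ⟨i, h⟩ else 0)
  simpa using this

/-- Adding a component `f_{N+1}` with the right Hochschild differential. -/
theorem IsPreMor.update (H : IsSignedBigrading 𝒜 σ) {N : ℕ} (hN : 1 ≤ N)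
    (hμ : IsAInf 𝒜 σ μ) (hν : IsAInf 𝒜 σ ν) (hf : IsPreMor 𝒜 σ μ ν f N)
    {h : MultilinearMap S (fun _ : Fin (N + 1) => A) A} (hh : h ∈ cochains 𝒜 (N + 1) (-N))
    (hob : hochD σ (N + 1) (-N) h =
      unbar σ (isML_morDefect (σ := σ) (μ := μ) (ν := ν) (f := f)) (N + 2)) :
    IsPreMor 𝒜 σ μ ν (f + Pi.single (N + 1) h) (N + 1) := by
  have hfu := isUnitalMor_bar H hf.zero hf.one hf.mem
  have hμu := hμ.isUnitalBar H
  have hνu := hν.isUnitalBar H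
  have hadd : bar σ (f + Pi.single (N + 1) h) =
    fun l => bar σ f l + bar σ (Pi.single (N + 1) h) l := rfl
  have hne : ∀ l : List A, l.length ≠ N + 1 → bar σ (Pi.single (N + 1) h) l = 0 :=
    fun l hl => bar_single_of_ne h hl
  refine ⟨?_, ?_, ?_, ?_, ?_⟩
  · simp [hf.zero]
  · intro a
    rw [Pi.add_apply, Pi.single_eq_of_ne (by omega), add_zero, hf.one]
  · intro n hn
    by_cases hnN : n = N + 1
    · subst hnN
      rw [Pi.add_apply, Pi.single_eq_same, hf.big _ (by omega), zero_add]
      convert hh using 2; push_cast; ring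
    · rw [Pi.add_apply, Pi.single_eq_of_ne hnN, add_zero]
      exact hf.mem n hn
  · intro n hn
    rw [Pi.add_apply, Pi.single_eq_of_ne (by omega), hf.big n (by omega), add_zero]
  · intro l hl
    rw [hadd, ins_add]
    rcases hl.lt_or_eq with hl | hl
    · have e₁ : ins (fun x => - σ x) (bar σ μ) (bar σ (Pi.single (N + 1) h)) l = 0 := by
        refine ins_eq_zero _ _ fun u v w huvw => ?_
        have hlen := congrArg List.length huvw
        simp only [List.length_append] at hlen
        by_cases hv : v.length ≤ 1
        · rw [hμu.of_length_le_one hv, (isML_bar _).zero_mid]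
        · exact hne _ (by simp; omega)
      have e₂ : pull (fun l => bar σ f l + bar σ (Pi.single (N + 1) h) l) (bar σ ν) l =
          pull (bar σ f) (bar σ ν) l := by
        by_cases hl' : l.length = N + 1
        · rw [pull_add_single_of_eq (by omega) hne hνu.ml hl', hνu.single, add_zero]
        · refine pull_congr_left fun v _ hv => ?_
          rw [hne v (by omega), add_zero]
      rw [e₁, e₂, add_zero]
      exact hf.rel l (by omega)
    · obtain ⟨a, ha⟩ := exists_twist H.sigma_sigma l
      rw [show l.length = N + 2 from hl] at ha
      have hodd := hochD_eq_ins_odd H (n := N + 1) (by omega) (j := -N) (by push_cast; omega) hh.2 a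
      rw [ha, hob, unbar_apply, ha] at hodd
      rw [ins_eq_ins_barMul hμu (isML_bar _) (fun l hl => hne l (by omega)) h (fun _ _ => rfl) hl,
        pull_add_single_of_eq_succ hfu.single (by omega) hne hνu hl]
      rw [sub_eq_iff_eq_add] at hodd
      rw [hodd]
      abel

end Morphisms


/-! ### Passage to the limit and classification by the operation `m_{d+2}`. -/

/-- Successive extension of families, adding one component at a time. -/
theorem exists_limit_family {V : ℕ → Type*} [∀ n, AddCommGroup (V n)]
    (P : ((n : ℕ) → V n) → ℕ → Prop) {x₀ : (n : ℕ) → V n} {N₀ : ℕ} (h₀ : P x₀ N₀)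
    (step : ∀ x N, N₀ ≤ N → P x N → ∃ h, P (x + Pi.single (N + 1) h) (N + 1)) :
    ∃ m : (n : ℕ) → V n, (∀ n, n ≤ N₀ → m n = x₀ n) ∧
      ∀ K, ∃ x N, K ≤ N ∧ P x N ∧ ∀ n, n ≤ N → m n = x n := by
  choose! h hh using step
  let X : ℕ → (n : ℕ) → V n := fun k =>
    Nat.rec x₀ (fun k x => x + Pi.single (N₀ + k + 1) (h x (N₀ + k))) k
  have hP : ∀ k, P (X k) (N₀ + k) := by
    intro k
    induction k with
    | zero => exact h₀
    | succ k ih => exact hh _ _ (by omega) ih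
  have hs : ∀ k n, n ≤ N₀ + k → X (k + 1) n = X k n := by
    intro k n hn
    change (X k + Pi.single (N₀ + k + 1) (h (X k) (N₀ + k))) n = _
    rw [Pi.add_apply, Pi.single_eq_of_ne (by omega), add_zero]
  have hs' : ∀ j k n, n ≤ N₀ + k → X (k + j) n = X k n := by
    intro j k n hn
    induction j with
    | zero => rfl
    | succ j ih => rw [← add_assoc, hs _ _ (by omega), ih]
  -- The components of `X k` up to index `N₀ + k` are never changed later, so the diagonal is the
  -- limit.
  refine ⟨fun n => X n n, fun n hn => by
    have := hs' n 0 n (by omega); rwa [zero_add] at this, fun K =>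
    ⟨X K, N₀ + K, by omega, hP K, fun n hn => ?_⟩⟩
  rcases le_total n K with h | h
  · obtain ⟨j, rfl⟩ := Nat.exists_eq_add_of_le h
    exact (hs' j n n (by omega)).symm
  · obtain ⟨j, rfl⟩ := Nat.exists_eq_add_of_le h
    exact hs' j K _ (by omega)

section Classification

variable {S A : Type*} [CommRing S] [Ring A] [Algebra S A]
  {𝒜 : ℤ → ℤ → Submodule S A} {σ : A →ₗ[S] A}
  {μ ν f : (n : ℕ) → MultilinearMap S (fun _ : Fin n => A) A}

theorem multilinear_ext_nat {n : ℕ} {g h : MultilinearMap S (fun _ : Fin n => A) A}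
    (H : ∀ a : ℕ → A, g (fun i => a i.val) = h (fun i => a i.val)) : g = h := by
  ext a
  have := H (fun i => if h : i < n then a ⟨i, h⟩ else 0)
  simpa using this

theorem bar_congr {l : List A} (h : μ l.length = ν l.length) : bar σ μ l = bar σ ν l := by
  rw [bar, bar, h]

theorem ins_barMul_barMul (H : IsSignedBigrading 𝒜 σ) (l : List A) :
    ins (fun x => - σ x) (barMul σ) (barMul σ) l = 0 := by
  by_cases hl : l.length = 3
  · match l, hl with
    | [a, b, c], _ =>
      rw [ins_barMul (v := [a, b]) (x := c) (by simp) (by simp), barMul_pair, barMul_pair,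
        sigma_mul H, map_neg, H.sigma_sigma]
      simp [mul_assoc]
  · refine ins_eq_zero _ _ fun u v w h => ?_
    have hlen := congrArg List.length h
    simp only [List.length_append] at hlen
    by_cases hv : v.length = 2
    · exact barMul_of_ne (by simp; omega)
    · rw [barMul_of_ne hv]; exact isML_barMul.zero_mid _ _

theorem isPreAInf_mul (H : IsSignedBigrading 𝒜 σ) {N : ℕ} (hN : 2 ≤ N) :
    IsPreAInf 𝒜 σ (Pi.single 2 (mulMap S A)) N where
  zero := Pi.single_eq_of_ne (by omega) _
  one := Pi.single_eq_of_ne (by omega) _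
  two := Pi.single_eq_same _ _
  mem n hn := by rw [Pi.single_eq_of_ne (by omega)]; exact Submodule.zero_mem _
  big n hn := Pi.single_eq_of_ne (by omega) _
  rel l _ := ins_barMul_barMul H l

/-- In arity at most `d + 1` the operations are those of the algebra, if there are no cochains of
intermediate degree. -/
theorem IsAInf.eq_single {d : ℕ} (hz : ∀ r : ℕ, 1 ≤ r → r < d → ∀ n, cochains 𝒜 n (-r) = ⊥)
    (hμ : IsAInf 𝒜 σ μ) {n : ℕ} (hn : n ≤ d + 1) :
    μ n = (Pi.single 2 (mulMap S A) : (n : ℕ) → MultilinearMap S (fun _ : Fin n => A) A) n := by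
  match n, hn with
  | 0, _ => rw [hμ.zero, Pi.single_eq_of_ne (by omega)]
  | 1, _ => rw [hμ.one, Pi.single_eq_of_ne (by omega)]
  | 2, _ => rw [hμ.two, Pi.single_eq_same]
  | n + 3, hn =>
    have h := hμ.mem (n + 3) (by omega)
    rw [show (2 - (n + 3 : ℕ) : ℤ) = -(n + 1 : ℕ) by push_cast; ring,
      hz (n + 1) (by omega) (by omega)] at h
    rw [(Submodule.mem_bot S).1 h, Pi.single_eq_of_ne (by omega)]

theorem IsAInf.bar_eq_barMul {d : ℕ} (hz : ∀ r : ℕ, 1 ≤ r → r < d → ∀ n, cochains 𝒜 n (-r) = ⊥)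
    (hμ : IsAInf 𝒜 σ μ) {l : List A} (hl : l.length ≤ d + 1) : bar σ μ l = barMul σ l :=
  bar_congr (hμ.eq_single hz hl)

/-- Up to arity `d + 1` there is only the product, so the relation on words of length `d + 3`
contains the product with itself, which vanishes by associativity, and the two composites of the
product with `m_{d+2}`. -/
theorem IsAInf.mem_cocycles (H : IsSignedBigrading 𝒜 σ) {d : ℕ} (hd : 1 ≤ d)
    (hz : ∀ r : ℕ, 1 ≤ r → r < d → ∀ n, cochains 𝒜 n (-r) = ⊥) (hμ : IsAInf 𝒜 σ μ) :
    μ (d + 2) ∈ cocycles 𝒜 σ (d + 2) (-d) := by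
  have hmem : μ (d + 2) ∈ cochains 𝒜 (d + 2) (-d) := by
    have := hμ.mem (d + 2) (by omega)
    rwa [show (2 - (d + 2 : ℕ) : ℤ) = -d by push_cast; ring] at this
  have hu := hμ.isUnitalBar H
  refine ⟨hmem, LinearMap.mem_ker.2 (multilinear_ext_nat fun a => ?_)⟩
  have h1 := hochD_eq_ins_even H (n := d + 2) (by omega) (j := -d) (by push_cast; omega) hmem.2 a
  have key : ins (fun x => - σ x) (bar σ μ) (bar σ μ) (twist σ (d + 2 + 1) a) =
      ins (fun x => - σ x) (barMul σ) (barMul σ) (twist σ (d + 2 + 1) a) +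
      ins (fun x => - σ x) (barMul σ) (bar σ (Pi.single (d + 2) (μ (d + 2)))) (twist σ (d + 2 + 1) a) +
      ins (fun x => - σ x) (bar σ (Pi.single (d + 2) (μ (d + 2)))) (barMul σ)
        (twist σ (d + 2 + 1) a) := by
    refine ins_add₃ fun u v w h => ?_
    have hlen := congrArg List.length h
    simp only [List.length_append, length_twist] at hlen
    have hs : ∀ l : List A, l.length = d + 2 →
        bar σ μ l = bar σ (Pi.single (d + 2) (μ (d + 2))) l :=
      fun l hl => bar_congr (by rw [hl, Pi.single_eq_same])
    rcases Nat.lt_or_ge (d + 1) v.length with hv | hv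
    · rw [barMul_of_ne (by omega : v.length ≠ 2), isML_barMul.zero_mid,
        (isML_bar (σ := σ) (Pi.single (d + 2) (μ (d + 2)))).zero_mid, zero_add, zero_add]
      by_cases hv' : v.length = d + 2
      · rw [hs v hv', hu.eq_barMul (by simp; omega)]
      · rw [hu.of_length_le_one (by simp; omega), barMul_of_ne (by simp; omega)]
    · rw [hμ.bar_eq_barMul hz hv, bar_single_of_ne _ (by omega : v.length ≠ d + 2),
        isML_barMul.zero_mid, add_zero]
      by_cases hv2 : v.length = 2
      · rw [hs _ (by simp; omega), barMul_of_ne (l := _ ++ _) (by simp; omega), zero_add]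
      · rw [barMul_of_ne hv2, hu.ml.zero_mid, isML_barMul.zero_mid,
          (isML_bar (σ := σ) (Pi.single (d + 2) (μ (d + 2)))).zero_mid, add_zero]
  rw [hμ.rel, ins_barMul_barMul H, zero_add, h1] at key
  simpa using key.symm

/-- Below `d` there are no cochains at all, above `d` the relevant cohomology vanishes; in both
cases the obstruction is exact. -/
theorem cochains_eq_bot_of {d r : ℕ}
    (hz : ∀ r : ℕ, 1 ≤ r → r < d → ∀ n, cochains 𝒜 n (-r) = ⊥)
    (hv : ∀ r n : ℕ, d < r → (n = r + 2 ∨ n = r + 3) → cocycles 𝒜 σ n (-r) ≤ coboundaries 𝒜 σ n (-r))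
    (hr : 1 ≤ r) (hrd : r ≠ d) {n : ℕ} (hn : n = r + 1 ∨ n = r + 2)
    {g : MultilinearMap S (fun _ : Fin (n + 1) => A) A} (hg : g ∈ cocycles 𝒜 σ (n + 1) (-r)) :
    ∃ h ∈ cochains 𝒜 n (-r), hochD σ n (-r) h = g := by
  rcases lt_or_gt_of_ne hrd with h | h
  · refine ⟨0, Submodule.zero_mem _, ?_⟩
    have := hg.1
    rw [hz r hr h] at this
    rw [map_zero, (Submodule.mem_bot S).1 this]
  · exact hv r (n + 1) h (by omega) hg

theorem unbar_eq_zero {c : List A → A} (hc : IsML S c) {n : ℕ}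
    (h : ∀ l : List A, l.length = n → c l = 0) : unbar σ hc n = 0 :=
  multilinear_ext_nat fun a => by rw [unbar_apply, h _ (by simp)]; rfl

/-- Every cocycle is the first nontrivial operation of a minimal `A_∞`-structure. -/
theorem exists_isAInf (H : IsSignedBigrading 𝒜 σ) {d : ℕ} (hd : 1 ≤ d)
    (hz : ∀ r : ℕ, 1 ≤ r → r < d → ∀ n, cochains 𝒜 n (-r) = ⊥)
    (hv : ∀ r n : ℕ, d < r → (n = r + 2 ∨ n = r + 3) → cocycles 𝒜 σ n (-r) ≤ coboundaries 𝒜 σ n (-r))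
    {c : MultilinearMap S (fun _ : Fin (d + 2) => A) A} (hc : c ∈ cocycles 𝒜 σ (d + 2) (-d)) :
    ∃ m, IsAInf 𝒜 σ m ∧ m (d + 2) = c := by
  -- The product alone has no defect, so the cocycle condition for `c` is exactly what is needed to
  -- add it as the operation of arity `d + 2`.
  have h0 : IsPreAInf 𝒜 σ (Pi.single 2 (mulMap S A) + Pi.single (d + 1 + 1) c) (d + 2) := by
    refine (isPreAInf_mul H (N := d + 1) (by omega)).update H (by omega) ?_ ?_
    · rw [show (1 - (d + 1 : ℕ) : ℤ) = -d by push_cast; ring]; exact hc.1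
    · rw [show (1 - (d + 1 : ℕ) : ℤ) = -d by push_cast; ring]
      exact (LinearMap.mem_ker.1 hc.2).trans
        (unbar_eq_zero _ (fun l _ => ins_barMul_barMul H l)).symm
  obtain ⟨m, hm0, hm⟩ := exists_limit_family (IsPreAInf 𝒜 σ) h0 (by
    intro x N hN hx
    have hob := obstruction_mem_cocycles H (by omega) hx
    rw [show (1 - N : ℤ) = -(N - 1 : ℕ) by omega] at hob
    obtain ⟨h, hh, he⟩ := cochains_eq_bot_of hz hv (by omega) (by omega) (by omega) hob
    rw [show (-(N - 1 : ℕ) : ℤ) = 1 - N by omega] at hh he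
    exact ⟨h, hx.update H (by omega) hh he⟩)
  have hagree : ∀ {n}, n ≤ d + 2 → m n =
    (Pi.single 2 (mulMap S A) + Pi.single (d + 1 + 1) c :
      (n : ℕ) → MultilinearMap S (fun _ : Fin n => A) A) n := fun hn => hm0 _ hn
  refine ⟨m, ⟨?_, ?_, ?_, ?_, ?_⟩, ?_⟩
  · rw [hagree (by omega), h0.zero]
  · rw [hagree (by omega), h0.one]
  · rw [hagree (by omega), h0.two]
  · intro n hn
    obtain ⟨x, N, hN, hx, hxm⟩ := hm n
    rw [hxm n hN]
    exact hx.mem n hn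
  · intro l
    obtain ⟨x, N, hN, hx, hxm⟩ := hm (l.length + 1)
    rw [← hx.rel l (by omega)]
    refine ins_congr₂ fun u v w h => ?_
    have hlen := congrArg List.length h
    simp only [List.length_append] at hlen
    rw [bar_congr (l := v) (ν := x) (hxm _ (by omega)), bar_congr (ν := x) (hxm _ (by simp; omega))]
  · rw [hagree le_rfl, Pi.add_apply, Pi.single_eq_of_ne (by omega), zero_add, Pi.single_eq_same]

variable (S A) in
/-- The identity, as a multilinear map. -/
def idMap : MultilinearMap S (fun _ : Fin 1 => A) A :=
  MultilinearMap.ofSubsingleton S A A (0 : Fin 1) LinearMap.id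

theorem idMap_apply (a : Fin 1 → A) : idMap S A a = a 0 := rfl

theorem bar_idMap (x : A) : bar σ (Pi.single 1 (idMap S A)) [x] = x := by
  rw [bar_eq _ [x] 1 rfl, Pi.single_eq_same]; rfl

theorem ins_bar_idMap {θ : A → A} {b : List A → A} (hb : b [] = 0) (l : List A) :
    ins θ b (bar σ (Pi.single 1 (idMap S A))) l = b l := by
  cases l with
  | nil => simp [hb]
  | cons a w =>
    rw [ins_cons, splitSum_eq_single (List.append_nil (a :: w)), bar_idMap, ins_eq_zero, add_zero]
    · intro u v w _; exact bar_single_of_ne _ (by simp)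
    · intro v r hvr hne
      have hlen := congrArg List.length hvr
      simp only [List.length_append] at hlen
      exact bar_single_of_ne _ (by simp; rintro rfl; simp at hlen; simp at hne; omega)

theorem pull_bar_idMap {G : List A → A} (hG : IsML S G) (l : List A) :
    pull (bar σ (Pi.single 1 (idMap S A))) G l = G l := by
  induction l generalizing G with
  | nil => simp
  | cons a w ih =>
    rw [pull_cons, splitSum_eq_single (List.nil_append w), ih (G := fun l => G (_ :: l)) (hG.cons _),
      bar_idMap]
    intro v r _ hv
    rw [bar_single_of_ne _ (by simpa using hv), pull_congr _ hG.zero_head, pull_zero]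

theorem eq_idMap (h0 : f 0 = 0) (h1 : ∀ a, f 1 a = a 0)
    (hf : ∀ n, 2 ≤ n → f n ∈ cochains 𝒜 n (1 - n)) {d : ℕ}
    (hz : ∀ r : ℕ, 1 ≤ r → r < d → ∀ n, cochains 𝒜 n (-r) = ⊥) {n : ℕ} (hn : n ≤ d) :
    f n = (Pi.single 1 (idMap S A) : (n : ℕ) → MultilinearMap S (fun _ : Fin n => A) A) n := by
  match n, hn with
  | 0, _ => rw [h0, Pi.single_eq_of_ne (by omega)]
  | 1, _ => rw [Pi.single_eq_same]; ext a; rw [h1, idMap_apply]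
  | n + 2, hn =>
    have h := hf (n + 2) (by omega)
    rw [show (1 - (n + 2 : ℕ) : ℤ) = -(n + 1 : ℕ) by push_cast; ring,
      hz (n + 1) (by omega) (by omega)] at h
    rw [(Submodule.mem_bot S).1 h, Pi.single_eq_of_ne (by omega)]

/-- The first nontrivial operations of gauge equivalent structures are cohomologous. -/
theorem sub_mem_coboundaries (H : IsSignedBigrading 𝒜 σ) {d : ℕ} (hd : 1 ≤ d)
    (hz : ∀ r : ℕ, 1 ≤ r → r < d → ∀ n, cochains 𝒜 n (-r) = ⊥)
    (hμ : IsAInf 𝒜 σ μ) (hν : IsAInf 𝒜 σ ν) (h0 : f 0 = 0) (h1 : ∀ a, f 1 a = a 0)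
    (hf : ∀ n, 2 ≤ n → f n ∈ cochains 𝒜 n (1 - n))
    (hrel : ∀ l : List A,
      ins (fun x => - σ x) (bar σ μ) (bar σ f) l = pull (bar σ f) (bar σ ν) l) :
    μ (d + 2) - ν (d + 2) ∈ coboundaries 𝒜 σ (d + 2) (-d) := by
  have hmem : f (d + 1) ∈ cochains 𝒜 (d + 1) (-d) := by
    have := hf (d + 1) (by omega)
    rwa [show (1 - (d + 1 : ℕ) : ℤ) = -d by push_cast; ring] at this
  have hμu := hμ.isUnitalBar H
  have hνu := hν.isUnitalBar H
  refine ⟨f (d + 1), hmem, multilinear_ext_nat fun a => ?_⟩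
  set I := bar σ (Pi.single 1 (idMap S A))
  set K := bar σ (Pi.single (d + 1) (f (d + 1)))
  set K' := bar σ (Pi.single (d + 2) (f (d + 2)))
  have hK : ∀ l : List A, l.length ≠ d + 1 → K l = 0 := fun l hl => bar_single_of_ne _ hl
  have hK' : ∀ l : List A, l.length ≠ d + 2 → K' l = 0 := fun l hl => bar_single_of_ne _ hl
  have hI : ∀ l : List A, l.length ≠ 1 → I l = 0 := fun l hl => bar_single_of_ne _ hl
  -- On words of length at most `d + 2` the morphism consists of the identity, `f_{d+1}` and
  -- `f_{d+2}`. The last one plays no role below, since it could only be composed with a unary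
  -- operation.
  have hF : ∀ l : List A, l.length ≤ d + 2 → bar σ f l = I l + K l + K' l := by
    intro l hl
    by_cases h : l.length ≤ d
    · rw [hK l (by omega), hK' l (by omega), add_zero, add_zero]
      exact bar_congr (eq_idMap h0 h1 hf hz h)
    · by_cases h' : l.length = d + 1
      · rw [hI l (by omega), hK' l (by omega), zero_add, add_zero]
        exact bar_congr (by rw [h', Pi.single_eq_same])
      · have h2 : l.length = d + 2 := by omega
        rw [hI l (by omega), hK l (by omega), zero_add, zero_add]
        exact bar_congr (by rw [h2, Pi.single_eq_same])
  have hl := hrel (twist σ (d + 1 + 1) a)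
  have e₁ : ins (fun x => - σ x) (bar σ μ) (bar σ f) (twist σ (d + 1 + 1) a) =
      bar σ μ (twist σ (d + 1 + 1) a) + ins (fun x => - σ x) (barMul σ) K (twist σ (d + 1 + 1) a) := by
    rw [← ins_eq_ins_barMul hμu (isML_bar _) (fun l hl => hK l (by omega)) _ (fun _ _ => rfl) (by simp),
      ← ins_bar_idMap (σ := σ) hμu.nil (twist σ _ a), ← ins_add]
    refine ins_congr₂ fun u v w h => ?_
    have hlen := congrArg List.length h
    simp only [List.length_append, length_twist] at hlen
    by_cases hv : v.length ≤ 1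
    · rw [hμu.of_length_le_one hv, (isML_bar _).zero_mid, (isML_bar _).zero_mid,
        (isML_bar _).zero_mid, add_zero]
    · rw [hF _ (by simp; omega), hK' _ (by simp; omega), add_zero]
  have e₂ : pull (bar σ f) (bar σ ν) (twist σ (d + 1 + 1) a) =
      bar σ ν (twist σ (d + 1 + 1) a) + ins id K (barMul σ) (twist σ (d + 1 + 1) a) := by
    rw [pull_congr_left (F' := fun l => (I l + K l) + K' l) (fun v _ hv => hF v (by simpa using hv)),
      pull_add_single_of_eq (n := d + 2) (by omega) hK' hνu.ml (by simp), hνu.single, add_zero,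
      pull_add_single_of_eq_succ (n := d + 1) (bar_idMap) (by omega) hK hνu (by simp),
      pull_bar_idMap hνu.ml]
  rw [e₁, e₂, bar_twist H.sigma_sigma, bar_twist H.sigma_sigma] at hl
  have hodd := hochD_eq_ins_odd H (n := d + 1) (by omega) (j := -d) (by push_cast; omega) hmem.2 a
  rw [← neg_eq_iff_eq_neg] at hodd
  rw [← hodd, neg_sub, sub_apply, sub_eq_sub_iff_add_eq_add, add_comm]
  exact hl.symm

/-- Structures whose first nontrivial operations are cohomologous are gauge equivalent. -/
theorem exists_morphism (H : IsSignedBigrading 𝒜 σ) {d : ℕ} (hd : 1 ≤ d)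
    (hz : ∀ r : ℕ, 1 ≤ r → r < d → ∀ n, cochains 𝒜 n (-r) = ⊥)
    (hv : ∀ r n : ℕ, d < r → (n = r + 2 ∨ n = r + 3) → cocycles 𝒜 σ n (-r) ≤ coboundaries 𝒜 σ n (-r))
    (hμ : IsAInf 𝒜 σ μ) (hν : IsAInf 𝒜 σ ν)
    (hco : μ (d + 2) - ν (d + 2) ∈ coboundaries 𝒜 σ (d + 2) (-d)) :
    ∃ f : (n : ℕ) → MultilinearMap S (fun _ : Fin n => A) A, f 0 = 0 ∧ (∀ a, f 1 a = a 0) ∧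
      (∀ n, 2 ≤ n → f n ∈ cochains 𝒜 n (1 - n)) ∧
      ∀ l : List A, ins (fun x => - σ x) (bar σ μ) (bar σ f) l = pull (bar σ f) (bar σ ν) l := by
  have hμu := hμ.isUnitalBar H
  have hνu := hν.isUnitalBar H
  -- The identity is a morphism up to its `d`-th component, because both structures are given by the
  -- product in arity at most `d + 1`. The difference of the operations `m_{d+2}` is then the first
  -- defect.
  have hid : IsPreMor 𝒜 σ μ ν (Pi.single 1 (idMap S A)) d := by
    refine ⟨Pi.single_eq_of_ne (by omega) _, fun a => by rw [Pi.single_eq_same]; rfl, ?_, ?_, ?_⟩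
    · intro n hn; rw [Pi.single_eq_of_ne (by omega)]; exact Submodule.zero_mem _
    · intro n hn; exact Pi.single_eq_of_ne (by omega) _
    · intro l hl
      rw [ins_bar_idMap hμu.nil, pull_bar_idMap hνu.ml, hμ.bar_eq_barMul hz hl,
        hν.bar_eq_barMul hz hl, sub_self]
  obtain ⟨h, hh, he⟩ := hco
  have h0 : IsPreMor 𝒜 σ μ ν (Pi.single 1 (idMap S A) + Pi.single (d + 1) h) (d + 1) := by
    refine hid.update H hd hμ hν hh (he.trans (multilinear_ext_nat fun a => ?_))
    rw [unbar_apply, ins_bar_idMap hμu.nil, pull_bar_idMap hνu.ml, bar_twist H.sigma_sigma,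
      bar_twist H.sigma_sigma]
    rfl
  obtain ⟨m, hm0, hm⟩ := exists_limit_family (IsPreMor 𝒜 σ μ ν) h0 (by
    intro x N hN hx
    obtain ⟨h, hh, he⟩ := cochains_eq_bot_of hz hv (by omega) (by omega) (by omega)
      (morDefect_mem_cocycles H (by omega) hμ hν hx)
    exact ⟨h, hx.update H (by omega) hμ hν hh he⟩)
  refine ⟨m, ?_, ?_, ?_, ?_⟩
  · rw [hm0 _ (by omega), h0.zero]
  · rw [hm0 _ (by omega)]; exact h0.one
  · intro n hn
    obtain ⟨x, N, hN, hx, hxm⟩ := hm n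
    rw [hxm n hN]
    exact hx.mem n hn
  · intro l
    obtain ⟨x, N, hN, hx, hxm⟩ := hm (l.length + 1)
    have hr := sub_eq_zero.1 (hx.rel l (by omega))
    rw [ins_congr' _ _ (G' := bar σ x), hr]
    · refine pull_congr_left fun v _ hv => ?_
      rw [bar_congr (ν := x) (hxm _ (by omega))]
    · intro u v w h
      have hlen := congrArg List.length h
      simp only [List.length_append] at hlen
      rw [bar_congr (ν := x) (hxm _ (by simp; omega))]

theorem MinimalAInf.isAInf (H : IsSignedBigrading 𝒜 σ) (μ : MinimalAInf 𝒜 σ) : IsAInf 𝒜 σ μ.m := by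
  have two : μ.m 2 = mulMap S A := by ext a; rw [μ.m_two]; simp [mulMap]
  refine ⟨μ.m_zero, μ.m_one, two, μ.m_mem, fun l => ?_⟩
  obtain ⟨a, ha⟩ := exists_twist H.sigma_sigma l
  rw [← ha, ← insertSum_eq_ins H.sigma_sigma μ.m_zero
    (sigma_apply_of_unital H (isHomogeneous_of_unital H μ.m_zero μ.m_one two μ.m_mem))]
  exact μ.relation _ _

/-- The minimal `A_∞`-structure given by operations which satisfy the relations on words. -/
def IsAInf.toMinimalAInf (H : IsSignedBigrading 𝒜 σ) (hμ : IsAInf 𝒜 σ μ) : MinimalAInf 𝒜 σ where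
  m := μ
  m_zero := hμ.zero
  m_one := hμ.one
  m_two a := by rw [hμ.two]; simp [mulMap]
  m_mem := hμ.mem
  relation n a := by
    rw [insertSum_eq_ins H.sigma_sigma hμ.zero (sigma_apply_of_unital H (hμ.isHomogeneous H))]
    exact hμ.rel _

theorem gaugeEquiv_iff (H : IsSignedBigrading 𝒜 σ) {d : ℕ} (hd : 1 ≤ d)
    (hz : ∀ r : ℕ, 1 ≤ r → r < d → ∀ n, cochains 𝒜 n (-r) = ⊥)
    (hv : ∀ r n : ℕ, d < r → (n = r + 2 ∨ n = r + 3) → cocycles 𝒜 σ n (-r) ≤ coboundaries 𝒜 σ n (-r))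
    (μ ν : MinimalAInf 𝒜 σ) :
    GaugeEquiv μ ν ↔ μ.m (d + 2) - ν.m (d + 2) ∈ coboundaries 𝒜 σ (d + 2) (-d) := by
  have hμ := μ.isAInf H
  constructor
  · rintro ⟨f, h0, h1, hf, hrel⟩
    refine sub_mem_coboundaries H hd hz hμ (ν.isAInf H) h0 h1 hf fun l => ?_
    obtain ⟨a, ha⟩ := exists_twist H.sigma_sigma l
    rw [← ha, ← insertSum_eq_ins H.sigma_sigma hμ.zero
      (sigma_apply_of_unital H (hμ.isHomogeneous H)), hrel,
      composeSum_eq_pull H.sigma_sigma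
        (sigma_apply_of_unitalMor H (isHomogeneous_of_unitalMor h0 h1 hf))]
  · intro h
    obtain ⟨f, h0, h1, hf, hrel⟩ := exists_morphism H hd hz hv hμ (ν.isAInf H) h
    refine ⟨f, h0, h1, hf, fun n a => ?_⟩
    rw [insertSum_eq_ins H.sigma_sigma hμ.zero
      (sigma_apply_of_unital H (hμ.isHomogeneous H)), hrel,
      composeSum_eq_pull H.sigma_sigma
        (sigma_apply_of_unitalMor H (isHomogeneous_of_unitalMor h0 h1 hf))]

theorem subquot_mk_eq_iff {E : Type*} [AddCommGroup E] [Module S E] {Z W : Submodule S E} {x y : Z} :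
    Subquot.mk Z W x = Subquot.mk Z W y ↔ (x : E) - y ∈ W := by
  exact (Submodule.Quotient.eq (W.submoduleOf Z) (x := x) (y := y)).trans Iff.rfl

theorem subquot_mk_surjective {E : Type*} [AddCommGroup E] [Module S E] (Z W : Submodule S E) :
    Function.Surjective (Subquot.mk Z W) := Submodule.mkQ_surjective _

/-- The classification of minimal `A_∞`-structures by their first nontrivial operation. -/
theorem classification (H : IsSignedBigrading 𝒜 σ) {d : ℕ} (hd : 1 ≤ d)
    (hz : ∀ r : ℕ, 1 ≤ r → r < d → ∀ n, cochains 𝒜 n (-r) = ⊥)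
    (hv : ∀ r n : ℕ, d < r → (n = r + 2 ∨ n = r + 3) →
      cocycles 𝒜 σ n (-r) ≤ coboundaries 𝒜 σ n (-r)) :
    Equivalence (GaugeEquiv : MinimalAInf 𝒜 σ → MinimalAInf 𝒜 σ → Prop) ∧
      ∃ Φ : Quot (GaugeEquiv : MinimalAInf 𝒜 σ → MinimalAInf 𝒜 σ → Prop) →
          Hoch 𝒜 σ (d + 2) (-d : ℤ),
        Function.Bijective Φ ∧
        ∀ μ : MinimalAInf 𝒜 σ, ∃ hμ : μ.m (d + 2) ∈ cocycles 𝒜 σ (d + 2) (-d : ℤ),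
          Φ (Quot.mk _ μ) = hochClass _ _ _ _ (μ.m (d + 2)) hμ := by
  have hiff := gaugeEquiv_iff H hd hz hv
  have hcoc : ∀ μ : MinimalAInf 𝒜 σ, μ.m (d + 2) ∈ cocycles 𝒜 σ (d + 2) (-d : ℤ) :=
    fun μ => (μ.isAInf H).mem_cocycles H hd hz
  have hcl : ∀ μ ν : MinimalAInf 𝒜 σ, GaugeEquiv μ ν ↔
      hochClass _ _ _ _ (μ.m (d + 2)) (hcoc μ) = hochClass _ _ _ _ (ν.m (d + 2)) (hcoc ν) :=
    fun μ ν => (hiff μ ν).trans (subquot_mk_eq_iff (x := ⟨_, hcoc μ⟩) (y := ⟨_, hcoc ν⟩)).symm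
  refine ⟨⟨fun μ => (hcl _ _).2 rfl, fun h => (hcl _ _).2 ((hcl _ _).1 h).symm,
    fun h h' => (hcl _ _).2 (((hcl _ _).1 h).trans ((hcl _ _).1 h'))⟩,
    Quot.lift (fun μ => hochClass _ _ _ _ (μ.m (d + 2)) (hcoc μ)) (fun μ ν h => (hcl μ ν).1 h),
    ⟨?_, ?_⟩, fun μ => ⟨hcoc μ, rfl⟩⟩
  · rintro ⟨μ⟩ ⟨ν⟩ h
    exact Quot.sound ((hcl μ ν).2 h)
  · intro x
    obtain ⟨⟨c, hc⟩, rfl⟩ := subquot_mk_surjective _ _ x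
    obtain ⟨m, hm, rfl⟩ := exists_isAInf H hd hz hv hc
    exact ⟨Quot.mk _ (hm.toMinimalAInf H), rfl⟩

end Classification


/-! ### Words as elements of the tensor algebra. -/

section Words

variable {S A X : Type*} [CommRing S] [Ring A] [Algebra S A] [AddCommGroup X] [Module S X]

/-- The tensor algebra of the module underlying an algebra. -/
def WordAlg (S A : Type*) [CommRing S] [Ring A] [Algebra S A] : Type _ := TensorAlgebra S A

instance : Ring (WordAlg S A) := inferInstanceAs (Ring (TensorAlgebra S A))

instance : Algebra S (WordAlg S A) := inferInstanceAs (Algebra S (TensorAlgebra S A))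

/-- The inclusion of the letters into the tensor algebra. -/
def letter (S : Type*) {A : Type*} [CommRing S] [Ring A] [Algebra S A] : A →ₗ[S] WordAlg S A :=
  TensorAlgebra.ι S

/-- The universal property of the tensor algebra. -/
def WordAlg.lift {R : Type*} [Ring R] [Algebra S R] (f : A →ₗ[S] R) : WordAlg S A →ₐ[S] R :=
  TensorAlgebra.lift S f

@[simp] theorem WordAlg.lift_letter {R : Type*} [Ring R] [Algebra S R] (f : A →ₗ[S] R) (a : A) :
    WordAlg.lift f (letter S a) = f a := TensorAlgebra.lift_ι_apply f a

theorem WordAlg.induction {C : WordAlg S A → Prop} (algebraMap : ∀ r, C (algebraMap S (WordAlg S A) r))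
    (letter : ∀ a, C (letter S a)) (mul : ∀ x y, C x → C y → C (x * y))
    (add : ∀ x y, C x → C y → C (x + y)) (z : WordAlg S A) : C z :=
  TensorAlgebra.induction (C := C) algebraMap letter mul add z

/-- The element of the tensor algebra given by a word. -/
def wd (S : Type*) {A : Type*} [CommRing S] [Ring A] [Algebra S A] (l : List A) :
    WordAlg S A := (l.map (letter S)).prod

@[simp] theorem wd_nil : wd S ([] : List A) = 1 := rfl

theorem wd_cons (a : A) (l : List A) : wd S (a :: l) = letter S a * wd S l := by
  simp [wd]

theorem wd_append (u v : List A) : wd S (u ++ v) = wd S u * wd S v := by simp [wd]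

theorem isML_wd : IsML S (wd S : List A → WordAlg S A) :=
  ⟨fun u x y r => by simp only [wd_append, wd_cons, map_add, add_mul, mul_add],
    fun u c x r => by simp only [wd_append, wd_cons, map_smul, smul_mul_assoc, mul_smul_comm]⟩

/-- The restriction of a multilinear function on words to words of length `n`. -/
def IsML.toMultilinear {G : List A → X} (hG : IsML S G) (n : ℕ) :
    MultilinearMap S (fun _ : Fin n => A) X :=
  MultilinearMap.mk' (fun a => G (List.ofFn a))
    (fun a i x y => by simp only [ofFn_update, hG.add])
    (fun a i r x => by simp only [ofFn_update, hG.smul])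

/-- The linear extension of a family of multilinear maps. -/
def extMultilinear (g : ∀ n : ℕ, MultilinearMap S (fun _ : Fin n => A) X) : WordAlg S A →ₗ[S] X :=
  DirectSum.toModule S ℕ X (fun n => PiTensorProduct.lift (g n)) ∘ₗ
    (TensorAlgebra.toDirectSum.toLinearMap : TensorAlgebra S A →ₗ[S] _)

theorem extMultilinear_wd (g : ∀ n : ℕ, MultilinearMap S (fun _ : Fin n => A) X) {n : ℕ}
    (a : Fin n → A) : extMultilinear g (wd S (List.ofFn a)) = g n a := by
  have h : wd S (List.ofFn a) = TensorAlgebra.tprod S A n a := by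
    rw [TensorAlgebra.tprod_apply, wd, List.map_ofFn]; rfl
  refine (congrArg (DirectSum.toModule S ℕ X fun n => PiTensorProduct.lift (g n))
    ((congrArg (TensorAlgebra.toDirectSum (R := S) (M := A)) h).trans
      (TensorAlgebra.toDirectSum_tensorPower_tprod a))).trans ?_
  rw [← DirectSum.lof_eq_of S, DirectSum.toModule_lof, PiTensorProduct.lift.tprod]

/-- The linear extension of a multilinear function on words. -/
def ext {G : List A → X} (hG : IsML S G) : WordAlg S A →ₗ[S] X :=
  extMultilinear fun n => hG.toMultilinear n

@[simp] theorem ext_wd {G : List A → X} (hG : IsML S G) (l : List A) : ext hG (wd S l) = G l := by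
  conv_lhs => rw [← List.ofFn_get l]
  rw [ext, extMultilinear_wd]
  change G (List.ofFn l.get) = G l
  rw [List.ofFn_get]

theorem span_wd : Submodule.span S (Set.range (wd S : List A → WordAlg S A)) = ⊤ := by
  rw [eq_top_iff]
  rintro x -
  induction x using WordAlg.induction with
  | algebraMap r =>
    rw [Algebra.algebraMap_eq_smul_one]
    exact Submodule.smul_mem _ _ (Submodule.subset_span ⟨[], rfl⟩)
  | letter a => exact Submodule.subset_span ⟨[a], by simp [wd]⟩
  | add x y hx hy => exact Submodule.add_mem _ hx hy
  | mul x y hx hy =>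
    have h := Submodule.mul_mem_mul hx hy
    rw [Submodule.span_mul_span] at h
    refine Submodule.span_mono ?_ h
    rintro _ ⟨_, ⟨u, rfl⟩, _, ⟨v, rfl⟩, rfl⟩
    exact ⟨u ++ v, wd_append u v⟩

theorem linearMap_ext_wd {f g : WordAlg S A →ₗ[S] X} (h : ∀ l, f (wd S l) = g (wd S l)) :
    f = g := by
  refine LinearMap.ext_on span_wd ?_
  rintro _ ⟨l, rfl⟩
  exact h l

theorem isML_comp (f : WordAlg S A →ₗ[S] X) : IsML S (fun l => f (wd S l)) :=
  ⟨fun u x y r => by rw [isML_wd.add, map_add], fun u c x r => by rw [isML_wd.smul, map_smul]⟩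

theorem IsML.splitSum {H : List A → List A → X} (h₁ : ∀ r, IsML S (fun v => H v r))
    (h₂ : ∀ v, IsML S (H v)) : IsML S (splitSum H) := by
  constructor
  · intro u x y r
    simp only [splitSum_append_cons, (h₁ _).add, (h₂ _).add, splitSum_add]
    abel
  · intro u c x r
    simp only [splitSum_append_cons, (h₁ _).smul, (h₂ _).smul, splitSum_smul, smul_add]

end Words

/-! ### The bar differential on the tensor algebra, and its failure to be a derivation for
concatenation. -/

section Differential

variable {S A X : Type*} [CommRing S] [Ring A] [Algebra S A] [AddCommGroup X] [Module S X]
  {𝒜 : ℤ → ℤ → Submodule S A} {σ : A →ₗ[S] A}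

variable (σ) in
/-- The differential of the bar construction, on words twisted by `σ`. -/
def barDiff : WordAlg S A →ₗ[S] WordAlg S A :=
  ext (IsML.ins (θ := -σ) (isML_barMul (σ := σ)) isML_wd)

theorem barDiff_wd (l : List A) :
    barDiff σ (wd S l) = ins (fun x => - σ x) (barMul σ) (wd S) l := ext_wd _ l

theorem map_barDiff (f : WordAlg S A →ₗ[S] X) (l : List A) :
    f (barDiff σ (wd S l)) = ins (fun x => - σ x) (barMul σ) (fun l => f (wd S l)) l := by
  rw [barDiff_wd, map_ins]

theorem barDiff_barDiff (H : IsSignedBigrading 𝒜 σ) (z : WordAlg S A) :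
    barDiff σ (barDiff σ z) = 0 := by
  suffices h : barDiff σ ∘ₗ barDiff σ = 0 from LinearMap.congr_fun h z
  refine linearMap_ext_wd fun l => ?_
  have hσ : ∀ l : List A, barMul σ (l.map fun x => - σ x) = σ (barMul σ l) := by
    have := bar_map_of_unital H (m := Pi.single 2 (mulMap S A))
      (isHomogeneous_of_unital H (isPreAInf_mul H le_rfl).zero (isPreAInf_mul H le_rfl).one
        (isPreAInf_mul H le_rfl).two (isPreAInf_mul H le_rfl).mem)
    exact this
  rw [LinearMap.comp_apply, map_barDiff, show (fun l => barDiff σ (wd S l)) =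
    ins (fun x => - σ x) (barMul σ) (wd S) from funext barDiff_wd,
    ins_ins (θ := fun x => - σ x) (by simp [H.sigma_sigma]) isUnitalBar_barMul.nil isML_barMul
      (by simpa using hσ) isML_wd]
  refine ins_eq_zero _ _ fun u v w _ => ?_
  rw [ins_barMul_barMul H, isML_wd.zero_mid]

@[simp] theorem barDiff_one : barDiff σ 1 = 0 := by
  rw [← wd_nil, barDiff_wd, ins_nil]

@[simp] theorem barDiff_letter (a : A) : barDiff σ (letter S a) = 0 := by
  have : letter S a = wd S [a] := by simp [wd]
  rw [this, barDiff_wd]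
  refine ins_eq_zero _ _ fun u v w h => ?_
  have hlen := congrArg List.length h
  simp only [List.length_append, List.length_singleton] at hlen
  rw [barMul_of_ne (by omega), isML_wd.zero_mid]

theorem barDiff_cons_cons (a a' : A) (w : List A) :
    barDiff σ (wd S (a :: a' :: w)) = wd S ((σ a * a') :: w) -
      letter S (σ a) * barDiff σ (wd S (a' :: w)) := by
  rw [barDiff_wd, ins_cons, splitSum_eq_single (show [a, a'] ++ w = a :: a' :: w from rfl),
    barMul_pair, barDiff_wd, sub_eq_add_neg]
  · congr 1
    rw [← LinearMap.mulLeft_apply (R := S), map_ins, ← ins_neg]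
    refine ins_congr _ _ (fun l _ => ?_) _
    rw [wd_cons, map_neg, neg_mul, LinearMap.mulLeft_apply]
  · intro v r _ hv
    rw [barMul_of_ne (by simpa using hv), isML_wd.zero_head]

variable (S σ) in
/-- The sign involution of the tensor algebra, which multiplies each letter by `-σ`. -/
def tsign : WordAlg S A →ₐ[S] WordAlg S A :=
  WordAlg.lift (letter S ∘ₗ (-σ))

@[simp] theorem tsign_letter (a : A) :
    tsign S σ (letter S a) = - letter S (σ a) := by simp [tsign]

theorem tsign_wd (l : List A) : tsign S σ (wd S l) = wd S (l.map fun x => - σ x) := by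
  induction l with
  | nil => simp
  | cons a l ih => rw [wd_cons, map_mul, ih, List.map_cons, wd_cons, tsign_letter, map_neg]

theorem barDiff_tsign (H : IsSignedBigrading 𝒜 σ) (z : WordAlg S A) :
    barDiff σ (tsign S σ z) = - tsign S σ (barDiff σ z) := by
  suffices h : barDiff σ ∘ₗ (tsign S σ).toLinearMap = - ((tsign S σ).toLinearMap ∘ₗ barDiff σ) from
    LinearMap.congr_fun h z
  refine linearMap_ext_wd fun l => ?_
  simp only [LinearMap.comp_apply, AlgHom.toLinearMap_apply, LinearMap.neg_apply]
  induction l with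
  | nil => simp
  | cons a w ih =>
    cases w with
    | nil => simp [wd]
    | cons a' w =>
      rw [tsign_wd] at ih ⊢
      rw [List.map_cons, List.map_cons, barDiff_cons_cons, barDiff_cons_cons, map_sub, map_mul,
        ← List.map_cons (f := fun x => - σ x), ih, tsign_letter, tsign_wd, List.map_cons, map_neg, sigma_mul H]
      simp only [wd_cons, map_neg, mul_neg, neg_mul, neg_neg, H.sigma_sigma]
      abel

/-- The Leibniz rule for the bar differential, with the term merging the two neighbouring
letters. -/
theorem barDiff_append (u : List A) (a a' : A) (v : List A) :
    barDiff σ (wd S (u ++ [a]) * wd S (a' :: v)) =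
      barDiff σ (wd S (u ++ [a])) * wd S (a' :: v) +
        tsign S σ (wd S (u ++ [a])) * barDiff σ (wd S (a' :: v)) +
        tsign S σ (wd S u) * wd S ((σ a * a') :: v) := by
  induction u with
  | nil =>
    rw [← wd_append, List.nil_append, List.cons_append, List.nil_append, barDiff_cons_cons]
    simp [wd]
    abel
  | cons c u ih =>
    obtain ⟨e, r, he⟩ : ∃ e r, u ++ [a] = e :: r := by
      cases u with
      | nil => exact ⟨a, [], rfl⟩
      | cons e u => exact ⟨e, u ++ [a], rfl⟩
    rw [List.cons_append]
    rw [he] at ih ⊢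
    rw [← wd_append] at ih
    rw [← wd_append, List.cons_append, List.cons_append, barDiff_cons_cons, ← List.cons_append (a := e),
      ih, barDiff_cons_cons, wd_cons c, wd_cons c, map_mul, map_mul, tsign_letter,
      wd_cons _ (r ++ _), wd_append, wd_cons (σ c * e) r]
    noncomm_ring

end Differential


open TrivSqZeroExt (inl inr)

/-! ### Typed words in the square-zero extension `B ⊕ M`. -/

section SquareZeroBasics

variable {S B M : Type*} [CommRing S] [Ring B] [Algebra S B] [AddCommGroup M] [Module S M]
  [Module B M] [Module Bᵐᵒᵖ M] [SMulCommClass B Bᵐᵒᵖ M] [IsScalarTower S B M]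
  [IsScalarTower S Bᵐᵒᵖ M]

/-- `M` is a graded bimodule over the connected graded algebra `B`. -/
structure IsGradedBimodule (𝓑 : ℕ → Submodule S B) [GradedAlgebra 𝓑] (𝓜 : ℤ → Submodule S M) :
    Prop where
  inj : Function.Injective (algebraMap S B)
  surj : ∀ b ∈ 𝓑 0, ∃ s, algebraMap S B s = b
  internal : DirectSum.IsInternal 𝓜
  left : ∀ (i : ℕ) (j : ℤ) (b : B) (x : M), b ∈ 𝓑 i → x ∈ 𝓜 j → b • x ∈ 𝓜 (i + j)
  right : ∀ (i : ℕ) (j : ℤ) (b : B) (x : M), b ∈ 𝓑 i → x ∈ 𝓜 j → MulOpposite.op b • x ∈ 𝓜 (i + j)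

variable {𝓑 : ℕ → Submodule S B} [GradedAlgebra 𝓑] {𝓜 : ℤ → Submodule S M} {d : ℕ}

theorem inl_mem_bigrading {c : ℕ} {b : B} (hb : b ∈ 𝓑 c) :
    (inl b : TrivSqZeroExt B M) ∈ bigrading 𝓑 𝓜 d 0 c := by
  refine ⟨?_, ?_⟩
  · simpa [extendZ] using hb
  · simp only [TrivSqZeroExt.snd_inl]; exact Submodule.zero_mem _

theorem inr_mem_bigrading {e : ℤ} {x : M} (hx : x ∈ 𝓜 e) :
    (inr x : TrivSqZeroExt B M) ∈ bigrading 𝓑 𝓜 d d e := by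
  refine ⟨?_, ?_⟩
  · simp only [TrivSqZeroExt.fst_inr]; exact Submodule.zero_mem _
  · simpa using hx

/-- Homogeneous letters other than multiples of the unit. -/
def IsLetter (𝓑 : ℕ → Submodule S B) (𝓜 : ℤ → Submodule S M) (a : TrivSqZeroExt B M) : Prop :=
  (∃ c b, 1 ≤ c ∧ b ∈ 𝓑 c ∧ a = inl b) ∨ ∃ e x, x ∈ 𝓜 e ∧ a = inr x

theorem span_letters (hG : IsGradedBimodule 𝓑 𝓜) :
    Submodule.span S {a : TrivSqZeroExt B M | a = 1 ∨ IsLetter 𝓑 𝓜 a} = ⊤ := by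
  rw [eq_top_iff]
  rintro a -
  rw [← TrivSqZeroExt.inl_fst_add_inr_snd_eq a]
  refine Submodule.add_mem _ ?_ ?_
  · generalize a.fst = b
    classical
    rw [← DirectSum.sum_support_decompose 𝓑 b]
    rw [show (inl (∑ i ∈ (DirectSum.decompose 𝓑 b).support, (DirectSum.decompose 𝓑 b i : B)) :
      TrivSqZeroExt B M) = inlS S B M _ from rfl, map_sum]
    refine Submodule.sum_mem _ fun c _ => ?_
    rcases Nat.eq_zero_or_pos c with rfl | hc
    · obtain ⟨s, hs⟩ := hG.surj _ (DirectSum.decompose 𝓑 b 0).2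
      rw [← hs, Algebra.algebraMap_eq_smul_one, map_smul]
      exact Submodule.smul_mem _ _ (Submodule.subset_span (Or.inl rfl))
    · exact Submodule.subset_span (Or.inr (Or.inl ⟨c, _, hc, (DirectSum.decompose 𝓑 b c).2, rfl⟩))
  · generalize a.snd = x
    let _ := hG.internal.chooseDecomposition
    classical
    rw [← DirectSum.sum_support_decompose 𝓜 x]
    rw [show (inr (∑ i ∈ (DirectSum.decompose 𝓜 x).support, (DirectSum.decompose 𝓜 x i : M)) :
      TrivSqZeroExt B M) = inrS S B M _ from rfl, map_sum]
    exact Submodule.sum_mem _ fun e _ =>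
      Submodule.subset_span (Or.inr (Or.inr ⟨e, _, (DirectSum.decompose 𝓜 x e).2, rfl⟩))

theorem mul_mem_extendZ {k k' : ℤ} {b b' : B} (hb : b ∈ extendZ 𝓑 k) (hb' : b' ∈ extendZ 𝓑 k') :
    b * b' ∈ extendZ 𝓑 (k + k') := by
  match k, k', hb, hb' with
  | Int.ofNat k, Int.ofNat k', hb, hb' => exact SetLike.GradedMul.mul_mem (A := 𝓑) hb hb'
  | Int.negSucc k, _, hb, hb' => rw [(Submodule.mem_bot S).1 hb, zero_mul]; exact Submodule.zero_mem _
  | _, Int.negSucc k, hb, hb' => rw [(Submodule.mem_bot S).1 hb', mul_zero]; exact Submodule.zero_mem _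

theorem isSignedBigrading (hG : IsGradedBimodule 𝓑 𝓜) :
    IsSignedBigrading (bigrading 𝓑 𝓜 d) (signInv S B M d) where
  span := by
    rw [eq_top_iff, ← span_letters hG]
    refine Submodule.span_mono ?_
    rintro a (rfl | ⟨c, b, _, hb, rfl⟩ | ⟨e, x, hx, rfl⟩)
    · exact ⟨0, _, inl_mem_bigrading (SetLike.GradedOne.one_mem (A := 𝓑))⟩
    · exact ⟨_, _, inl_mem_bigrading hb⟩
    · exact ⟨_, _, inr_mem_bigrading hx⟩
  sign h k a ha := signInv_apply 𝓑 𝓜 d h k a ha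
  one_mem := inl_mem_bigrading (SetLike.GradedOne.one_mem (A := 𝓑))
  mul_mem h k h' k' a ha a' ha' := by
    obtain ⟨h1, h2⟩ := ha
    obtain ⟨h1', h2'⟩ := ha'
    have key : ∀ (k k' : ℤ) (b : B) (x : M), b ∈ extendZ 𝓑 k → x ∈ 𝓜 k' →
        b • x ∈ 𝓜 (k + k') ∧ MulOpposite.op b • x ∈ 𝓜 (k + k') := by
      intro k k' b x hb hx
      match k, hb with
      | Int.ofNat k, hb => exact ⟨hG.left k k' b x hb hx, hG.right k k' b x hb hx⟩
      | Int.negSucc k, hb =>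
        rw [(Submodule.mem_bot S).1 hb]
        simp
    refine ⟨?_, ?_⟩
    · rw [TrivSqZeroExt.fst_mul]
      by_cases h0 : h = 0
      · by_cases h0' : h' = 0
        · rw [if_pos h0] at h1
          rw [if_pos h0'] at h1'
          rw [if_pos (by omega)]
          exact mul_mem_extendZ h1 h1'
        · rw [if_neg h0'] at h1'
          rw [(Submodule.mem_bot S).1 h1', mul_zero]; exact Submodule.zero_mem _
      · rw [if_neg h0] at h1
        rw [(Submodule.mem_bot S).1 h1, zero_mul]; exact Submodule.zero_mem _
    · rw [TrivSqZeroExt.snd_mul]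
      refine Submodule.add_mem _ ?_ ?_
      · by_cases h0 : h = 0
        · by_cases h0' : h' = d
          · rw [if_pos h0] at h1
            rw [if_pos h0'] at h2'
            rw [if_pos (by omega)]
            exact (key _ _ _ _ h1 h2').1
          · rw [if_neg h0'] at h2'
            rw [(Submodule.mem_bot S).1 h2', smul_zero]; exact Submodule.zero_mem _
        · rw [if_neg h0] at h1
          rw [(Submodule.mem_bot S).1 h1, zero_smul]; exact Submodule.zero_mem _
      · by_cases h0 : h' = 0
        · by_cases h0' : h = d
          · rw [if_pos h0] at h1'
            rw [if_pos h0'] at h2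
            rw [if_pos (by omega), add_comm k]
            exact (key _ _ _ _ h1' h2).2
          · rw [if_neg h0'] at h2
            rw [(Submodule.mem_bot S).1 h2, smul_zero]; exact Submodule.zero_mem _
        · rw [if_neg h0] at h1'
          rw [(Submodule.mem_bot S).1 h1', MulOpposite.op_zero, zero_smul]; exact Submodule.zero_mem _

@[simp] theorem signInv_inl (b : B) : signInv S B M d (inl b) = inl b := by
  ext <;> simp [signInv]

@[simp] theorem signInv_inr (x : M) : signInv S B M d (inr x) = (-1 : S) ^ d • inr x := by
  ext <;> simp [signInv]

/-- `Typed 𝓑 𝓜 m k l`: the word `l` consists of homogeneous letters, those in `B` of positive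
degree, `m` of them in `M`, and `k` is the sum of their internal degrees. -/
inductive Typed (𝓑 : ℕ → Submodule S B) (𝓜 : ℤ → Submodule S M) :
    ℕ → ℤ → List (TrivSqZeroExt B M) → Prop
  | nil : Typed 𝓑 𝓜 0 0 []
  | consB {m : ℕ} {k : ℤ} {l : List (TrivSqZeroExt B M)} (c : ℕ) (b : B) (hc : 1 ≤ c) (hb : b ∈ 𝓑 c)
      (h : Typed 𝓑 𝓜 m k l) : Typed 𝓑 𝓜 m (c + k) (inl b :: l)
  | consM {m : ℕ} {k : ℤ} {l : List (TrivSqZeroExt B M)} (e : ℤ) (x : M) (hx : x ∈ 𝓜 e)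
      (h : Typed 𝓑 𝓜 m k l) : Typed 𝓑 𝓜 (m + 1) (e + k) (inr x :: l)

namespace Typed

theorem consB' {m : ℕ} {k k' : ℤ} {l : List (TrivSqZeroExt B M)} {c : ℕ} {b : B} (hc : 1 ≤ c)
    (hb : b ∈ 𝓑 c) (h : Typed 𝓑 𝓜 m k l) (hk : k' = c + k) : Typed 𝓑 𝓜 m k' (inl b :: l) :=
  hk ▸ consB c b hc hb h

theorem consM' {m : ℕ} {k k' : ℤ} {l : List (TrivSqZeroExt B M)} {e : ℤ} {x : M} (hx : x ∈ 𝓜 e)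
    (h : Typed 𝓑 𝓜 m k l) (hk : k' = e + k) : Typed 𝓑 𝓜 (m + 1) k' (inr x :: l) :=
  hk ▸ consM e x hx h

theorem append {m m' : ℕ} {k k' : ℤ} {u v : List (TrivSqZeroExt B M)} (hu : Typed 𝓑 𝓜 m k u)
    (hv : Typed 𝓑 𝓜 m' k' v) : Typed 𝓑 𝓜 (m + m') (k + k') (u ++ v) := by
  induction hu with
  | nil => simpa using hv
  | consB c b hc hb h ih => exact ih.consB' hc hb (by ring)
  | consM e x hx h ih =>
    rw [Nat.add_right_comm]
    exact ih.consM' hx (by ring)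

theorem append' {m m' n : ℕ} {k k' j : ℤ} {u v : List (TrivSqZeroExt B M)} (hu : Typed 𝓑 𝓜 m k u)
    (hv : Typed 𝓑 𝓜 m' k' v) (hn : n = m + m') (hj : j = k + k') : Typed 𝓑 𝓜 n j (u ++ v) := by
  subst hn hj; exact hu.append hv

theorem of_append {m : ℕ} {k : ℤ} {u v : List (TrivSqZeroExt B M)} (h : Typed 𝓑 𝓜 m k (u ++ v)) :
    ∃ m₁ k₁ m₂ k₂, Typed 𝓑 𝓜 m₁ k₁ u ∧ Typed 𝓑 𝓜 m₂ k₂ v ∧ m = m₁ + m₂ ∧ k = k₁ + k₂ := by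
  induction u generalizing m k with
  | nil => exact ⟨0, 0, m, k, .nil, h, by simp, by simp⟩
  | cons a u ih =>
    cases h with
    | consB c b hc hb h =>
      obtain ⟨m₁, k₁, m₂, k₂, h₁, h₂, rfl, rfl⟩ := ih h
      exact ⟨m₁, _, m₂, k₂, h₁.consB c b hc hb, h₂, rfl, by ring⟩
    | consM e x hx h =>
      obtain ⟨m₁, k₁, m₂, k₂, h₁, h₂, rfl, rfl⟩ := ih h
      exact ⟨m₁ + 1, _, m₂, k₂, h₁.consM e x hx, h₂, by ring, by ring⟩

/-- The decomposition of a word before its last letter from `M`. -/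
theorem exists_last {m : ℕ} {k : ℤ} {l : List (TrivSqZeroExt B M)} (h : Typed 𝓑 𝓜 (m + 1) k l) :
    ∃ u x t e k₁ k₂, l = u ++ inr x :: t ∧ Typed 𝓑 𝓜 m k₁ u ∧ x ∈ 𝓜 e ∧ Typed 𝓑 𝓜 0 k₂ t ∧
      k = k₁ + e + k₂ := by
  generalize hm' : m + 1 = m' at h
  induction h generalizing m with
  | nil => simp at hm'
  | consB c b hc hb h ih =>
    obtain ⟨u, x, t, e, k₁, k₂, rfl, hu, hx, ht, rfl⟩ := ih hm'
    exact ⟨_, x, t, e, _, k₂, rfl, hu.consB c b hc hb, hx, ht, by ring⟩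
  | @consM m₀ k₀ l₀ e x hx h ih =>
    obtain rfl : m = m₀ := by omega
    cases m with
    | zero => exact ⟨[], x, l₀, e, 0, _, rfl, .nil, hx, h, by ring⟩
    | succ m =>
      obtain ⟨u, y, t, e', k₁, k₂, rfl, hu, hy, ht, rfl⟩ := ih rfl
      exact ⟨_, y, t, e', _, k₂, rfl, hu.consM e x hx, hy, ht, by ring⟩

end Typed

theorem Typed.exists_concat {m : ℕ} {k : ℤ} {l : List (TrivSqZeroExt B M)} (h : Typed 𝓑 𝓜 m k l) :
    (m = 0 ∧ k = 0 ∧ l = []) ∨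
    (∃ u c b k', 1 ≤ c ∧ b ∈ 𝓑 c ∧ Typed 𝓑 𝓜 m k' u ∧ k = k' + c ∧ l = u ++ [inl b]) ∨
    ∃ u e x k' m', x ∈ 𝓜 e ∧ Typed 𝓑 𝓜 m' k' u ∧ m = m' + 1 ∧ k = k' + e ∧ l = u ++ [inr x] := by
  induction h with
  | nil => exact Or.inl ⟨rfl, rfl, rfl⟩
  | consB c b hc hb h ih =>
    rcases ih with ⟨rfl, rfl, rfl⟩ | ⟨u, c', b', k', hc', hb', hu, rfl, rfl⟩ |
      ⟨u, e, x, k', m', hx, hu, rfl, rfl, rfl⟩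
    · exact Or.inr (Or.inl ⟨[], c, b, 0, hc, hb, .nil, by ring, rfl⟩)
    · exact Or.inr (Or.inl ⟨_, c', b', _, hc', hb', hu.consB c b hc hb, by ring, rfl⟩)
    · exact Or.inr (Or.inr ⟨_, e, x, _, m', hx, hu.consB c b hc hb, rfl, by ring, rfl⟩)
  | consM e x hx h ih =>
    rcases ih with ⟨rfl, rfl, rfl⟩ | ⟨u, c', b', k', hc', hb', hu, rfl, rfl⟩ |
      ⟨u, e', x', k', m', hx', hu, rfl, rfl, rfl⟩
    · exact Or.inr (Or.inr ⟨[], e, x, 0, 0, hx, .nil, rfl, by ring, rfl⟩)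
    · exact Or.inr (Or.inl ⟨_, c', b', _, hc', hb', hu.consM e x hx, by ring, rfl⟩)
    · exact Or.inr (Or.inr ⟨_, e', x', _, _, hx', hu.consM e x hx, rfl, by ring, rfl⟩)

/-- Typed words which are empty or start with a letter from `M`. -/
def StartTyped (𝓑 : ℕ → Submodule S B) (𝓜 : ℤ → Submodule S M) (m : ℕ) (k : ℤ)
    (l : List (TrivSqZeroExt B M)) : Prop :=
  (m = 0 ∧ k = 0 ∧ l = []) ∨
    ∃ m' e k' x t, m = m' + 1 ∧ k = e + k' ∧ x ∈ 𝓜 e ∧ Typed 𝓑 𝓜 m' k' t ∧ l = inr x :: t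

namespace StartTyped

theorem nil : StartTyped 𝓑 𝓜 0 0 [] := Or.inl ⟨rfl, rfl, rfl⟩

theorem consM {m : ℕ} {k : ℤ} {l : List (TrivSqZeroExt B M)} {e : ℤ} {x : M} (hx : x ∈ 𝓜 e)
    (h : Typed 𝓑 𝓜 m k l) : StartTyped 𝓑 𝓜 (m + 1) (e + k) (inr x :: l) :=
  Or.inr ⟨m, e, k, x, l, rfl, rfl, hx, h, rfl⟩

theorem consM' {m : ℕ} {k k' : ℤ} {l : List (TrivSqZeroExt B M)} {e : ℤ} {x : M} (hx : x ∈ 𝓜 e)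
    (h : Typed 𝓑 𝓜 m k l) (hk : k' = e + k) : StartTyped 𝓑 𝓜 (m + 1) k' (inr x :: l) :=
  hk ▸ consM hx h

theorem typed {m : ℕ} {k : ℤ} {l : List (TrivSqZeroExt B M)} (h : StartTyped 𝓑 𝓜 m k l) :
    Typed 𝓑 𝓜 m k l := by
  rcases h with ⟨rfl, rfl, rfl⟩ | ⟨m', e, k', x, t, rfl, rfl, hx, ht, rfl⟩
  · exact .nil
  · exact ht.consM e x hx

theorem append {m m' : ℕ} {k k' : ℤ} {u v : List (TrivSqZeroExt B M)} (hu : StartTyped 𝓑 𝓜 m k u)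
    (hv : StartTyped 𝓑 𝓜 m' k' v) : StartTyped 𝓑 𝓜 (m + m') (k + k') (u ++ v) := by
  rcases hu with ⟨rfl, rfl, rfl⟩ | ⟨m', e, k', x, t, rfl, rfl, hx, ht, rfl⟩
  · simpa using hv
  · rw [Nat.add_right_comm, List.cons_append]
    exact consM' hx (ht.append hv.typed) (by ring)

theorem exists_last {m : ℕ} {k : ℤ} {l : List (TrivSqZeroExt B M)} (h : StartTyped 𝓑 𝓜 (m + 1) k l) :
    ∃ u x t e k₁ k₂, l = u ++ inr x :: t ∧ StartTyped 𝓑 𝓜 m k₁ u ∧ x ∈ 𝓜 e ∧ Typed 𝓑 𝓜 0 k₂ t ∧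
      k = k₁ + e + k₂ := by
  rcases h with ⟨h, -⟩ | ⟨m', e, k', x, t, hm, rfl, hx, ht, rfl⟩
  · omega
  · obtain rfl : m = m' := by omega
    cases m with
    | zero => exact ⟨[], x, t, e, 0, _, rfl, nil, hx, ht, by ring⟩
    | succ m =>
      obtain ⟨u, y, t, e', k₁, k₂, rfl, hu, hy, ht', rfl⟩ := ht.exists_last
      exact ⟨_, y, t, e', _, k₂, rfl, consM hx hu, hy, ht', by ring⟩

theorem exists_concat {m : ℕ} {k : ℤ} {l : List (TrivSqZeroExt B M)} (h : StartTyped 𝓑 𝓜 m k l) :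
    (m = 0 ∧ k = 0 ∧ l = []) ∨
    (∃ u c b k', 1 ≤ c ∧ b ∈ 𝓑 c ∧ StartTyped 𝓑 𝓜 m k' u ∧ k = k' + c ∧ l = u ++ [inl b]) ∨
    ∃ u e x k' m', x ∈ 𝓜 e ∧ StartTyped 𝓑 𝓜 m' k' u ∧ m = m' + 1 ∧ k = k' + e ∧ l = u ++ [inr x] := by
  rcases h with h | ⟨m', e, k', x, t, rfl, rfl, hx, ht, rfl⟩
  · exact Or.inl h
  · rcases ht.exists_concat with ⟨rfl, rfl, rfl⟩ | ⟨u, c', b', k', hc', hb', hu, rfl, rfl⟩ |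
      ⟨u, e', x', k', m', hx', hu, rfl, rfl, rfl⟩
    · exact Or.inr (Or.inr ⟨[], e, x, 0, 0, hx, nil, rfl, by ring, rfl⟩)
    · exact Or.inr (Or.inl ⟨_, c', b', _, hc', hb', consM hx hu, by ring, rfl⟩)
    · exact Or.inr (Or.inr ⟨_, e', x', _, _, hx', consM hx hu, rfl, by ring, rfl⟩)

end StartTyped

/-- The decomposition of a word before its first letter from `M`. -/
theorem Typed.exists_first {m : ℕ} {k : ℤ} {l : List (TrivSqZeroExt B M)} (h : Typed 𝓑 𝓜 m k l) :
    ∃ p u k₁ k₂, l = p ++ u ∧ Typed 𝓑 𝓜 0 k₁ p ∧ StartTyped 𝓑 𝓜 m k₂ u ∧ k = k₁ + k₂ := by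
  induction h with
  | nil => exact ⟨[], [], 0, 0, rfl, .nil, .nil, by simp⟩
  | consB c b hc hb h ih =>
    obtain ⟨p, u, k₁, k₂, rfl, hp, hu, rfl⟩ := ih
    exact ⟨_, u, _, k₂, rfl, hp.consB c b hc hb, hu, by ring⟩
  | consM e x hx h ih =>
    exact ⟨[], _, 0, _, rfl, .nil, .consM hx h, by simp⟩

variable (S) in
/-- The span of the typed words with `m` letters from `M`, of length `n` and degree `k`. -/
def typedSpan (𝓑 : ℕ → Submodule S B) (𝓜 : ℤ → Submodule S M) (m n : ℕ) (k : ℤ) :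
    Submodule S (WordAlg S (TrivSqZeroExt B M)) :=
  Submodule.span S {z | ∃ l, Typed 𝓑 𝓜 m k l ∧ l.length = n ∧ z = wd S l}

variable (S) in
/-- The span of those typed words which start with a letter from `M`. -/
def startSpan (𝓑 : ℕ → Submodule S B) (𝓜 : ℤ → Submodule S M) (m n : ℕ) (k : ℤ) :
    Submodule S (WordAlg S (TrivSqZeroExt B M)) :=
  Submodule.span S {z | ∃ l, StartTyped 𝓑 𝓜 m k l ∧ l.length = n ∧ z = wd S l}

theorem wd_mem_typedSpan {m : ℕ} {k : ℤ} {l : List (TrivSqZeroExt B M)} (h : Typed 𝓑 𝓜 m k l) :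
    wd S l ∈ typedSpan S 𝓑 𝓜 m l.length k := Submodule.subset_span ⟨l, h, rfl, rfl⟩

theorem wd_mem_startSpan {m : ℕ} {k : ℤ} {l : List (TrivSqZeroExt B M)} (h : StartTyped 𝓑 𝓜 m k l) :
    wd S l ∈ startSpan S 𝓑 𝓜 m l.length k :=
  Submodule.subset_span ⟨l, h, rfl, rfl⟩

theorem startSpan_le {m n : ℕ} {k : ℤ} : startSpan S 𝓑 𝓜 m n k ≤ typedSpan S 𝓑 𝓜 m n k :=
  Submodule.span_mono fun _ ⟨l, h, hn, hz⟩ => ⟨l, h.typed, hn, hz⟩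

/-- Bilinear membership from spanning sets. -/
theorem mul_mem_of_span {R : Type*} [Ring R] [Algebra S R] {s t : Set R} {p : Submodule S R}
    (h : ∀ x ∈ s, ∀ y ∈ t, x * y ∈ p) {x y : R} (hx : x ∈ Submodule.span S s)
    (hy : y ∈ Submodule.span S t) : x * y ∈ p := by
  have := Submodule.mul_mem_mul hx hy
  rw [Submodule.span_mul_span] at this
  refine Submodule.span_le.2 ?_ this
  rintro _ ⟨x, hx, y, hy, rfl⟩
  exact h x hx y hy

theorem mul_mem_typedSpan {m m' n n' : ℕ} {k k' : ℤ} {z w : WordAlg S (TrivSqZeroExt B M)}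
    (hz : z ∈ typedSpan S 𝓑 𝓜 m n k) (hw : w ∈ typedSpan S 𝓑 𝓜 m' n' k') :
    z * w ∈ typedSpan S 𝓑 𝓜 (m + m') (n + n') (k + k') := by
  refine mul_mem_of_span ?_ hz hw
  rintro _ ⟨u, hu, rfl, rfl⟩ _ ⟨v, hv, rfl, rfl⟩
  rw [← wd_append]
  exact Submodule.subset_span ⟨u ++ v, hu.append hv, by simp, rfl⟩

theorem mul_mem_startSpan {m m' n n' : ℕ} {k k' : ℤ} {z w : WordAlg S (TrivSqZeroExt B M)}
    (hz : z ∈ startSpan S 𝓑 𝓜 m n k) (hw : w ∈ startSpan S 𝓑 𝓜 m' n' k') :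
    z * w ∈ startSpan S 𝓑 𝓜 (m + m') (n + n') (k + k') := by
  refine mul_mem_of_span ?_ hz hw
  rintro _ ⟨u, hu, rfl, rfl⟩ _ ⟨v, hv, rfl, rfl⟩
  rw [← wd_append]
  exact Submodule.subset_span ⟨u ++ v, hu.append hv, by simp, rfl⟩

theorem letter_inr_mul_mem {m n : ℕ} {k e : ℤ} {x : M} (hx : x ∈ 𝓜 e)
    {z : WordAlg S (TrivSqZeroExt B M)} (hz : z ∈ typedSpan S 𝓑 𝓜 m n k) :
    letter S (inr x) * z ∈ startSpan S 𝓑 𝓜 (m + 1) (n + 1) (e + k) := by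
  refine mul_mem_of_span (s := {letter S (inr x)}) ?_ (Submodule.subset_span rfl) hz
  rintro _ rfl _ ⟨v, hv, rfl, rfl⟩
  rw [← wd_cons]
  exact Submodule.subset_span ⟨_, .consM hx hv, by simp, rfl⟩

theorem letter_inl_mul_mem {m n : ℕ} {k : ℤ} {c : ℕ} (hc : 1 ≤ c) {b : B} (hb : b ∈ 𝓑 c)
    {z : WordAlg S (TrivSqZeroExt B M)} (hz : z ∈ typedSpan S 𝓑 𝓜 m n k) :
    letter S (inl b) * z ∈ typedSpan S 𝓑 𝓜 m (n + 1) (c + k) := by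
  refine mul_mem_of_span (s := {letter S (inl b)}) ?_ (Submodule.subset_span rfl) hz
  rintro _ rfl _ ⟨v, hv, rfl, rfl⟩
  rw [← wd_cons]
  exact Submodule.subset_span ⟨_, hv.consB c b hc hb, by simp, rfl⟩

/-- Every letter contributes `-1` from the suspension, and every letter from `M` contributes a
further `(-1)^d`. -/
theorem tsign_wd_typed {m : ℕ} {k : ℤ} {l : List (TrivSqZeroExt B M)} (h : Typed 𝓑 𝓜 m k l) :
    tsign S (signInv S B M d) (wd S l) = (-1 : S) ^ (l.length + m * d) • wd S l := by
  induction h with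
  | nil => simp
  | consB c b hc hb h ih =>
    rw [wd_cons, map_mul, ih, tsign_letter, signInv_inl]
    simp only [List.length_cons, mul_smul_comm, neg_mul]
    rw [show ∀ a b : ℕ, a + 1 + b = (a + b) + 1 by intros; ring, pow_succ]
    simp
  | consM e x hx h ih =>
    rw [wd_cons, map_mul, ih, tsign_letter, signInv_inr, map_smul]
    simp only [List.length_cons, mul_smul_comm, neg_mul, smul_mul_assoc]
    rw [show ∀ a b : ℕ, a + 1 + (b + 1) * d = (a + b * d) + d + 1 by intros; ring, pow_succ, pow_add _ _ d]
    simp [mul_smul]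

theorem tsign_of_mem_startSpan {m n : ℕ} {k : ℤ} {z : WordAlg S (TrivSqZeroExt B M)}
    (hz : z ∈ startSpan S 𝓑 𝓜 m n k) :
    tsign S (signInv S B M d) z = (-1 : S) ^ (n + m * d) • z := by
  induction hz using Submodule.span_induction with
  | mem z hz => obtain ⟨l, h, rfl, rfl⟩ := hz; exact tsign_wd_typed h.typed
  | zero => simp
  | add z w _ _ hz hw => rw [map_add, hz, hw, smul_add]
  | smul c z _ hz => rw [map_smul, hz, smul_comm]

/-- Two neighbouring letters from `M` multiply to zero. Every other product preserves the number of
letters from `M` and the degree, and a product of two letters in positive degrees of `B` is again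
one. -/
theorem barDiff_mem_typedSpan (hG : IsGradedBimodule 𝓑 𝓜) {m : ℕ} {k : ℤ}
    {l : List (TrivSqZeroExt B M)} (h : Typed 𝓑 𝓜 m k l) {n : ℕ} (hn : l.length = n + 1) :
    barDiff (signInv S B M d) (wd S l) ∈ typedSpan S 𝓑 𝓜 m n k := by
  induction h generalizing n with
  | nil => simp at hn
  | @consB m k l c b hc hb h ih =>
    cases h with
    | nil => rw [wd_cons]; simp
    | @consB _ k' l' c' b' hc' hb' h' =>
      obtain ⟨n, rfl⟩ : ∃ n', n = n' + 1 := ⟨n - 1, by simp at hn; omega⟩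
      rw [barDiff_cons_cons]
      refine Submodule.sub_mem _ (Submodule.subset_span ⟨_, ?_, ?_, rfl⟩) ?_
      · rw [signInv_inl, ← TrivSqZeroExt.inl_mul]
        exact h'.consB' (c := c + c') (by omega) (SetLike.GradedMul.mul_mem hb hb') (by push_cast; ring)
      · simpa using hn
      · rw [signInv_inl]; exact letter_inl_mul_mem hc hb (ih (by simpa using hn))
    | @consM _ k' l' e x hx h' =>
      obtain ⟨n, rfl⟩ : ∃ n', n = n' + 1 := ⟨n - 1, by simp at hn; omega⟩
      rw [barDiff_cons_cons]
      refine Submodule.sub_mem _ (Submodule.subset_span ⟨_, ?_, ?_, rfl⟩) ?_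
      · rw [signInv_inl, TrivSqZeroExt.inl_mul_inr]
        exact h'.consM' (hG.left _ _ _ _ hb hx) (by ring)
      · simpa using hn
      · rw [signInv_inl]; exact letter_inl_mul_mem hc hb (ih (by simpa using hn))
  | @consM m k l e x hx h ih =>
    cases h with
    | nil => rw [wd_cons]; simp
    | @consB _ k' l' c' b' hc' hb' h' =>
      obtain ⟨n, rfl⟩ : ∃ n', n = n' + 1 := ⟨n - 1, by simp at hn; omega⟩
      rw [barDiff_cons_cons]
      refine Submodule.sub_mem _ ?_ ?_
      · rw [signInv_inr, smul_mul_assoc, TrivSqZeroExt.inr_mul_inl, wd_cons, map_smul, smul_mul_assoc,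
          ← wd_cons]
        exact Submodule.smul_mem _ _ (Submodule.subset_span ⟨_, h'.consM' (hG.right _ _ _ _ hb' hx)
          (by ring), by simpa using hn, rfl⟩)
      · rw [signInv_inr, map_smul, smul_mul_assoc]
        exact Submodule.smul_mem _ _ (startSpan_le (letter_inr_mul_mem hx (ih (by simpa using hn))))
    | @consM _ k' l' e' x' hx' h' =>
      obtain ⟨n, rfl⟩ : ∃ n', n = n' + 1 := ⟨n - 1, by simp at hn; omega⟩
      rw [barDiff_cons_cons]
      refine Submodule.sub_mem _ ?_ ?_
      · rw [signInv_inr, smul_mul_assoc, TrivSqZeroExt.inr_mul_inr, smul_zero, isML_wd.zero_head]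
        exact Submodule.zero_mem _
      · rw [signInv_inr, map_smul, smul_mul_assoc]
        exact Submodule.smul_mem _ _ (startSpan_le (letter_inr_mul_mem hx (ih (by simpa using hn))))

/-- The leading letter has no left neighbour, so it can only be multiplied on the right by a letter
from `B` and stays in `M`. -/
theorem barDiff_mem_startSpan (hG : IsGradedBimodule 𝓑 𝓜) {m n : ℕ} {k : ℤ}
    {z : WordAlg S (TrivSqZeroExt B M)} (hz : z ∈ startSpan S 𝓑 𝓜 m (n + 1) k) :
    barDiff (signInv S B M d) z ∈ startSpan S 𝓑 𝓜 m n k := by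
  induction hz using Submodule.span_induction with
  | zero => simp
  | add z w _ _ hz hw => rw [map_add]; exact Submodule.add_mem _ hz hw
  | smul c z _ hz => rw [map_smul]; exact Submodule.smul_mem _ _ hz
  | mem z hz =>
    obtain ⟨l, h, hn, rfl⟩ := hz
    rcases h with ⟨rfl, rfl, rfl⟩ | ⟨m, e, k, x, t, rfl, rfl, hx, h, rfl⟩
    · simp at hn
    cases h with
    | nil => rw [wd_cons]; simp
    | @consB _ k' l' c' b' hc' hb' h' =>
      obtain ⟨n, rfl⟩ : ∃ n', n = n' + 1 := ⟨n - 1, by simp at hn; omega⟩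
      rw [barDiff_cons_cons]
      refine Submodule.sub_mem _ ?_ ?_
      · rw [signInv_inr, smul_mul_assoc, TrivSqZeroExt.inr_mul_inl, wd_cons, map_smul, smul_mul_assoc,
          ← wd_cons]
        exact Submodule.smul_mem _ _ (Submodule.subset_span ⟨_, .consM' (hG.right _ _ _ _ hb' hx) h'
          (by ring), by simpa using hn, rfl⟩)
      · rw [signInv_inr, map_smul, smul_mul_assoc]
        exact Submodule.smul_mem _ _ (letter_inr_mul_mem hx
          (barDiff_mem_typedSpan hG (h'.consB _ _ hc' hb') (by simpa using hn)))
    | @consM _ k' l' e' x' hx' h' =>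
      obtain ⟨n, rfl⟩ : ∃ n', n = n' + 1 := ⟨n - 1, by simp at hn; omega⟩
      rw [barDiff_cons_cons]
      refine Submodule.sub_mem _ ?_ ?_
      · rw [signInv_inr, smul_mul_assoc, TrivSqZeroExt.inr_mul_inr, smul_zero, isML_wd.zero_head]
        exact Submodule.zero_mem _
      · rw [signInv_inr, map_smul, smul_mul_assoc]
        exact Submodule.smul_mem _ _ (letter_inr_mul_mem hx
          (barDiff_mem_typedSpan hG (h'.consM _ _ hx') (by simpa using hn)))

end SquareZeroBasics


open TrivSqZeroExt (inl inr)

theorem span_wd_of_span {S A : Type*} [CommRing S] [Ring A] [Algebra S A] {R : Set A}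
    (hR : Submodule.span S R = ⊤) :
    Submodule.span S {z | ∃ l : List A, (∀ a ∈ l, a ∈ R) ∧ z = wd S l} = ⊤ := by
  rw [eq_top_iff]
  rintro x -
  induction x using WordAlg.induction with
  | algebraMap r =>
    rw [Algebra.algebraMap_eq_smul_one]
    exact Submodule.smul_mem _ _ (Submodule.subset_span ⟨[], by simp, rfl⟩)
  | letter a =>
    have ha : a ∈ Submodule.span S R := hR ▸ Submodule.mem_top
    induction ha using Submodule.span_induction with
    | mem a ha => exact Submodule.subset_span ⟨[a], by simpa using ha, by simp [wd]⟩
    | zero => simp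
    | add x y _ _ hx hy => rw [map_add]; exact Submodule.add_mem _ hx hy
    | smul c x _ hx => rw [map_smul]; exact Submodule.smul_mem _ _ hx
  | add x y hx hy => exact Submodule.add_mem _ hx hy
  | mul x y hx hy =>
    refine mul_mem_of_span ?_ hx hy
    rintro _ ⟨u, hu, rfl⟩ _ ⟨v, hv, rfl⟩
    refine Submodule.subset_span ⟨u ++ v, ?_, (wd_append u v).symm⟩
    intro a ha
    rcases List.mem_append.1 ha with h | h
    exacts [hu a h, hv a h]

/-! ### Projections onto fixed numbers of letters from `M` and fixed internal degrees. -/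

section Coaction

variable {S B M : Type*} [CommRing S] [Ring B] [Algebra S B] [AddCommGroup M] [Module S M]
  [Module B M] [Module Bᵐᵒᵖ M] [SMulCommClass B Bᵐᵒᵖ M] [IsScalarTower S B M]
  [IsScalarTower S Bᵐᵒᵖ M]
  (𝓑 : ℕ → Submodule S B) [GradedAlgebra 𝓑] (𝓜 : ℤ → Submodule S M) [DirectSum.Decomposition 𝓜]

variable (S B M) in
/-- The first projection, as an `S`-linear map. -/
def fstS : TrivSqZeroExt B M →ₗ[S] B where
  toFun := TrivSqZeroExt.fst
  map_add' _ _ := rfl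
  map_smul' _ _ := rfl

variable (S B M) in
/-- The second projection, as an `S`-linear map. -/
def sndS : TrivSqZeroExt B M →ₗ[S] M where
  toFun := TrivSqZeroExt.snd
  map_add' _ _ := rfl
  map_smul' _ _ := rfl

@[simp] theorem fstS_apply (a : TrivSqZeroExt B M) : fstS S B M a = a.fst := rfl

@[simp] theorem sndS_apply (a : TrivSqZeroExt B M) : sndS S B M a = a.snd := rfl

variable (S B M) in
/-- The tensor algebra graded by the number of letters from `M` and the internal degree. -/
abbrev GradedTensor : Type _ := AddMonoidAlgebra (WordAlg S (TrivSqZeroExt B M)) (ℕ × ℤ)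

variable (S B M) in
/-- The inclusion of an element in a given degree. -/
def putDegree (i : ℕ × ℤ) :
    WordAlg S (TrivSqZeroExt B M) →ₗ[S] GradedTensor S B M where
  toFun z := AddMonoidAlgebra.single i z
  map_add' _ _ := AddMonoidAlgebra.single_add _ _ _
  map_smul' c z := (AddMonoidAlgebra.smul_single c i z).symm

variable (S B M) in
/-- The coefficients, as a linear map. -/
def coeffS : GradedTensor S B M →ₗ[S] ((ℕ × ℤ) →₀ WordAlg S (TrivSqZeroExt B M)) where
  toFun := AddMonoidAlgebra.coeff
  map_add' _ _ := rfl
  map_smul' _ _ := rfl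

/-- The degree coaction on letters; it kills the unit. -/
def coactLetter : TrivSqZeroExt B M →ₗ[S] GradedTensor S B M :=
  DirectSum.toModule S ℕ _ (fun c => if 1 ≤ c then
      putDegree S B M (0, c) ∘ₗ letter S ∘ₗ inlS S B M ∘ₗ (𝓑 c).subtype else 0) ∘ₗ
    (DirectSum.decomposeLinearEquiv 𝓑).toLinearMap ∘ₗ fstS S B M +
  DirectSum.toModule S ℤ _ (fun e =>
      putDegree S B M (1, e) ∘ₗ letter S ∘ₗ inrS S B M ∘ₗ (𝓜 e).subtype) ∘ₗ
    (DirectSum.decomposeLinearEquiv 𝓜).toLinearMap ∘ₗ sndS S B M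

theorem coactLetter_inl {c : ℕ} (hc : 1 ≤ c) {b : B} (hb : b ∈ 𝓑 c) :
    coactLetter 𝓑 𝓜 (inl b) =
      AddMonoidAlgebra.single (0, (c : ℤ)) (letter S (inl b : TrivSqZeroExt B M)) := by
  have h := DirectSum.decompose_of_mem 𝓑 hb
  simp only [coactLetter, LinearMap.add_apply, LinearMap.comp_apply, LinearEquiv.coe_coe, fstS_apply,
    sndS_apply, TrivSqZeroExt.fst_inl, TrivSqZeroExt.snd_inl, map_zero, add_zero]
  rw [DirectSum.decomposeLinearEquiv_apply, h, ← DirectSum.lof_eq_of S, DirectSum.toModule_lof, if_pos hc]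
  rfl

theorem coactLetter_inr {e : ℤ} {x : M} (hx : x ∈ 𝓜 e) :
    coactLetter 𝓑 𝓜 (inr x) =
      AddMonoidAlgebra.single (1, e) (letter S (inr x : TrivSqZeroExt B M)) := by
  have h := DirectSum.decompose_of_mem 𝓜 hx
  simp only [coactLetter, LinearMap.add_apply, LinearMap.comp_apply, LinearEquiv.coe_coe, fstS_apply,
    sndS_apply, TrivSqZeroExt.fst_inr, TrivSqZeroExt.snd_inr, map_zero, zero_add]
  rw [DirectSum.decomposeLinearEquiv_apply, h, ← DirectSum.lof_eq_of S, DirectSum.toModule_lof]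
  rfl

theorem coactLetter_one : coactLetter 𝓑 𝓜 1 = 0 := by
  have h := DirectSum.decompose_of_mem 𝓑 (SetLike.GradedOne.one_mem (A := 𝓑))
  simp only [coactLetter, LinearMap.add_apply, LinearMap.comp_apply, LinearEquiv.coe_coe, fstS_apply,
    sndS_apply, TrivSqZeroExt.fst_one, TrivSqZeroExt.snd_one, map_zero, add_zero]
  rw [DirectSum.decomposeLinearEquiv_apply, h, ← DirectSum.lof_eq_of S, DirectSum.toModule_lof,
    if_neg (by omega)]
  rfl

/-- The degree coaction on the tensor algebra. -/
def coact : WordAlg S (TrivSqZeroExt B M) →ₐ[S] GradedTensor S B M :=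
  WordAlg.lift (coactLetter 𝓑 𝓜)

-- The type of a word is not a function of the list, as a zero letter has every type. The coaction,
-- an algebra map into the monoid algebra over `ℕ × ℤ`, supplies well-defined linear projections
-- that see the type on the level of tensors.
variable {𝓑 𝓜} in
theorem coact_wd {m : ℕ} {k : ℤ} {l : List (TrivSqZeroExt B M)} (h : Typed 𝓑 𝓜 m k l) :
    coact 𝓑 𝓜 (wd S l) = AddMonoidAlgebra.single (m, k) (wd S l) := by
  induction h with
  | nil => rw [wd_nil, map_one]; rfl
  | consB c b hc hb h ih =>
    rw [wd_cons, map_mul, ih, coact, WordAlg.lift_letter, coactLetter_inl 𝓑 𝓜 hc hb,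
      AddMonoidAlgebra.single_mul_single]
    simp
  | consM e x hx h ih =>
    rw [wd_cons, map_mul, ih, coact, WordAlg.lift_letter, coactLetter_inr 𝓑 𝓜 hx,
      AddMonoidAlgebra.single_mul_single]
    simp [add_comm]

theorem coact_wd_of_one_mem {l : List (TrivSqZeroExt B M)} (h : 1 ∈ l) :
    coact 𝓑 𝓜 (wd S l) = 0 := by
  obtain ⟨u, v, rfl⟩ := List.append_of_mem h
  rw [wd_append, wd_cons, map_mul, map_mul, coact, WordAlg.lift_letter, coactLetter_one,
    zero_mul, mul_zero]

/-- The projection onto the words with `m` letters from `M` of internal degree `k`. -/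
def pr (m : ℕ) (k : ℤ) :
    WordAlg S (TrivSqZeroExt B M) →ₗ[S] WordAlg S (TrivSqZeroExt B M) :=
  Finsupp.lapply (m, k) ∘ₗ coeffS S B M ∘ₗ (coact 𝓑 𝓜).toLinearMap

variable {𝓑 𝓜}

theorem pr_wd {m : ℕ} {k : ℤ} {l : List (TrivSqZeroExt B M)} (h : Typed 𝓑 𝓜 m k l) (m' : ℕ) (k' : ℤ) :
    pr 𝓑 𝓜 m' k' (wd S l) = if (m', k') = (m, k) then wd S l else 0 := by
  simp only [pr, LinearMap.comp_apply, AlgHom.toLinearMap_apply, coact_wd h]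
  change (Finsupp.single (m, k) (wd S l)) (m', k') = _
  rw [Finsupp.single_apply]
  simp only [eq_comm]

theorem typed_of_isLetter {l : List (TrivSqZeroExt B M)} (h : ∀ a ∈ l, IsLetter 𝓑 𝓜 a) :
    ∃ m k, Typed 𝓑 𝓜 m k l := by
  induction l with
  | nil => exact ⟨0, 0, .nil⟩
  | cons a l ih =>
    obtain ⟨m, k, hl⟩ := ih fun a ha => h a (by simp [ha])
    rcases h a (by simp) with ⟨c, b, hc, hb, rfl⟩ | ⟨e, x, hx, rfl⟩
    · exact ⟨_, _, hl.consB c b hc hb⟩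
    · exact ⟨_, _, hl.consM e x hx⟩

variable (𝓑 𝓜) in
/-- The span of all typed words of given degrees. -/
def typedAll (m : ℕ) (k : ℤ) : Submodule S (WordAlg S (TrivSqZeroExt B M)) :=
  Submodule.span S {z | ∃ l, Typed 𝓑 𝓜 m k l ∧ z = wd S l}

theorem span_typed_or_one (hG : IsGradedBimodule 𝓑 𝓜) :
    Submodule.span S {z : WordAlg S (TrivSqZeroExt B M) |
      ∃ l, (1 ∈ l ∨ ∃ m k, Typed 𝓑 𝓜 m k l) ∧ z = wd S l} = ⊤ := by
  rw [eq_top_iff, ← span_wd_of_span (span_letters hG)]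
  refine Submodule.span_mono ?_
  rintro _ ⟨l, hl, rfl⟩
  refine ⟨l, ?_, rfl⟩
  by_cases h1 : (1 : TrivSqZeroExt B M) ∈ l
  · exact Or.inl h1
  · exact Or.inr (typed_of_isLetter fun a ha => (hl a ha).resolve_left (by rintro rfl; exact h1 ha))

variable (𝓑 𝓜) in
/-- The homogeneous part of an operator, supported on words with `m` letters from `M`. -/
def homog (m : ℕ) (s : WordAlg S (TrivSqZeroExt B M) →ₗ[S] WordAlg S (TrivSqZeroExt B M)) :
    WordAlg S (TrivSqZeroExt B M) →ₗ[S] WordAlg S (TrivSqZeroExt B M) :=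
  Finsupp.lsum S (fun i : ℕ × ℤ => if i.1 = m then pr 𝓑 𝓜 m i.2 ∘ₗ s else 0) ∘ₗ
    coeffS S B M ∘ₗ (coact 𝓑 𝓜).toLinearMap

variable {s : WordAlg S (TrivSqZeroExt B M) →ₗ[S] WordAlg S (TrivSqZeroExt B M)}

theorem homog_wd {m : ℕ} {k : ℤ} {l : List (TrivSqZeroExt B M)} (h : Typed 𝓑 𝓜 m k l) :
    homog 𝓑 𝓜 m s (wd S l) = pr 𝓑 𝓜 m k (s (wd S l)) := by
  simp only [homog, LinearMap.comp_apply, AlgHom.toLinearMap_apply, coact_wd h]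
  change Finsupp.lsum S _ (Finsupp.single (m, k) (wd S l)) = _
  rw [Finsupp.lsum_single, if_pos rfl, LinearMap.comp_apply]

theorem homog_wd_of_ne {m m' : ℕ} (hm : m' ≠ m) {k : ℤ} {l : List (TrivSqZeroExt B M)}
    (h : Typed 𝓑 𝓜 m k l) : homog 𝓑 𝓜 m' s (wd S l) = 0 := by
  simp only [homog, LinearMap.comp_apply, AlgHom.toLinearMap_apply, coact_wd h]
  change Finsupp.lsum S _ (Finsupp.single (m, k) (wd S l)) = _
  rw [Finsupp.lsum_single, if_neg (Ne.symm hm), LinearMap.zero_apply]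

theorem homog_wd_of_one_mem {m : ℕ} {l : List (TrivSqZeroExt B M)} (h : 1 ∈ l) :
    homog 𝓑 𝓜 m s (wd S l) = 0 := by
  simp only [homog, LinearMap.comp_apply, AlgHom.toLinearMap_apply, coact_wd_of_one_mem 𝓑 𝓜 h, map_zero]

theorem homog_of_mem {m : ℕ} {k : ℤ} {z : WordAlg S (TrivSqZeroExt B M)}
    (hz : z ∈ typedAll 𝓑 𝓜 m k) : homog 𝓑 𝓜 m s z = pr 𝓑 𝓜 m k (s z) := by
  induction hz using Submodule.span_induction with
  | zero => simp
  | add z w _ _ hz hw => rw [map_add, hz, hw, map_add, map_add]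
  | smul c z _ hz => rw [map_smul, hz, map_smul, map_smul]
  | mem z hz => obtain ⟨l, hl, rfl⟩ := hz; exact homog_wd hl

theorem typedSpan_le_typedAll {m n : ℕ} {k : ℤ} : typedSpan S 𝓑 𝓜 m n k ≤ typedAll 𝓑 𝓜 m k :=
  Submodule.span_mono fun _ ⟨l, h, _, hz⟩ => ⟨l, h, hz⟩

theorem startSpan_le_typedAll {m n : ℕ} {k : ℤ} : startSpan S 𝓑 𝓜 m n k ≤ typedAll 𝓑 𝓜 m k :=
  startSpan_le.trans typedSpan_le_typedAll

theorem pr_of_mem {m : ℕ} {k : ℤ} {z : WordAlg S (TrivSqZeroExt B M)}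
    (hz : z ∈ typedAll 𝓑 𝓜 m k) : pr 𝓑 𝓜 m k z = z := by
  induction hz using Submodule.span_induction with
  | zero => simp
  | add z w _ _ hz hw => rw [map_add, hz, hw]
  | smul c z _ hz => rw [map_smul, hz]
  | mem z hz => obtain ⟨l, hl, rfl⟩ := hz; rw [pr_wd hl, if_pos rfl]

theorem pr_of_mem_of_ne {m m' : ℕ} {k k' : ℤ} (h : (m', k') ≠ (m, k))
    {z : WordAlg S (TrivSqZeroExt B M)} (hz : z ∈ typedAll 𝓑 𝓜 m k) : pr 𝓑 𝓜 m' k' z = 0 := by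
  induction hz using Submodule.span_induction with
  | zero => simp
  | add z w _ _ hz hw => rw [map_add, hz, hw, add_zero]
  | smul c z _ hz => rw [map_smul, hz, smul_zero]
  | mem z hz => obtain ⟨l, hl, rfl⟩ := hz; rw [pr_wd hl, if_neg h]

theorem pr_barDiff (hG : IsGradedBimodule 𝓑 𝓜) {d : ℕ} {m : ℕ} {k : ℤ}
    {z : WordAlg S (TrivSqZeroExt B M)}
    (hz : z ∈ Submodule.span S {z : WordAlg S (TrivSqZeroExt B M) |
      ∃ l, (∃ m k, Typed 𝓑 𝓜 m k l) ∧ z = wd S l}) :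
    pr 𝓑 𝓜 m k (barDiff (signInv S B M d) z) = barDiff (signInv S B M d) (pr 𝓑 𝓜 m k z) := by
  induction hz using Submodule.span_induction with
  | zero => simp
  | add z w _ _ hz hw => simp only [map_add, hz, hw]
  | smul c z _ hz => simp only [map_smul, hz]
  | mem z hz =>
    obtain ⟨l, ⟨m', k', hl⟩, rfl⟩ := hz
    have hmem : barDiff (signInv S B M d) (wd S l) ∈ typedAll 𝓑 𝓜 m' k' := by
      cases hn : l.length with
      | zero => rw [List.length_eq_zero_iff.1 hn]; simp
      | succ n => exact typedSpan_le_typedAll (barDiff_mem_typedSpan hG hl hn)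
    rw [pr_wd hl]
    split_ifs with h
    · obtain ⟨rfl, rfl⟩ := Prod.mk.inj h
      exact pr_of_mem hmem
    · rw [map_zero]
      exact pr_of_mem_of_ne h hmem

end Coaction


/-! ### Splitting of complexes of projective modules with projective homology. -/

section Splitting

variable {S : Type*} [CommRing S]

/-- A section `t` of the quotient map yields the retraction `z ↦ z - t [z]`. -/
theorem exists_retraction {E : Type*} [AddCommGroup E] [Module S E] {Z W : Submodule S E} (h : W ≤ Z)
    [Module.Projective S (Subquot Z W)] : ∃ r : Z →ₗ[S] W, ∀ (y : E) (hy : y ∈ W), r ⟨y, h hy⟩ = ⟨y, hy⟩ := by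
  obtain ⟨t, ht⟩ := Module.projective_lifting_property (Subquot.mk Z W) LinearMap.id
    (subquot_mk_surjective Z W)
  have hmem : ∀ z : Z, (z : E) - t (Subquot.mk Z W z) ∈ W := fun z => by
    rw [← subquot_mk_eq_iff]
    exact (LinearMap.congr_fun ht (Subquot.mk Z W z)).symm
  refine ⟨{ toFun := fun z => ⟨z - t (Subquot.mk Z W z), hmem z⟩
            map_add' := fun a b => by ext; simp; abel
            map_smul' := fun c a => by ext; simp [smul_sub] }, fun y hy => ?_⟩
  have : Subquot.mk Z W ⟨y, h hy⟩ = 0 := by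
    rw [← map_zero (Subquot.mk Z W), subquot_mk_eq_iff]
    simpa using hy
  ext
  simp [this]

/-- The cycles of a complex of modules. -/
def cyclesOf {C : ℕ → Type*} [∀ n, AddCommGroup (C n)] [∀ n, Module S (C n)]
    (δ : ∀ n, C (n + 1) →ₗ[S] C n) : (n : ℕ) → Submodule S (C n)
  | 0 => ⊤
  | n + 1 => LinearMap.ker (δ n)

/-- A complex of projective modules whose homology is projective splits. -/
theorem exists_splitting {C : ℕ → Type*} [∀ n, AddCommGroup (C n)] [∀ n, Module S (C n)]
    [∀ n, Module.Projective S (C n)] (δ : ∀ n, C (n + 1) →ₗ[S] C n)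
    (hδ : ∀ n y, δ n (δ (n + 1) y) = 0)
    (hH : ∀ n, Module.Projective S (Subquot (cyclesOf δ n) (LinearMap.range (δ n)))) :
    ∃ (s : ∀ n, C n →ₗ[S] C (n + 1)) (π : ∀ n, C n →ₗ[S] C n),
      (∀ y, δ 0 (s 0 y) = y - π 0 y) ∧ (∀ n y, δ (n + 1) (s (n + 1) y) + s n (δ n y) = y - π (n + 1) y) ∧
      (∀ n y, π n (δ n y) = 0) ∧ (∀ n y, π n y ∈ cyclesOf δ n) ∧
      ∀ n, cyclesOf δ n ≤ LinearMap.range (δ n) → π n = 0 := by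
  have hle : ∀ n, LinearMap.range (δ n) ≤ cyclesOf δ n := by
    rintro n _ ⟨y, rfl⟩
    cases n with
    | zero => exact Submodule.mem_top
    | succ n => exact hδ n y
  have hr := fun n => exists_retraction (hle n)
  choose r hr using hr
  have hBproj : ∀ n, Module.Projective S (cyclesOf δ n) → Module.Projective S (LinearMap.range (δ n)) :=
    fun n _ => Module.Projective.of_split (Submodule.inclusion (hle n)) (r n)
      (LinearMap.ext fun y => hr n y.1 y.2)
  have htex : ∀ n, Module.Projective S (LinearMap.range (δ n)) →
      ∃ t : LinearMap.range (δ n) →ₗ[S] C (n + 1), ∀ y, (δ n).rangeRestrict (t y) = y := fun n _ => by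
    obtain ⟨t, ht⟩ := Module.projective_lifting_property (δ n).rangeRestrict LinearMap.id
      (LinearMap.surjective_rangeRestrict _)
    exact ⟨t, fun y => LinearMap.congr_fun ht y⟩
  -- Induction from the bottom of the complex: the boundaries are a direct summand of the cycles
  -- because the homology is projective, hence they are projective and lift to degree `n + 1`, where
  -- the cycles are a complement of the lifted boundaries.
  have hZproj : ∀ n, Module.Projective S (cyclesOf δ n) := by
    intro n
    induction n with
    | zero => exact Module.Projective.of_equiv (Submodule.topEquiv (R := S) (M := C 0)).symm
    | succ n ih =>
      obtain ⟨t, ht⟩ := htex n (hBproj n ih)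
      have hmem : ∀ y : C (n + 1), y - t ((δ n).rangeRestrict y) ∈ cyclesOf δ (n + 1) := fun y => by
        change δ n _ = 0
        have : δ n (t ((δ n).rangeRestrict y)) = δ n y :=
          congrArg Subtype.val (ht ((δ n).rangeRestrict y))
        rw [map_sub, this, sub_self]
      refine Module.Projective.of_split (cyclesOf δ (n + 1)).subtype
        (LinearMap.codRestrict _ (LinearMap.id - t ∘ₗ (δ n).rangeRestrict) hmem) ?_
      ext ⟨y, hy⟩
      have : (δ n).rangeRestrict y = 0 := Subtype.ext hy
      simp [this]
  choose t ht using fun n => htex n (hBproj n (hZproj n))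
  have ht' : ∀ n y, δ n (t n y) = y := fun n y => congrArg Subtype.val (ht n y)
  -- the projection onto the cycles
  obtain ⟨z, hz0, hz⟩ : ∃ z : ∀ n, C n →ₗ[S] cyclesOf δ n, (∀ y, (z 0 y : C 0) = y) ∧
      ∀ n y, (z (n + 1) y : C (n + 1)) = y - t n ((δ n).rangeRestrict y) := by
    refine ⟨fun n => match n with
      | 0 => (Submodule.topEquiv (R := S) (M := C 0)).symm.toLinearMap
      | n + 1 => LinearMap.codRestrict (cyclesOf δ (n + 1)) (LinearMap.id - t n ∘ₗ (δ n).rangeRestrict)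
          (fun y => ?_), fun _ => rfl, fun _ _ => rfl⟩
    change δ n (y - t n _) = 0
    rw [map_sub, ht']
    exact sub_self _
  have hzr : ∀ n (y : C (n + 1)), (z n (δ n y) : C n) = δ n y := by
    intro n y
    cases n with
    | zero => exact hz0 _
    | succ n =>
      rw [hz]
      have : (δ n).rangeRestrict (δ (n + 1) y) = 0 := Subtype.ext (hδ n y)
      rw [this, map_zero, sub_zero]
  have hrz : ∀ n (y : C (n + 1)), r n (z n (δ n y)) = (δ n).rangeRestrict y := by
    intro n y
    rw [show z n (δ n y) = ⟨δ n y, hle n ⟨y, rfl⟩⟩ from Subtype.ext (hzr n y), hr n _ ⟨y, rfl⟩]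
    rfl
  -- With `z` the projection onto the cycles, `r` the retraction onto the boundaries and `t` a lift
  -- of the boundaries, the homotopy is `t r z` and the projection is `z - r z`.
  refine ⟨fun n => t n ∘ₗ r n ∘ₗ z n, fun n => (cyclesOf δ n).subtype ∘ₗ z n -
    (LinearMap.range (δ n)).subtype ∘ₗ r n ∘ₗ z n, ?_, ?_, ?_, ?_, ?_⟩
  · intro y
    simp only [LinearMap.comp_apply, LinearMap.sub_apply, Submodule.subtype_apply, ht', hz0]
    abel
  · intro n y
    simp only [LinearMap.comp_apply, LinearMap.sub_apply, Submodule.subtype_apply, ht', hz, hrz]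
    abel
  · intro n y
    simp only [LinearMap.comp_apply, LinearMap.sub_apply, Submodule.subtype_apply, hzr, hrz]
    simp
  · intro n y
    exact Submodule.sub_mem _ (z n y).2 (hle n (r n (z n y)).2)
  · intro n hn
    ext y
    simp only [LinearMap.comp_apply, LinearMap.sub_apply, Submodule.subtype_apply, LinearMap.zero_apply]
    have := hr n (z n y) (hn (z n y).2)
    rw [show (⟨(z n y : C n), hle n (hn (z n y).2)⟩ : cyclesOf δ n) = z n y from rfl] at this
    rw [this, sub_self]

end Splitting

open TrivSqZeroExt (inl inr)

/-! ### The bar complex `M ⊗ T(B₊)` as a complex of projectives inside the tensor algebra. -/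

section Projective

/-- The tensor power is a retract of the tensor power of a free module, which has a basis. -/
theorem projective_piTensorProduct {S V : Type*} [CommRing S] [AddCommGroup V] [Module S V]
    [Module.Projective S V] (n : ℕ) :
    Module.Projective S (PiTensorProduct S (fun _ : Fin n => V)) := by
  obtain ⟨s, hs⟩ := Module.projective_def'.1 ‹Module.Projective S V›
  have : Module.Projective S (PiTensorProduct S (fun _ : Fin n => V →₀ S)) :=
    Module.Projective.of_basis (Basis.piTensorProduct fun _ => Finsupp.basisSingleOne)
  refine Module.Projective.of_split (PiTensorProduct.map fun _ => s)
    (PiTensorProduct.map fun _ => Finsupp.linearCombination S id) ?_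
  rw [← PiTensorProduct.map_comp, hs, PiTensorProduct.map_id]

end Projective

section BarWord

variable {S B M : Type*} [CommRing S] [Ring B] [Algebra S B] [AddCommGroup M] [Module S M]
  [Module B M] [Module Bᵐᵒᵖ M] [SMulCommClass B Bᵐᵒᵖ M] [IsScalarTower S B M]
  [IsScalarTower S Bᵐᵒᵖ M]
  (𝓑 : ℕ → Submodule S B) [GradedAlgebra 𝓑] (𝓜 : ℤ → Submodule S M)
  {X : Type*} [AddCommGroup X] [Module S X] {d : ℕ}

variable (M) in
/-- The bar complex inside the tensor algebra: `x ⊗ b₁ ⊗ … ⊗ b_n` is the word `x b₁ … b_n`. -/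
def barWord (n : ℕ) : BarTerm S (plus 𝓑) M n →ₗ[S] WordAlg S (TrivSqZeroExt B M) :=
  LinearMap.mul' S _ ∘ₗ TensorProduct.map (letter S ∘ₗ inrS S B M)
    (PiTensorProduct.lift ((isML_wd.toMultilinear n).compLinearMap
      fun _ => inlS S B M ∘ₗ (plus 𝓑).subtype))

theorem barWord_tmul {n : ℕ} (x : M) (b : Fin n → plus 𝓑) :
    barWord M 𝓑 n (x ⊗ₜ PiTensorProduct.tprod S b) =
      wd S (inr x :: List.ofFn fun i => inl (b i : B)) := by
  simp only [barWord, LinearMap.comp_apply, TensorProduct.map_tmul, PiTensorProduct.lift.tprod,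
    LinearMap.mul'_apply, wd_cons]
  rfl

/-- The projection of `B` onto the augmentation ideal. -/
def toPlus : B →ₗ[S] plus 𝓑 :=
  LinearMap.codRestrict _ (LinearMap.id - GradedAlgebra.proj 𝓑 0) fun b => by
    rw [plus, LinearMap.mem_ker, LinearMap.sub_apply, map_sub]
    simp [GradedAlgebra.proj_apply]

theorem toPlus_of_mem {b : B} (hb : b ∈ plus 𝓑) : toPlus 𝓑 b = ⟨b, hb⟩ := by
  ext
  have : GradedAlgebra.proj 𝓑 0 b = 0 := hb
  simp [toPlus, this]

theorem toPlus_coe (b : plus 𝓑) : toPlus 𝓑 (b : B) = b := toPlus_of_mem 𝓑 b.2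

theorem mem_plus {c : ℕ} (hc : 1 ≤ c) {b : B} (hb : b ∈ 𝓑 c) : b ∈ plus 𝓑 := by
  rw [plus, LinearMap.mem_ker, GradedAlgebra.proj_apply, DirectSum.decompose_of_mem_ne 𝓑 hb (by omega)]

/-- The multilinear map underlying `liftBar`. -/
def liftBarAux (φ : ∀ n, BarTerm S (plus 𝓑) M n →ₗ[S] X) :
    (n : ℕ) → MultilinearMap S (fun _ : Fin n => TrivSqZeroExt B M) X
  | 0 => 0
  | n + 1 => (φ n).compMultilinearMap (LinearMap.uncurryLeft (M := fun _ : Fin (n + 1) => TrivSqZeroExt B M)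
      { toFun := fun a => (TensorProduct.mk S M _ a.snd).compMultilinearMap
          ((PiTensorProduct.tprod S).compLinearMap fun _ => toPlus 𝓑 ∘ₗ fstS S B M)
        map_add' := fun a a' => by ext; exact TensorProduct.add_tmul _ _ _
        map_smul' := fun c a => by ext; exact (TensorProduct.smul_tmul' _ _ _).symm })

/-- The linear map on the tensor algebra given by linear maps on the terms of the bar complex. -/
def liftBar (φ : ∀ n, BarTerm S (plus 𝓑) M n →ₗ[S] X) :
    WordAlg S (TrivSqZeroExt B M) →ₗ[S] X := extMultilinear (liftBarAux 𝓑 φ)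

variable {𝓑}
variable (φ : ∀ n, BarTerm S (plus 𝓑) M n →ₗ[S] X)

theorem liftBar_wd {n : ℕ} (a : Fin n → TrivSqZeroExt B M) :
    liftBar 𝓑 φ (wd S (List.ofFn a)) = liftBarAux 𝓑 φ n a := extMultilinear_wd _ a

theorem liftBar_wd_cons {n : ℕ} (a : TrivSqZeroExt B M) (b : Fin n → TrivSqZeroExt B M) :
    liftBar 𝓑 φ (wd S (a :: List.ofFn b)) =
      φ n (a.snd ⊗ₜ PiTensorProduct.tprod S fun i => toPlus 𝓑 (b i).fst) := by
  rw [← List.ofFn_cons, liftBar_wd]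
  rfl

theorem liftBar_inl (b : B) (l : List (TrivSqZeroExt B M)) :
    liftBar 𝓑 φ (wd S (inl b :: l)) = 0 := by
  rw [← List.ofFn_get l, liftBar_wd_cons]
  simp

theorem liftBar_barWord {n : ℕ} (y : BarTerm S (plus 𝓑) M n) :
    liftBar 𝓑 φ (barWord M 𝓑 n y) = φ n y := by
  suffices h : liftBar 𝓑 φ ∘ₗ barWord M 𝓑 n = φ n from LinearMap.congr_fun h y
  ext x b
  simp only [TensorProduct.AlgebraTensorModule.curry_apply, LinearMap.restrictScalars_self,
    TensorProduct.curry_apply, LinearMap.comp_apply, LinearMap.compMultilinearMap_apply, barWord_tmul,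
    liftBar_wd_cons, TrivSqZeroExt.snd_inr, TrivSqZeroExt.fst_inl, toPlus_coe]

/-- `liftBar` with values in the product of all terms of the bar complex gives a left inverse. -/
theorem barWord_injective (n : ℕ) : Function.Injective (barWord M 𝓑 n) := by
  intro y z h
  have := congrArg (liftBar 𝓑 (X := ∀ n, BarTerm S (plus 𝓑) M n) fun n => LinearMap.single S _ n) h
  rw [liftBar_barWord, liftBar_barWord] at this
  exact Pi.single_injective n this

theorem mergeAt_zero {V : Type*} [AddCommGroup V] [Module S V] (mul : V →ₗ[S] V →ₗ[S] V) {n : ℕ}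
    (a : Fin (n + 2) → V) :
    mergeAt mul 0 a = Fin.cons (mul (a 0) (a 1)) (fun i => a i.succ.succ) := by
  funext k
  refine Fin.cases ?_ (fun k => ?_) k
  · simp [mergeAt]
  · simp [mergeAt, Fin.ext_iff]

theorem mergeAt_succ {V : Type*} [AddCommGroup V] [Module S V] (mul : V →ₗ[S] V →ₗ[S] V) {n : ℕ}
    (j : Fin n) (a : Fin (n + 2) → V) :
    mergeAt mul j.succ a = Fin.cons (a 0) (mergeAt mul j (Fin.tail a)) := by
  funext k
  refine Fin.cases ?_ (fun k => ?_) k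
  · simp [mergeAt]
  · simp only [mergeAt, Fin.cons_succ, Fin.tail, Fin.succ_lt_succ_iff, Fin.succ_inj, Fin.succ_castSucc]

theorem barDiff_ofFn_inl {n : ℕ} (b : Fin (n + 1) → plus 𝓑) :
    barDiff (signInv S B M d) (wd S (List.ofFn fun i => inl (b i : B))) =
      ∑ i : Fin n, (-1 : S) ^ i.val •
        wd S (List.ofFn fun k => (inl ((mergeAt (plusMul 𝓑) i b k : plus 𝓑) : B) : TrivSqZeroExt B M)) := by
  induction n with
  | zero => simp [barDiff_letter, wd_cons]
  | succ n ih =>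
    rw [List.ofFn_succ, List.ofFn_succ, barDiff_cons_cons, signInv_inl, ← TrivSqZeroExt.inl_mul,
      Fin.sum_univ_succ, ← List.ofFn_succ (f := fun i : Fin (n + 1) => (inl (b i.succ : B) : TrivSqZeroExt B M)),
      ih (fun i => b i.succ), Finset.mul_sum]
    simp only [mergeAt_zero, mergeAt_succ, List.ofFn_succ (n := n), Fin.cons_zero, Fin.cons_succ]
    rw [sub_eq_add_neg, ← Finset.sum_neg_distrib]
    congr 1
    · simp [plusMul]
    · refine Finset.sum_congr rfl fun i _ => ?_
      rw [wd_cons, mul_smul_comm, Fin.val_succ, pow_succ, mul_neg_one, neg_smul]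
      rfl

/-- The sign comes from the leading letter, which has homological degree `d`: `σ` is applied to it
both when it is multiplied and when it is passed. -/
theorem barDiff_barWord {n : ℕ} (y : BarTerm S (plus 𝓑) M (n + 1)) :
    barDiff (signInv S B M d) (barWord M 𝓑 (n + 1) y) =
      (-1 : S) ^ d • barWord M 𝓑 n (barD (plusMul 𝓑) (plusRight M 𝓑) n y) := by
  suffices h : barDiff (signInv S B M d) ∘ₗ barWord M 𝓑 (n + 1) =
      (-1 : S) ^ d • (barWord M 𝓑 n ∘ₗ barD (plusMul 𝓑) (plusRight M 𝓑) n) from LinearMap.congr_fun h y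
  ext x b
  simp only [TensorProduct.AlgebraTensorModule.curry_apply, LinearMap.restrictScalars_self,
    TensorProduct.curry_apply, LinearMap.comp_apply, LinearMap.compMultilinearMap_apply, barWord_tmul,
    LinearMap.smul_apply, barD_tmul, map_add, map_sum, map_smul]
  have h := barDiff_ofFn_inl (M := M) (d := d) b
  rw [List.ofFn_succ] at h ⊢
  rw [barDiff_cons_cons, h, signInv_inr, smul_add, sub_eq_add_neg]
  congr 1
  · rw [wd_cons, wd_cons, smul_mul_assoc, TrivSqZeroExt.inr_mul_inl, map_smul, smul_mul_assoc]
    rfl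
  · rw [Finset.smul_sum, Finset.mul_sum, ← Finset.sum_neg_distrib]
    refine Finset.sum_congr rfl fun i _ => ?_
    rw [map_smul, smul_mul_assoc, mul_smul_comm, ← wd_cons, pow_succ, mul_neg_one,
      neg_smul, smul_neg]

theorem barDiff_sq_of_isSignedBigrading
    (H : IsSignedBigrading (bigrading 𝓑 𝓜 d) (signInv S B M d)) (z : WordAlg S (TrivSqZeroExt B M)) :
    barDiff (signInv S B M d) (barDiff (signInv S B M d) z) = 0 := by
  have h := barDiff_barDiff H z
  exact h

variable {𝓜} in
theorem barDiff_sq (hG : IsGradedBimodule 𝓑 𝓜) (z : WordAlg S (TrivSqZeroExt B M)) :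
    barDiff (signInv S B M d) (barDiff (signInv S B M d) z) = 0 :=
  barDiff_sq_of_isSignedBigrading 𝓜 (isSignedBigrading hG) z

theorem barDiff_tsign_of_isSignedBigrading
    (H : IsSignedBigrading (bigrading 𝓑 𝓜 d) (signInv S B M d)) (z : WordAlg S (TrivSqZeroExt B M)) :
    barDiff (signInv S B M d) (tsign S (signInv S B M d) z) =
      - tsign S (signInv S B M d) (barDiff (signInv S B M d) z) := by
  have h := barDiff_tsign H z
  exact h

variable {𝓜} in
theorem barDiff_tsign_signInv (hG : IsGradedBimodule 𝓑 𝓜) (z : WordAlg S (TrivSqZeroExt B M)) :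
    barDiff (signInv S B M d) (tsign S (signInv S B M d) z) =
      - tsign S (signInv S B M d) (barDiff (signInv S B M d) z) :=
  barDiff_tsign_of_isSignedBigrading 𝓜 (isSignedBigrading hG) z

variable {𝓜}

theorem barD_barD (hG : IsGradedBimodule 𝓑 𝓜) {n : ℕ} (y : BarTerm S (plus 𝓑) M (n + 1 + 1)) :
    barD (plusMul 𝓑) (plusRight M 𝓑) n (barD (plusMul 𝓑) (plusRight M 𝓑) (n + 1) y) = 0 := by
  apply barWord_injective n
  -- The differential `barD` does not involve `d`; the choice `d = 0` removes the signs.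
  have h := barDiff_sq (d := 0) hG (barWord M 𝓑 (n + 1 + 1) y)
  rw [barDiff_barWord, map_smul, barDiff_barWord, pow_zero, one_smul, one_smul] at h
  rw [h, map_zero]

theorem projective_plus (hB : ∀ n, Module.Projective S (𝓑 n)) : Module.Projective S (plus 𝓑) := by
  have : Module.Projective S B := Module.Projective.of_equiv' (DirectSum.decomposeLinearEquiv 𝓑).symm
  exact Module.Projective.of_split (plus 𝓑).subtype (toPlus 𝓑) (LinearMap.ext fun b => toPlus_coe 𝓑 b)

theorem projective_barTerm (hG : IsGradedBimodule 𝓑 𝓜) (hB : ∀ n, Module.Projective S (𝓑 n))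
    (hM : ∀ n, Module.Projective S (𝓜 n)) (n : ℕ) : Module.Projective S (BarTerm S (plus 𝓑) M n) := by
  have := projective_plus hB
  have := projective_piTensorProduct (S := S) (V := plus 𝓑) n
  have : Module.Projective S M :=
    Module.Projective.of_equiv' (LinearEquiv.ofBijective (DirectSum.coeLinearMap 𝓜) hG.internal)
  infer_instance

theorem barCycles_eq_cyclesOf (n : ℕ) :
    barCycles (plusMul 𝓑) (plusRight M 𝓑) n = cyclesOf (barD (plusMul 𝓑) (plusRight M 𝓑)) n := by
  cases n <;> rfl

end BarWord

open TrivSqZeroExt (inl inr)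

/-! ### A homogeneous splitting of the bar complex. -/

section Contraction

variable {S B M : Type*} [CommRing S] [Ring B] [Algebra S B] [AddCommGroup M] [Module S M]
  [Module B M] [Module Bᵐᵒᵖ M] [SMulCommClass B Bᵐᵒᵖ M] [IsScalarTower S B M]
  [IsScalarTower S Bᵐᵒᵖ M]
  {𝓑 : ℕ → Submodule S B} [GradedAlgebra 𝓑] {𝓜 : ℤ → Submodule S M} {d : ℕ}

theorem Typed.exists_ofFn {k : ℤ} {l : List (TrivSqZeroExt B M)} (h : Typed 𝓑 𝓜 0 k l) :
    ∃ (b : Fin l.length → plus 𝓑) (f : Fin l.length → ℕ), (∀ i, b i ∈ plusDegree 𝓑 (f i)) ∧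
      ∑ i, (f i : ℤ) = k ∧ l = List.ofFn fun i => inl (b i : B) := by
  generalize hm : 0 = m at h
  induction h with
  | nil => exact ⟨Fin.elim0, Fin.elim0, fun i => i.elim0, by simp, by simp⟩
  | consB c b hc hb h ih =>
    obtain ⟨b', f, hb', rfl, hl⟩ := ih hm
    refine ⟨Fin.cons ⟨b, mem_plus 𝓑 hc hb⟩ b', Fin.cons c f, ?_, ?_, ?_⟩
    · intro i
      refine Fin.cases ?_ (fun i => ?_) i
      · exact hb
      · simpa using hb' i
    · simp only [List.length_cons]
      rw [Fin.sum_univ_succ]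
      simp
    · simp only [List.length_cons]
      rw [List.ofFn_succ]
      simp only [Fin.cons_zero, Fin.cons_succ]
      rw [← hl]
  | consM e x hx h ih => omega

theorem typed_ofFn {n : ℕ} {b : Fin n → plus 𝓑} {f : Fin n → ℕ} (hf : ∀ i, 1 ≤ f i)
    (hb : ∀ i, b i ∈ plusDegree 𝓑 (f i)) :
    Typed 𝓑 𝓜 0 (∑ i, (f i : ℤ)) (List.ofFn fun i => (inl (b i : B) : TrivSqZeroExt B M)) := by
  induction n with
  | zero => simpa using Typed.nil
  | succ n ih =>
    rw [List.ofFn_succ, Fin.sum_univ_succ]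
    exact (ih (fun i => hf i.succ) fun i => hb i.succ).consB (f 0) _ (hf 0) (hb 0)

theorem exists_mem_barDegree {n : ℕ} {k : ℤ} {z : WordAlg S (TrivSqZeroExt B M)}
    (hz : z ∈ startSpan S 𝓑 𝓜 1 (n + 1) k) :
    ∃ y ∈ barDegree (plusDegree 𝓑) 𝓜 n k, barWord M 𝓑 n y = z := by
  suffices h : startSpan S 𝓑 𝓜 1 (n + 1) k ≤ (barDegree (plusDegree 𝓑) 𝓜 n k).map (barWord M 𝓑 n) from
    h hz
  refine Submodule.span_le.2 ?_
  rintro _ ⟨l, hl, hn, rfl⟩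
  rcases hl with ⟨h, -⟩ | ⟨m', e, k', x, t, hm, rfl, hx, ht, rfl⟩
  · omega
  obtain rfl : m' = 0 := by omega
  obtain ⟨b, f, hb, hf, ht⟩ := ht.exists_ofFn
  obtain rfl : t.length = n := by simpa using hn
  refine ⟨x ⊗ₜ PiTensorProduct.tprod S b, Submodule.subset_span ⟨e, x, f, b, hx, hb, by rw [hf], rfl⟩, ?_⟩
  rw [barWord_tmul, ← ht]

theorem barWord_mem {n : ℕ} {k : ℤ} {y : BarTerm S (plus 𝓑) M n}
    (hy : y ∈ barDegree (plusDegree 𝓑) 𝓜 n k) : barWord M 𝓑 n y ∈ startSpan S 𝓑 𝓜 1 (n + 1) k := by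
  suffices h : barDegree (plusDegree 𝓑) 𝓜 n k ≤ (startSpan S 𝓑 𝓜 1 (n + 1) k).comap (barWord M 𝓑 n) from
    h hy
  refine Submodule.span_le.2 ?_
  rintro _ ⟨e, x, f, b, hx, hb, rfl, rfl⟩
  rw [SetLike.mem_coe, Submodule.mem_comap]
  by_cases hf : ∀ i, 1 ≤ f i
  · rw [barWord_tmul]
    exact Submodule.subset_span ⟨_, .consM hx (typed_ofFn hf hb), by simp, rfl⟩
  · obtain ⟨i, hi⟩ := not_forall.1 hf
    have hfi : f i = 0 := by omega
    -- An element of the augmentation ideal of degree `0` is zero; this disposes of the generators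
    -- which do not come from typed words.
    have hbi : b i = 0 := by
      have h1 : (b i : B) ∈ 𝓑 0 := by have := hb i; rwa [hfi] at this
      have h2 : GradedAlgebra.proj 𝓑 0 (b i : B) = 0 := (b i).2
      rw [GradedAlgebra.proj_apply, DirectSum.decompose_of_mem_same 𝓑 h1] at h2
      exact Subtype.ext h2
    rw [MultilinearMap.map_coord_zero _ i hbi, TensorProduct.tmul_zero, map_zero]
    exact Submodule.zero_mem _

variable (S 𝓑 𝓜) in
/-- The span of the words starting with a letter from `M`, of all internal degrees. -/
def startAll (m n : ℕ) : Submodule S (WordAlg S (TrivSqZeroExt B M)) :=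
  Submodule.span S {z | ∃ l, (∃ k, StartTyped 𝓑 𝓜 m k l) ∧ l.length = n ∧ z = wd S l}

theorem mem_span_homogeneous_inl {b : B} (hb : b ∈ plus 𝓑) :
    letter S (inl b : TrivSqZeroExt B M) ∈
      Submodule.span S {z | ∃ c b, 1 ≤ c ∧ b ∈ 𝓑 c ∧ z = letter S (inl b : TrivSqZeroExt B M)} := by
  classical
  have h : letter S (inl b : TrivSqZeroExt B M) = ∑ c ∈ (DirectSum.decompose 𝓑 b).support,
      (letter S ∘ₗ inlS S B M) (DirectSum.decompose 𝓑 b c : B) := by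
    rw [← map_sum, DirectSum.sum_support_decompose]; rfl
  rw [h]
  refine Submodule.sum_mem _ fun c hc => ?_
  by_cases h0 : c = 0
  · subst h0
    have : (DirectSum.decompose 𝓑 b 0 : B) = 0 := hb
    rw [this, map_zero]
    exact Submodule.zero_mem _
  · exact Submodule.subset_span ⟨c, _, by omega, (DirectSum.decompose 𝓑 b c).2, rfl⟩

theorem mem_span_homogeneous_inr (hG : IsGradedBimodule 𝓑 𝓜) (x : M) :
    letter S (inr x : TrivSqZeroExt B M) ∈
      Submodule.span S {z | ∃ e x, x ∈ 𝓜 e ∧ z = letter S (inr x : TrivSqZeroExt B M)} := by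
  classical
  let _ := hG.internal.chooseDecomposition
  have h : letter S (inr x : TrivSqZeroExt B M) = ∑ e ∈ (DirectSum.decompose 𝓜 x).support,
      (letter S ∘ₗ inrS S B M) (DirectSum.decompose 𝓜 x e : M) := by
    rw [← map_sum, DirectSum.sum_support_decompose]; rfl
  rw [h]
  exact Submodule.sum_mem _ fun e _ => Submodule.subset_span ⟨e, _, (DirectSum.decompose 𝓜 x e).2, rfl⟩

theorem wd_ofFn_inl_mem {n : ℕ} (b : Fin n → plus 𝓑) :
    wd S (List.ofFn fun i => (inl (b i : B) : TrivSqZeroExt B M)) ∈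
      Submodule.span S {z | ∃ l, (∃ k, Typed 𝓑 𝓜 0 k l) ∧ l.length = n ∧ z = wd S l} := by
  induction n with
  | zero => exact Submodule.subset_span ⟨[], ⟨0, .nil⟩, rfl, by simp⟩
  | succ n ih =>
    rw [List.ofFn_succ, wd_cons]
    refine mul_mem_of_span ?_ (mem_span_homogeneous_inl (b 0).2) (ih fun i => b i.succ)
    rintro _ ⟨c, a, hc, ha, rfl⟩ _ ⟨l, ⟨k, hl⟩, hn, rfl⟩
    rw [← wd_cons]
    exact Submodule.subset_span ⟨_, ⟨_, hl.consB c a hc ha⟩, by simp [hn], rfl⟩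

theorem barWord_mem_startAll (hG : IsGradedBimodule 𝓑 𝓜) {n : ℕ} (y : BarTerm S (plus 𝓑) M n) :
    barWord M 𝓑 n y ∈ startAll S 𝓑 𝓜 1 (n + 1) := by
  induction y using TensorProduct.induction_on with
  | zero => rw [map_zero]; exact Submodule.zero_mem _
  | add y y' hy hy' => rw [map_add]; exact Submodule.add_mem _ hy hy'
  | tmul x t =>
    induction t using PiTensorProduct.induction_on with
    | add t t' ht ht' => rw [TensorProduct.tmul_add, map_add]; exact Submodule.add_mem _ ht ht'
    | smul_tprod r b =>
      rw [TensorProduct.tmul_smul, map_smul, barWord_tmul, wd_cons]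
      refine Submodule.smul_mem _ r ?_
      refine mul_mem_of_span ?_ (mem_span_homogeneous_inr hG x) (wd_ofFn_inl_mem (𝓜 := 𝓜) b)
      rintro _ ⟨e, x, hx, rfl⟩ _ ⟨l, ⟨k, hl⟩, rfl, rfl⟩
      rw [← wd_cons]
      exact Submodule.subset_span ⟨_, ⟨_, .consM hx hl⟩, rfl, rfl⟩

theorem startSpan_one_zero {k : ℤ} {z : WordAlg S (TrivSqZeroExt B M)}
    (hz : z ∈ startSpan S 𝓑 𝓜 1 0 k) : z = 0 := by
  have : startSpan S 𝓑 𝓜 1 0 k = ⊥ := by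
    rw [startSpan, Submodule.span_eq_bot]
    rintro _ ⟨l, ⟨h, -⟩ | ⟨m', e, k', x, t, hm, rfl, hx, ht, rfl⟩, hn, rfl⟩
    · omega
    · simp at hn
  rw [this] at hz
  exact hz

variable [DirectSum.Decomposition 𝓜]

theorem pr_mem_startSpan {m n : ℕ} {z : WordAlg S (TrivSqZeroExt B M)}
    (hz : z ∈ startAll S 𝓑 𝓜 m n) (k : ℤ) : pr 𝓑 𝓜 m k z ∈ startSpan S 𝓑 𝓜 m n k := by
  induction hz using Submodule.span_induction with
  | zero => simp
  | add z w _ _ hz hw => rw [map_add]; exact Submodule.add_mem _ hz hw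
  | smul c z _ hz => rw [map_smul]; exact Submodule.smul_mem _ _ hz
  | mem z hz =>
    obtain ⟨l, ⟨k', hl⟩, rfl, rfl⟩ := hz
    rw [pr_wd hl.typed]
    split_ifs with h
    · obtain ⟨-, rfl⟩ := Prod.mk.inj h
      exact wd_mem_startSpan hl
    · exact Submodule.zero_mem _

theorem pr_barDiff_of_mem_startAll (hG : IsGradedBimodule 𝓑 𝓜) {m n : ℕ} {k : ℤ}
    {z : WordAlg S (TrivSqZeroExt B M)} (hz : z ∈ startAll S 𝓑 𝓜 m n) :
    pr 𝓑 𝓜 m k (barDiff (signInv S B M d) z) = barDiff (signInv S B M d) (pr 𝓑 𝓜 m k z) :=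
  pr_barDiff hG (Submodule.span_mono
    (by rintro _ ⟨l, ⟨k, hl⟩, -, h⟩; exact ⟨l, ⟨m, k, hl.typed⟩, h⟩) hz)

variable (𝓑 𝓜 d) in
/-- A splitting of the bar complex `M ⊗ T(B₊)`, as a pair of operators on the tensor algebra: a
homotopy `s` between the identity and a projection `π` onto the homology. -/
structure IsBarSplitting (s π : WordAlg S (TrivSqZeroExt B M) →ₗ[S] WordAlg S (TrivSqZeroExt B M)) :
    Prop where
  homotopy : ∀ {n k z}, z ∈ startSpan S 𝓑 𝓜 1 n k →
    barDiff (signInv S B M d) (s z) + s (barDiff (signInv S B M d) z) = z - π z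
  diff_proj : ∀ {n k z}, z ∈ startSpan S 𝓑 𝓜 1 n k → barDiff (signInv S B M d) (π z) = 0
  proj_diff : ∀ {n k z}, z ∈ startSpan S 𝓑 𝓜 1 n k → π (barDiff (signInv S B M d) z) = 0
  mem : ∀ {n k z}, z ∈ startSpan S 𝓑 𝓜 1 n k → s z ∈ startSpan S 𝓑 𝓜 1 (n + 1) k
  proj_mem : ∀ {n k z}, z ∈ startSpan S 𝓑 𝓜 1 n k → π z ∈ startSpan S 𝓑 𝓜 1 n k
  proj_eq_zero : ∀ {n k z}, z ∈ startSpan S 𝓑 𝓜 1 n k → (n ≠ d + 2 ∨ k ≠ 0) → π z = 0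
  kill : ∀ {m k l}, Typed 𝓑 𝓜 m k l → (∀ k, ¬ StartTyped 𝓑 𝓜 1 k l) → s (wd S l) = 0
  proj_kill : ∀ {m k l}, Typed 𝓑 𝓜 m k l → (∀ k, ¬ StartTyped 𝓑 𝓜 1 k l) → π (wd S l) = 0

theorem homog_liftBar_kill
    (φ : ∀ n, BarTerm S (plus 𝓑) M n →ₗ[S] WordAlg S (TrivSqZeroExt B M)) {m : ℕ} {k : ℤ}
    {l : List (TrivSqZeroExt B M)} (hl : Typed 𝓑 𝓜 m k l) (h : ∀ k, ¬ StartTyped 𝓑 𝓜 1 k l) :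
    homog 𝓑 𝓜 1 (liftBar 𝓑 φ) (wd S l) = 0 := by
  by_cases hm : m = 1
  · subst hm
    rw [homog_wd hl]
    suffices h0 : liftBar 𝓑 φ (wd S l) = 0 by rw [h0, map_zero]
    cases hl with
    | consB c b hc hb ht => exact liftBar_inl φ b _
    | consM e x hx ht => exact absurd (StartTyped.consM hx ht) (h _)
  · exact homog_wd_of_ne (Ne.symm hm) hl

/-- The abstract splitting need not respect the internal degree. Its homogeneous part still
satisfies the same identities, because the bar differential is homogeneous; one iteration of the
projection then removes all components of non-zero degree. -/
theorem exists_isBarSplitting (hG : IsGradedBimodule 𝓑 𝓜) (hB : ∀ n, Module.Projective S (𝓑 n))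
    (hM : ∀ n, Module.Projective S (𝓜 n)) (hT : TorRightConcentrated 𝓑 𝓜 (d + 1)) :
    ∃ s π, IsBarSplitting 𝓑 𝓜 d s π := by
  have hproj := projective_barTerm hG hB hM
  have hH : ∀ n, Module.Projective S (Subquot (cyclesOf (barD (plusMul 𝓑) (plusRight M 𝓑)) n)
      (LinearMap.range (barD (plusMul 𝓑) (plusRight M 𝓑) n))) := by
    intro n
    rw [← barCycles_eq_cyclesOf]
    by_cases hn : n = d + 1
    · subst hn; exact hT.projective
    · have : Subsingleton (Subquot (barCycles (plusMul 𝓑) (plusRight M 𝓑) n)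
          (LinearMap.range (barD (plusMul 𝓑) (plusRight M 𝓑) n))) := by
        refine ⟨fun a b => ?_⟩
        obtain ⟨a, rfl⟩ := subquot_mk_surjective _ _ a
        obtain ⟨b, rfl⟩ := subquot_mk_surjective _ _ b
        rw [subquot_mk_eq_iff]
        exact hT.degree n hn (Submodule.sub_mem _ a.2 b.2)
      infer_instance
  obtain ⟨t, p, h0, hs, hpd, hpc, hp0⟩ := exists_splitting (barD (plusMul 𝓑) (plusRight M 𝓑))
    (fun n y => barD_barD hG y) hH
  have hε : (-1 : S) ^ d * (-1 : S) ^ d = 1 := by rw [← mul_pow]; simp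
  let s' : WordAlg S (TrivSqZeroExt B M) →ₗ[S] WordAlg S (TrivSqZeroExt B M) :=
    liftBar 𝓑 fun n => (-1 : S) ^ d • (barWord M 𝓑 (n + 1) ∘ₗ t n)
  let p' : WordAlg S (TrivSqZeroExt B M) →ₗ[S] WordAlg S (TrivSqZeroExt B M) :=
    liftBar 𝓑 fun n => barWord M 𝓑 n ∘ₗ p n
  have hs' : ∀ {n} (y : BarTerm S (plus 𝓑) M n),
      s' (barWord M 𝓑 n y) = (-1 : S) ^ d • barWord M 𝓑 (n + 1) (t n y) := fun y => liftBar_barWord _ y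
  have hp' : ∀ {n} (y : BarTerm S (plus 𝓑) M n),
      p' (barWord M 𝓑 n y) = barWord M 𝓑 n (p n y) := fun y => liftBar_barWord _ y
  have hD0 : ∀ y : BarTerm S (plus 𝓑) M 0, barDiff (signInv S B M d) (barWord M 𝓑 0 y) = 0 := by
    intro y
    have := barWord_mem_startAll hG y
    generalize barWord M 𝓑 0 y = z at this ⊢
    induction this using Submodule.span_induction with
    | zero => simp
    | add z w _ _ hz hw => rw [map_add, hz, hw, add_zero]
    | smul c z _ hz => rw [map_smul, hz, smul_zero]
    | mem z hz =>
      obtain ⟨l, -, hl, rfl⟩ := hz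
      obtain ⟨a, rfl⟩ := List.length_eq_one_iff.1 hl
      rw [wd_cons, wd_nil, mul_one, barDiff_letter]
  have hhom : ∀ n (y : BarTerm S (plus 𝓑) M n),
      barDiff (signInv S B M d) (s' (barWord M 𝓑 n y)) + s' (barDiff (signInv S B M d) (barWord M 𝓑 n y)) =
        barWord M 𝓑 n y - p' (barWord M 𝓑 n y) := by
    intro n y
    rw [hs', map_smul, barDiff_barWord, smul_smul, hε, one_smul, hp', ← map_sub]
    cases n with
    | zero => rw [hD0, map_zero, add_zero, h0]
    | succ n => rw [barDiff_barWord, map_smul, hs', smul_smul, hε, one_smul, ← map_add, hs]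
  have hdp : ∀ n (y : BarTerm S (plus 𝓑) M n), barDiff (signInv S B M d) (p' (barWord M 𝓑 n y)) = 0 := by
    intro n y
    rw [hp']
    cases n with
    | zero => exact hD0 _
    | succ n =>
      have : barD (plusMul 𝓑) (plusRight M 𝓑) n (p (n + 1) y) = 0 := hpc (n + 1) y
      rw [barDiff_barWord, this, map_zero, smul_zero]
  have hpd' : ∀ n (y : BarTerm S (plus 𝓑) M n), p' (barDiff (signInv S B M d) (barWord M 𝓑 n y)) = 0 := by
    intro n y
    cases n with
    | zero => rw [hD0, map_zero]
    | succ n => rw [barDiff_barWord, map_smul, hp', hpd, map_zero, smul_zero]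
  -- the homogeneous parts
  have hsA : ∀ {n} (y : BarTerm S (plus 𝓑) M n), s' (barWord M 𝓑 n y) ∈ startAll S 𝓑 𝓜 1 (n + 2) := by
    intro n y
    rw [hs']
    exact Submodule.smul_mem _ _ (barWord_mem_startAll hG _)
  have hpA : ∀ {n} (y : BarTerm S (plus 𝓑) M n), p' (barWord M 𝓑 n y) ∈ startAll S 𝓑 𝓜 1 (n + 1) := by
    intro n y
    rw [hp']
    exact barWord_mem_startAll hG _
  let s₁ := homog 𝓑 𝓜 1 s'
  let p₁ := homog 𝓑 𝓜 1 p'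
  have hs₁ : ∀ {n k z}, z ∈ startSpan S 𝓑 𝓜 1 n k → s₁ z = pr 𝓑 𝓜 1 k (s' z) :=
    fun hz => homog_of_mem (startSpan_le_typedAll hz)
  have hp₁ : ∀ {n k z}, z ∈ startSpan S 𝓑 𝓜 1 n k → p₁ z = pr 𝓑 𝓜 1 k (p' z) :=
    fun hz => homog_of_mem (startSpan_le_typedAll hz)
  have hex : ∀ {n k z}, z ∈ startSpan S 𝓑 𝓜 1 n k → z ≠ 0 → ∃ j, ∃ y ∈ barDegree (plusDegree 𝓑) 𝓜 j k,
      n = j + 1 ∧ barWord M 𝓑 j y = z := by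
    intro n k z hz hz0
    cases n with
    | zero => exact absurd (startSpan_one_zero hz) hz0
    | succ n =>
      obtain ⟨y, hy, h⟩ := exists_mem_barDegree hz
      exact ⟨n, y, hy, rfl, h⟩
  have hsm : ∀ {n k z}, z ∈ startSpan S 𝓑 𝓜 1 n k → s₁ z ∈ startSpan S 𝓑 𝓜 1 (n + 1) k := by
    intro n k z hz
    by_cases hz0 : z = 0
    · rw [hz0, map_zero]; exact Submodule.zero_mem _
    rw [hs₁ hz]
    obtain ⟨j, y, -, rfl, rfl⟩ := hex hz hz0
    exact pr_mem_startSpan (hsA y) k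
  have hpm : ∀ {n k z}, z ∈ startSpan S 𝓑 𝓜 1 n k → p₁ z ∈ startSpan S 𝓑 𝓜 1 n k := by
    intro n k z hz
    by_cases hz0 : z = 0
    · rw [hz0, map_zero]; exact Submodule.zero_mem _
    rw [hp₁ hz]
    obtain ⟨j, y, -, rfl, rfl⟩ := hex hz hz0
    exact pr_mem_startSpan (hpA y) k
  have hDm : ∀ {j k z}, z ∈ startSpan S 𝓑 𝓜 1 (j + 1) k →
      barDiff (signInv S B M d) z ∈ startSpan S 𝓑 𝓜 1 j k := fun hz => barDiff_mem_startSpan hG hz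
  have hhom₁ : ∀ {n k z}, z ∈ startSpan S 𝓑 𝓜 1 n k → barDiff (signInv S B M d) (s₁ z) +
      s₁ (barDiff (signInv S B M d) z) = z - p₁ z := by
    intro n k z hz
    by_cases hz0 : z = 0
    · simp [hz0]
    rw [hs₁ hz, hp₁ hz]
    obtain ⟨j, y, -, rfl, rfl⟩ := hex hz hz0
    rw [hs₁ (hDm hz), ← pr_barDiff_of_mem_startAll hG (hsA y), ← map_add, hhom, map_sub,
      pr_of_mem (startSpan_le_typedAll hz)]
  have hdp₁ : ∀ {n k z}, z ∈ startSpan S 𝓑 𝓜 1 n k → barDiff (signInv S B M d) (p₁ z) = 0 := by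
    intro n k z hz
    by_cases hz0 : z = 0
    · simp [hz0]
    rw [hp₁ hz]
    obtain ⟨j, y, -, rfl, rfl⟩ := hex hz hz0
    rw [← pr_barDiff_of_mem_startAll hG (hpA y), hdp, map_zero]
  have hpd₁ : ∀ {n k z}, z ∈ startSpan S 𝓑 𝓜 1 n k → p₁ (barDiff (signInv S B M d) z) = 0 := by
    intro n k z hz
    by_cases hz0 : z = 0
    · simp [hz0]
    obtain ⟨j, y, -, rfl, rfl⟩ := hex hz hz0
    rw [hp₁ (hDm hz), hpd', map_zero]
  -- A value of `p₁` in non-zero degree is a cycle, hence a boundary by the assumption on the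
  -- internal degree of the homology, and the second application kills it. In lengths other than `d
  -- + 2` the homology vanishes and the projection is zero.
  have hzero : ∀ {n k z}, z ∈ startSpan S 𝓑 𝓜 1 n k → (n ≠ d + 2 ∨ k ≠ 0) → p₁ (p₁ z) = 0 := by
    intro n k z hz hnk
    by_cases hz0 : p₁ z = 0
    · rw [hz0, map_zero]
    obtain ⟨j, y, hy, rfl, hyz⟩ := hex (hpm hz) hz0
    rw [hp₁ (hpm hz), ← hyz, hp']
    by_cases hj : j = d + 1
    · subst hj
      have hk : k ≠ 0 := by rcases hnk with h | h; · omega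
                            · exact h
      have hcyc : y ∈ barCycles (plusMul 𝓑) (plusRight M 𝓑) (d + 1) := by
        change barD (plusMul 𝓑) (plusRight M 𝓑) d y = 0
        apply barWord_injective d
        have := hdp₁ hz
        rw [← hyz, barDiff_barWord] at this
        have h2 := congrArg (fun w => (-1 : S) ^ d • w) this
        simpa only [smul_smul, hε, one_smul, smul_zero, map_zero] using h2
      obtain ⟨y', rfl⟩ := hT.internal k hk ⟨hcyc, hy⟩
      rw [hpd, map_zero, map_zero]
    · rw [hp0 j (by rw [← barCycles_eq_cyclesOf]; exact hT.degree j hj), LinearMap.zero_apply, map_zero,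
        map_zero]
  -- Only the square of `p₁` is known to vanish in non-zero degree. As `p₁` has values in cycles,
  -- `s₁ ∘ p₁` is a homotopy between `p₁` and `p₁ ∘ p₁`, and it is added to `s₁`.
  refine ⟨s₁ + s₁ ∘ₗ p₁, p₁ ∘ₗ p₁, ?_, ?_, ?_, ?_, ?_, ?_, ?_, ?_⟩
  · intro n k z hz
    simp only [LinearMap.add_apply, LinearMap.comp_apply, map_add]
    rw [hpd₁ hz, map_zero, add_zero]
    have h1 := hhom₁ hz
    have h2 := hhom₁ (hpm hz)
    rw [hdp₁ hz, map_zero, add_zero] at h2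
    rw [h2, add_right_comm, h1]
    abel
  · intro n k z hz; exact hdp₁ (hpm hz)
  · intro n k z hz
    simp only [LinearMap.comp_apply, hpd₁ hz, map_zero]
  · intro n k z hz; exact Submodule.add_mem _ (hsm hz) (hsm (hpm hz))
  · intro n k z hz; exact hpm (hpm hz)
  · intro n k z hz h; exact hzero hz h
  · intro m k l hl h
    simp only [LinearMap.add_apply, LinearMap.comp_apply]
    rw [show p₁ (wd S l) = 0 from homog_liftBar_kill _ hl h, map_zero, add_zero]
    exact homog_liftBar_kill _ hl h
  · intro m k l hl h
    simp only [LinearMap.comp_apply]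
    rw [show p₁ (wd S l) = 0 from homog_liftBar_kill _ hl h, map_zero]

end Contraction

open TrivSqZeroExt (inl inr)

/-! ### Künneth argument: contracting words with several letters from `M`. -/

section PowerContraction

variable {S B M : Type*} [CommRing S] [Ring B] [Algebra S B] [AddCommGroup M] [Module S M]
  [Module B M] [Module Bᵐᵒᵖ M] [SMulCommClass B Bᵐᵒᵖ M] [IsScalarTower S B M]
  [IsScalarTower S Bᵐᵒᵖ M]
  {𝓑 : ℕ → Submodule S B} [GradedAlgebra 𝓑] {𝓜 : ℤ → Submodule S M} {d : ℕ}

theorem wd_eq_zero_of_mem {l : List (TrivSqZeroExt B M)} (h : 0 ∈ l) : wd S l = 0 := by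
  obtain ⟨u, v, rfl⟩ := List.append_of_mem h
  rw [wd_append, wd_cons, map_zero, zero_mul, mul_zero]

theorem Typed.exists_inl {m : ℕ} {k : ℤ} {l : List (TrivSqZeroExt B M)} (h : Typed 𝓑 𝓜 m k l) (hm : m = 0)
    {a : TrivSqZeroExt B M} (ha : a ∈ l) : ∃ b, a = inl b := by
  induction h with
  | nil => simp at ha
  | consB c b hc hb h ih =>
    rcases List.mem_cons.1 ha with rfl | ha
    · exact ⟨b, rfl⟩
    · exact ih hm ha
  | consM e x hx h ih => omega

theorem inl_eq_inr {b : B} {x : M} (h : (inl b : TrivSqZeroExt B M) = inr x) :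
    (inl b : TrivSqZeroExt B M) = 0 := by
  have : b = 0 := by simpa using congrArg TrivSqZeroExt.fst h
  rw [this, TrivSqZeroExt.inl_zero]

theorem inr_eq_inl {b : B} {x : M} (h : (inr x : TrivSqZeroExt B M) = inl b) :
    (inr x : TrivSqZeroExt B M) = 0 := by rw [h]; exact inl_eq_inr h.symm

/-- A word has only one suffix that starts with its only letter from `M`, so any other cut leaves a
remainder on which `f` vanishes. A letter that could be read both as an element of `B` and as an
element of `M` is zero, and then the whole word is zero. -/
theorem kill_of_split {f : WordAlg S (TrivSqZeroExt B M) →ₗ[S] WordAlg S (TrivSqZeroExt B M)}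
    (hf : ∀ {m k l}, Typed 𝓑 𝓜 m k l → (∀ k, ¬ StartTyped 𝓑 𝓜 1 k l) → f (wd S l) = 0)
    {m : ℕ} {k k' : ℤ} {u w v r : List (TrivSqZeroExt B M)} (hu : Typed 𝓑 𝓜 m k u)
    (hw : StartTyped 𝓑 𝓜 1 k' w) (h : v ++ r = u ++ w) (hne : v.length ≠ u.length) :
    f (wd S r) = 0 := by
  by_cases h0 : (0 : TrivSqZeroExt B M) ∈ r
  · rw [wd_eq_zero_of_mem h0, map_zero]
  obtain ⟨m₁, k₁, m₂, k₂, -, hr, -, -⟩ := (h ▸ hu.append hw.typed : Typed 𝓑 𝓜 _ _ (v ++ r)).of_append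
  refine hf hr fun k'' hst => h0 ?_
  rcases hst with ⟨h', -⟩ | ⟨m', e, k₃, y, t', hm, -, -, ht', rfl⟩
  · omega
  rcases hw with ⟨h', -⟩ | ⟨m'', e', k₄, x, t, hm', -, -, ht, rfl⟩
  · omega
  rcases List.append_eq_append_iff.1 h with ⟨as, rfl, has⟩ | ⟨bs, rfl, hbs⟩
  · cases as with
    | nil => simp at hne
    | cons a as =>
      obtain ⟨rfl, rfl⟩ := List.cons.inj has
      obtain ⟨b, hb⟩ := ht'.exists_inl (by omega) (a := inr x) (by simp)
      rw [inr_eq_inl hb]; simp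
  · cases bs with
    | nil => simp at hne
    | cons a bs =>
      obtain ⟨rfl, rfl⟩ := List.cons.inj hbs
      obtain ⟨b, hb⟩ := ht.exists_inl (by omega) (a := inr y) (by simp)
      rw [inr_eq_inl hb]; simp

/-- Bilinear membership from spanning sets, for a linear map applied to a product and the like. -/
theorem bilin_mem_of_span {R R' X : Type*} [AddCommGroup R] [Module S R] [AddCommGroup R'] [Module S R']
    [AddCommGroup X] [Module S X] (E : R →ₗ[S] R' →ₗ[S] X) {s : Set R} {t : Set R'} {p : Submodule S X}
    (h : ∀ x ∈ s, ∀ y ∈ t, E x y ∈ p) {x : R} {y : R'} (hx : x ∈ Submodule.span S s)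
    (hy : y ∈ Submodule.span S t) : E x y ∈ p := by
  have h1 : ∀ x ∈ s, Submodule.span S t ≤ p.comap (E x) := fun x hx => Submodule.span_le.2 (h x hx)
  have h2 : Submodule.span S s ≤ p.comap (E.flip y) := Submodule.span_le.2 fun x hx => h1 x hx hy
  exact h2 hx

variable (S B M d) in
/-- The defect of the bar differential to be a derivation. -/
def derDefect : WordAlg S (TrivSqZeroExt B M) →ₗ[S] WordAlg S (TrivSqZeroExt B M) →ₗ[S]
    WordAlg S (TrivSqZeroExt B M) :=
  (LinearMap.mul S (WordAlg S (TrivSqZeroExt B M))).compr₂ (barDiff (signInv S B M d)) -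
    (LinearMap.mul S (WordAlg S (TrivSqZeroExt B M))) ∘ₗ barDiff (signInv S B M d) -
    ((LinearMap.mul S (WordAlg S (TrivSqZeroExt B M))).compl₂ (barDiff (signInv S B M d))) ∘ₗ
      (tsign S (signInv S B M d)).toLinearMap

theorem derDefect_apply (z w : WordAlg S (TrivSqZeroExt B M)) :
    derDefect S B M d z w = barDiff (signInv S B M d) (z * w) - barDiff (signInv S B M d) z * w -
      tsign S (signInv S B M d) z * barDiff (signInv S B M d) w := rfl

variable (S 𝓑 𝓜) in
/-- The span of the words `u w`, with `u` having `m` letters from `M` and length `a` and `w` having one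
letter from `M`, length `j` and degree `k₂ > κ`. -/
def shiftSpan (m a j : ℕ) (k κ : ℤ) : Submodule S (WordAlg S (TrivSqZeroExt B M)) :=
  Submodule.span S {z | ∃ u w k₁ k₂, StartTyped 𝓑 𝓜 m k₁ u ∧ StartTyped 𝓑 𝓜 1 k₂ w ∧ u.length = a ∧
    w.length = j ∧ k₁ + k₂ = k ∧ κ < k₂ ∧ z = wd S u * wd S w}

theorem derDefect_mem (hG : IsGradedBimodule 𝓑 𝓜) {m a j : ℕ} (hm : 1 ≤ m) {k₁ k₂ : ℤ}
    {z w : WordAlg S (TrivSqZeroExt B M)} (hz : z ∈ startSpan S 𝓑 𝓜 m (a + 1) k₁)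
    (hw : w ∈ startSpan S 𝓑 𝓜 1 j k₂) :
    derDefect S B M d z w ∈ shiftSpan S 𝓑 𝓜 m a j (k₁ + k₂) k₂ := by
  refine bilin_mem_of_span (derDefect S B M d) ?_ hz hw
  rintro _ ⟨u, hu, hun, rfl⟩ _ ⟨w, ⟨h', -⟩ | ⟨m', e, k', x, t, hm', rfl, hx, ht, rfl⟩, hwn, rfl⟩
  · omega
  obtain rfl : m' = 0 := by omega
  have key : ∀ (u' : List (TrivSqZeroExt B M)) (a' : TrivSqZeroExt B M), derDefect S B M d (wd S (u' ++ [a']))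
      (wd S (inr x :: t)) = tsign S (signInv S B M d) (wd S u') *
        wd S ((signInv S B M d a' * inr x) :: t) := by
    intro u' a'
    rw [derDefect_apply, barDiff_append]
    abel
  rcases hu.exists_concat with ⟨h', -⟩ | ⟨u', c, b, k'', hc, hb, hu', rfl, rfl⟩ |
    ⟨u', e', y, k'', m', hy, hu', rfl, rfl, rfl⟩
  · omega
  · rw [key, signInv_inl, TrivSqZeroExt.inl_mul_inr, tsign_wd_typed hu'.typed, smul_mul_assoc]
    refine Submodule.smul_mem _ _ (Submodule.subset_span ⟨u', inr (b • x) :: t, k'', (c + e) + k', hu',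
      .consM' (hG.left c e b x hb hx) ht rfl, by simpa using hun, by simpa using hwn, by ring, by omega, rfl⟩)
  · rw [key, signInv_inr, smul_mul_assoc, TrivSqZeroExt.inr_mul_inr, smul_zero, wd_cons, map_zero, zero_mul,
      mul_zero]
    exact Submodule.zero_mem _

/-- The weight of the internal degree of the last block. -/
def degPen (k : ℤ) : ℕ := if k < 0 then 2 else if k = 0 then 1 else 0

theorem degPen_le {k k' : ℤ} (h : k ≤ k') : degPen k' ≤ degPen k := by
  unfold degPen; split_ifs <;> omega

variable (S 𝓑 𝓜) in
/-- The filtration by the length of all blocks but the last. -/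
def blockFil (m q n : ℕ) (k : ℤ) : Submodule S (WordAlg S (TrivSqZeroExt B M)) :=
  Submodule.span S {z | ∃ u w k₁ k₂, StartTyped 𝓑 𝓜 m k₁ u ∧ StartTyped 𝓑 𝓜 1 k₂ w ∧
    u.length + w.length = n ∧ k₁ + k₂ = k ∧ u.length + degPen k₂ ≤ q ∧ z = wd S u * wd S w}

theorem mul_mem_blockFil {m q a j : ℕ} {k₁ k₂ : ℤ} {z w : WordAlg S (TrivSqZeroExt B M)}
    (hz : z ∈ startSpan S 𝓑 𝓜 m a k₁) (hw : w ∈ startSpan S 𝓑 𝓜 1 j k₂) (hq : a + degPen k₂ ≤ q) :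
    z * w ∈ blockFil S 𝓑 𝓜 m q (a + j) (k₁ + k₂) := by
  refine mul_mem_of_span ?_ hz hw
  rintro _ ⟨u, hu, rfl, rfl⟩ _ ⟨v, hv, rfl, rfl⟩
  exact Submodule.subset_span ⟨u, v, k₁, k₂, hu, hv, rfl, rfl, hq, rfl⟩

theorem startSpan_le_blockFil {m n : ℕ} {k : ℤ} :
    startSpan S 𝓑 𝓜 (m + 1) n k ≤ blockFil S 𝓑 𝓜 m (n + 2) n k := by
  refine Submodule.span_le.2 ?_
  rintro _ ⟨l, hl, rfl, rfl⟩
  obtain ⟨u, x, t, e, k₁, k₂, rfl, hu, hx, ht, rfl⟩ := hl.exists_last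
  refine Submodule.subset_span ⟨u, inr x :: t, k₁, e + k₂, hu, .consM hx ht, by simp, by ring, ?_, wd_append _ _⟩
  simp only [List.length_append]
  have : degPen (e + k₂) ≤ 2 := by unfold degPen; split_ifs <;> omega
  omega

theorem blockFil_le_startSpan {m q n : ℕ} {k : ℤ} :
    blockFil S 𝓑 𝓜 m q n k ≤ startSpan S 𝓑 𝓜 (m + 1) n k := by
  refine Submodule.span_le.2 ?_
  rintro _ ⟨u, w, k₁, k₂, hu, hw, rfl, rfl, hq, rfl⟩
  exact mul_mem_startSpan (wd_mem_startSpan hu) (wd_mem_startSpan hw)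

theorem StartTyped.length_pos {m : ℕ} (hm : 1 ≤ m) {k : ℤ} {l : List (TrivSqZeroExt B M)}
    (h : StartTyped 𝓑 𝓜 m k l) : 1 ≤ l.length := by
  rcases h with ⟨h, -⟩ | ⟨m', e, k', x, t, -, -, -, -, rfl⟩
  · omega
  · simp

theorem blockFil_zero {m n : ℕ} (hm : 1 ≤ m) {k : ℤ} : blockFil S 𝓑 𝓜 m 0 n k = ⊥ := by
  rw [blockFil, Submodule.span_eq_bot]
  rintro _ ⟨u, w, k₁, k₂, hu, hw, rfl, rfl, hq, rfl⟩
  have := hu.length_pos hm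
  omega

theorem startSpan_zero {m : ℕ} (hm : 1 ≤ m) {k : ℤ} {z : WordAlg S (TrivSqZeroExt B M)}
    (hz : z ∈ startSpan S 𝓑 𝓜 m 0 k) : z = 0 := by
  have : startSpan S 𝓑 𝓜 m 0 k = ⊥ := by
    rw [startSpan, Submodule.span_eq_bot]
    rintro _ ⟨l, hl, hn, rfl⟩
    have := hl.length_pos hm
    omega
  rw [this] at hz
  exact hz

variable (𝓑 𝓜 d) in
/-- A contraction, below length `m (d + 2)`, of the complex of words with `m` letters from `M` starting
with such a letter. -/
structure IsContraction (m : ℕ) (s : WordAlg S (TrivSqZeroExt B M) →ₗ[S] WordAlg S (TrivSqZeroExt B M)) :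
    Prop where
  mem : ∀ {n k z}, z ∈ startSpan S 𝓑 𝓜 m n k → s z ∈ startSpan S 𝓑 𝓜 m (n + 1) k
  homotopy : ∀ {n k z}, z ∈ startSpan S 𝓑 𝓜 m n k → n < m * (d + 2) →
    barDiff (signInv S B M d) (s z) + s (barDiff (signInv S B M d) z) = z

section Step

variable (σm σw π : WordAlg S (TrivSqZeroExt B M) →ₗ[S] WordAlg S (TrivSqZeroExt B M))

theorem isML_blockHomotopy :
    IsML S (splitSum fun v r => σm (wd S v) * π (wd S r) + tsign S (signInv S B M d) (wd S v) * σw (wd S r)) := by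
  refine IsML.splitSum (fun r => ?_) fun v => ?_
  · refine isML_comp ((LinearMap.mulRight S (π (wd S r))) ∘ₗ σm +
      (LinearMap.mulRight S (σw (wd S r))) ∘ₗ (tsign S (signInv S B M d)).toLinearMap)
  · refine isML_comp ((LinearMap.mulLeft S (σm (wd S v))) ∘ₗ π +
      (LinearMap.mulLeft S (tsign S (signInv S B M d) (wd S v))) ∘ₗ σw)

variable (d) in
/-- The first approximation to a contraction of the complex of words with several blocks. -/
def blockHomotopy : WordAlg S (TrivSqZeroExt B M) →ₗ[S] WordAlg S (TrivSqZeroExt B M) :=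
  ext (isML_blockHomotopy (d := d) σm σw π)

variable {σm σw π} [DirectSum.Decomposition 𝓜]

theorem blockHomotopy_mul (hW : IsBarSplitting 𝓑 𝓜 d σw π) {m a j : ℕ} {k₁ k₂ : ℤ}
    {z w : WordAlg S (TrivSqZeroExt B M)} (hz : z ∈ startSpan S 𝓑 𝓜 m a k₁)
    (hw : w ∈ startSpan S 𝓑 𝓜 1 j k₂) :
    blockHomotopy d σm σw π (z * w) = σm z * π w + tsign S (signInv S B M d) z * σw w := by
  let E : WordAlg S (TrivSqZeroExt B M) →ₗ[S] WordAlg S (TrivSqZeroExt B M) →ₗ[S]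
      WordAlg S (TrivSqZeroExt B M) :=
    (LinearMap.mul S _).compr₂ (blockHomotopy d σm σw π) - (LinearMap.mul S _).compl₁₂ σm π -
      (LinearMap.mul S _).compl₁₂ (tsign S (signInv S B M d)).toLinearMap σw
  have hE : ∀ z w, E z w = blockHomotopy d σm σw π (z * w) - σm z * π w -
      tsign S (signInv S B M d) z * σw w := fun _ _ => rfl
  have : E z w ∈ (⊥ : Submodule S (WordAlg S (TrivSqZeroExt B M))) := by
    refine bilin_mem_of_span E ?_ hz hw
    rintro _ ⟨u, hu, -, rfl⟩ _ ⟨w, hw', -, rfl⟩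
    rw [Submodule.mem_bot, hE, ← wd_append, blockHomotopy, ext_wd, splitSum_eq_single rfl]
    · abel
    · intro v r hvr hne
      rw [kill_of_split hW.kill hu.typed hw' hvr hne, kill_of_split hW.proj_kill hu.typed hw' hvr hne]
      simp
  rw [Submodule.mem_bot, hE] at this
  rw [sub_sub, sub_eq_zero] at this
  exact this

theorem tsign_mem_startSpan {m n : ℕ} {k : ℤ} {z : WordAlg S (TrivSqZeroExt B M)}
    (hz : z ∈ startSpan S 𝓑 𝓜 m n k) : tsign S (signInv S B M d) z ∈ startSpan S 𝓑 𝓜 m n k := by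
  rw [tsign_of_mem_startSpan hz]
  exact Submodule.smul_mem _ _ hz

/-- The additional room is needed only for `k₂ = 0`: otherwise `π w` vanishes and the operator `σm`,
which lengthens the first factor, does not occur. -/
theorem blockHomotopy_mul_mem (hW : IsBarSplitting 𝓑 𝓜 d σw π) {m a j : ℕ}
    (hm : ∀ {n k z}, z ∈ startSpan S 𝓑 𝓜 m n k → σm z ∈ startSpan S 𝓑 𝓜 m (n + 1) k) {k₁ k₂ : ℤ}
    {z w : WordAlg S (TrivSqZeroExt B M)} (hz : z ∈ startSpan S 𝓑 𝓜 m a k₁)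
    (hw : w ∈ startSpan S 𝓑 𝓜 1 j k₂) {q : ℕ} (hq : a + degPen k₂ ≤ q) (hq' : k₂ = 0 → a + 2 ≤ q) :
    blockHomotopy d σm σw π (z * w) ∈ blockFil S 𝓑 𝓜 m q (a + j + 1) (k₁ + k₂) := by
  rw [blockHomotopy_mul hW hz hw]
  refine Submodule.add_mem _ ?_ ?_
  · by_cases hk : k₂ = 0
    · have := mul_mem_blockFil (q := q) (hm hz) (hW.proj_mem hw) (by have := hq' hk; simp [degPen, hk]; omega)
      rwa [show a + j + 1 = a + 1 + j by ring]
    · rw [hW.proj_eq_zero hw (Or.inr hk), mul_zero]; exact Submodule.zero_mem _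
  · rw [add_assoc]
    exact mul_mem_blockFil (tsign_mem_startSpan hz) (hW.mem hw) hq

theorem blockHomotopy_mem (hW : IsBarSplitting 𝓑 𝓜 d σw π) {m : ℕ}
    (hm : ∀ {n k z}, z ∈ startSpan S 𝓑 𝓜 m n k → σm z ∈ startSpan S 𝓑 𝓜 m (n + 1) k) {n : ℕ} {k : ℤ}
    {z : WordAlg S (TrivSqZeroExt B M)} (hz : z ∈ startSpan S 𝓑 𝓜 (m + 1) n k) :
    blockHomotopy d σm σw π z ∈ startSpan S 𝓑 𝓜 (m + 1) (n + 1) k := by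
  suffices h : startSpan S 𝓑 𝓜 (m + 1) n k ≤
      (startSpan S 𝓑 𝓜 (m + 1) (n + 1) k).comap (blockHomotopy d σm σw π) from h hz
  refine startSpan_le_blockFil.trans (Submodule.span_le.2 ?_)
  rintro _ ⟨u, w, k₁, k₂, hu, hw, rfl, rfl, hq, rfl⟩
  exact blockFil_le_startSpan (blockHomotopy_mul_mem hW hm (wd_mem_startSpan hu) (wd_mem_startSpan hw)
    (q := u.length + 4) (by unfold degPen; split_ifs <;> omega) (by omega))

/-- For an honest tensor product of complexes, `σm ⊗ π + τ ⊗ σw`, with `τ` the sign, contracts in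
the given range. The bar differential has in addition the terms merging the two factors; each of the
resulting errors lies one step lower in the filtration by the length of the first factor plus the
penalty `degPen`. -/
theorem blockHomotopy_defect (hG : IsGradedBimodule 𝓑 𝓜) (hW : IsBarSplitting 𝓑 𝓜 d σw π) {m : ℕ}
    (hm1 : 1 ≤ m) (hm : IsContraction 𝓑 𝓜 d m σm) {q n : ℕ} (hn : n < (m + 1) * (d + 2)) {k : ℤ}
    {z : WordAlg S (TrivSqZeroExt B M)} (hz : z ∈ blockFil S 𝓑 𝓜 m (q + 1) n k) :
    barDiff (signInv S B M d) (blockHomotopy d σm σw π z) +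
      blockHomotopy d σm σw π (barDiff (signInv S B M d) z) - z ∈ blockFil S 𝓑 𝓜 m q n k := by
  suffices h : blockFil S 𝓑 𝓜 m (q + 1) n k ≤ (blockFil S 𝓑 𝓜 m q n k).comap
      (barDiff (signInv S B M d) ∘ₗ blockHomotopy d σm σw π +
        blockHomotopy d σm σw π ∘ₗ barDiff (signInv S B M d) - LinearMap.id) from h hz
  refine Submodule.span_le.2 ?_
  rintro _ ⟨u, w, k₁, k₂, hu, hw, rfl, rfl, hq, rfl⟩
  change barDiff (signInv S B M d) (blockHomotopy d σm σw π (wd S u * wd S w)) +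
    blockHomotopy d σm σw π (barDiff (signInv S B M d) (wd S u * wd S w)) - wd S u * wd S w ∈
    blockFil S 𝓑 𝓜 m q (u.length + w.length) (k₁ + k₂)
  have hzu := wd_mem_startSpan (S := S) hu
  have hzw := wd_mem_startSpan (S := S) hw
  obtain ⟨a, ha⟩ : ∃ a, u.length = a + 1 := ⟨u.length - 1, by have := hu.length_pos hm1; omega⟩
  obtain ⟨j, hj⟩ : ∃ j, w.length = j + 1 := ⟨w.length - 1, by have := hw.length_pos le_rfl; omega⟩
  rw [ha] at hzu hq hn ⊢
  rw [hj] at hzw hn ⊢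
  set z := wd S u
  set w' := wd S w
  set D := barDiff (signInv S B M d)
  have hDz : D z ∈ startSpan S 𝓑 𝓜 m a k₁ := barDiff_mem_startSpan hG hzu
  have hDw : D w' ∈ startSpan S 𝓑 𝓜 1 j k₂ := barDiff_mem_startSpan hG hzw
  have hτz := tsign_mem_startSpan (d := d) hzu
  -- the three error terms
  have e1 := derDefect_mem (d := d) hG hm1 (hm.mem hzu) (hW.proj_mem hzw)
  have e2 := derDefect_mem (d := d) hG hm1 hτz (hW.mem hzw)
  have e3 := derDefect_mem (d := d) hG hm1 hzu hzw
  -- If `π w'` is non-zero then `w` has length `d + 2`, so the bound on the total length leaves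
  -- fewer than `m (d + 2)` letters to `u`, within the range of the contraction `σm`.
  have hcontr : (D (σm z) + σm (D z)) * π w' = z * π w' := by
    by_cases hj' : j + 1 = d + 2
    · rw [hm.homotopy hzu (by rw [add_mul] at hn; omega)]
    · rw [hW.proj_eq_zero hzw (Or.inl hj'), mul_zero, mul_zero]
  have hττ : tsign S (signInv S B M d) (tsign S (signInv S B M d) z) = z := by
    rw [tsign_of_mem_startSpan hτz, tsign_of_mem_startSpan hzu, smul_smul, ← mul_pow]
    simp
  -- All terms of the tensor product differential cancel; three merging terms remain, two from the
  -- differential after the homotopy and one from the homotopy after the differential.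
  have hsum : D (blockHomotopy d σm σw π (z * w')) + blockHomotopy d σm σw π (D (z * w')) - z * w' =
      derDefect S B M d (σm z) (π w') + derDefect S B M d (tsign S (signInv S B M d) z) (σw w') +
        blockHomotopy d σm σw π (derDefect S B M d z w') := by
    have hD3 : D (z * w') = derDefect S B M d z w' + D z * w' + tsign S (signInv S B M d) z * D w' := by
      rw [derDefect_apply]; abel
    have hS : blockHomotopy d σm σw π (D (z * w')) = blockHomotopy d σm σw π (derDefect S B M d z w') +
        (σm (D z) * π w' + tsign S (signInv S B M d) (D z) * σw w') + z * σw (D w') := by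
      rw [hD3, map_add, map_add, blockHomotopy_mul hW hDz hzw, blockHomotopy_mul hW hτz hDw, hττ,
        hW.proj_diff hzw, mul_zero, zero_add]
    have hD4 : D (blockHomotopy d σm σw π (z * w')) = derDefect S B M d (σm z) (π w') +
        derDefect S B M d (tsign S (signInv S B M d) z) (σw w') + D (σm z) * π w' -
          tsign S (signInv S B M d) (D z) * σw w' + z * D (σw w') := by
      rw [blockHomotopy_mul hW hzu hzw, map_add, derDefect_apply, derDefect_apply, hττ, hW.diff_proj hzw,
        mul_zero, barDiff_tsign_signInv hG]
      simp only [neg_mul]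
      abel
    have hw2 : z * D (σw w') + z * σw (D w') = z * w' - z * π w' := by
      rw [← mul_add, hW.homotopy hzw, mul_sub]
    rw [hD4, hS]
    have h5 : D (σm z) * π w' + σm (D z) * π w' = z * π w' := by rw [← add_mul, hcontr]
    rw [← h5, eq_sub_iff_add_eq] at hw2
    rw [← hw2]
    abel
  rw [hsum]
  have hpos : 1 ≤ a + 1 := by omega
  refine Submodule.add_mem _ (Submodule.add_mem _ ?_ ?_) ?_
  -- Here `σm` lengthens the first factor and the merging shortens it again. The gain comes from the
  -- last block, whose degree rises from `0` to a positive value, so that its penalty drops from `1`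
  -- to `0`.
  · by_cases hk : k₂ = 0
    · refine Submodule.span_le.2 ?_ e1
      rintro _ ⟨u', w', l₁, l₂, hu', hw', h1, h2, h3, h4, rfl⟩
      refine Submodule.subset_span ⟨u', w', l₁, l₂, hu', hw', by omega, h3, ?_, rfl⟩
      have : degPen l₂ = 0 := by unfold degPen; split_ifs <;> omega
      have : degPen k₂ = 1 := by simp [degPen, hk]
      omega
    · rw [hW.proj_eq_zero hzw (Or.inr hk), map_zero]; exact Submodule.zero_mem _
  · refine Submodule.span_le.2 ?_ e2
    rintro _ ⟨u', w', l₁, l₂, hu', hw', h1, h2, h3, h4, rfl⟩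
    refine Submodule.subset_span ⟨u', w', l₁, l₂, hu', hw', by omega, h3, ?_, rfl⟩
    have := degPen_le h4.le
    omega
  -- The merging shortens the first factor, but `σm` may lengthen it afterwards if the new degree of
  -- the last block is `0`. In that case the old degree was negative and its penalty `2` pays for
  -- this.
  · have : shiftSpan S 𝓑 𝓜 m a (j + 1) (k₁ + k₂) k₂ ≤
        (blockFil S 𝓑 𝓜 m q (a + 1 + (j + 1)) (k₁ + k₂)).comap (blockHomotopy d σm σw π) := by
      refine Submodule.span_le.2 ?_
      rintro _ ⟨u', w', l₁, l₂, hu', hw', h1, h2, h3, h4, rfl⟩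
      have := degPen_le h4.le
      have h5 := blockHomotopy_mul_mem hW hm.mem (wd_mem_startSpan hu') (wd_mem_startSpan hw')
        (q := q) (by omega) (by
          intro h0
          have : degPen k₂ = 2 := by unfold degPen; rw [if_pos (by omega)]
          omega)
      rw [h1, h2, h3] at h5
      rwa [show a + 1 + (j + 1) = a + (j + 1) + 1 by ring]
    exact this e3

/-- The operator `N = 1 - (D Θ + Θ D)` commutes with `D` and lowers the filtration, so it is
nilpotent in each length under consideration. Composing `Θ` with the geometric series of `N` turns
it into a contraction. -/
theorem exists_isContraction_succ (hG : IsGradedBimodule 𝓑 𝓜) (hW : IsBarSplitting 𝓑 𝓜 d σw π) {m : ℕ}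
    (hm1 : 1 ≤ m) (hm : IsContraction 𝓑 𝓜 d m σm) : ∃ s, IsContraction 𝓑 𝓜 d (m + 1) s := by
  set Θ := blockHomotopy d σm σw π
  set D := barDiff (signInv S B M d)
  let N : Module.End S (WordAlg S (TrivSqZeroExt B M)) := 1 - (D ∘ₗ Θ + Θ ∘ₗ D)
  have hN : ∀ z, N z = z - (D (Θ z) + Θ (D z)) := fun _ => rfl
  have hDD : ∀ z, D (D z) = 0 := fun z => barDiff_sq hG z
  have hND : ∀ z, N (D z) = D (N z) := by
    intro z
    simp only [hN, hDD, map_sub, map_add, map_zero, add_zero, zero_add]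
  have hNmem : ∀ {n k z}, z ∈ startSpan S 𝓑 𝓜 (m + 1) n k → N z ∈ startSpan S 𝓑 𝓜 (m + 1) n k := by
    intro n k z hz
    cases n with
    | zero => rw [startSpan_zero (by omega) hz, map_zero]; exact Submodule.zero_mem _
    | succ n =>
      refine Submodule.sub_mem _ hz (Submodule.add_mem _ ?_ ?_)
      · exact barDiff_mem_startSpan hG (blockHomotopy_mem hW hm.mem hz)
      · exact blockHomotopy_mem hW hm.mem (barDiff_mem_startSpan hG hz)
  have hNpow : ∀ {n k} (i : ℕ) {z}, z ∈ startSpan S 𝓑 𝓜 (m + 1) n k →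
      (N ^ i) z ∈ startSpan S 𝓑 𝓜 (m + 1) n k := by
    intro n k i z hz
    induction i with
    | zero => exact hz
    | succ i ih => rw [pow_succ', Module.End.mul_apply]; exact hNmem ih
  have hNpowD : ∀ (i : ℕ) z, (N ^ i) (D z) = D ((N ^ i) z) := by
    intro i z
    induction i with
    | zero => rfl
    | succ i ih => rw [pow_succ', Module.End.mul_apply, ih, hND, Module.End.mul_apply]
  have hnil : ∀ {n k} (_ : n < (m + 1) * (d + 2)) (q : ℕ) {z}, z ∈ blockFil S 𝓑 𝓜 m q n k →
      (N ^ q) z = 0 := by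
    intro n k hn q
    induction q with
    | zero => intro z hz; rw [blockFil_zero hm1] at hz; rw [(Submodule.mem_bot S).1 hz, map_zero]
    | succ q ih =>
      intro z hz
      rw [pow_succ, Module.End.mul_apply]
      refine ih ?_
      have := Submodule.neg_mem _ (blockHomotopy_defect hG hW hm1 hm hn hz)
      rwa [neg_sub] at this
  -- Words of length `n` lie in filtration step `n + 2`, the summand `2` being the largest penalty,
  -- and `n < (m + 1) (d + 2)`; this number of terms therefore suffices in all lengths at once.
  refine ⟨Θ ∘ₗ ∑ i ∈ Finset.range ((m + 1) * (d + 2) + 2), N ^ i, ?_, ?_⟩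
  · intro n k z hz
    rw [LinearMap.comp_apply, LinearMap.sum_apply]
    exact blockHomotopy_mem hW hm.mem (Submodule.sum_mem _ fun i _ => hNpow i hz)
  · intro n k z hz hn
    have hgeom := fun K => LinearMap.congr_fun (mul_neg_geom_sum N K) z
    have h0 : (N ^ ((m + 1) * (d + 2) + 2)) z = 0 := by
      rw [show (m + 1) * (d + 2) + 2 = ((m + 1) * (d + 2) - n) + (n + 2) by omega, pow_add,
        Module.End.mul_apply, hnil hn _ (startSpan_le_blockFil hz), map_zero]
    have h1 := hgeom ((m + 1) * (d + 2) + 2)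
    change (∑ i ∈ Finset.range ((m + 1) * (d + 2) + 2), N ^ i) z -
      N ((∑ i ∈ Finset.range ((m + 1) * (d + 2) + 2), N ^ i) z) = z - (N ^ ((m + 1) * (d + 2) + 2)) z at h1
    rw [h0, sub_zero, hN, sub_sub_cancel] at h1
    simp only [LinearMap.comp_apply]
    have h2 : (∑ i ∈ Finset.range ((m + 1) * (d + 2) + 2), N ^ i) (D z) =
        D ((∑ i ∈ Finset.range ((m + 1) * (d + 2) + 2), N ^ i) z) := by
      rw [LinearMap.sum_apply, LinearMap.sum_apply, map_sum]
      exact Finset.sum_congr rfl fun i _ => hNpowD i z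
    rw [h2, h1]

theorem exists_isContraction (hG : IsGradedBimodule 𝓑 𝓜) (hW : IsBarSplitting 𝓑 𝓜 d σw π) {m : ℕ}
    (hm1 : 1 ≤ m) : ∃ s, IsContraction 𝓑 𝓜 d m s := by
  induction m, hm1 using Nat.le_induction with
  | base =>
    refine ⟨σw, hW.mem, fun hz hn => ?_⟩
    rw [hW.homotopy hz, hW.proj_eq_zero hz (Or.inl (by omega)), sub_zero]
  | succ m hm ih =>
    obtain ⟨s, hs⟩ := ih
    exact exists_isContraction_succ hG hW hm hs

end Step

end PowerContraction

open TrivSqZeroExt (inl inr)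

/-! ### Cochains as linear functions on the tensor algebra. -/

section Cofunctional

variable {S A : Type*} [CommRing S] [Ring A] [Algebra S A]
  {𝒜 : ℤ → ℤ → Submodule S A} {σ : A →ₗ[S] A} {n : ℕ}

variable (σ) in
/-- The linear function on the tensor algebra given by a cochain. -/
def cof (f : MultilinearMap S (fun _ : Fin n => A) A) : WordAlg S A →ₗ[S] A :=
  ext (isML_bar (σ := σ) (Pi.single n f))

theorem cof_wd (f : MultilinearMap S (fun _ : Fin n => A) A) (l : List A) :
    cof σ f (wd S l) = bar σ (Pi.single n f) l := ext_wd _ l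

theorem cof_of_ne (f : MultilinearMap S (fun _ : Fin n => A) A) {l : List A} (hl : l.length ≠ n) :
    cof σ f (wd S l) = 0 := by rw [cof_wd, bar_single_of_ne f hl]

theorem cof_of_length (f : MultilinearMap S (fun _ : Fin n => A) A) {l : List A} (hl : l.length = n) :
    cof σ f (wd S l) = f (fun i => (σ ^ (n - 1 - i.val)) (l.getD i.val 0)) := by
  rw [cof_wd, bar_single f hl]

theorem cof_twist (hσ : ∀ a, σ (σ a) = a) (f : MultilinearMap S (fun _ : Fin n => A) A) (a : ℕ → A) :
    cof σ f (wd S (twist σ n a)) = f (fun i => a i.val) := by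
  rw [cof_wd, bar_single_twist hσ]

theorem cof_add (f g : MultilinearMap S (fun _ : Fin n => A) A) :
    cof σ (f + g) = cof σ f + cof σ g := by
  refine linearMap_ext_wd fun l => ?_
  by_cases hl : l.length = n
  · simp only [LinearMap.add_apply, cof_of_length _ hl]; rfl
  · simp only [LinearMap.add_apply, cof_of_ne _ hl, add_zero]

theorem cof_zero : cof σ (0 : MultilinearMap S (fun _ : Fin n => A) A) = 0 := by
  refine linearMap_ext_wd fun l => ?_
  by_cases hl : l.length = n
  · rw [cof_of_length _ hl]; rfl
  · rw [cof_of_ne _ hl]; rfl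

theorem cof_kill (H : IsSignedBigrading 𝒜 σ) {j : ℤ} {f : MultilinearMap S (fun _ : Fin n => A) A}
    (hf : f ∈ cochains 𝒜 n j) {l : List A} (hl : (1 : A) ∈ l) : cof σ f (wd S l) = 0 := by
  by_cases h : l.length = n
  · subst h
    rw [cof_wd]
    exact bar_kill H (j := j) (by rwa [Pi.single_eq_same]) hl
  · exact cof_of_ne f h

theorem eq_zero_of_cof (hσ : ∀ a, σ (σ a) = a) {f : MultilinearMap S (fun _ : Fin n => A) A}
    (h : ∀ l : List A, l.length = n → cof σ f (wd S l) = 0) : f = 0 := by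
  ext a
  have := h (twist σ n (fun i => if hi : i < n then a ⟨i, hi⟩ else 0)) (by simp)
  rw [cof_twist hσ] at this
  simpa using this

theorem cof_unbar (hσ : ∀ a, σ (σ a) = a) (G : WordAlg S A →ₗ[S] A) {l : List A} (hl : l.length = n) :
    cof σ (unbar σ (isML_comp G) n) (wd S l) = G (wd S l) := by
  rw [cof_wd, bar_single_unbar hσ _ hl]

/-- The Hochschild differential in terms of the bar differential, where the outer terms vanish. -/
theorem cof_hochD (H : IsSignedBigrading 𝒜 σ) (hn : 1 ≤ n) {j : ℤ}
    {f : MultilinearMap S (fun _ : Fin n => A) A} (hf : IsHomogeneous 𝒜 f j) {l : List A}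
    (hl : l.length = n + 1) (hhead : ∀ a w, l = a :: w → cof σ f (wd S w) = 0)
    (hlast : ∀ v x, l = v ++ [x] → cof σ f (wd S v) = 0) :
    cof σ (hochD σ n j f) (wd S l) = - cof σ f (barDiff σ (wd S l)) := by
  have hout : ∀ θ : A → A, ins θ (bar σ (Pi.single n f)) (barMul σ) l = 0 := by
    intro θ
    obtain ⟨a, w, rfl⟩ : ∃ a w, l = a :: w := List.exists_cons_of_length_eq_add_one hl
    obtain ⟨v, x, hvx⟩ : ∃ v x, a :: w = v ++ [x] :=
      ⟨_, _, (List.dropLast_append_getLast (List.cons_ne_nil a w)).symm⟩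
    rw [ins_barMul hvx (by simp at hl; omega), ← cof_wd, ← cof_wd, hhead a w rfl, hlast v x hvx]
    simp
  have hD : cof σ f (barDiff σ (wd S l)) = ins (fun x => - σ x) (barMul σ) (bar σ (Pi.single n f)) l := by
    rw [map_barDiff]; simp only [cof_wd]
  obtain ⟨a, ha⟩ := exists_twist H.sigma_sigma l
  rw [hl] at ha
  rw [hD]
  rw [← ha, cof_twist H.sigma_sigma, ha]
  rcases Int.even_or_odd (j - n) with h | h
  · have := hochD_eq_ins_even H hn h.two_dvd hf a
    rw [ha, hout, add_zero] at this
    rw [this, neg_neg]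
  · have := hochD_eq_ins_odd H hn (by obtain ⟨r, hr⟩ := h; exact ⟨r, by omega⟩) hf a
    rw [ha, hout, sub_zero] at this
    rw [this, neg_neg]

theorem cof_mem (H : IsSignedBigrading 𝒜 σ) {j : ℤ} {f : MultilinearMap S (fun _ : Fin n => A) A}
    (hf : f ∈ cochains 𝒜 n j) (L : List (A × ℤ × ℤ)) (hL : ∀ t ∈ L, t.1 ∈ 𝒜 t.2.1 t.2.2) :
    cof σ f (wd S (L.map Prod.fst)) ∈ 𝒜 ((L.map fun t => t.2.1).sum + j) (L.map fun t => t.2.2).sum := by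
  by_cases hn : L.length = n
  · subst hn
    rw [cof_of_length _ (by simp)]
    have := hf.2 (fun i => (L[i.val]).2.1) (fun i => (L[i.val]).2.2)
      (fun i => (σ ^ (L.length - 1 - i.val)) ((L.map Prod.fst).getD i.val 0)) (fun i => by
        rw [List.getD_eq_getElem _ _ (by simp), List.getElem_map]
        exact H.sigma_pow_mem (hL _ (by simp)) _)
    convert this using 2
    · rw [← List.sum_ofFn]
      congr 2
      exact List.ext_getElem (by simp) (by simp)
    · rw [← List.sum_ofFn]
      congr 1
      exact List.ext_getElem (by simp) (by simp)
  · rw [cof_of_ne _ (by simpa using hn)]; exact Submodule.zero_mem _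

theorem unbar_mem_cochains_of_list (H : IsSignedBigrading 𝒜 σ) {j : ℤ} (G : WordAlg S A →ₗ[S] A)
    (hG1 : ∀ l, 1 ∈ l → G (wd S l) = 0)
    (hL : ∀ L : List (A × ℤ × ℤ), (∀ t ∈ L, t.1 ∈ 𝒜 t.2.1 t.2.2) → L.length = n →
      G (wd S (L.map Prod.fst)) ∈ 𝒜 ((L.map fun t => t.2.1).sum + j) (L.map fun t => t.2.2).sum) :
    unbar σ (isML_comp G) n ∈ cochains 𝒜 n j := by
  refine ⟨?_, ?_⟩
  · rintro a ⟨i, hi⟩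
    refine hG1 _ ?_
    rw [List.mem_ofFn]
    exact ⟨i, by rw [hi, H.sigma_pow_one]⟩
  · intro h k a ha
    have := hL (List.ofFn fun i : Fin n => ((σ ^ (n - 1 - i.val)) (a i), h i, k i)) (by
      intro t ht
      rw [List.mem_ofFn] at ht
      obtain ⟨i, rfl⟩ := ht
      exact H.sigma_pow_mem (ha i) _) (by simp)
    rw [List.map_ofFn, List.map_ofFn, List.map_ofFn, List.sum_ofFn, List.sum_ofFn] at this
    exact this

end Cofunctional

/-! ### Cochains of degree `-md` on the square-zero extension. -/

section CofunctionalSquareZero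

variable {S B M : Type*} [CommRing S] [Ring B] [Algebra S B] [AddCommGroup M] [Module S M]
  [Module B M] [Module Bᵐᵒᵖ M] [SMulCommClass B Bᵐᵒᵖ M] [IsScalarTower S B M]
  [IsScalarTower S Bᵐᵒᵖ M]
  {𝓑 : ℕ → Submodule S B} [GradedAlgebra 𝓑] {𝓜 : ℤ → Submodule S M} {d n : ℕ}

theorem Typed.exists_triples {m : ℕ} {k : ℤ} {l : List (TrivSqZeroExt B M)} (h : Typed 𝓑 𝓜 m k l) :
    ∃ L : List (TrivSqZeroExt B M × ℤ × ℤ), (∀ t ∈ L, t.1 ∈ bigrading 𝓑 𝓜 d t.2.1 t.2.2) ∧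
      L.map Prod.fst = l ∧ (L.map fun t => t.2.1).sum = m * d ∧ (L.map fun t => t.2.2).sum = k := by
  induction h with
  | nil => exact ⟨[], by simp, rfl, by simp, rfl⟩
  | consB c b hc hb h ih =>
    obtain ⟨L, h1, h2, h3, h4⟩ := ih
    exact ⟨(inl b, 0, c) :: L, List.forall_mem_cons.2 ⟨inl_mem_bigrading hb, h1⟩, by simp [h2],
      by simp [h3], by simp [h4]⟩
  | consM e x hx h ih =>
    obtain ⟨L, h1, h2, h3, h4⟩ := ih
    exact ⟨(inr x, d, e) :: L, List.forall_mem_cons.2 ⟨inr_mem_bigrading hx, h1⟩, by simp [h2],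
      by simp [h3]; ring, by simp [h4]⟩

theorem mem_bigrading_cases (hG : IsGradedBimodule 𝓑 𝓜) (hd : 1 ≤ d) {h k : ℤ} {a : TrivSqZeroExt B M}
    (ha : a ∈ bigrading 𝓑 𝓜 d h k) : a = 0 ∨ (h = 0 ∧ k = 0 ∧ ∃ s : S, a = s • 1) ∨
      (h = 0 ∧ ∃ c b, 1 ≤ c ∧ b ∈ 𝓑 c ∧ k = c ∧ a = inl b) ∨ (h = d ∧ ∃ x ∈ 𝓜 k, a = inr x) := by
  obtain ⟨ha1, ha2⟩ := ha
  rw [← TrivSqZeroExt.inl_fst_add_inr_snd_eq a]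
  by_cases h0 : h = 0
  · rw [if_pos h0] at ha1
    rw [if_neg (by omega), Submodule.mem_bot] at ha2
    rw [ha2, TrivSqZeroExt.inr_zero, add_zero]
    match k, ha1 with
    | Int.ofNat 0, ha1 =>
      obtain ⟨s, hs⟩ := hG.surj _ ha1
      refine Or.inr (Or.inl ⟨h0, rfl, s, ?_⟩)
      rw [← hs, Algebra.algebraMap_eq_smul_one, TrivSqZeroExt.inl_smul]; rfl
    | Int.ofNat (c + 1), ha1 => exact Or.inr (Or.inr (Or.inl ⟨h0, c + 1, _, by omega, ha1, rfl, rfl⟩))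
    | Int.negSucc c, ha1 =>
      left
      rw [(Submodule.mem_bot S).1 ha1, TrivSqZeroExt.inl_zero]
  · rw [if_neg h0, Submodule.mem_bot] at ha1
    rw [ha1, TrivSqZeroExt.inl_zero, zero_add]
    by_cases h1 : h = d
    · rw [if_pos h1] at ha2
      exact Or.inr (Or.inr (Or.inr ⟨h1, _, ha2, rfl⟩))
    · rw [if_neg h1, Submodule.mem_bot] at ha2
      left
      rw [ha2, TrivSqZeroExt.inr_zero]

/-- A homogeneous word is typed, unless it is irrelevant for normalized functions. -/
theorem typed_or_killed (hG : IsGradedBimodule 𝓑 𝓜) (hd : 1 ≤ d) {X : Type*} [AddCommGroup X] [Module S X]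
    (L : List (TrivSqZeroExt B M × ℤ × ℤ)) (hL : ∀ t ∈ L, t.1 ∈ bigrading 𝓑 𝓜 d t.2.1 t.2.2) :
    (∃ m : ℕ, Typed 𝓑 𝓜 m (L.map fun t => t.2.2).sum (L.map Prod.fst) ∧
      (L.map fun t => t.2.1).sum = m * d) ∨
    ∀ G : WordAlg S (TrivSqZeroExt B M) →ₗ[S] X, (∀ l, 1 ∈ l → G (wd S l) = 0) →
      G (wd S (L.map Prod.fst)) = 0 := by
  induction L with
  | nil => exact Or.inl ⟨0, .nil, by simp⟩
  | cons t L ih =>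
    obtain ⟨a, h, k⟩ := t
    obtain ⟨h1, h2⟩ := List.forall_mem_cons.1 hL
    simp only [List.map_cons, List.sum_cons]
    rcases ih h2 with ⟨m, hm, hs⟩ | ih
    · rcases mem_bigrading_cases hG hd h1 with h0 | ⟨-, -, s, h0⟩ | ⟨hh, c, b, hc, hb, hk, h0⟩ | ⟨hh, x, hx, h0⟩ <;>
        simp only at h0
      · exact Or.inr fun G _ => by rw [wd_eq_zero_of_mem (by simp [h0]), map_zero]
      · refine Or.inr fun G hG1 => ?_
        rw [wd_cons, h0, map_smul, smul_mul_assoc, ← wd_cons, map_smul, hG1 _ (by simp), smul_zero]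
      · simp only at hh hk
        exact Or.inl ⟨m, h0 ▸ hm.consB' hc hb (by rw [hk]), by rw [hs, hh]; ring⟩
      · simp only at hh hx
        exact Or.inl ⟨m + 1, h0 ▸ hm.consM' hx rfl, by rw [hs, hh]; push_cast; ring⟩
    · refine Or.inr fun G hG1 => ?_
      rw [wd_cons]
      exact ih (G ∘ₗ LinearMap.mulLeft S (letter S a)) fun l hl => by
        rw [LinearMap.comp_apply, LinearMap.mulLeft_apply, ← wd_cons]
        exact hG1 _ (List.mem_cons_of_mem _ hl)

theorem cof_mem_bigrading_aux (H : IsSignedBigrading (bigrading 𝓑 𝓜 d) (signInv S B M d)) {j : ℤ}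
    {f : MultilinearMap S (fun _ : Fin n => TrivSqZeroExt B M) (TrivSqZeroExt B M)}
    (hf : f ∈ cochains (bigrading 𝓑 𝓜 d) n j) {m : ℕ} {k : ℤ} {l : List (TrivSqZeroExt B M)}
    (hl : Typed 𝓑 𝓜 m k l) : cof (signInv S B M d) f (wd S l) ∈ bigrading 𝓑 𝓜 d (m * d + j) k := by
  obtain ⟨L, h1, rfl, h3, rfl⟩ := hl.exists_triples (d := d)
  have := cof_mem H hf L h1
  rwa [h3] at this

theorem cof_mem_bigrading (hG : IsGradedBimodule 𝓑 𝓜) {j : ℤ}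
    {f : MultilinearMap S (fun _ : Fin n => TrivSqZeroExt B M) (TrivSqZeroExt B M)}
    (hf : f ∈ cochains (bigrading 𝓑 𝓜 d) n j) {m : ℕ} {k : ℤ} {l : List (TrivSqZeroExt B M)}
    (hl : Typed 𝓑 𝓜 m k l) : cof (signInv S B M d) f (wd S l) ∈ bigrading 𝓑 𝓜 d (m * d + j) k :=
  cof_mem_bigrading_aux (isSignedBigrading hG) hf hl

theorem bigrading_eq_zero {h k : ℤ} (h0 : h ≠ 0) (hd : h ≠ d) {a : TrivSqZeroExt B M}
    (ha : a ∈ bigrading 𝓑 𝓜 d h k) : a = 0 := by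
  obtain ⟨ha1, ha2⟩ := ha
  rw [if_neg h0, Submodule.mem_bot] at ha1
  rw [if_neg hd, Submodule.mem_bot] at ha2
  exact TrivSqZeroExt.ext ha1 ha2

theorem bigrading_zero_of_neg (hd : 1 ≤ d) {k : ℤ} (hk : k < 0) {a : TrivSqZeroExt B M}
    (ha : a ∈ bigrading 𝓑 𝓜 d 0 k) : a = 0 := by
  obtain ⟨ha1, ha2⟩ := ha
  rw [if_pos rfl] at ha1
  rw [if_neg (by omega), Submodule.mem_bot] at ha2
  match k, hk, ha1 with
  | Int.negSucc c, _, ha1 => exact TrivSqZeroExt.ext ((Submodule.mem_bot S).1 ha1) ha2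

/-- A cochain of degree `-md` vanishes on the words whose number of letters from `M` is neither `m` nor
`m + 1`. -/
theorem cof_eq_zero_of_ne (hG : IsGradedBimodule 𝓑 𝓜) (hd : 1 ≤ d) {m m' : ℕ}
    {f : MultilinearMap S (fun _ : Fin n => TrivSqZeroExt B M) (TrivSqZeroExt B M)}
    (hf : f ∈ cochains (bigrading 𝓑 𝓜 d) n (-(m * d : ℤ))) {k : ℤ} {l : List (TrivSqZeroExt B M)}
    (hl : Typed 𝓑 𝓜 m' k l) (h0 : m' ≠ m) (h1 : m' ≠ m + 1) : cof (signInv S B M d) f (wd S l) = 0 := by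
  refine bigrading_eq_zero ?_ ?_ (cof_mem_bigrading hG hf hl)
  · rw [← sub_eq_add_neg, ← sub_mul]
    refine mul_ne_zero ?_ (by omega)
    omega
  · intro h
    have : (m' - m - 1 : ℤ) * d = 0 := by linarith
    rcases mul_eq_zero.1 this with h | h <;> omega

/-- The value has homological degree `0`, hence lies in `B`, which has no negative internal degrees.
-/
theorem cof_eq_zero_of_neg (hG : IsGradedBimodule 𝓑 𝓜) (hd : 1 ≤ d) {m : ℕ}
    {f : MultilinearMap S (fun _ : Fin n => TrivSqZeroExt B M) (TrivSqZeroExt B M)}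
    (hf : f ∈ cochains (bigrading 𝓑 𝓜 d) n (-(m * d : ℤ))) {k : ℤ} (hk : k < 0)
    {l : List (TrivSqZeroExt B M)} (hl : Typed 𝓑 𝓜 m k l) : cof (signInv S B M d) f (wd S l) = 0 := by
  have := cof_mem_bigrading hG hf hl
  rw [add_neg_cancel] at this
  exact bigrading_zero_of_neg hd hk this

/-- A normalized function on words which is homogeneous on typed words is a cochain. -/
theorem unbar_mem_cochains_of_typed_aux (hG : IsGradedBimodule 𝓑 𝓜) (hd : 1 ≤ d)
    (H : IsSignedBigrading (bigrading 𝓑 𝓜 d) (signInv S B M d)) {j : ℤ}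
    (G : WordAlg S (TrivSqZeroExt B M) →ₗ[S] TrivSqZeroExt B M) (hG1 : ∀ l, 1 ∈ l → G (wd S l) = 0)
    (hGt : ∀ {m k l}, Typed 𝓑 𝓜 m k l → l.length = n → G (wd S l) ∈ bigrading 𝓑 𝓜 d (m * d + j) k) :
    unbar (signInv S B M d) (isML_comp G) n ∈ cochains (bigrading 𝓑 𝓜 d) n j := by
  refine unbar_mem_cochains_of_list H G hG1 fun L hL hn => ?_
  rcases typed_or_killed hG hd (X := TrivSqZeroExt B M) L hL with ⟨m, hm, hs⟩ | h
  · rw [hs]; exact hGt hm (by simpa using hn)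
  · rw [h G hG1]; exact Submodule.zero_mem _

theorem unbar_mem_cochains_of_typed (hG : IsGradedBimodule 𝓑 𝓜) (hd : 1 ≤ d) {j : ℤ}
    (G : WordAlg S (TrivSqZeroExt B M) →ₗ[S] TrivSqZeroExt B M) (hG1 : ∀ l, 1 ∈ l → G (wd S l) = 0)
    (hGt : ∀ {m k l}, Typed 𝓑 𝓜 m k l → l.length = n → G (wd S l) ∈ bigrading 𝓑 𝓜 d (m * d + j) k) :
    unbar (signInv S B M d) (isML_comp G) n ∈ cochains (bigrading 𝓑 𝓜 d) n j :=
  unbar_mem_cochains_of_typed_aux hG hd (isSignedBigrading hG) G hG1 hGt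

theorem eq_zero_of_typed_aux (hG : IsGradedBimodule 𝓑 𝓜)
    (H : IsSignedBigrading (bigrading 𝓑 𝓜 d) (signInv S B M d)) {j : ℤ}
    {f : MultilinearMap S (fun _ : Fin n => TrivSqZeroExt B M) (TrivSqZeroExt B M)}
    (hf : f ∈ cochains (bigrading 𝓑 𝓜 d) n j)
    (h : ∀ {m k l}, Typed 𝓑 𝓜 m k l → cof (signInv S B M d) f (wd S l) = 0) : f = 0 := by
  let _ := hG.internal.chooseDecomposition
  have h0 : cof (signInv S B M d) f = 0 := by
    refine LinearMap.ext_on (span_typed_or_one hG) ?_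
    rintro _ ⟨l, h1 | ⟨m, k, hl⟩, rfl⟩
    · rw [cof_kill H hf h1]; rfl
    · rw [h hl]; rfl
  exact eq_zero_of_cof H.sigma_sigma fun l _ => by rw [h0]; rfl

/-- A cochain vanishing on the typed words is zero. -/
theorem eq_zero_of_typed (hG : IsGradedBimodule 𝓑 𝓜) {j : ℤ}
    {f : MultilinearMap S (fun _ : Fin n => TrivSqZeroExt B M) (TrivSqZeroExt B M)}
    (hf : f ∈ cochains (bigrading 𝓑 𝓜 d) n j)
    (h : ∀ {m k l}, Typed 𝓑 𝓜 m k l → cof (signInv S B M d) f (wd S l) = 0) : f = 0 :=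
  eq_zero_of_typed_aux hG (isSignedBigrading hG) hf h

theorem cochains_zero_eq_zero (hd : 1 ≤ d) {m : ℕ} (hm : 1 ≤ m)
    {f : MultilinearMap S (fun _ : Fin 0 => TrivSqZeroExt B M) (TrivSqZeroExt B M)}
    (hf : f ∈ cochains (bigrading 𝓑 𝓜 d) 0 (-(m * d : ℤ))) : f = 0 := by
  have hmd : (0 : ℤ) < m * d := by positivity
  ext1 a
  have := hf.2 (fun _ => 0) (fun _ => 0) a (fun i => i.elim0)
  simp only [Finset.univ_eq_empty, Finset.sum_empty, zero_add] at this
  exact bigrading_eq_zero (fun h => by linarith) (fun h => by linarith) this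

theorem cof_hochD_typed_aux (H : IsSignedBigrading (bigrading 𝓑 𝓜 d) (signInv S B M d)) (hd : 1 ≤ d) {m : ℕ}
    (hm : 1 ≤ m) {f : MultilinearMap S (fun _ : Fin n => TrivSqZeroExt B M) (TrivSqZeroExt B M)}
    (hf : f ∈ cochains (bigrading 𝓑 𝓜 d) n (-(m * d : ℤ))) {l : List (TrivSqZeroExt B M)}
    (hl : l.length = n + 1) (hhead : ∀ a w, l = a :: w → cof (signInv S B M d) f (wd S w) = 0)
    (hlast : ∀ v x, l = v ++ [x] → cof (signInv S B M d) f (wd S v) = 0) :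
    cof (signInv S B M d) (hochD (signInv S B M d) n (-(m * d : ℤ)) f) (wd S l) =
      - cof (signInv S B M d) f (barDiff (signInv S B M d) (wd S l)) := by
  rcases Nat.eq_zero_or_pos n with rfl | hn
  · rw [cochains_zero_eq_zero hd hm hf, map_zero, cof_zero, cof_zero]; simp
  · exact cof_hochD H hn hf.2 hl hhead hlast

/-- The Hochschild differential in terms of the bar differential, where the outer terms vanish. -/
theorem cof_hochD_typed (hG : IsGradedBimodule 𝓑 𝓜) (hd : 1 ≤ d) {m : ℕ}
    (hm : 1 ≤ m) {f : MultilinearMap S (fun _ : Fin n => TrivSqZeroExt B M) (TrivSqZeroExt B M)}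
    (hf : f ∈ cochains (bigrading 𝓑 𝓜 d) n (-(m * d : ℤ))) {l : List (TrivSqZeroExt B M)}
    (hl : l.length = n + 1) (hhead : ∀ a w, l = a :: w → cof (signInv S B M d) f (wd S w) = 0)
    (hlast : ∀ v x, l = v ++ [x] → cof (signInv S B M d) f (wd S v) = 0) :
    cof (signInv S B M d) (hochD (signInv S B M d) n (-(m * d : ℤ)) f) (wd S l) =
      - cof (signInv S B M d) f (barDiff (signInv S B M d) (wd S l)) :=
  cof_hochD_typed_aux (isSignedBigrading hG) hd hm hf hl hhead hlast

end CofunctionalSquareZero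

open TrivSqZeroExt (inl inr)

/-! ### Operators acting on the middle part of a word `p u w`. -/

section StartProj

variable {S B M : Type*} [CommRing S] [Ring B] [Algebra S B] [AddCommGroup M] [Module S M]
  [Module B M] [Module Bᵐᵒᵖ M] [SMulCommClass B Bᵐᵒᵖ M] [IsScalarTower S B M]
  [IsScalarTower S Bᵐᵒᵖ M]
  {𝓑 : ℕ → Submodule S B} [GradedAlgebra 𝓑] {𝓜 : ℤ → Submodule S M} {d n : ℕ}

variable (S) in
/-- The projection of the first letter of a word to `M`. -/
def headPart : List (TrivSqZeroExt B M) → WordAlg S (TrivSqZeroExt B M)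
  | [] => 1
  | a :: t => letter S (inr a.snd) * wd S t

theorem isML_headPart : IsML S (headPart S (B := B) (M := M)) := by
  constructor
  · rintro (_ | ⟨a, u⟩) x y r
    · simp only [List.nil_append, headPart, TrivSqZeroExt.snd_add, TrivSqZeroExt.inr_add, map_add, add_mul]
    · simp only [List.cons_append, headPart, isML_wd.add, mul_add]
  · rintro (_ | ⟨a, u⟩) c x r
    · simp only [List.nil_append, headPart, TrivSqZeroExt.snd_smul, TrivSqZeroExt.inr_smul, map_smul,
        smul_mul_assoc]
    · simp only [List.cons_append, headPart, isML_wd.smul, mul_smul_comm]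

variable [DirectSum.Decomposition 𝓜]

variable (𝓑 𝓜) in
/-- The projection onto the words with `c` letters from `M` which are empty or start with such a letter. -/
def startProj (c : ℕ) : WordAlg S (TrivSqZeroExt B M) →ₗ[S] WordAlg S (TrivSqZeroExt B M) :=
  homog 𝓑 𝓜 c (ext isML_headPart)

theorem startProj_wd {c : ℕ} {k : ℤ} {l : List (TrivSqZeroExt B M)} (h : StartTyped 𝓑 𝓜 c k l) :
    startProj 𝓑 𝓜 c (wd S l) = wd S l := by
  have : headPart S l = wd S l := by
    rcases h with ⟨-, -, rfl⟩ | ⟨m', e, k', x, t, -, -, -, -, rfl⟩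
    · rfl
    · rw [wd_cons]; rfl
  rw [startProj, homog_wd h.typed, ext_wd, this, pr_wd h.typed, if_pos rfl]

theorem startProj_of_ne {c m : ℕ} (hc : m ≠ c) {k : ℤ} {l : List (TrivSqZeroExt B M)} (h : Typed 𝓑 𝓜 m k l) :
    startProj 𝓑 𝓜 c (wd S l) = 0 := homog_wd_of_ne hc.symm h

theorem startProj_inl {c m : ℕ} {k : ℤ} {b : B} {l : List (TrivSqZeroExt B M)}
    (h : Typed 𝓑 𝓜 m k (inl b :: l)) : startProj 𝓑 𝓜 c (wd S (inl b :: l)) = 0 := by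
  by_cases hc : m = c
  · subst hc
    rw [startProj, homog_wd h, ext_wd, headPart, TrivSqZeroExt.snd_inl, TrivSqZeroExt.inr_zero, map_zero,
      zero_mul, map_zero]
  · exact startProj_of_ne hc h

/-- The number `c` of letters from `M`, together with the condition on the leading letter,
determines the place of the cut: a longer remainder starts in `B` or contains more than `c` letters
from `M`, a shorter one has lost the leading letter of `w`. -/
theorem startProj_of_split {m c : ℕ} {k k' : ℤ} {u w v r : List (TrivSqZeroExt B M)} (hu : Typed 𝓑 𝓜 m k u)
    (hw : StartTyped 𝓑 𝓜 c k' w) (h : v ++ r = u ++ w) (hne : v.length ≠ u.length) :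
    startProj 𝓑 𝓜 c (wd S r) = 0 := by
  rcases List.append_eq_append_iff.1 h with ⟨as, rfl, rfl⟩ | ⟨bs, rfl, rfl⟩
  · obtain ⟨m₁, k₁, m₂, k₂, -, has, -, -⟩ := hu.of_append
    cases has with
    | nil => simp at hne
    | consB c' b hc hb h' => exact startProj_inl ((h'.consB c' b hc hb).append hw.typed)
    | consM e x hx h' => exact startProj_of_ne (by omega) ((h'.consM e x hx).append hw.typed)
  · cases bs with
    | nil => simp at hne
    | cons a bs =>
      rcases hw with ⟨-, -, h⟩ | ⟨m', e, k', x, t, rfl, rfl, hx, ht, h⟩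
      · simp at h
      · obtain ⟨rfl, rfl⟩ := List.cons.inj h
        obtain ⟨m₁, k₁, m₂, k₂, -, hr, rfl, -⟩ := ht.of_append
        exact startProj_of_ne (by omega) hr

variable (𝓑 𝓜 d) in
/-- The operator `p u ↦ ± p s(u)` for words `u` starting with a letter from `M` and words `p` in `B`. -/
def leftOp (m : ℕ) (s : WordAlg S (TrivSqZeroExt B M) →ₗ[S] WordAlg S (TrivSqZeroExt B M)) :
    WordAlg S (TrivSqZeroExt B M) →ₗ[S] WordAlg S (TrivSqZeroExt B M) :=
  ext (G := splitSum fun p r => tsign S (signInv S B M d) (wd S p) * s (startProj 𝓑 𝓜 m (wd S r)))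
    (IsML.splitSum
      (fun r => isML_comp ((LinearMap.mulRight S (s (startProj 𝓑 𝓜 m (wd S r)))) ∘ₗ
        (tsign S (signInv S B M d)).toLinearMap))
      fun p => isML_comp ((LinearMap.mulLeft S (tsign S (signInv S B M d) (wd S p))) ∘ₗ s ∘ₗ startProj 𝓑 𝓜 m))

variable (𝓑 𝓜 d) in
/-- The operator `p u w ↦ ± p s(u) w`, for words `u` with `m` and `w` with `c` letters from `M`, starting
with such letters, and words `p` in `B`. -/
def midOp (m c : ℕ) (s : WordAlg S (TrivSqZeroExt B M) →ₗ[S] WordAlg S (TrivSqZeroExt B M)) :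
    WordAlg S (TrivSqZeroExt B M) →ₗ[S] WordAlg S (TrivSqZeroExt B M) :=
  homog 𝓑 𝓜 (m + c) (ext (G := splitSum fun v r => leftOp 𝓑 𝓜 d m s (wd S v) * startProj 𝓑 𝓜 c (wd S r))
    (IsML.splitSum
      (fun r => isML_comp ((LinearMap.mulRight S (startProj 𝓑 𝓜 c (wd S r))) ∘ₗ leftOp 𝓑 𝓜 d m s))
      fun v => isML_comp ((LinearMap.mulLeft S (leftOp 𝓑 𝓜 d m s (wd S v))) ∘ₗ startProj 𝓑 𝓜 c)))

variable {s : WordAlg S (TrivSqZeroExt B M) →ₗ[S] WordAlg S (TrivSqZeroExt B M)}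

theorem midOp_of_ne {m m' c : ℕ} (hc : m' ≠ m + c) {k : ℤ} {l : List (TrivSqZeroExt B M)}
    (h : Typed 𝓑 𝓜 m' k l) : midOp 𝓑 𝓜 d m c s (wd S l) = 0 := homog_wd_of_ne hc.symm h

theorem midOp_of_one_mem {m c : ℕ} {l : List (TrivSqZeroExt B M)} (h : 1 ∈ l) :
    midOp 𝓑 𝓜 d m c s (wd S l) = 0 := homog_wd_of_one_mem h

theorem midOp_wd {m c : ℕ} (hs : ∀ {n k z}, z ∈ startSpan S 𝓑 𝓜 m n k → s z ∈ startSpan S 𝓑 𝓜 m (n + 1) k)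
    {k₁ k₂ k₃ : ℤ} {p u w : List (TrivSqZeroExt B M)} (hp : Typed 𝓑 𝓜 0 k₁ p) (hu : StartTyped 𝓑 𝓜 m k₂ u)
    (hw : StartTyped 𝓑 𝓜 c k₃ w) :
    midOp 𝓑 𝓜 d m c s (wd S p * (wd S u * wd S w)) =
      (-1 : S) ^ p.length • (wd S p * (s (wd S u) * wd S w)) := by
  have hmem : wd S p * (s (wd S u) * wd S w) ∈
      typedSpan S 𝓑 𝓜 (0 + (m + c)) (p.length + (u.length + 1 + w.length)) (k₁ + (k₂ + k₃)) :=
    mul_mem_typedSpan (wd_mem_typedSpan hp) (mul_mem_typedSpan (startSpan_le (hs (wd_mem_startSpan hu)))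
      (wd_mem_typedSpan hw.typed))
  rw [zero_add] at hmem
  have hl : Typed 𝓑 𝓜 (m + c) (k₁ + (k₂ + k₃)) (p ++ (u ++ w)) :=
    hp.append' (hu.typed.append hw.typed) (by simp) rfl
  rw [← wd_append, ← wd_append, midOp, homog_wd hl, ext_wd,
    splitSum_eq_single (show (p ++ u) ++ w = p ++ (u ++ w) by simp), startProj_wd hw, leftOp, ext_wd,
    splitSum_eq_single rfl, startProj_wd hu, tsign_wd_typed hp, zero_mul, add_zero, smul_mul_assoc,
    smul_mul_assoc, map_smul, mul_assoc, pr_of_mem (typedSpan_le_typedAll hmem)]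
  · intro v r hvr hne
    rw [startProj_of_split hp hu hvr hne, map_zero, mul_zero]
  · intro v r hvr hne
    rw [startProj_of_split (hp.append hu.typed) hw (by simpa using hvr) hne, mul_zero]

end StartProj

/-! ### The Hochschild differential on a word `p u w`. -/

section Block

variable {S B M : Type*} [CommRing S] [Ring B] [Algebra S B] [AddCommGroup M] [Module S M]
  [Module B M] [Module Bᵐᵒᵖ M] [SMulCommClass B Bᵐᵒᵖ M] [IsScalarTower S B M]
  [IsScalarTower S Bᵐᵒᵖ M]
  {𝓑 : ℕ → Submodule S B} [GradedAlgebra 𝓑] {𝓜 : ℤ → Submodule S M} {d n : ℕ}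

/-- The differential inside `p`, the merging of `p` with `u` and the removal of a leading letter of
`p` all lead to a shorter `p` without raising the degree, where `F` vanishes by `hshort`. The
merging of `u` with `w`, the differential of `w` and the other outer terms vanish by the remaining
hypotheses. Only the differential of `u` is left. -/
theorem cof_hochD_block (hG : IsGradedBimodule 𝓑 𝓜) (hd : 1 ≤ d) {m : ℕ} (hm : 1 ≤ m)
    {f : MultilinearMap S (fun _ : Fin n => TrivSqZeroExt B M) (TrivSqZeroExt B M)}
    (hf : f ∈ cochains (bigrading 𝓑 𝓜 d) n (-(m * d : ℤ)))
    {F : WordAlg S (TrivSqZeroExt B M) →ₗ[S] TrivSqZeroExt B M} (hF : F = cof (signInv S B M d) f)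
    {k₁ k₂ : ℤ} {p u w : List (TrivSqZeroExt B M)} (hp : Typed 𝓑 𝓜 0 k₁ p) (hu : StartTyped 𝓑 𝓜 m k₂ u)
    (hlen : (p ++ (u ++ w)).length = n + 1)
    (hshort : ∀ {p' u' k₁' k₂'}, Typed 𝓑 𝓜 0 k₁' p' → StartTyped 𝓑 𝓜 m k₂' u' → p'.length < p.length →
      k₁' + k₂' ≤ k₁ + k₂ → F (wd S p' * (wd S u' * wd S w)) = 0)
    (hjoin : F (wd S p * derDefect S B M d (wd S u) (wd S w)) = 0)
    (hsuf : F (wd S p * (wd S u * barDiff (signInv S B M d) (wd S w))) = 0)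
    (hhead : ∀ x t, p = [] → u = inr x :: t → F (wd S (t ++ w)) = 0)
    (hlast : ∀ v x, p ++ (u ++ w) = v ++ [x] → F (wd S v) = 0) :
    cof (signInv S B M d) (hochD (signInv S B M d) n (-(m * d : ℤ)) f) (wd S p * (wd S u * wd S w)) =
      - (-1 : S) ^ p.length • F (wd S p * (barDiff (signInv S B M d) (wd S u) * wd S w)) := by
  rw [← wd_append, ← wd_append, cof_hochD_typed hG hd hm hf hlen, ← hF, wd_append, wd_append]
  · obtain ⟨e, y, t, hut⟩ : ∃ e y t, u = inr y :: t ∧ y ∈ 𝓜 e ∧ ∃ k m', Typed 𝓑 𝓜 m' k t ∧ k₂ = e + k ∧ m = m' + 1 := by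
      rcases hu with ⟨h, -⟩ | ⟨m', e, k', x, t, h1, h2, hx, ht, h3⟩
      · omega
      · exact ⟨e, x, t, h3, hx, k', m', ht, h2, h1⟩
    obtain ⟨hut, hy, k', m', ht, hk₂, hm'⟩ := hut
    have h1 : F (barDiff (signInv S B M d) (wd S p) * (wd S u * wd S w)) = 0 := by
      cases hn : p.length with
      | zero => rw [List.length_eq_zero_iff.1 hn]; simp
      | succ j =>
        have := barDiff_mem_typedSpan (S := S) (d := d) hG hp hn
        suffices h : typedSpan S 𝓑 𝓜 0 j k₁ ≤ LinearMap.ker (F ∘ₗ LinearMap.mulRight S (wd S u * wd S w)) from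
          h this
        refine Submodule.span_le.2 ?_
        rintro _ ⟨p', hp', hj, rfl⟩
        exact hshort hp' hu (by omega) le_rfl
    -- The last letter of `p` acts on the leading letter of `u`: degree moves from `p` to `u`, the
    -- sum of both degrees is unchanged, and `p` becomes shorter.
    have h2 : F (derDefect S B M d (wd S p) (wd S u * wd S w)) = 0 := by
      rcases hp.exists_concat with ⟨-, -, rfl⟩ | ⟨p', c, b, k'', hc, hb, hp', rfl, rfl⟩ |
        ⟨u', e', y, k'', m', hy, hu', h, -⟩
      · rw [derDefect_apply]; simp
      · rw [hut, ← wd_append, derDefect_apply, List.cons_append, barDiff_append,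
          show ∀ x y z : WordAlg S (TrivSqZeroExt B M), x + y + z - x - y = z by intros; abel, signInv_inl,
          TrivSqZeroExt.inl_mul_inr, tsign_wd_typed hp', smul_mul_assoc, map_smul, ← List.cons_append, wd_append]
        rw [hshort hp' (k₂' := c + e + k') (hm' ▸ .consM' (hG.left c e b y hb hy) ht rfl) (by simp) (by omega), smul_zero]
      · omega
    have hD : barDiff (signInv S B M d) (wd S p * (wd S u * wd S w)) =
        derDefect S B M d (wd S p) (wd S u * wd S w) +
        barDiff (signInv S B M d) (wd S p) * (wd S u * wd S w) +
        tsign S (signInv S B M d) (wd S p) * (derDefect S B M d (wd S u) (wd S w) +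
          barDiff (signInv S B M d) (wd S u) * wd S w +
          tsign S (signInv S B M d) (wd S u) * barDiff (signInv S B M d) (wd S w)) := by
      simp only [derDefect_apply]
      rw [show ∀ x y z : WordAlg S (TrivSqZeroExt B M), x - y - z + y + z = x by intros; abel]
      abel
    rw [hD, map_add, map_add, h1, h2, add_zero, zero_add, tsign_wd_typed hp, zero_mul, add_zero, smul_mul_assoc,
      map_smul, mul_add, mul_add, map_add, map_add, hjoin, tsign_wd_typed hu.typed, smul_mul_assoc,
      mul_smul_comm, map_smul, hsuf, smul_zero, zero_add, add_zero, neg_smul]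
  · intro a t' h
    rw [← hF]
    cases hp with
    | nil =>
      rcases hu with ⟨h', -⟩ | ⟨m', e, k', x, t, -, -, -, -, rfl⟩
      · omega
      · rw [List.nil_append, List.cons_append] at h
        obtain ⟨rfl, rfl⟩ := List.cons.inj h
        exact hhead x t rfl rfl
    | consB c b hc hb hp' =>
      rw [List.cons_append] at h
      obtain ⟨rfl, rfl⟩ := List.cons.inj h
      rw [wd_append, wd_append]
      exact hshort hp' hu (by simp) (by omega)
  · rw [← hF]; exact hlast

end Block

open TrivSqZeroExt (inl inr)

/-! ### The weight filtration on words and its compatibility with the Hochschild differential. -/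

section Filtration

variable {S B M : Type*} [CommRing S] [Ring B] [Algebra S B] [AddCommGroup M] [Module S M]
  [Module B M] [Module Bᵐᵒᵖ M] [SMulCommClass B Bᵐᵒᵖ M] [IsScalarTower S B M]
  [IsScalarTower S Bᵐᵒᵖ M]
  {𝓑 : ℕ → Submodule S B} [GradedAlgebra 𝓑] {𝓜 : ℤ → Submodule S M} {d n : ℕ} {n₀ : ℤ}

variable (𝓑 𝓜 n₀) in
/-- The empty word, and the words starting with their only letter from `M`, together with a weight. -/
inductive Suffix : ℕ → ℤ → List (TrivSqZeroExt B M) → Prop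
  | nil : Suffix 0 0 []
  | cons {e k : ℤ} {x : M} {t : List (TrivSqZeroExt B M)} (hx : x ∈ 𝓜 e) (ht : Typed 𝓑 𝓜 0 k t) :
      Suffix 1 (n₀ - e + t.length) (inr x :: t)

theorem Suffix.exists_startTyped {c : ℕ} {p : ℤ} {w : List (TrivSqZeroExt B M)} (h : Suffix 𝓑 𝓜 n₀ c p w) :
    ∃ k, StartTyped 𝓑 𝓜 c k w := by
  cases h with
  | nil => exact ⟨0, .nil⟩
  | cons hx ht => exact ⟨_, .consM hx ht⟩

variable (𝓑 𝓜 n₀) in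
/-- `p u w` is a word of weight `q`, where `p` is a word in `B`, the word `u` starts with the first of its
`m` letters from `M`, and `w` is a suffix with `c` letters from `M`. -/
structure Block (m c : ℕ) (k₁ k₂ q : ℤ) (p u w : List (TrivSqZeroExt B M)) : Prop where
  pre : Typed 𝓑 𝓜 0 k₁ p
  mid : StartTyped 𝓑 𝓜 m k₂ u
  suf : ∃ r, Suffix 𝓑 𝓜 n₀ c r w ∧ q = p.length + (if c = 0 then k₁ + k₂ else 0) + r

variable (𝓑 𝓜 n₀) in
/-- The function `F` vanishes on the words of weight less than `q`, and on the words with one letter from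
`M` less. -/
structure Vanish (m c : ℕ) (q : ℤ) (F : WordAlg S (TrivSqZeroExt B M) →ₗ[S] TrivSqZeroExt B M) : Prop where
  block : ∀ {k₁ k₂ q' p u w}, Block 𝓑 𝓜 n₀ m c k₁ k₂ q' p u w → q' < q → F (wd S p * (wd S u * wd S w)) = 0
  low : ∀ {m' k l}, Typed 𝓑 𝓜 m' k l → m' + 1 = m + c → F (wd S l) = 0

theorem Vanish.span {m c : ℕ} {q : ℤ} {F : WordAlg S (TrivSqZeroExt B M) →ₗ[S] TrivSqZeroExt B M}
    (h : Vanish 𝓑 𝓜 n₀ m c q F) {k₁ k₂ q' : ℤ} {p u w : List (TrivSqZeroExt B M)}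
    (hb : Block 𝓑 𝓜 n₀ m c k₁ k₂ q' p u w) (hq : q' < q) {j : ℕ} {z : WordAlg S (TrivSqZeroExt B M)}
    (hz : z ∈ startSpan S 𝓑 𝓜 m j k₂) : F (wd S p * (z * wd S w)) = 0 := by
  suffices h : startSpan S 𝓑 𝓜 m j k₂ ≤
      LinearMap.ker (F ∘ₗ LinearMap.mulLeft S (wd S p) ∘ₗ LinearMap.mulRight S (wd S w)) from h hz
  refine Submodule.span_le.2 ?_
  rintro _ ⟨u', hu', -, rfl⟩
  exact h.block ⟨hb.pre, hu', hb.suf⟩ hq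

/-- A letter from `B` at the end of `u` raises the degree of the leading letter of the suffix when
it acts on it, and so lowers the weight; a letter from `M` gives the product zero. -/
theorem Vanish.join (hG : IsGradedBimodule 𝓑 𝓜) {m c : ℕ} (hm : 1 ≤ m) {q : ℤ}
    {F : WordAlg S (TrivSqZeroExt B M) →ₗ[S] TrivSqZeroExt B M}
    (h : Vanish 𝓑 𝓜 n₀ m c q F) {k₁ k₂ q' : ℤ} {p u w : List (TrivSqZeroExt B M)}
    (hb : Block 𝓑 𝓜 n₀ m c k₁ k₂ q' p u w) (hq : q' ≤ q) :
    F (wd S p * derDefect S B M d (wd S u) (wd S w)) = 0 := by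
  obtain ⟨hp, hu, r, hw, rfl⟩ := hb
  cases hw with
  | nil => rw [derDefect_apply]; simp
  | @cons e k x t hx ht =>
    rcases hu.exists_concat with ⟨h', -⟩ | ⟨u', b', b, k'', hc, hb, hu', rfl, rfl⟩ |
      ⟨u', e', y, k'', m', hy, hu', rfl, rfl, rfl⟩
    · omega
    · rw [derDefect_apply, barDiff_append,
        show ∀ x y z : WordAlg S (TrivSqZeroExt B M), x + y + z - x - y = z by intros; abel, signInv_inl,
        TrivSqZeroExt.inl_mul_inr, tsign_wd_typed hu'.typed, smul_mul_assoc, mul_smul_comm, map_smul]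
      rw [h.block ⟨hp, hu', _, .cons (hG.left _ _ _ _ hb hx) ht, rfl⟩ (by simp at hq ⊢; omega), smul_zero]
    · rw [derDefect_apply, barDiff_append,
        show ∀ x y z : WordAlg S (TrivSqZeroExt B M), x + y + z - x - y = z by intros; abel, signInv_inr,
        smul_mul_assoc, TrivSqZeroExt.inr_mul_inr, smul_zero, wd_cons, map_zero, zero_mul, mul_zero, mul_zero,
        map_zero]

/-- Multiplying the leading letter of the suffix on the right raises its degree and shortens the
tail; every other merging shortens the tail. The weight drops in each case. -/
theorem Vanish.suffix (hG : IsGradedBimodule 𝓑 𝓜) {m c : ℕ} {q : ℤ}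
    {F : WordAlg S (TrivSqZeroExt B M) →ₗ[S] TrivSqZeroExt B M}
    (h : Vanish 𝓑 𝓜 n₀ m c q F) {k₁ k₂ q' : ℤ} {p u w : List (TrivSqZeroExt B M)}
    (hb : Block 𝓑 𝓜 n₀ m c k₁ k₂ q' p u w) (hq : q' ≤ q) :
    F (wd S p * (wd S u * barDiff (signInv S B M d) (wd S w))) = 0 := by
  obtain ⟨hp, hu, r, hw, rfl⟩ := hb
  cases hw with
  | nil => simp
  | @cons e k x t hx ht =>
    cases ht with
    | nil => simp [wd]
    | @consB _ k' t' cb b hc hb' ht' =>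
      rw [barDiff_cons_cons, mul_sub, mul_sub, map_sub, signInv_inr, smul_mul_assoc,
        TrivSqZeroExt.inr_mul_inl, wd_cons, map_smul, smul_mul_assoc, ← wd_cons, mul_smul_comm, mul_smul_comm,
        map_smul, h.block ⟨hp, hu, _, .cons (hG.right _ _ _ _ hb' hx) ht', rfl⟩ (by simp at hq ⊢; omega),
        smul_zero, zero_sub, map_smul, smul_mul_assoc, mul_smul_comm, mul_smul_comm, map_smul]
      have := barDiff_mem_typedSpan (S := S) (d := d) hG (ht'.consB cb b hc hb') (List.length_cons)
      suffices h' : typedSpan S 𝓑 𝓜 0 t'.length (cb + k') ≤ LinearMap.ker (F ∘ₗ LinearMap.mulLeft S (wd S p) ∘ₗ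
          LinearMap.mulLeft S (wd S u) ∘ₗ LinearMap.mulLeft S (letter S (inr x))) by
        have := h' this
        rw [LinearMap.mem_ker] at this
        simp only [LinearMap.comp_apply, LinearMap.mulLeft_apply] at this
        rw [this, smul_zero, neg_zero]
      refine Submodule.span_le.2 ?_
      rintro _ ⟨t, ht, htn, rfl⟩
      simp only [SetLike.mem_coe, LinearMap.mem_ker, LinearMap.comp_apply, LinearMap.mulLeft_apply]
      rw [← wd_cons]
      refine h.block ⟨hp, hu, _, .cons hx ht, rfl⟩ ?_
      simp at hq ⊢
      omega

/-- Removing a last letter from `B` lowers the weight, through the total degree if the suffix is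
empty and through the length of its tail otherwise. Removing a last letter from `M` leaves one such
letter less, where `F` vanishes by assumption. -/
theorem Vanish.last {m c : ℕ} (hm : 1 ≤ m) {q : ℤ}
    {F : WordAlg S (TrivSqZeroExt B M) →ₗ[S] TrivSqZeroExt B M}
    (h : Vanish 𝓑 𝓜 n₀ m c q F) {k₁ k₂ q' : ℤ} {p u w : List (TrivSqZeroExt B M)}
    (hb : Block 𝓑 𝓜 n₀ m c k₁ k₂ q' p u w) (hq : q' ≤ q) {v : List (TrivSqZeroExt B M)}
    {x : TrivSqZeroExt B M} (hv : p ++ (u ++ w) = v ++ [x]) : F (wd S v) = 0 := by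
  obtain ⟨hp, hu, r, hw, rfl⟩ := hb
  cases hw with
  | nil =>
    rcases hu.exists_concat with ⟨h', -⟩ | ⟨u', b', b, k'', hc, hb, hu', rfl, rfl⟩ |
      ⟨u', e', y, k'', m', hy, hu', rfl, rfl, rfl⟩
    · omega
    · rw [List.append_nil, ← List.append_assoc] at hv
      obtain ⟨rfl, -⟩ := List.append_inj' hv rfl
      have := h.block ⟨hp, hu', 0, .nil, rfl⟩ (by simp at hq ⊢; omega)
      rwa [wd_append, ← mul_one (wd S u'), ← wd_nil]
    · rw [List.append_nil, ← List.append_assoc] at hv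
      obtain ⟨rfl, -⟩ := List.append_inj' hv rfl
      exact h.low (hp.append hu'.typed) (by omega)
  | @cons e k x t hx ht =>
    rcases ht.exists_concat with ⟨-, -, rfl⟩ | ⟨t', b', b, k'', hc, hb, ht', rfl, rfl⟩ |
      ⟨u', e', y, k'', m', hy, hu', h', -⟩
    · rw [← List.append_assoc] at hv
      obtain ⟨rfl, -⟩ := List.append_inj' hv rfl
      exact h.low (hp.append hu.typed) (by omega)
    · rw [← List.cons_append, ← List.append_assoc, ← List.append_assoc] at hv
      obtain ⟨rfl, -⟩ := List.append_inj' hv rfl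
      have := h.block ⟨hp, hu, _, .cons hx ht', rfl⟩ (by simp at hq ⊢; omega)
      rwa [wd_append, wd_append, mul_assoc]
    · omega

theorem cof_block_of_ne (f : MultilinearMap S (fun _ : Fin n => TrivSqZeroExt B M) (TrivSqZeroExt B M))
    {m j : ℕ} {k : ℤ} {z : WordAlg S (TrivSqZeroExt B M)} (hz : z ∈ startSpan S 𝓑 𝓜 m j k)
    {p w : List (TrivSqZeroExt B M)} (h : p.length + (j + w.length) ≠ n) :
    cof (signInv S B M d) f (wd S p * (z * wd S w)) = 0 := by
  suffices h : startSpan S 𝓑 𝓜 m j k ≤ LinearMap.ker (cof (signInv S B M d) f ∘ₗ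
      LinearMap.mulLeft S (wd S p) ∘ₗ LinearMap.mulRight S (wd S w)) from h hz
  refine Submodule.span_le.2 ?_
  rintro _ ⟨u, -, hu, rfl⟩
  simp only [SetLike.mem_coe, LinearMap.mem_ker, LinearMap.comp_apply, LinearMap.mulLeft_apply,
    LinearMap.mulRight_apply]
  rw [← wd_append, ← wd_append, cof_of_ne]
  simp only [List.length_append]
  omega

/-- On words of small weight, the Hochschild differential is given by the bar differential of the middle
part. -/
theorem Vanish.hochD (hG : IsGradedBimodule 𝓑 𝓜) (hd : 1 ≤ d) {m c : ℕ} (hm : 1 ≤ m) {q : ℤ}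
    {f : MultilinearMap S (fun _ : Fin n => TrivSqZeroExt B M) (TrivSqZeroExt B M)}
    (hf : f ∈ cochains (bigrading 𝓑 𝓜 d) n (-(m * d : ℤ)))
    (h : Vanish 𝓑 𝓜 n₀ m c q (cof (signInv S B M d) f)) {k₁ k₂ q' : ℤ} {p u w : List (TrivSqZeroExt B M)}
    (hb : Block 𝓑 𝓜 n₀ m c k₁ k₂ q' p u w) (hq : q' ≤ q) :
    cof (signInv S B M d) (hochD (signInv S B M d) n (-(m * d : ℤ)) f) (wd S p * (wd S u * wd S w)) =
      - (-1 : S) ^ p.length •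
        cof (signInv S B M d) f (wd S p * (barDiff (signInv S B M d) (wd S u) * wd S w)) := by
  by_cases hlen : (p ++ (u ++ w)).length = n + 1
  · refine cof_hochD_block hG hd hm hf rfl hb.pre hb.mid hlen ?_ (h.join hG hm hb hq) (h.suffix hG hb hq) ?_
      fun v x hv => h.last hm hb hq hv
    · intro p' u' k₁' k₂' hp' hu' hlt hk
      obtain ⟨hp, hu, r, hw, rfl⟩ := hb
      refine h.block ⟨hp', hu', r, hw, rfl⟩ ?_
      split_ifs at hq ⊢ <;> omega
    · rintro x t - rfl
      obtain ⟨k, hw⟩ := hb.suf.choose_spec.1.exists_startTyped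
      rcases hb.mid with ⟨h', -⟩ | ⟨m', e, k', x, t, h1, h2, hx, ht, h3⟩
      · omega
      · obtain ⟨-, rfl⟩ := List.cons.inj h3
        exact h.low (ht.append hw.typed) (by omega)
  · rw [← wd_append, ← wd_append, cof_of_ne _ hlen]
    obtain ⟨j, hj⟩ : ∃ j, u.length = j + 1 := ⟨u.length - 1, by have := hb.mid.length_pos hm; omega⟩
    rw [cof_block_of_ne f (barDiff_mem_startSpan (d := d) hG (hj ▸ wd_mem_startSpan (S := S) hb.mid)), smul_zero]
    simp only [List.length_append] at hlen
    omega

theorem Vanish.hochD_span (hG : IsGradedBimodule 𝓑 𝓜) (hd : 1 ≤ d) {m c : ℕ} (hm : 1 ≤ m) {q : ℤ}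
    {f : MultilinearMap S (fun _ : Fin n => TrivSqZeroExt B M) (TrivSqZeroExt B M)}
    (hf : f ∈ cochains (bigrading 𝓑 𝓜 d) n (-(m * d : ℤ)))
    (h : Vanish 𝓑 𝓜 n₀ m c q (cof (signInv S B M d) f)) {k₁ k₂ q' : ℤ} {p u w : List (TrivSqZeroExt B M)}
    (hb : Block 𝓑 𝓜 n₀ m c k₁ k₂ q' p u w) (hq : q' ≤ q) {j : ℕ} {z : WordAlg S (TrivSqZeroExt B M)}
    (hz : z ∈ startSpan S 𝓑 𝓜 m j k₂) :
    cof (signInv S B M d) (SqZero.hochD (signInv S B M d) n (-(m * d : ℤ)) f) (wd S p * (z * wd S w)) =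
      - (-1 : S) ^ p.length •
        cof (signInv S B M d) f (wd S p * (barDiff (signInv S B M d) z * wd S w)) := by
  induction hz using Submodule.span_induction with
  | zero => simp
  | add z w _ _ hz hw => simp only [add_mul, mul_add, map_add, hz, hw, smul_add]
  | smul r z _ hz =>
    simp only [smul_mul_assoc, mul_smul_comm, map_smul, hz]
    rw [smul_comm]
  | mem z hz =>
    obtain ⟨u', hu', -, rfl⟩ := hz
    exact h.hochD hG hd hm hf ⟨hb.pre, hu', hb.suf⟩ hq

end Filtration


/-! ### The normalized Hochschild cochains form a complex. -/

section HochschildComplex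

variable {S A : Type*} [CommRing S] [Ring A] [Algebra S A]
  {𝒜 : ℤ → ℤ → Submodule S A} {σ : A →ₗ[S] A} {n : ℕ} {j : ℤ}
  {f : MultilinearMap S (fun _ : Fin n => A) A}

theorem isHomogeneous_single (hf : IsHomogeneous 𝒜 f j) (k : ℕ) :
    IsHomogeneous 𝒜 ((Pi.single n f : (k : ℕ) → MultilinearMap S (fun _ : Fin k => A) A) k)
      (j + n - 1 + 1 - k) := by
  by_cases hk : k = n
  · subst hk
    rw [Pi.single_eq_same]
    convert hf using 1
    ring
  · rw [Pi.single_eq_of_ne hk]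
    exact isHomogeneous_zero

theorem bar_single_map (H : IsSignedBigrading 𝒜 σ) (hf : IsHomogeneous 𝒜 f j) (l : List A) :
    bar σ (Pi.single n f) (l.map fun x => - σ x) =
      (-1 : S) ^ (j - n).natAbs • σ (bar σ (Pi.single n f) l) := by
  refine bar_map_neg_sigma (fun k a => ?_) l
  by_cases hk : k = n
  · subst hk
    rw [Pi.single_eq_same, H.sigma_apply hf]
    congr 1
    exact neg_one_pow_natAbs_congr (x := j) (y := (k + (j - k).natAbs : ℕ)) (by omega)
  · rw [Pi.single_eq_of_ne hk]; simp

theorem cof_tsign (H : IsSignedBigrading 𝒜 σ) (hf : IsHomogeneous 𝒜 f j) (z : WordAlg S A) :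
    cof σ f (tsign S σ z) = (-1 : S) ^ (j - n).natAbs • σ (cof σ f z) := by
  suffices h : cof σ f ∘ₗ (tsign S σ).toLinearMap = (-1 : S) ^ (j - n).natAbs • σ ∘ₗ cof σ f from
    LinearMap.congr_fun h z
  refine linearMap_ext_wd fun l => ?_
  simp only [LinearMap.comp_apply, AlgHom.toLinearMap_apply, LinearMap.smul_apply, tsign_wd, cof_wd]
  exact bar_single_map H hf l

/-- The Hochschild differential on words. -/
theorem cof_hochD_eq (H : IsSignedBigrading 𝒜 σ) (hn : 1 ≤ n) (hf : IsHomogeneous 𝒜 f j) {a x : A}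
    {v w : List A} (hvw : a :: w = v ++ [x]) (hl : w.length = n) :
    cof σ (hochD σ n j f) (wd S (a :: w)) = - cof σ f (barDiff σ (wd S (a :: w))) -
      (-1 : S) ^ (j - n).natAbs • (σ (cof σ f (wd S v)) * x) +
      (σ ^ (j - n).natAbs) a * cof σ f (wd S w) := by
  have hD : cof σ f (barDiff σ (wd S (a :: w))) =
      ins (fun x => - σ x) (barMul σ) (bar σ (Pi.single n f)) (a :: w) := by
    rw [map_barDiff]; simp only [cof_wd]
  obtain ⟨t, ht⟩ := exists_twist H.sigma_sigma (a :: w)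
  rw [List.length_cons, hl] at ht
  rw [hD, ← ht, cof_twist H.sigma_sigma]
  rcases Int.even_or_odd (j - n) with h | h
  · have := hochD_eq_ins_even H hn h.two_dvd hf t
    have h1 : σ ^ (j - n).natAbs = σ ^ 0 := sigma_pow_congr H.sigma_sigma (by
      obtain ⟨r, hr⟩ := h; omega)
    rw [h1, (Int.natAbs_even.2 h).neg_one_pow]
    rw [ht, ins_barMul hvw (by omega), ← cof_wd, ← cof_wd] at this
    rw [ht, ← neg_eq_iff_eq_neg.2 this]
    simp [H.sigma_sigma]
    abel
  · have := hochD_eq_ins_odd H hn (by obtain ⟨r, hr⟩ := h; exact ⟨r, by omega⟩) hf t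
    have h1 : σ ^ (j - n).natAbs = σ ^ 1 := sigma_pow_congr H.sigma_sigma (by
      obtain ⟨r, hr⟩ := h; omega)
    rw [h1, (Int.natAbs_odd.2 h).neg_one_pow]
    rw [ht, ins_barMul hvw (by omega), ← cof_wd, ← cof_wd] at this
    rw [ht, ← neg_eq_iff_eq_neg.2 this]
    simp
    abel

theorem hasDeg_barMul (H : IsSignedBigrading 𝒜 σ) : HasDeg 𝒜 (barMul σ) 1 0 :=
  hasDeg_bar H (isHomogeneous_of_unital H (isPreAInf_mul H le_rfl).zero (isPreAInf_mul H le_rfl).one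
    (isPreAInf_mul H le_rfl).two (isPreAInf_mul H le_rfl).mem)

theorem isHomogeneous_hochD (H : IsSignedBigrading 𝒜 σ) (hn : 1 ≤ n) (hf : IsHomogeneous 𝒜 f j) :
    IsHomogeneous 𝒜 (hochD σ n j f) j := by
  have hF := hasDeg_bar H (isHomogeneous_single hf)
  have h1 := HasDeg.ins (neg_sigma_mem H) (hasDeg_barMul H) hF
  have h2 := HasDeg.ins (neg_sigma_mem H) hF (hasDeg_barMul H)
  have h3 := HasDeg.ins (θ := id) (fun _ _ _ h => h) hF (hasDeg_barMul H)
  have m1 : IsML S (ins (fun x => - σ x) (barMul σ) (bar σ (Pi.single n f))) :=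
    IsML.ins (θ := -σ) isML_barMul (isML_bar _)
  have m2 : IsML S (ins (fun x => - σ x) (bar σ (Pi.single n f)) (barMul σ)) :=
    IsML.ins (θ := -σ) (isML_bar _) isML_barMul
  have m3 : IsML S (ins id (bar σ (Pi.single n f)) (barMul σ)) :=
    IsML.ins (θ := LinearMap.id) (isML_bar _) isML_barMul
  have u1 := unbar_isHomogeneous H m1 h1 (n + 1)
  have u2 := unbar_isHomogeneous H m2 (e := 1 + (j + n - 1)) (by rw [add_comm 1]; exact h2) (n + 1)
  have u3 := unbar_isHomogeneous H m3 (e := 1 + (j + n - 1)) (by rw [add_comm 1]; exact h3) (n + 1)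
  have hj : 1 + (j + n - 1) + 1 - ((n + 1 : ℕ) : ℤ) = j := by push_cast; ring
  rw [hj] at u1 u2 u3
  rcases Int.even_or_odd (j - n) with h | h
  · have e : hochD σ n j f = - (unbar σ m1 (n + 1) + unbar σ m2 (n + 1)) := by
      refine multilinear_ext_nat fun a => ?_
      have := hochD_eq_ins_even H hn h.two_dvd hf a
      rw [eq_comm, neg_eq_iff_eq_neg] at this
      rw [this]; rfl
    rw [e]
    exact fun h k a ha => Submodule.neg_mem _ (Submodule.add_mem _ (u1 h k a ha) (u2 h k a ha))
  · have e : hochD σ n j f = - (unbar σ m1 (n + 1) - unbar σ m3 (n + 1)) := by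
      refine multilinear_ext_nat fun a => ?_
      have := hochD_eq_ins_odd H hn (by obtain ⟨r, hr⟩ := h; exact ⟨r, by omega⟩) hf a
      rw [eq_comm, neg_eq_iff_eq_neg] at this
      rw [this]; rfl
    rw [e]
    exact fun h k a ha => Submodule.neg_mem _ (Submodule.sub_mem _ (u1 h k a ha) (u3 h k a ha))

/-- The Hochschild differential of a normalized cochain is normalized. -/
theorem hochD_mem_cochains (H : IsSignedBigrading 𝒜 σ) (hn : 1 ≤ n) (hf : f ∈ cochains 𝒜 n j) :
    hochD σ n j f ∈ cochains 𝒜 (n + 1) j := by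
  refine ⟨?_, isHomogeneous_hochD H hn hf.2⟩
  suffices h : ∀ l : List A, 1 ∈ l → l.length = n + 1 → cof σ (hochD σ n j f) (wd S l) = 0 by
    rintro a ⟨i, hi⟩
    have := h (twist σ (n + 1) fun k => if hk : k < n + 1 then a ⟨k, hk⟩ else 0) (by
      rw [twist, List.mem_ofFn]
      exact ⟨i, by rw [dif_pos i.2, Fin.eta, hi, H.sigma_pow_one]⟩) (by simp)
    rw [cof_twist H.sigma_sigma] at this
    simpa [Fin.is_le] using this
  intro l h1 hl
  obtain ⟨a, w, rfl⟩ : ∃ a w, l = a :: w := List.exists_cons_of_length_eq_add_one hl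
  obtain ⟨v, x, hvx⟩ : ∃ v x, a :: w = v ++ [x] :=
    ⟨_, _, (List.dropLast_append_getLast (List.cons_ne_nil a w)).symm⟩
  have hw : w.length = n := by simpa using hl
  have hv : v.length = n := by have := congrArg List.length hvx; simp at this; omega
  have hkill : ∀ l, (1 : A) ∈ l → cof σ f (wd S l) = 0 := fun l hl => cof_kill H hf hl
  have hkill' : ∀ l, (1 : A) ∈ l → bar σ (Pi.single n f) l = 0 := fun l hl => by
    rw [← cof_wd]; exact hkill l hl
  rw [cof_hochD_eq H hn hf.2 hvx hw, map_barDiff]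
  simp only [cof_wd]
  by_cases ha : a = 1
  · subst ha
    have h1v : (1 : A) ∈ v := by
      cases v with
      | nil => simp at hv; omega
      | cons b v => rw [List.cons_append] at hvx; rw [(List.cons.inj hvx).1]; simp
    rw [ins_one_cons isUnitalBar_barMul H.sigma_one (isML_bar _) (fun l _ => hkill' _ (by simp))
      (by rintro rfl; simp at hw; omega), hkill' v h1v, H.sigma_pow_one]
    simp
  · obtain ⟨u, r, hur⟩ := List.append_of_mem h1
    have hu : u ≠ [] := by rintro rfl; exact ha (List.cons.inj hur).1
    have h1w : (1 : A) ∈ w := by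
      cases u with
      | nil => exact absurd rfl hu
      | cons b u => rw [(List.cons.inj hur).2]; simp
    rw [hur, ins_append_one_cons isUnitalBar_barMul H.sigma_one (isML_bar _) (fun l h _ => hkill' _ h) hu,
      hkill' w h1w, mul_zero, add_zero]
    split_ifs with hr
    · subst hr
      rw [hur] at hvx
      obtain ⟨rfl, h⟩ := List.append_inj' hvx rfl
      rw [← (List.cons.inj h).1, bar_single_map H hf.2, mul_one]
      simp
    · obtain ⟨r', y, rfl⟩ := (List.eq_nil_or_concat r).resolve_left hr
      rw [hur, List.concat_eq_append, ← List.cons_append, ← List.append_assoc] at hvx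
      obtain ⟨rfl, -⟩ := List.append_inj' hvx rfl
      rw [hkill' _ (by simp)]
      simp

theorem barDiff_mem_length {m : ℕ} {l : List A} (hl : l.length = m + 1) :
    barDiff σ (wd S l) ∈ Submodule.span S {z | ∃ r : List A, r.length = m ∧ z = wd S r} := by
  induction l generalizing m with
  | nil => simp at hl
  | cons a w ih =>
    cases w with
    | nil => simp [wd]
    | cons a' w =>
      obtain ⟨m, rfl⟩ : ∃ k, m = k + 1 := ⟨m - 1, by simp at hl; omega⟩
      rw [barDiff_cons_cons]
      refine Submodule.sub_mem _ (Submodule.subset_span ⟨_, by simpa using hl, rfl⟩) ?_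
      refine mul_mem_of_span (s := {letter S (σ a)}) ?_ (Submodule.subset_span rfl) (ih (by simpa using hl))
      rintro _ rfl _ ⟨r, hr, rfl⟩
      exact Submodule.subset_span ⟨_, by simpa using hr, (wd_cons _ _).symm⟩

/-- The Hochschild differential squares to zero. -/
theorem hochD_hochD (H : IsSignedBigrading 𝒜 σ) (hn : 1 ≤ n) (hf : IsHomogeneous 𝒜 f j) :
    hochD σ (n + 1) j (hochD σ n j f) = 0 := by
  refine eq_zero_of_cof H.sigma_sigma fun l hl => ?_
  obtain ⟨a, w, rfl⟩ : ∃ a w, l = a :: w := List.exists_cons_of_length_eq_add_one hl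
  obtain ⟨t, x, rfl⟩ : ∃ t x, w = t ++ [x] :=
    ⟨_, _, (List.dropLast_append_getLast (by rintro rfl; simp at hl)).symm⟩
  have ht : t.length = n := by simp at hl; omega
  obtain ⟨y, t₁, hy⟩ : ∃ y t₁, t = y :: t₁ := List.exists_cons_of_length_pos (by omega)
  obtain ⟨t₂, y₂, hy₂⟩ : ∃ t₂ y₂, t = t₂ ++ [y₂] :=
    ⟨_, _, (List.dropLast_append_getLast (by rintro rfl; simp at ht; omega)).symm⟩
  set F := cof σ f with hF
  set D := barDiff (S := S) σ with hD
  set κ : S := (-1) ^ (j - n).natAbs with hκ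
  set ρ : Module.End S A := σ ^ (j - n).natAbs with hρ
  have hκκ : κ * κ = 1 := by rw [hκ, ← mul_pow]; simp
  have hκ' : (-1 : S) ^ (j - (n + 1 : ℕ)).natAbs = - κ := by
    rw [neg_one_pow_natAbs_congr (y := ((j - n).natAbs + 1 : ℕ)) (by omega), Int.natAbs_natCast, pow_succ, mul_neg,
      mul_one]
  have hρ' : ∀ a, (σ ^ (j - (n + 1 : ℕ)).natAbs) a = ρ (σ a) := by
    intro a
    rw [sigma_pow_congr H.sigma_sigma (j := (j - n).natAbs + 1) (by omega), pow_succ, Module.End.mul_apply]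
  have hρmul : ∀ a b, ρ (a * b) = ρ a * ρ b := by
    intro a b
    rw [hρ]
    generalize (j - n).natAbs = i
    induction i with
    | zero => simp
    | succ i ih => rw [pow_succ', Module.End.mul_apply, ih, sigma_mul H]; rfl
  have hστ : ∀ z, F (tsign S σ z) = κ • σ (F z) := fun z => cof_tsign H hf z
  have hδ : ∀ {a x : A} {v w : List A}, a :: w = v ++ [x] → w.length = n →
      cof σ (hochD σ n j f) (wd S (a :: w)) = - F (D (wd S (a :: w))) - κ • (σ (F (wd S v)) * x) +
        ρ a * F (wd S w) := fun h h' => cof_hochD_eq H hn hf h h'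
  -- The formula for the differential is needed with fixed outer letters and a linear combination of
  -- words in the middle, namely the bar differential of `t`.
  have hmid : ∀ (b : A) {z : WordAlg S A}, z ∈ Submodule.span S {z | ∃ r : List A, r.length + 1 = n ∧ z = wd S r} →
      cof σ (hochD σ n j f) (letter S b * (z * letter S x)) = - F (D (letter S b * (z * letter S x))) -
        κ • (σ (F (letter S b * z)) * x) + ρ b * F (z * letter S x) := by
    intro b z hz
    induction hz using Submodule.span_induction with
    | zero => simp
    | add z w _ _ hz hw =>
      simp only [add_mul, mul_add, map_add, hz, hw, smul_add]
      abel
    | smul r z _ hz =>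
      simp only [smul_mul_assoc, mul_smul_comm, map_smul, hz, smul_add, smul_sub, smul_neg]
      rw [smul_comm κ]
    | mem z hz =>
      obtain ⟨r, hr, rfl⟩ := hz
      have := hδ (show b :: (r ++ [x]) = (b :: r) ++ [x] from rfl) (by simpa using hr)
      simpa only [wd_cons, wd_append, wd_nil, mul_one] using this
  set E := cof σ (hochD σ n j f) with hE
  have hσρ : ∀ a, σ (ρ a) = ρ (σ a) := by
    intro a
    rw [hρ, ← Module.End.mul_apply, ← pow_succ', pow_succ, Module.End.mul_apply]
  have hD1 : D (wd S (a :: t)) = letter S (σ a * y) * wd S t₁ - letter S (σ a) * D (wd S t) := by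
    rw [hy, hD, barDiff_cons_cons, wd_cons (σ a * y)]
  have hD2 : D (wd S (t ++ [x])) = D (wd S t) * letter S x + tsign S σ (wd S t₂) * letter S (σ y₂ * x) := by
    have := barDiff_append (σ := σ) (S := S) t₂ y₂ x []
    rw [← hy₂, ← wd_append, ← hD, wd_cons x [], wd_cons _ [], wd_nil, mul_one, mul_one, hD, barDiff_letter, mul_zero,
      add_zero] at this
    exact this
  have hD3 : D (wd S (a :: (t ++ [x]))) = letter S (σ a * y) * (wd S t₁ * letter S x) -
      letter S (σ a) * (D (wd S t) * letter S x) -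
      letter S (σ a) * (tsign S σ (wd S t₂) * letter S (σ y₂ * x)) := by
    rw [sub_sub, ← mul_add, ← hD2, hy, hD, List.cons_append, barDiff_cons_cons, wd_cons (σ a * y), wd_append,
      wd_cons x [], wd_nil, mul_one]
  have ht₁ : t₁.length + 1 = n := by rw [← ht, hy]; rfl
  have ht₂ : t₂.length + 1 = n := by rw [← ht, hy₂]; simp
  have e1 := hmid (σ a * y) (Submodule.subset_span ⟨t₁, ht₁, rfl⟩)
  have e2 := hmid (σ a) (z := D (wd S t)) (by
    obtain ⟨m, rfl⟩ : ∃ k, n = k + 1 := ⟨n - 1, by omega⟩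
    have := barDiff_mem_length (S := S) (σ := σ) ht
    simpa using this)
  have e3 : E (letter S (σ a) * (tsign S σ (wd S t₂) * letter S (σ y₂ * x))) =
      - F (D (letter S (σ a) * (tsign S σ (wd S t₂) * letter S (σ y₂ * x)))) +
        F (wd S (a :: t₂)) * (σ y₂ * x) + ρ (σ a) * F (tsign S σ (wd S t₂) * letter S (σ y₂ * x)) := by
    have := hδ (show σ a :: (t₂.map (fun x => - σ x) ++ [σ y₂ * x]) =
      (σ a :: t₂.map (fun x => - σ x)) ++ [σ y₂ * x] from rfl) (by simpa using ht₂)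
    rw [wd_cons, wd_append, wd_cons _ (List.map _ _), wd_cons _ [], wd_nil, mul_one, ← tsign_wd,
      show letter S (σ a) * tsign S σ (wd S t₂) = - tsign S σ (wd S (a :: t₂)) by
        rw [wd_cons, map_mul, tsign_letter, neg_mul, neg_neg], map_neg, hστ] at this
    rw [this, map_neg, map_smul, H.sigma_sigma, neg_mul, smul_neg, smul_mul_assoc, smul_smul, hκκ, one_smul,
      sub_neg_eq_add]
  have e4 := hδ (show a :: t = (a :: t₂) ++ [y₂] by rw [hy₂]; rfl) ht
  have e5 := hδ (show y :: (t₁ ++ [x]) = t ++ [x] by rw [hy]; rfl) (by simpa using ht₁)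
  rw [show y :: (t₁ ++ [x]) = t ++ [x] by rw [hy]; rfl] at e5
  have hDD : F (D (D (wd S (a :: (t ++ [x]))))) = 0 := by rw [hD, barDiff_barDiff H, map_zero]
  rw [hD3, map_sub, map_sub, map_sub, map_sub] at hDD
  rw [cof_hochD_eq H (by omega) (isHomogeneous_hochD H hn hf) (show a :: (t ++ [x]) = (a :: t) ++ [x] from rfl)
    (by simpa using ht), hκ', hρ', ← hE, ← hD, hD3, map_sub, map_sub, e1, e2, e3, e4, e5, hD1, hD2]
  simp only [map_sub, map_add, map_neg, map_smul, hσρ, sigma_mul H, H.sigma_sigma, hρmul, wd_append, wd_cons x [],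
    wd_nil, mul_one, sub_mul, add_mul, mul_sub, mul_add, neg_mul, mul_neg, smul_mul_assoc, mul_smul_comm, smul_sub,
    smul_add, smul_neg, neg_smul, smul_smul, hκκ, one_smul, mul_assoc]
  have h0 := sub_eq_zero.1 hDD
  rw [← h0]
  abel

end HochschildComplex

open TrivSqZeroExt (inl inr)

/-! ### Locally finite sums of cochains. -/

section Limit

variable {S A : Type*} [CommRing S] [Ring A] [Algebra S A]
  {𝒜 : ℤ → ℤ → Submodule S A} {n : ℕ} {j : ℤ}

/-- Locally finite sums of cochains. -/
theorem exists_locally_finite_sum (σ : A →ₗ[S] A) {g : ℕ → MultilinearMap S (fun _ : Fin n => A) A}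
    (hg : ∀ q, g q ∈ cochains 𝒜 n j) (hfin : ∀ a, ∀ᶠ q in Filter.atTop, g q a = 0) :
    ∃ G ∈ cochains 𝒜 n j, ∀ a, ∀ᶠ Q in Filter.atTop,
      hochD σ n j G a = ∑ q ∈ Finset.range Q, hochD σ n j (g q) a := by
  have hsupp : ∀ a, (Function.support fun q => g q a).Finite := by
    intro a
    obtain ⟨N, hN⟩ := Filter.eventually_atTop.1 (hfin a)
    refine (Set.finite_lt_nat N).subset fun q hq => ?_
    by_contra h
    exact hq (hN q (by simpa using h))
  let G : MultilinearMap S (fun _ : Fin n => A) A := MultilinearMap.mk' (fun a => ∑ᶠ q, g q a)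
    (fun a i x y => by
      simp only [MultilinearMap.map_update_add]
      exact finsum_add_distrib (hsupp _) (hsupp _))
    (fun a i c x => by
      simp only [MultilinearMap.map_update_smul]
      exact (smul_finsum' c (hsupp _)).symm)
  have hG : ∀ a, G a = ∑ᶠ q, g q a := fun _ => rfl
  have hsum : ∀ a, ∀ᶠ Q in Filter.atTop, G a = ∑ q ∈ Finset.range Q, g q a := by
    intro a
    obtain ⟨N, hN⟩ := Filter.eventually_atTop.1 (hfin a)
    refine Filter.eventually_atTop.2 ⟨N, fun Q hQ => ?_⟩
    rw [hG]
    refine finsum_eq_sum_of_support_subset _ fun q hq => ?_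
    by_contra h
    exact hq (hN q (by simp at h; omega))
  refine ⟨G, ⟨fun a ha => ?_, fun h k a ha => ?_⟩, fun a => ?_⟩
  · rw [hG]; simp [fun q => (hg q).1 a ha]
  · obtain ⟨Q, hQ⟩ := (hsum a).exists
    rw [hQ]
    exact Submodule.sum_mem _ fun q _ => (hg q).2 h k a ha
  -- The differential at `a` involves finitely many values of `G`, so one bound `Q` serves all of
  -- them.
  · filter_upwards [hsum (Fin.tail a), hsum (Fin.init a),
      Filter.eventually_all.2 fun i : Fin n => hsum (mergeAt (LinearMap.mul S A) i a)] with Q h1 h2 h3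
    have : ∑ q ∈ Finset.range Q, hochD σ n j (g q) a = hochD σ n j (∑ q ∈ Finset.range Q, g q) a := by
      rw [map_sum, sum_apply]
    rw [this, hochD_apply, hochD_apply]
    simp only [sum_apply, ← h1, ← h2, ← h3]

end Limit

/-! ### Correcting a cocycle by the coboundary of `f ∘ s`. -/

section Correction

variable {S B M : Type*} [CommRing S] [Ring B] [Algebra S B] [AddCommGroup M] [Module S M]
  [Module B M] [Module Bᵐᵒᵖ M] [SMulCommClass B Bᵐᵒᵖ M] [IsScalarTower S B M]
  [IsScalarTower S Bᵐᵒᵖ M]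
  {𝓑 : ℕ → Submodule S B} [GradedAlgebra 𝓑] {𝓜 : ℤ → Submodule S M} {d n : ℕ} {n₀ : ℤ}

-- The word is cut before its first letter from `M`, and for `c = 1` also before its last one.
variable (n₀) in
theorem Typed.exists_block {m c : ℕ} (hc : c ≤ 1) {k : ℤ} {l : List (TrivSqZeroExt B M)}
    (h : Typed 𝓑 𝓜 (m + c) k l) : ∃ k₁ k₂ k₃ q p u w, Block 𝓑 𝓜 n₀ m c k₁ k₂ q p u w ∧
      StartTyped 𝓑 𝓜 c k₃ w ∧ k = k₁ + (k₂ + k₃) ∧ l = p ++ (u ++ w) := by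
  rcases Nat.le_one_iff_eq_zero_or_eq_one.1 hc with rfl | rfl
  · obtain ⟨p, u, k₁, k₂, rfl, hp, hu, rfl⟩ := h.exists_first
    exact ⟨k₁, k₂, 0, _, p, u, [], ⟨hp, hu, 0, .nil, rfl⟩, .nil, by ring, by simp⟩
  · obtain ⟨v, x, t, e, k', k₃, rfl, hv, hx, ht, rfl⟩ := h.exists_last
    obtain ⟨p, u, k₁, k₂, rfl, hp, hu, rfl⟩ := hv.exists_first
    exact ⟨k₁, k₂, e + k₃, _, p, u, inr x :: t, ⟨hp, hu, _, .cons hx ht, rfl⟩, .consM hx ht, by ring, by simp⟩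

variable [DirectSum.Decomposition 𝓜]

variable (𝓑 𝓜 d) in
/-- The cochain `f ∘ s`, for the operator `s` applied to the middle part of a word. -/
def correction (m c : ℕ) (s : WordAlg S (TrivSqZeroExt B M) →ₗ[S] WordAlg S (TrivSqZeroExt B M))
    (f : MultilinearMap S (fun _ : Fin (n + 1) => TrivSqZeroExt B M) (TrivSqZeroExt B M)) :
    MultilinearMap S (fun _ : Fin n => TrivSqZeroExt B M) (TrivSqZeroExt B M) :=
  unbar (signInv S B M d) (isML_comp (cof (signInv S B M d) f ∘ₗ midOp 𝓑 𝓜 d m c s)) n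

variable {m c : ℕ} {s : WordAlg S (TrivSqZeroExt B M) →ₗ[S] WordAlg S (TrivSqZeroExt B M)}

theorem cof_correction_aux (H : IsSignedBigrading (bigrading 𝓑 𝓜 d) (signInv S B M d))
    (f : MultilinearMap S (fun _ : Fin (n + 1) => TrivSqZeroExt B M) (TrivSqZeroExt B M))
    {l : List (TrivSqZeroExt B M)} (hl : l.length = n) :
    cof (signInv S B M d) (correction 𝓑 𝓜 d m c s f) (wd S l) =
      cof (signInv S B M d) f (midOp 𝓑 𝓜 d m c s (wd S l)) :=
  cof_unbar H.sigma_sigma _ hl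

theorem cof_correction (hG : IsGradedBimodule 𝓑 𝓜)
    (f : MultilinearMap S (fun _ : Fin (n + 1) => TrivSqZeroExt B M) (TrivSqZeroExt B M))
    {l : List (TrivSqZeroExt B M)} (hl : l.length = n) :
    cof (signInv S B M d) (correction 𝓑 𝓜 d m c s f) (wd S l) =
      cof (signInv S B M d) f (midOp 𝓑 𝓜 d m c s (wd S l)) :=
  cof_correction_aux (isSignedBigrading hG) f hl

theorem cof_correction_of_ne (hG : IsGradedBimodule 𝓑 𝓜)
    (f : MultilinearMap S (fun _ : Fin (n + 1) => TrivSqZeroExt B M) (TrivSqZeroExt B M)) {m' : ℕ}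
    (hm' : m' ≠ m + c) {k : ℤ} {l : List (TrivSqZeroExt B M)} (hl : Typed 𝓑 𝓜 m' k l) :
    cof (signInv S B M d) (correction 𝓑 𝓜 d m c s f) (wd S l) = 0 := by
  by_cases h : l.length = n
  · rw [cof_correction hG f h, midOp_of_ne hm' hl, map_zero]
  · exact cof_of_ne _ h

theorem cof_mem_of_typedSpan (hG : IsGradedBimodule 𝓑 𝓜) {j : ℤ}
    {f : MultilinearMap S (fun _ : Fin n => TrivSqZeroExt B M) (TrivSqZeroExt B M)}
    (hf : f ∈ cochains (bigrading 𝓑 𝓜 d) n j) {m i : ℕ} {k : ℤ} {z : WordAlg S (TrivSqZeroExt B M)}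
    (hz : z ∈ typedSpan S 𝓑 𝓜 m i k) : cof (signInv S B M d) f z ∈ bigrading 𝓑 𝓜 d (m * d + j) k := by
  suffices h : typedSpan S 𝓑 𝓜 m i k ≤ (bigrading 𝓑 𝓜 d (m * d + j) k).comap (cof (signInv S B M d) f) from h hz
  refine Submodule.span_le.2 ?_
  rintro _ ⟨l, hl, -, rfl⟩
  exact cof_mem_bigrading hG hf hl

theorem correction_mem (hG : IsGradedBimodule 𝓑 𝓜) (hd : 1 ≤ d) (hc : c ≤ 1)
    (hs : ∀ {n k z}, z ∈ startSpan S 𝓑 𝓜 m n k → s z ∈ startSpan S 𝓑 𝓜 m (n + 1) k) {j : ℤ}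
    {f : MultilinearMap S (fun _ : Fin (n + 1) => TrivSqZeroExt B M) (TrivSqZeroExt B M)}
    (hf : f ∈ cochains (bigrading 𝓑 𝓜 d) (n + 1) j) :
    correction 𝓑 𝓜 d m c s f ∈ cochains (bigrading 𝓑 𝓜 d) n j := by
  refine unbar_mem_cochains_of_typed hG hd _ (fun l hl => ?_) fun {m' k l} hl hn => ?_
  · rw [LinearMap.comp_apply, midOp_of_one_mem hl, map_zero]
  · rw [LinearMap.comp_apply]
    by_cases hm' : m' = m + c
    · subst hm'
      obtain ⟨k₁, k₂, k₃, q, p, u, w, hb, hw, rfl, rfl⟩ := hl.exists_block 0 hc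
      rw [wd_append, wd_append, midOp_wd hs hb.pre hb.mid hw, map_smul]
      refine Submodule.smul_mem _ _ ?_
      have := cof_mem_of_typedSpan hG hf (mul_mem_typedSpan (wd_mem_typedSpan hb.pre)
        (mul_mem_typedSpan (startSpan_le (hs (wd_mem_startSpan hb.mid))) (wd_mem_typedSpan hw.typed)))
      rwa [zero_add] at this
    · rw [midOp_of_ne hm' hl, map_zero]; exact Submodule.zero_mem _

theorem cof_correction_block (hG : IsGradedBimodule 𝓑 𝓜)
    (hs : ∀ {n k z}, z ∈ startSpan S 𝓑 𝓜 m n k → s z ∈ startSpan S 𝓑 𝓜 m (n + 1) k)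
    (f : MultilinearMap S (fun _ : Fin (n + 1) => TrivSqZeroExt B M) (TrivSqZeroExt B M))
    {k₁ k₂ q : ℤ} {p u w : List (TrivSqZeroExt B M)} (hb : Block 𝓑 𝓜 n₀ m c k₁ k₂ q p u w) {j : ℕ}
    {z : WordAlg S (TrivSqZeroExt B M)} (hz : z ∈ startSpan S 𝓑 𝓜 m j k₂) :
    cof (signInv S B M d) (correction 𝓑 𝓜 d m c s f) (wd S p * (z * wd S w)) =
      (-1 : S) ^ p.length • cof (signInv S B M d) f (wd S p * (s z * wd S w)) := by
  by_cases hlen : p.length + (j + w.length) = n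
  · obtain ⟨k₃, hw⟩ := hb.suf.choose_spec.1.exists_startTyped
    induction hz using Submodule.span_induction with
    | zero => simp
    | add z w _ _ hz hw => simp only [add_mul, mul_add, map_add, hz, hw, smul_add]
    | smul r z _ hz =>
      simp only [smul_mul_assoc, mul_smul_comm, map_smul, hz]
      rw [smul_comm]
    | mem z hz =>
      obtain ⟨u', hu', rfl, rfl⟩ := hz
      rw [← map_smul, ← midOp_wd hs hb.pre hu' hw, ← wd_append, ← wd_append, cof_correction hG f (by simpa using hlen)]
  · rw [cof_block_of_ne _ hz hlen, cof_block_of_ne f (hs hz) (by omega), smul_zero]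

theorem Vanish.correction (hG : IsGradedBimodule 𝓑 𝓜)
    (hs : ∀ {n k z}, z ∈ startSpan S 𝓑 𝓜 m n k → s z ∈ startSpan S 𝓑 𝓜 m (n + 1) k)
    {f : MultilinearMap S (fun _ : Fin (n + 1) => TrivSqZeroExt B M) (TrivSqZeroExt B M)} {q : ℤ}
    (h : Vanish 𝓑 𝓜 n₀ m c q (cof (signInv S B M d) f)) :
    Vanish 𝓑 𝓜 n₀ m c q (cof (signInv S B M d) (correction 𝓑 𝓜 d m c s f)) where
  block hb hq := by
    rw [cof_correction_block hG hs f hb (wd_mem_startSpan hb.mid),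
      h.span hb hq (hs (wd_mem_startSpan hb.mid)), smul_zero]
  low hl hm' := cof_correction_of_ne hG f (by omega) hl

theorem cof_hochD_correction_low (hG : IsGradedBimodule 𝓑 𝓜) (hd : 1 ≤ d) (hm : 1 ≤ m) (hc : c ≤ 1)
    (hs : ∀ {n k z}, z ∈ startSpan S 𝓑 𝓜 m n k → s z ∈ startSpan S 𝓑 𝓜 m (n + 1) k)
    {f : MultilinearMap S (fun _ : Fin (n + 1) => TrivSqZeroExt B M) (TrivSqZeroExt B M)}
    (hf : f ∈ cochains (bigrading 𝓑 𝓜 d) (n + 1) (-(m * d : ℤ))) {m' : ℕ} {k : ℤ}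
    {l : List (TrivSqZeroExt B M)} (hl : Typed 𝓑 𝓜 m' k l) (hm' : m' + 1 = m + c) :
    cof (signInv S B M d) (SqZero.hochD (signInv S B M d) n (-(m * d : ℤ)) (correction 𝓑 𝓜 d m c s f))
      (wd S l) = 0 := by
  by_cases hlen : l.length = n + 1
  · rw [cof_hochD_typed hG hd hm (correction_mem hG hd hc hs hf) hlen, neg_eq_zero]
    · have := barDiff_mem_typedSpan (S := S) (d := d) hG hl hlen
      suffices h : typedSpan S 𝓑 𝓜 m' n k ≤
        LinearMap.ker (cof (signInv S B M d) (correction 𝓑 𝓜 d m c s f)) from h this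
      refine Submodule.span_le.2 ?_
      rintro _ ⟨l', hl', -, rfl⟩
      exact cof_correction_of_ne hG f (by omega) hl'
    · rintro a w rfl
      obtain ⟨m₁, k₁, m₂, k₂, -, hr, h, -⟩ := Typed.of_append (u := [a]) hl
      exact cof_correction_of_ne hG f (by omega) hr
    · rintro v x rfl
      obtain ⟨m₁, k₁, m₂, k₂, hr, -, h, -⟩ := hl.of_append
      exact cof_correction_of_ne hG f (by omega) hr
  · exact cof_of_ne _ hlen

/-- One step of the correction of a cocycle by coboundaries. -/
theorem Vanish.step (hG : IsGradedBimodule 𝓑 𝓜) (hd : 1 ≤ d) (hm : 1 ≤ m) (hc : c ≤ 1)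
    (hs : ∀ {n k z}, z ∈ startSpan S 𝓑 𝓜 m n k → s z ∈ startSpan S 𝓑 𝓜 m (n + 1) k)
    {f : MultilinearMap S (fun _ : Fin (n + 1) => TrivSqZeroExt B M) (TrivSqZeroExt B M)}
    (hf : f ∈ cocycles (bigrading 𝓑 𝓜 d) (signInv S B M d) (n + 1) (-(m * d : ℤ))) {q : ℤ}
    (h : Vanish 𝓑 𝓜 n₀ m c q (cof (signInv S B M d) f))
    (hE : ∀ {k₁ k₂ q' p u w}, Block 𝓑 𝓜 n₀ m c k₁ k₂ q' p u w → p.length + (u.length + w.length) = n + 1 →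
      cof (signInv S B M d) f (wd S p * ((wd S u - barDiff (signInv S B M d) (s (wd S u)) -
        s (barDiff (signInv S B M d) (wd S u))) * wd S w)) = 0) :
    Vanish 𝓑 𝓜 n₀ m c (q + 1) (cof (signInv S B M d) (f +
      SqZero.hochD (signInv S B M d) n (-(m * d : ℤ)) (SqZero.correction 𝓑 𝓜 d m c s f))) where
  block {k₁ k₂ q' p u w} hb hq := by
    by_cases hlen : p.length + (u.length + w.length) = n + 1
    · have hmem := wd_mem_startSpan (S := S) hb.mid
      obtain ⟨j, hj⟩ : ∃ j, u.length = j + 1 := ⟨u.length - 1, by have := hb.mid.length_pos hm; omega⟩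
      have hDmem := barDiff_mem_startSpan (d := d) hG (hj ▸ hmem)
      -- The cocycle condition on `p (s u) w`: all terms except the bar differential of `s u`
      -- vanish, so `f` is zero on `p (D (s u)) w`.
      have e1 := h.hochD_span hG hd hm hf.1 hb (by omega) (hs hmem)
      rw [LinearMap.mem_ker.1 hf.2, cof_zero, LinearMap.zero_apply, eq_comm, neg_smul, neg_eq_zero] at e1
      replace e1 := congrArg ((-1 : S) ^ p.length • ·) e1
      simp only [smul_smul, ← mul_pow, mul_neg, mul_one, neg_neg, one_pow, one_smul, smul_zero] at e1
      -- On `p u w` the added coboundary equals minus the value of `f` on `p (s (D u)) w`. Together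
      -- with the preceding identity, the corrected cocycle takes on `p u w` the value of `f` on the
      -- defect `u - D (s u) - s (D u)` of the homotopy.
      have e2 := (h.correction hG hs).hochD_span hG hd hm (correction_mem hG hd hc hs hf.1) hb (by omega) hmem
      rw [cof_correction_block hG hs f hb hDmem, smul_smul, neg_mul, ← mul_pow] at e2
      have e3 := hE hb hlen
      rw [sub_mul, sub_mul, mul_sub, mul_sub, map_sub, map_sub, e1, sub_zero] at e3
      rw [cof_add, LinearMap.add_apply, e2]
      simpa [sub_eq_add_neg] using e3
    · rw [cof_block_of_ne _ (wd_mem_startSpan hb.mid) hlen]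
  low hl hm' := by
    rw [cof_add, LinearMap.add_apply, h.low hl hm', cof_hochD_correction_low hG hd hm hc hs hf.1 hl hm', add_zero]

end Correction

open TrivSqZeroExt (inl inr)

theorem exists_word_eval {S A : Type*} [CommRing S] [Ring A] [Algebra S A] {𝒜 : ℤ → ℤ → Submodule S A}
    {σ : A →ₗ[S] A} (H : IsSignedBigrading 𝒜 σ) {n : ℕ} (a : Fin n → A) :
    ∃ l : List A, l.length = n ∧
      ∀ f : MultilinearMap S (fun _ : Fin n => A) A, cof σ f (wd S l) = f a := by
  refine ⟨twist σ n fun i => if hi : i < n then a ⟨i, hi⟩ else 0, by simp, fun f => ?_⟩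
  rw [cof_twist H.sigma_sigma]
  congr 1
  funext i
  rw [dif_pos i.2]

/-! ### Iterating the corrections: vanishing of Hochschild cohomology. -/

section Iteration

variable {S B M : Type*} [CommRing S] [Ring B] [Algebra S B] [AddCommGroup M] [Module S M]
  [Module B M] [Module Bᵐᵒᵖ M] [SMulCommClass B Bᵐᵒᵖ M] [IsScalarTower S B M]
  [IsScalarTower S Bᵐᵒᵖ M]
  {𝓑 : ℕ → Submodule S B} [GradedAlgebra 𝓑] {𝓜 : ℤ → Submodule S M} {d n : ℕ} {n₀ : ℤ}

theorem exists_word_eval_squareZero_aux (H : IsSignedBigrading (bigrading 𝓑 𝓜 d) (signInv S B M d))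
    (a : Fin n → TrivSqZeroExt B M) :
    ∃ l : List (TrivSqZeroExt B M), l.length = n ∧
      ∀ f : MultilinearMap S (fun _ : Fin n => TrivSqZeroExt B M) (TrivSqZeroExt B M),
        cof (signInv S B M d) f (wd S l) = f a := exists_word_eval H a

theorem exists_word_eval_squareZero (hG : IsGradedBimodule 𝓑 𝓜) (a : Fin n → TrivSqZeroExt B M) :
    ∃ l : List (TrivSqZeroExt B M), l.length = n ∧
      ∀ f : MultilinearMap S (fun _ : Fin n => TrivSqZeroExt B M) (TrivSqZeroExt B M),
        cof (signInv S B M d) f (wd S l) = f a := exists_word_eval_squareZero_aux (isSignedBigrading hG) a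

theorem cof_kill_squareZero_aux (H : IsSignedBigrading (bigrading 𝓑 𝓜 d) (signInv S B M d)) {j : ℤ}
    {f : MultilinearMap S (fun _ : Fin n => TrivSqZeroExt B M) (TrivSqZeroExt B M)}
    (hf : f ∈ cochains (bigrading 𝓑 𝓜 d) n j) {l : List (TrivSqZeroExt B M)} (hl : 1 ∈ l) :
    cof (signInv S B M d) f (wd S l) = 0 := cof_kill H hf hl

theorem cof_kill_squareZero (hG : IsGradedBimodule 𝓑 𝓜) {j : ℤ}
    {f : MultilinearMap S (fun _ : Fin n => TrivSqZeroExt B M) (TrivSqZeroExt B M)}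
    (hf : f ∈ cochains (bigrading 𝓑 𝓜 d) n j) {l : List (TrivSqZeroExt B M)} (hl : 1 ∈ l) :
    cof (signInv S B M d) f (wd S l) = 0 := cof_kill_squareZero_aux (isSignedBigrading hG) hf hl

theorem hochD_mem_cocycles_aux (H : IsSignedBigrading (bigrading 𝓑 𝓜 d) (signInv S B M d)) (hd : 1 ≤ d)
    {m : ℕ} (hm : 1 ≤ m) {g : MultilinearMap S (fun _ : Fin n => TrivSqZeroExt B M) (TrivSqZeroExt B M)}
    (hg : g ∈ cochains (bigrading 𝓑 𝓜 d) n (-(m * d : ℤ))) :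
    hochD (signInv S B M d) n (-(m * d : ℤ)) g ∈
      cocycles (bigrading 𝓑 𝓜 d) (signInv S B M d) (n + 1) (-(m * d : ℤ)) := by
  rcases Nat.eq_zero_or_pos n with rfl | hn
  · rw [cochains_zero_eq_zero hd hm hg, map_zero]; exact Submodule.zero_mem _
  · exact ⟨hochD_mem_cochains H hn hg, hochD_hochD H hn hg.2⟩

theorem hochD_mem_cocycles (hG : IsGradedBimodule 𝓑 𝓜) (hd : 1 ≤ d)
    {m : ℕ} (hm : 1 ≤ m) {g : MultilinearMap S (fun _ : Fin n => TrivSqZeroExt B M) (TrivSqZeroExt B M)}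
    (hg : g ∈ cochains (bigrading 𝓑 𝓜 d) n (-(m * d : ℤ))) :
    hochD (signInv S B M d) n (-(m * d : ℤ)) g ∈
      cocycles (bigrading 𝓑 𝓜 d) (signInv S B M d) (n + 1) (-(m * d : ℤ)) :=
  hochD_mem_cocycles_aux (isSignedBigrading hG) hd hm hg

variable [DirectSum.Decomposition 𝓜]

variable (𝓑 𝓜 d) in
/-- The successive corrections of a cocycle. -/
def correctionSeq (m c : ℕ) (s : WordAlg S (TrivSqZeroExt B M) →ₗ[S] WordAlg S (TrivSqZeroExt B M))
    (f : MultilinearMap S (fun _ : Fin (n + 1) => TrivSqZeroExt B M) (TrivSqZeroExt B M)) :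
    ℕ → MultilinearMap S (fun _ : Fin (n + 1) => TrivSqZeroExt B M) (TrivSqZeroExt B M)
  | 0 => f
  | q + 1 => correctionSeq m c s f q +
      hochD (signInv S B M d) n (-(m * d : ℤ)) (correction 𝓑 𝓜 d m c s (correctionSeq m c s f q))

variable {m c : ℕ} {s : WordAlg S (TrivSqZeroExt B M) →ₗ[S] WordAlg S (TrivSqZeroExt B M)}

theorem correctionSeq_eq_sum
    (f : MultilinearMap S (fun _ : Fin (n + 1) => TrivSqZeroExt B M) (TrivSqZeroExt B M)) (Q : ℕ) :
    correctionSeq 𝓑 𝓜 d m c s f Q = f + ∑ q ∈ Finset.range Q, hochD (signInv S B M d) n (-(m * d : ℤ))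
      (correction 𝓑 𝓜 d m c s (correctionSeq 𝓑 𝓜 d m c s f q)) := by
  induction Q with
  | zero => simp [correctionSeq]
  | succ Q ih => rw [Finset.sum_range_succ, ← add_assoc, ← ih]; rfl

/-- A negative weight means, for an empty suffix, that the total degree is negative, while the value
lies in `B`; and otherwise that the leading letter of the suffix has degree greater than `n₀`, so
that it is zero. -/
theorem vanish_zero (hG : IsGradedBimodule 𝓑 𝓜) (hd : 1 ≤ d) (hbdd : ∀ n, n₀ < n → 𝓜 n = ⊥)
    {f : MultilinearMap S (fun _ : Fin n => TrivSqZeroExt B M) (TrivSqZeroExt B M)}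
    (hf : f ∈ cochains (bigrading 𝓑 𝓜 d) n (-(m * d : ℤ)))
    (hlow : ∀ {m' k l}, Typed 𝓑 𝓜 m' k l → m' + 1 = m + c → cof (signInv S B M d) f (wd S l) = 0) :
    Vanish 𝓑 𝓜 n₀ m c 0 (cof (signInv S B M d) f) where
  low := hlow
  block {k₁ k₂ q' p u w} hb hq := by
    obtain ⟨hp, hu, r, hw, rfl⟩ := hb
    cases hw with
    | nil =>
      rw [wd_nil, mul_one, ← wd_append]
      exact cof_eq_zero_of_neg hG hd hf (k := k₁ + k₂) (by simp at hq; omega)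
        (hp.append' hu.typed (by simp) rfl)
    | @cons e k x t hx ht =>
      rw [hbdd e (by simp at hq; omega)] at hx
      rw [(Submodule.mem_bot S).1 hx, wd_cons, TrivSqZeroExt.inr_zero, map_zero]
      simp

/-- A cocycle is cohomologous to one which vanishes on all words with `m + c` letters from `M`. -/
theorem exists_vanish (hG : IsGradedBimodule 𝓑 𝓜) (hd : 1 ≤ d) (hm : 1 ≤ m) (hc : c ≤ 1)
    (hbdd : ∀ n, n₀ < n → 𝓜 n = ⊥)
    (hs : ∀ {n k z}, z ∈ startSpan S 𝓑 𝓜 m n k → s z ∈ startSpan S 𝓑 𝓜 m (n + 1) k)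
    {f : MultilinearMap S (fun _ : Fin (n + 1) => TrivSqZeroExt B M) (TrivSqZeroExt B M)}
    (hf : f ∈ cocycles (bigrading 𝓑 𝓜 d) (signInv S B M d) (n + 1) (-(m * d : ℤ)))
    (hlow : ∀ {m' k l}, Typed 𝓑 𝓜 m' k l → m' + 1 = m + c → cof (signInv S B M d) f (wd S l) = 0)
    (hE : ∀ f' ∈ cocycles (bigrading 𝓑 𝓜 d) (signInv S B M d) (n + 1) (-(m * d : ℤ)),
      f' - f ∈ coboundaries (bigrading 𝓑 𝓜 d) (signInv S B M d) (n + 1) (-(m * d : ℤ)) →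
      ∀ {k₁ k₂ q' p u w}, Block 𝓑 𝓜 n₀ m c k₁ k₂ q' p u w → p.length + (u.length + w.length) = n + 1 →
      cof (signInv S B M d) f' (wd S p * ((wd S u - barDiff (signInv S B M d) (s (wd S u)) -
        s (barDiff (signInv S B M d) (wd S u))) * wd S w)) = 0) :
    ∃ g ∈ cochains (bigrading 𝓑 𝓜 d) n (-(m * d : ℤ)),
      ∀ {m' k l}, Typed 𝓑 𝓜 m' k l → (m' = m + c ∨ m' + 1 = m + c) →
        cof (signInv S B M d) (f + hochD (signInv S B M d) n (-(m * d : ℤ)) g) (wd S l) = 0 := by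
  have key : ∀ q : ℕ, correctionSeq 𝓑 𝓜 d m c s f q ∈
        cocycles (bigrading 𝓑 𝓜 d) (signInv S B M d) (n + 1) (-(m * d : ℤ)) ∧
      correctionSeq 𝓑 𝓜 d m c s f q - f ∈
        coboundaries (bigrading 𝓑 𝓜 d) (signInv S B M d) (n + 1) (-(m * d : ℤ)) ∧
      Vanish 𝓑 𝓜 n₀ m c q (cof (signInv S B M d) (correctionSeq 𝓑 𝓜 d m c s f q)) := by
    intro q
    induction q with
    | zero =>
      refine ⟨hf, ?_, ?_⟩
      · rw [correctionSeq, sub_self]; exact Submodule.zero_mem _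
      · exact vanish_zero hG hd hbdd hf.1 hlow
    | succ q ih =>
      obtain ⟨h1, h2, h3⟩ := ih
      have hcm := correction_mem hG hd hc hs h1.1
      refine ⟨Submodule.add_mem _ h1 (hochD_mem_cocycles hG hd hm hcm), ?_, ?_⟩
      · rw [correctionSeq, add_sub_right_comm]
        exact Submodule.add_mem _ h2 ⟨_, hcm, rfl⟩
      · rw [Nat.cast_succ]
        exact h3.step hG hd hm hc hs h1 (hE _ h1 h2)
  have hcm := fun q => correction_mem (c := c) hG hd hc hs (key q).1.1
  -- A given block word has a fixed weight, and the correction at stage `q` vanishes on all weights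
  -- below `q`; hence only finitely many corrections affect it.
  have hloc : ∀ z, ∀ᶠ q in Filter.atTop,
      cof (signInv S B M d) (correction 𝓑 𝓜 d m c s (correctionSeq 𝓑 𝓜 d m c s f q)) z = 0 := by
    intro z
    have hz : z ∈ Submodule.span S {z : WordAlg S (TrivSqZeroExt B M) |
      ∃ l, (1 ∈ l ∨ ∃ m k, Typed 𝓑 𝓜 m k l) ∧ z = wd S l} := span_typed_or_one hG ▸ Submodule.mem_top
    induction hz using Submodule.span_induction with
    | zero => simp
    | add z w _ _ hz hw => filter_upwards [hz, hw] with q h1 h2; rw [map_add, h1, h2, add_zero]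
    | smul r z _ hz => filter_upwards [hz] with q h1; rw [map_smul, h1, smul_zero]
    | mem z hz =>
      obtain ⟨l, h1 | ⟨m', k', hl⟩, rfl⟩ := hz
      · exact Filter.Eventually.of_forall fun q => cof_kill_squareZero hG (hcm q) h1
      · by_cases hm' : m' = m + c
        · subst hm'
          obtain ⟨k₁, k₂, k₃, q₀, p, u, w, hb, hw, rfl, rfl⟩ := hl.exists_block n₀ hc
          refine Filter.eventually_atTop.2 ⟨(q₀ + 1).toNat, fun q hq => ?_⟩
          rw [wd_append, wd_append]
          exact ((key q).2.2.correction hG hs).block hb (by omega)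
        · exact Filter.Eventually.of_forall fun q => cof_correction_of_ne hG _ hm' hl
  obtain ⟨g, hg, hsum⟩ := exists_locally_finite_sum (signInv S B M d) hcm fun a => by
    obtain ⟨l, -, hl⟩ := exists_word_eval_squareZero (d := d) hG a
    filter_upwards [hloc (wd S l)] with q hq
    rw [← hl, hq]
  -- The limit coincides on each word with the cocycle corrected sufficiently often, so it inherits
  -- the vanishing in every weight.
  have hlim : ∀ l, ∀ᶠ Q in Filter.atTop,
      cof (signInv S B M d) (f + hochD (signInv S B M d) n (-(m * d : ℤ)) g) (wd S l) =
        cof (signInv S B M d) (correctionSeq 𝓑 𝓜 d m c s f Q) (wd S l) := by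
    intro l
    by_cases hl : l.length = n + 1
    · filter_upwards [hsum fun i => ((signInv S B M d) ^ (n + 1 - 1 - i.val)) (l.getD i.val 0)] with Q hQ
      rw [cof_of_length _ hl, cof_of_length _ hl, correctionSeq_eq_sum, add_apply, add_apply, hQ, sum_apply]
    · exact Filter.Eventually.of_forall fun Q => by rw [cof_of_ne _ hl, cof_of_ne _ hl]
  refine ⟨g, hg, fun {m' k l} hl hm' => ?_⟩
  rcases hm' with rfl | hm'
  · obtain ⟨k₁, k₂, k₃, q₀, p, u, w, hb, hw, rfl, rfl⟩ := hl.exists_block n₀ hc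
    obtain ⟨Q, h1, h2⟩ := ((hlim _).and (Filter.eventually_ge_atTop (q₀ + 1).toNat)).exists
    rw [h1, wd_append, wd_append]
    exact (key Q).2.2.block hb (by omega)
  · obtain ⟨Q, hQ⟩ := (hlim l).exists
    rw [hQ]
    exact (key Q).2.2.low hl hm'

/-- A cocycle is a coboundary as soon as it vanishes on the defect of a partial contraction. -/
theorem mem_coboundaries_of_defect (hG : IsGradedBimodule 𝓑 𝓜) (hd : 1 ≤ d) (hm : 1 ≤ m)
    (hbdd : ∀ n, n₀ < n → 𝓜 n = ⊥)
    (hs : ∀ {n k z}, z ∈ startSpan S 𝓑 𝓜 m n k → s z ∈ startSpan S 𝓑 𝓜 m (n + 1) k)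
    {f : MultilinearMap S (fun _ : Fin (n + 1) => TrivSqZeroExt B M) (TrivSqZeroExt B M)}
    (hf : f ∈ cocycles (bigrading 𝓑 𝓜 d) (signInv S B M d) (n + 1) (-(m * d : ℤ)))
    (hE : ∀ f' ∈ cocycles (bigrading 𝓑 𝓜 d) (signInv S B M d) (n + 1) (-(m * d : ℤ)),
      f' - f ∈ coboundaries (bigrading 𝓑 𝓜 d) (signInv S B M d) (n + 1) (-(m * d : ℤ)) →
      ∀ {c k₁ k₂ q' p u w}, Block 𝓑 𝓜 n₀ m c k₁ k₂ q' p u w → p.length + (u.length + w.length) = n + 1 →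
      cof (signInv S B M d) f' (wd S p * ((wd S u - barDiff (signInv S B M d) (s (wd S u)) -
        s (barDiff (signInv S B M d) (wd S u))) * wd S w)) = 0) :
    f ∈ coboundaries (bigrading 𝓑 𝓜 d) (signInv S B M d) (n + 1) (-(m * d : ℤ)) := by
  -- The values in `B`, on words with `m` letters from `M`, are removed before those in `M`: for `c
  -- = 1` the outer terms of the differential involve words with `m` letters from `M`, on which the
  -- cocycle has to vanish already.
  obtain ⟨g, hg, hg0⟩ := exists_vanish (c := 0) hG hd hm (by omega) hbdd hs hf
    (fun hl h => cof_eq_zero_of_ne hG hd hf.1 hl (by omega) (by omega)) fun f' h1 h2 => hE f' h1 h2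
  have hf1 := Submodule.add_mem _ hf (hochD_mem_cocycles hG hd hm hg)
  obtain ⟨g', hg', hg'0⟩ := exists_vanish (c := 1) hG hd hm le_rfl hbdd hs hf1
    (fun hl h => hg0 hl (by omega)) fun f' h1 h2 => hE f' h1 (by
      have := Submodule.add_mem _ h2 (show hochD (signInv S B M d) n (-(m * d : ℤ)) g ∈
        coboundaries (bigrading 𝓑 𝓜 d) (signInv S B M d) (n + 1) (-(m * d : ℤ)) from ⟨g, hg, rfl⟩)
      convert this using 1
      abel)
  have hf2 := Submodule.add_mem _ hf1 (hochD_mem_cocycles hG hd hm hg')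
  have h0 : f + hochD (signInv S B M d) n (-(m * d : ℤ)) g + hochD (signInv S B M d) n (-(m * d : ℤ)) g' = 0 := by
    refine eq_zero_of_typed hG hf2.1 fun {m' k l} hl => ?_
    by_cases h1 : m' = m
    · exact hg'0 hl (by omega)
    · by_cases h2 : m' = m + 1
      · exact hg'0 hl (by omega)
      · exact cof_eq_zero_of_ne hG hd hf2.1 hl h1 h2
  refine ⟨-(g + g'), Submodule.neg_mem _ (Submodule.add_mem _ hg hg'), ?_⟩
  rw [map_neg, map_add, eq_comm, ← add_eq_zero_iff_eq_neg, ← add_assoc]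
  exact h0

/-- The vanishing of the Hochschild cohomology in low degrees. -/
theorem cocycles_le_coboundaries (hG : IsGradedBimodule 𝓑 𝓜) (hd : 1 ≤ d) (hm : 1 ≤ m)
    (hbdd : ∀ n, n₀ < n → 𝓜 n = ⊥) (hs : IsContraction 𝓑 𝓜 d m s) (hn : n < m * (d + 2)) :
    cocycles (bigrading 𝓑 𝓜 d) (signInv S B M d) n (-(m * d : ℤ)) ≤
      coboundaries (bigrading 𝓑 𝓜 d) (signInv S B M d) n (-(m * d : ℤ)) := by
  intro f hf
  cases n with
  | zero => rw [cochains_zero_eq_zero hd hm hf.1]; exact Submodule.zero_mem _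
  | succ n =>
    refine mem_coboundaries_of_defect hG hd hm hbdd hs.mem hf fun f' _ _ {c k₁ k₂ q' p u w} hb hlen => ?_
    rw [sub_sub, hs.homotopy (wd_mem_startSpan hb.mid) (by omega), sub_self]
    simp

end Iteration

open TrivSqZeroExt (inl inr)

/-! ### The classification for the square-zero extension. -/

section Evaluation

variable {S B M : Type*} [CommRing S] [Ring B] [Algebra S B] [AddCommGroup M] [Module S M]
  [Module B M] [Module Bᵐᵒᵖ M] [SMulCommClass B Bᵐᵒᵖ M] [IsScalarTower S B M]
  [IsScalarTower S Bᵐᵒᵖ M]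
  {𝓑 : ℕ → Submodule S B} [GradedAlgebra 𝓑] {𝓜 : ℤ → Submodule S M} {d n : ℕ} {n₀ : ℤ}

/-- All homological degrees of `A` are multiples of `d`. -/
theorem cochains_eq_bot_of_not_dvd (hG : IsGradedBimodule 𝓑 𝓜) {r : ℕ} (hr : ¬ d ∣ r) :
    cochains (bigrading 𝓑 𝓜 d) n (-r : ℤ) = ⊥ := by
  refine eq_bot_iff.2 fun f hf => (Submodule.mem_bot S).2 (eq_zero_of_typed hG hf fun {m k l} hl => ?_)
  refine bigrading_eq_zero (fun h => hr ?_) (fun h => hr ?_) (cof_mem_bigrading hG hf hl)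
  · exact Int.natCast_dvd_natCast.1 ⟨m, by linarith⟩
  · exact Int.natCast_dvd_natCast.1 ⟨m - 1, by linarith⟩

theorem classification_squareZero_aux (H : IsSignedBigrading (bigrading 𝓑 𝓜 d) (signInv S B M d)) (hd : 1 ≤ d)
    (hz : ∀ r : ℕ, 1 ≤ r → r < d → ∀ n, cochains (bigrading 𝓑 𝓜 d) n (-r) = ⊥)
    (hv : ∀ r n : ℕ, d < r → (n = r + 2 ∨ n = r + 3) → cocycles (bigrading 𝓑 𝓜 d) (signInv S B M d) n (-r) ≤
      coboundaries (bigrading 𝓑 𝓜 d) (signInv S B M d) n (-r)) :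
    Equivalence (GaugeEquiv : AInf 𝓑 𝓜 d → AInf 𝓑 𝓜 d → Prop) ∧
      ∃ Φ : Quot (GaugeEquiv : AInf 𝓑 𝓜 d → AInf 𝓑 𝓜 d → Prop) → HH 𝓑 𝓜 d (d + 2) (-d : ℤ),
        Function.Bijective Φ ∧
        ∀ μ : AInf 𝓑 𝓜 d,
          ∃ hμ : μ.m (d + 2) ∈ cocycles (bigrading 𝓑 𝓜 d) (signInv S B M d) (d + 2) (-d : ℤ),
            Φ (Quot.mk _ μ) = hochClass _ _ _ _ (μ.m (d + 2)) hμ := classification H hd hz hv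

variable [DirectSum.Decomposition 𝓜]
  {s π : WordAlg S (TrivSqZeroExt B M) →ₗ[S] WordAlg S (TrivSqZeroExt B M)}

/-- If `r = d m` with `r > d` then `m ≥ 2`, and so `n ≤ r + 3 < r + 2 m = m (d + 2)`, which is the
range of the contraction. -/
theorem cocycles_le_coboundaries_of_lt (hG : IsGradedBimodule 𝓑 𝓜) (hd : 1 ≤ d)
    (hbdd : ∀ n, n₀ < n → 𝓜 n = ⊥) (hW : IsBarSplitting 𝓑 𝓜 d s π) {r n : ℕ} (hr : d < r)
    (hn : n = r + 2 ∨ n = r + 3) :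
    cocycles (bigrading 𝓑 𝓜 d) (signInv S B M d) n (-r : ℤ) ≤
      coboundaries (bigrading 𝓑 𝓜 d) (signInv S B M d) n (-r : ℤ) := by
  by_cases hdvd : d ∣ r
  · obtain ⟨m, rfl⟩ := hdvd
    have hm : 2 ≤ m := by
      by_contra h
      interval_cases m <;> omega
    obtain ⟨σ, hσ⟩ := exists_isContraction hG hW (m := m) (by omega)
    rw [show (-((d * m : ℕ) : ℤ)) = -(m * d : ℤ) by push_cast; ring]
    exact cocycles_le_coboundaries hG hd (by omega) hbdd hσ (by rw [mul_add, mul_comm m d]; omega)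
  · intro f hf
    have h := hf.1
    rw [cochains_eq_bot_of_not_dvd hG hdvd] at h
    rw [(Submodule.mem_bot S).1 h]
    exact Submodule.zero_mem _

theorem classification_squareZero (hG : IsGradedBimodule 𝓑 𝓜) (hd : 1 ≤ d)
    (hbdd : ∀ n, n₀ < n → 𝓜 n = ⊥) (hW : IsBarSplitting 𝓑 𝓜 d s π) :
    Equivalence (GaugeEquiv : AInf 𝓑 𝓜 d → AInf 𝓑 𝓜 d → Prop) ∧
      ∃ Φ : Quot (GaugeEquiv : AInf 𝓑 𝓜 d → AInf 𝓑 𝓜 d → Prop) → HH 𝓑 𝓜 d (d + 2) (-d : ℤ),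
        Function.Bijective Φ ∧
        ∀ μ : AInf 𝓑 𝓜 d,
          ∃ hμ : μ.m (d + 2) ∈ cocycles (bigrading 𝓑 𝓜 d) (signInv S B M d) (d + 2) (-d : ℤ),
            Φ (Quot.mk _ μ) = hochClass _ _ _ _ (μ.m (d + 2)) hμ :=
  classification_squareZero_aux (isSignedBigrading hG) hd
    (fun r h1 h2 n => cochains_eq_bot_of_not_dvd hG fun h => absurd (Nat.le_of_dvd h1 h) (by omega))
    fun r n h1 h2 => cocycles_le_coboundaries_of_lt hG hd hbdd hW h1 h2

end Evaluation

/-! ### Pairing Hochschild classes with the homology of the bar complex. -/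

section Pairing

variable {S B M : Type*} [CommRing S] [Ring B] [Algebra S B] [AddCommGroup M] [Module S M]
  [Module B M] [Module Bᵐᵒᵖ M] [SMulCommClass B Bᵐᵒᵖ M] [IsScalarTower S B M]
  [IsScalarTower S Bᵐᵒᵖ M]
  {𝓑 : ℕ → Submodule S B} [GradedAlgebra 𝓑] {𝓜 : ℤ → Submodule S M} {d n : ℕ} {n₀ j : ℤ}

theorem signInv_pow_inl (b : B) (k : ℕ) : (signInv S B M d ^ k) (inl b) = inl b := by
  induction k with
  | zero => rfl
  | succ k ih => rw [pow_succ, Module.End.mul_apply, signInv_inl, ih]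

theorem signInv_pow_inr (x : M) (k : ℕ) : (signInv S B M d ^ k) (inr x) = (-1 : S) ^ (d * k) • inr x := by
  induction k with
  | zero => simp
  | succ k ih => rw [pow_succ, Module.End.mul_apply, signInv_inr, map_smul, ih, smul_smul, ← pow_add,
      mul_add, mul_one, add_comm]

theorem cof_barWord (f : MultilinearMap S (fun _ : Fin (n + 1) => TrivSqZeroExt B M) (TrivSqZeroExt B M))
    (y : BarTerm S (plus 𝓑) M n) :
    cof (signInv S B M d) f (barWord M 𝓑 n y) = (-1 : S) ^ (d * n) • evalBar M 𝓑 f y := by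
  suffices h : cof (signInv S B M d) f ∘ₗ barWord M 𝓑 n = (-1 : S) ^ (d * n) • evalBar M 𝓑 f from
    LinearMap.congr_fun h y
  ext x b : 4
  simp only [TensorProduct.AlgebraTensorModule.curry_apply, LinearMap.restrictScalars_self,
    LinearMap.compMultilinearMap_apply, TensorProduct.curry_apply, LinearMap.comp_apply, LinearMap.smul_apply]
  rw [barWord_tmul, evalBar_tmul, cof_of_length _ (by simp), ← MultilinearMap.cons_smul]
  refine congrArg f (funext fun i => ?_)
  refine Fin.cases ?_ (fun i => ?_) i
  · simp [signInv_pow_inr]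
  · simp [signInv_pow_inl]

theorem cof_barWord_eq_zero_iff
    {f : MultilinearMap S (fun _ : Fin (n + 1) => TrivSqZeroExt B M) (TrivSqZeroExt B M)}
    {y : BarTerm S (plus 𝓑) M n} :
    cof (signInv S B M d) f (barWord M 𝓑 n y) = 0 ↔ evalBar M 𝓑 f y = 0 := by
  rw [cof_barWord, IsUnit.smul_eq_zero (((isUnit_one (M := S)).neg).pow _)]

theorem evalBar_add (f g : MultilinearMap S (fun _ : Fin (n + 1) => TrivSqZeroExt B M) (TrivSqZeroExt B M)) :
    evalBar M 𝓑 (f + g) = evalBar M 𝓑 f + evalBar M 𝓑 g := by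
  ext <;> simp [evalBar]

theorem evalBar_smul (c : S)
    (f : MultilinearMap S (fun _ : Fin (n + 1) => TrivSqZeroExt B M) (TrivSqZeroExt B M)) :
    evalBar M 𝓑 (c • f) = c • evalBar M 𝓑 f := by
  ext <;> simp [evalBar]

/-- On words of nonpositive degree with one letter from `M`, which is the first one, the outer terms of the
Hochschild differential vanish. -/
theorem cof_hochD_startSpan (hG : IsGradedBimodule 𝓑 𝓜) (hd : 1 ≤ d) (hj : j = -((1 : ℕ) * d : ℤ))
    {g : MultilinearMap S (fun _ : Fin n => TrivSqZeroExt B M) (TrivSqZeroExt B M)}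
    (hg : g ∈ cochains (bigrading 𝓑 𝓜 d) n j) {z : WordAlg S (TrivSqZeroExt B M)}
    (hz : z ∈ startSpan S 𝓑 𝓜 1 (n + 1) 0) :
    cof (signInv S B M d) (hochD (signInv S B M d) n j g) z =
      - cof (signInv S B M d) g (barDiff (signInv S B M d) z) := by
  subst hj
  induction hz using Submodule.span_induction with
  | zero => simp
  | add z w _ _ hz hw => rw [map_add, map_add, map_add, hz, hw, neg_add]
  | smul c z _ hz => rw [map_smul, map_smul, map_smul, hz, smul_neg]
  | mem z hz =>
    obtain ⟨l, hl, hlen, rfl⟩ := hz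
    refine cof_hochD_typed hG hd le_rfl hg hlen ?_ ?_
    · rintro a w rfl
      rcases hl with ⟨h, -⟩ | ⟨m', e, k', x, t, hm, -, hx, ht, h⟩
      · omega
      obtain rfl : m' = 0 := by omega
      rw [(List.cons.inj h).2]
      exact cof_eq_zero_of_ne hG hd hg ht (by omega) (by omega)
    · rintro v x rfl
      rcases hl.exists_concat with ⟨h, -⟩ | ⟨u, c, b, k', hc, hb, hu, hk, h⟩ | ⟨u, e, y, k', m', hy, hu, hm, hk, h⟩
      · omega
      · rw [(List.append_inj' h rfl).1]
        exact cof_eq_zero_of_neg hG hd hg (k := k') (by omega) hu.typed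
      · rw [(List.append_inj' h rfl).1]
        exact cof_eq_zero_of_ne hG hd hg hu.typed (by omega) (by omega)

/-- One letter from `M` and the degree `-d` of the cochain give homological degree `0`; in internal
degree `0` the value lies in `B_0`, which is the image of `S`. -/
theorem evalBar_mem [DirectSum.Decomposition 𝓜] (hG : IsGradedBimodule 𝓑 𝓜) (hd : 1 ≤ d)
    {f : MultilinearMap S (fun _ : Fin (n + 1) => TrivSqZeroExt B M) (TrivSqZeroExt B M)}
    (hf : f ∈ cochains (bigrading 𝓑 𝓜 d) (n + 1) (-d : ℤ)) {y : BarTerm S (plus 𝓑) M n}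
    (hy : y ∈ barDegree (plusDegree 𝓑) 𝓜 n 0) :
    ∃ c : S, algebraMap S (TrivSqZeroExt B M) c = evalBar M 𝓑 f y := by
  have h := cof_mem_of_typedSpan hG hf (startSpan_le (barWord_mem hy))
  rw [cof_barWord, Submodule.smul_mem_iff_of_isUnit _ (((isUnit_one (M := S)).neg).pow _)] at h
  obtain ⟨h1, h2⟩ := h
  rw [if_pos (by simp)] at h1
  rw [if_neg (by simp; omega), Submodule.mem_bot] at h2
  obtain ⟨c, hc⟩ := hG.surj _ h1
  exact ⟨c, TrivSqZeroExt.ext hc h2.symm⟩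

theorem barDiff_barWord_of_mem_barCycles {y : BarTerm S (plus 𝓑) M (n + 1)}
    (hy : y ∈ barCycles (plusMul 𝓑) (plusRight M 𝓑) (n + 1)) :
    barDiff (signInv S B M d) (barWord M 𝓑 (n + 1) y) = 0 := by
  rw [barDiff_barWord, LinearMap.mem_ker.1 hy, map_zero, smul_zero]

theorem mem_barCycles_of_barDiff_barWord {y : BarTerm S (plus 𝓑) M (n + 1)}
    (hy : barDiff (signInv S B M d) (barWord M 𝓑 (n + 1) y) = 0) :
    y ∈ barCycles (plusMul 𝓑) (plusRight M 𝓑) (n + 1) := by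
  rw [barDiff_barWord, IsUnit.smul_eq_zero (((isUnit_one (M := S)).neg).pow _)] at hy
  exact barWord_injective n (hy.trans (map_zero _).symm)

theorem evalBar_coboundary (hG : IsGradedBimodule 𝓑 𝓜) (hd : 1 ≤ d)
    {f : MultilinearMap S (fun _ : Fin (n + 2) => TrivSqZeroExt B M) (TrivSqZeroExt B M)}
    (hf : f ∈ coboundaries (bigrading 𝓑 𝓜 d) (signInv S B M d) (n + 2) (-d : ℤ))
    {y : BarTerm S (plus 𝓑) M (n + 1)} (hy : y ∈ barDegree (plusDegree 𝓑) 𝓜 (n + 1) 0)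
    (hc : y ∈ barCycles (plusMul 𝓑) (plusRight M 𝓑) (n + 1)) : evalBar M 𝓑 f y = 0 := by
  obtain ⟨g, hg, rfl⟩ := hf
  rw [← cof_barWord_eq_zero_iff (d := d), cof_hochD_startSpan hG hd (by simp) hg (barWord_mem hy),
    barDiff_barWord_of_mem_barCycles hc, map_zero, neg_zero]

variable [DirectSum.Decomposition 𝓜]
  {s π : WordAlg S (TrivSqZeroExt B M) →ₗ[S] WordAlg S (TrivSqZeroExt B M)}

/-- The element bounded by `y` may be inhomogeneous. Its component of degree `0` has the same
boundary, and the outer terms of the Hochschild differential vanish on it. -/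
theorem evalBar_boundary (hG : IsGradedBimodule 𝓑 𝓜) (hd : 1 ≤ d)
    {f : MultilinearMap S (fun _ : Fin (n + 1) => TrivSqZeroExt B M) (TrivSqZeroExt B M)}
    (hf : f ∈ cocycles (bigrading 𝓑 𝓜 d) (signInv S B M d) (n + 1) (-d : ℤ))
    {y : BarTerm S (plus 𝓑) M n} (hy : y ∈ barDegree (plusDegree 𝓑) 𝓜 n 0)
    (hb : y ∈ barBoundaries (plusMul 𝓑) (plusRight M 𝓑) n) : evalBar M 𝓑 f y = 0 := by
  obtain ⟨e, rfl⟩ := hb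
  have he := barWord_mem_startAll (𝓜 := 𝓜) hG e
  have h1 := cof_hochD_startSpan hG hd (by simp) hf.1 (pr_mem_startSpan he 0)
  rw [LinearMap.mem_ker.1 hf.2, cof_zero, LinearMap.zero_apply, eq_comm, neg_eq_zero,
    ← pr_barDiff_of_mem_startAll hG he, barDiff_barWord, map_smul,
    pr_of_mem (startSpan_le_typedAll (barWord_mem hy)), map_smul,
    IsUnit.smul_eq_zero (((isUnit_one (M := S)).neg).pow _)] at h1
  exact cof_barWord_eq_zero_iff.1 h1

/-- The homotopy formula extended to inhomogeneous elements of the bar complex; there `π` retains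
only the part of internal degree `0`. -/
theorem IsBarSplitting.exists_of_mem_startAll (hW : IsBarSplitting 𝓑 𝓜 d s π)
    {z : WordAlg S (TrivSqZeroExt B M)} (hz : z ∈ startAll S 𝓑 𝓜 1 (d + 2)) :
    (∃ e, barWord M 𝓑 (d + 2) e = s z) ∧ π z ∈ startSpan S 𝓑 𝓜 1 (d + 2) 0 ∧
      barDiff (signInv S B M d) (s z) + s (barDiff (signInv S B M d) z) = z - π z := by
  induction hz using Submodule.span_induction with
  | zero => exact ⟨⟨0, by simp⟩, by simp, by simp⟩
  | add z w _ _ hz hw =>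
    obtain ⟨⟨e, he⟩, h1, h2⟩ := hz
    obtain ⟨⟨e', he'⟩, h1', h2'⟩ := hw
    refine ⟨⟨e + e', by rw [map_add, he, he', map_add]⟩, by rw [map_add]; exact Submodule.add_mem _ h1 h1', ?_⟩
    simp only [map_add]
    rw [add_add_add_comm, h2, h2']
    abel
  | smul c z _ hz =>
    obtain ⟨⟨e, he⟩, h1, h2⟩ := hz
    refine ⟨⟨c • e, by rw [map_smul, he, map_smul]⟩, by rw [map_smul]; exact Submodule.smul_mem _ c h1, ?_⟩
    simp only [map_smul]
    rw [← smul_add, h2, smul_sub]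
  | mem z hz =>
    obtain ⟨l, ⟨k, hl⟩, hlen, rfl⟩ := hz
    have hl' := wd_mem_startSpan (S := S) hl
    rw [hlen] at hl'
    obtain ⟨e, -, he⟩ := exists_mem_barDegree (hW.mem hl')
    refine ⟨⟨e, he⟩, ?_, hW.homotopy hl'⟩
    by_cases hk : k = 0
    · exact hk ▸ hW.proj_mem hl'
    · rw [hW.proj_eq_zero hl' (Or.inr hk)]; exact Submodule.zero_mem _

/-- Each class is represented by a cycle of internal degree `0`. -/
theorem exists_cycle_of_degree_zero (hG : IsGradedBimodule 𝓑 𝓜) (hW : IsBarSplitting 𝓑 𝓜 d s π)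
    (p : TorRight M 𝓑 (d + 1)) :
    ∃ y : barCycles (plusMul 𝓑) (plusRight M 𝓑) (d + 1),
      (y : BarTerm S (plus 𝓑) M (d + 1)) ∈ barDegree (plusDegree 𝓑) 𝓜 (d + 1) 0 ∧
      Subquot.mk _ (barBoundaries (plusMul 𝓑) (plusRight M 𝓑) (d + 1)) y = p := by
  obtain ⟨⟨y, hy⟩, rfl⟩ := subquot_mk_surjective _ _ p
  obtain ⟨⟨e, he⟩, h1, h2⟩ := hW.exists_of_mem_startAll (barWord_mem_startAll hG y)
  obtain ⟨y', hy', h⟩ := exists_mem_barDegree h1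
  -- For a cycle the homotopy formula says that it differs from its projection, which has degree
  -- `0`, by a boundary.
  rw [barDiff_barWord_of_mem_barCycles hy, map_zero, add_zero, ← he, barDiff_barWord, ← h, ← map_smul,
    ← map_sub] at h2
  have h3 := barWord_injective (d + 1) h2
  have hb : y' - y ∈ barBoundaries (plusMul 𝓑) (plusRight M 𝓑) (d + 1) :=
    ⟨-((-1 : S) ^ d • e), by rw [map_neg, map_smul, h3, neg_sub]⟩
  have hc : y' ∈ barCycles (plusMul 𝓑) (plusRight M 𝓑) (d + 1) := by
    have h4 : y' - y ∈ barCycles (plusMul 𝓑) (plusRight M 𝓑) (d + 1) := by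
      obtain ⟨e', he'⟩ := hb
      rw [← he']
      exact barD_barD hG e'
    have := Submodule.add_mem _ h4 hy
    rwa [sub_add_cancel] at this
  exact ⟨⟨y', hc⟩, hy', subquot_mk_eq_iff.2 hb⟩

/-- A cocycle which vanishes on the cycles of internal degree `0` is a coboundary. -/
theorem mem_coboundaries_of_evalBar (hG : IsGradedBimodule 𝓑 𝓜) (hd : 1 ≤ d)
    (hbdd : ∀ n, n₀ < n → 𝓜 n = ⊥) (hW : IsBarSplitting 𝓑 𝓜 d s π)
    {f : MultilinearMap S (fun _ : Fin (d + 2) => TrivSqZeroExt B M) (TrivSqZeroExt B M)}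
    (hf : f ∈ cocycles (bigrading 𝓑 𝓜 d) (signInv S B M d) (d + 2) (-d : ℤ))
    (h0 : ∀ y ∈ barDegree (plusDegree 𝓑) 𝓜 (d + 1) 0,
      y ∈ barCycles (plusMul 𝓑) (plusRight M 𝓑) (d + 1) → evalBar M 𝓑 f y = 0) :
    f ∈ coboundaries (bigrading 𝓑 𝓜 d) (signInv S B M d) (d + 2) (-d : ℤ) := by
  have hj : (-d : ℤ) = -((1 : ℕ) * d : ℤ) := by simp
  rw [hj] at hf ⊢
  refine mem_coboundaries_of_defect hG hd le_rfl hbdd hW.mem hf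
    fun f' _ hf' {c k₁ k₂ q' p u w} hb hlen => ?_
  rw [← hj] at hf'
  rw [sub_sub, hW.homotopy (wd_mem_startSpan hb.mid), sub_sub_cancel]
  -- The defect of the homotopy is `π u`, which vanishes unless `u` has length `d + 2` and degree
  -- `0`. Then `u` is the whole word, and `π u` is a bar cycle of degree `0`.
  by_cases hu : u.length = d + 2 ∧ k₂ = 0
  · obtain ⟨hu, rfl⟩ := hu
    obtain rfl : p = [] := List.eq_nil_of_length_eq_zero (by omega)
    obtain rfl : w = [] := List.eq_nil_of_length_eq_zero (by omega)
    have hu' := wd_mem_startSpan (S := S) hb.mid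
    rw [hu] at hu'
    obtain ⟨y, hy, h⟩ := exists_mem_barDegree (hW.proj_mem hu')
    have hc := mem_barCycles_of_barDiff_barWord (d := d) (by rw [h]; exact hW.diff_proj hu')
    rw [wd_nil, one_mul, mul_one, ← h, cof_barWord_eq_zero_iff, ← sub_add_cancel f' f, evalBar_add,
      LinearMap.add_apply, h0 y hy hc, evalBar_coboundary hG hd hf' hy hc, add_zero]
  · rw [hW.proj_eq_zero (wd_mem_startSpan hb.mid) (by tauto)]
    simp

/-- The evaluation of Hochschild classes on cycles of internal degree `0`. -/
theorem exists_evaluation (hG : IsGradedBimodule 𝓑 𝓜) (hd : 1 ≤ d)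
    (hbdd : ∀ n, n₀ < n → 𝓜 n = ⊥) (hW : IsBarSplitting 𝓑 𝓜 d s π) :
    ∃ Ψ : HH 𝓑 𝓜 d (d + 2) (-d : ℤ) →ₗ[S] Module.Dual S (TorRight M 𝓑 (d + 1)),
      Function.Injective Ψ ∧
      ∀ f (hf : f ∈ cocycles (bigrading 𝓑 𝓜 d) (signInv S B M d) (d + 2) (-d : ℤ)),
        ∀ y ∈ barDegree (plusDegree 𝓑) 𝓜 (d + 1) 0,
        ∀ hy : y ∈ barCycles (plusMul 𝓑) (plusRight M 𝓑) (d + 1),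
        algebraMap S (TrivSqZeroExt B M) (Ψ (hochClass _ _ _ _ f hf) (Subquot.mk _ _ ⟨y, hy⟩)) =
          evalBar M 𝓑 f y := by
  have hinj : Function.Injective (algebraMap S (TrivSqZeroExt B M)) := fun a b h =>
    hG.inj (congrArg TrivSqZeroExt.fst h)
  choose r hr0 hr using exists_cycle_of_degree_zero hG hW
  have hex : ∀ (f : cocycles (bigrading 𝓑 𝓜 d) (signInv S B M d) (d + 2) (-d : ℤ)) p,
      ∃ c : S, algebraMap S (TrivSqZeroExt B M) c = evalBar M 𝓑 f.1 (r p : BarTerm S (plus 𝓑) M (d + 1)) :=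
    fun f p => evalBar_mem hG hd f.2.1 (hr0 p)
  choose c hc using hex
  -- Independence of the representative of degree `0`; this is what makes the pairing linear in the
  -- class.
  have hcy : ∀ (f : cocycles (bigrading 𝓑 𝓜 d) (signInv S B M d) (d + 2) (-d : ℤ)),
      ∀ y : barCycles (plusMul 𝓑) (plusRight M 𝓑) (d + 1),
      (y : BarTerm S (plus 𝓑) M (d + 1)) ∈ barDegree (plusDegree 𝓑) 𝓜 (d + 1) 0 →
      algebraMap S (TrivSqZeroExt B M) (c f (Subquot.mk _ _ y)) = evalBar M 𝓑 f.1 y := by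
    intro f y hy0
    rw [hc, ← sub_eq_zero, ← map_sub]
    exact evalBar_boundary hG hd f.2 (Submodule.sub_mem _ (hr0 _) hy0) (subquot_mk_eq_iff.1 (hr _))
  let E : cocycles (bigrading 𝓑 𝓜 d) (signInv S B M d) (d + 2) (-d : ℤ) →ₗ[S]
      Module.Dual S (TorRight M 𝓑 (d + 1)) :=
    LinearMap.mk₂ S c
      (fun f g p => hinj (by
        rw [map_add, hc, hc, hc, Submodule.coe_add, evalBar_add, LinearMap.add_apply]))
      (fun a f p => hinj (by
        rw [smul_eq_mul, map_mul, hc, hc, Submodule.coe_smul, evalBar_smul, LinearMap.smul_apply,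
          Algebra.smul_def]))
      (fun f p q => hinj (by
        have := hcy f (r p + r q) (Submodule.add_mem _ (hr0 p) (hr0 q))
        rw [map_add (Subquot.mk _ _), hr, hr] at this
        rw [this, map_add, hc f p, hc f q, Submodule.coe_add, map_add]))
      (fun a f p => hinj (by
        have := hcy f (a • r p) (Submodule.smul_mem _ a (hr0 p))
        rw [map_smul (Subquot.mk _ _), hr] at this
        rw [this, smul_eq_mul, map_mul, hc f p, ← Algebra.smul_def, Submodule.coe_smul, map_smul]))
  have hE : ∀ f p, E f p = c f p := fun _ _ => rfl
  refine ⟨Submodule.liftQ _ E ?_, ?_, ?_⟩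
  · intro f hf
    rw [LinearMap.mem_ker]
    ext p
    refine hinj ?_
    rw [hE, hc, LinearMap.zero_apply, map_zero]
    exact evalBar_coboundary hG hd hf (hr0 p) (r p).2
  · refine (injective_iff_map_eq_zero _).2 fun x hx => ?_
    obtain ⟨f, rfl⟩ := subquot_mk_surjective _ _ x
    have hx' : E f = 0 := hx
    rw [← map_zero (Subquot.mk _ _), subquot_mk_eq_iff, Submodule.coe_zero, sub_zero]
    refine mem_coboundaries_of_evalBar hG hd hbdd hW f.2 fun y hy0 hy => ?_
    rw [← hcy f ⟨y, hy⟩ hy0, ← hE, hx', LinearMap.zero_apply, map_zero]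
  · intro f hf y hy0 hy
    exact hcy ⟨f, hf⟩ ⟨y, hy⟩ hy0

end Pairing

open TrivSqZeroExt (inl inr)

/-! ### Triple products as evaluations on bar cycles. -/

section TripleProduct

variable {S B M : Type*} [CommRing S] [Ring B] [Algebra S B] [AddCommGroup M] [Module S M]
  [Module B M] [Module Bᵐᵒᵖ M] [SMulCommClass B Bᵐᵒᵖ M] [IsScalarTower S B M]
  [IsScalarTower S Bᵐᵒᵖ M]
  {𝓑 : ℕ → Submodule S B} [GradedAlgebra 𝓑] {𝓜 : ℤ → Submodule S M} {d : ℕ}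

variable (S B M) in
/-- `x ⊗ b` as a word. -/
def pairWord : M ⊗[S] B →ₗ[S] WordAlg S (TrivSqZeroExt B M) :=
  LinearMap.mul' S _ ∘ₗ TensorProduct.map (letter S ∘ₗ inrS S B M) (letter S ∘ₗ inlS S B M)

variable (S B M) in
/-- `x ⊗ b ⊗ b'` as a word. -/
def tripleWord : (M ⊗[S] B) ⊗[S] B →ₗ[S] WordAlg S (TrivSqZeroExt B M) :=
  LinearMap.mul' S _ ∘ₗ TensorProduct.map (pairWord S B M) (letter S ∘ₗ inlS S B M)

theorem pairWord_tmul (x : M) (b : B) : pairWord S B M (x ⊗ₜ b) = wd S [inr x, inl b] := by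
  simp only [wd_cons, wd_nil, mul_one]
  rfl

theorem tripleWord_tmul (x : M) (b b' : B) :
    tripleWord S B M ((x ⊗ₜ b) ⊗ₜ b') = wd S [inr x, inl b, inl b'] := by
  change pairWord S B M (x ⊗ₜ b) * letter S (inl b') = _
  simp only [pairWord_tmul, wd_cons, wd_nil, mul_one, mul_assoc]

theorem cof_tripleWord (f : MultilinearMap S (fun _ : Fin 3 => TrivSqZeroExt B M) (TrivSqZeroExt B M))
    (z : (M ⊗[S] B) ⊗[S] B) : cof (signInv S B M d) f (tripleWord S B M z) = evalTriple f z := by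
  suffices h : cof (signInv S B M d) f ∘ₗ tripleWord S B M = evalTriple f from LinearMap.congr_fun h z
  refine TensorProduct.ext_threefold fun x b b' => ?_
  rw [LinearMap.comp_apply, tripleWord_tmul, evalTriple_tmul, cof_of_length f (l := [inr x, inl b, inl b']) rfl]
  refine congrArg f (funext fun i => ?_)
  fin_cases i
  · simp [signInv_pow_inr, mul_comm d]
  · exact signInv_pow_inl b 1
  · rfl

theorem barDiff_tripleWord (z : (M ⊗[S] B) ⊗[S] B) :
    barDiff (signInv S B M d) (tripleWord S B M z) = (-1 : S) ^ d •
      (pairWord S B M (LinearMap.rTensor B (TensorProduct.lift (rightAct S B M)) z) -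
        pairWord S B M (LinearMap.lTensor M (LinearMap.mul' S B) (TensorProduct.assoc S M B B z))) := by
  suffices h : barDiff (signInv S B M d) ∘ₗ tripleWord S B M = (-1 : S) ^ d •
      (pairWord S B M ∘ₗ LinearMap.rTensor B (TensorProduct.lift (rightAct S B M)) -
        pairWord S B M ∘ₗ LinearMap.lTensor M (LinearMap.mul' S B) ∘ₗ
          (TensorProduct.assoc S M B B).toLinearMap) from LinearMap.congr_fun h z
  refine TensorProduct.ext_threefold fun x b b' => ?_
  simp only [LinearMap.comp_apply, LinearMap.smul_apply, LinearMap.sub_apply, tripleWord_tmul,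
    LinearMap.rTensor_tmul, TensorProduct.lift.tmul, LinearEquiv.coe_coe, TensorProduct.assoc_tmul,
    LinearMap.lTensor_tmul, LinearMap.mul'_apply, pairWord_tmul]
  rw [barDiff_cons_cons, barDiff_cons_cons, signInv_inr, signInv_inl, smul_mul_assoc,
    TrivSqZeroExt.inr_mul_inl, ← TrivSqZeroExt.inl_mul]
  simp only [wd_cons, wd_nil, mul_one, barDiff_letter, mul_zero, sub_zero, map_smul, smul_mul_assoc, smul_sub]
  rfl

variable {L Q : Type*} [AddCommGroup L] [Module S L] [AddCommGroup Q] [Module S Q]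

theorem mul_contractL (g : M ⊗[S] L) (u : B ⊗[S] Module.Dual S L) (b : B) :
    LinearMap.lTensor M (LinearMap.mul' S B) (TensorProduct.assoc S M B B (contractL S B M L (g ⊗ₜ u) ⊗ₜ b)) =
      contractL S B M L (g ⊗ₜ LinearMap.rTensor (Module.Dual S L) (LinearMap.mul' S B)
        (TensorProduct.rightComm S B (Module.Dual S L) B (u ⊗ₜ b))) := by
  induction g using TensorProduct.induction_on with
  | zero => simp
  | add g g' h h' => simp only [TensorProduct.add_tmul, map_add, h, h']
  | tmul x l =>
    induction u using TensorProduct.induction_on with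
    | zero => simp
    | add u u' h h' => simp only [TensorProduct.add_tmul, TensorProduct.tmul_add, map_add, h, h']
    | tmul b' ξ => simp [contractL_tmul, ← TensorProduct.smul_tmul']

variable {n₁ n₂ : ℕ} (α : Q →ₗ[S] 𝓑 n₁) (β : Module.Dual S Q →ₗ[S] 𝓑 n₂ ⊗[S] Module.Dual S L)
  (γ : 𝓜 (-(n₁ : ℤ) - n₂) ⊗[S] L)

theorem tripleWord_gammaBetaAlpha_mem (h₁ : 0 < n₁) (h₂ : 0 < n₂) (t : Module.Dual S Q ⊗[S] Q) :
    tripleWord S B M (gammaBetaAlpha 𝓑 𝓜 γ β α t) ∈ startSpan S 𝓑 𝓜 1 3 0 := by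
  induction t using TensorProduct.induction_on with
  | zero => simp
  | add t t' h h' => rw [map_add, map_add]; exact Submodule.add_mem _ h h'
  | tmul q v =>
    change tripleWord S B M (contractL S B M L (LinearMap.rTensor L _ γ ⊗ₜ
      LinearMap.rTensor (Module.Dual S L) _ (β q)) ⊗ₜ (α v : B)) ∈ _
    generalize β q = u
    induction γ using TensorProduct.induction_on with
    | zero => simp
    | add g g' h h' =>
      simp only [TensorProduct.add_tmul, map_add]
      exact Submodule.add_mem _ h h'
    | tmul x l =>
      induction u using TensorProduct.induction_on with
      | zero => simp
      | add u u' h h' =>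
        simp only [TensorProduct.add_tmul, TensorProduct.tmul_add, map_add]
        exact Submodule.add_mem _ h h'
      | tmul b ξ =>
        rw [LinearMap.rTensor_tmul, LinearMap.rTensor_tmul, contractL_tmul, ← TensorProduct.smul_tmul', map_smul]
        refine Submodule.smul_mem _ _ ?_
        rw [Submodule.subtype_apply, Submodule.subtype_apply, tripleWord_tmul]
        have ht : Typed 𝓑 𝓜 0 (n₂ + (n₁ + 0)) [inl (b : B), inl (α v : B)] :=
          (Typed.nil.consB n₁ _ h₁ (α v).2).consB n₂ _ h₂ b.2
        exact Submodule.subset_span ⟨_, .consM' x.2 ht (by ring), rfl, rfl⟩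

/-- The bar differential of a word of length three multiplies the first two or the last two letters.
For `γ ⊗ β ⊗ α` these products are the contractions of `m₂(γ ⊗ β)` and `m₂(β ⊗ α)`, which vanish by
assumption. -/
theorem barDiff_tripleWord_gammaBetaAlpha (t : Module.Dual S Q ⊗[S] Q) (h₁ : m₂BetaAlpha 𝓑 β α t = 0)
    (h₂ : m₂GammaBeta 𝓑 𝓜 γ β = 0) :
    barDiff (signInv S B M d) (tripleWord S B M (gammaBetaAlpha 𝓑 𝓜 γ β α t)) = 0 := by
  have e₁ : LinearMap.rTensor B (TensorProduct.lift (rightAct S B M)) (gammaBetaAlpha 𝓑 𝓜 γ β α t) = 0 := by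
    rw [gammaBetaAlpha, LinearMap.rTensor, ← LinearMap.comp_apply, ← TensorProduct.map_comp]
    rw [m₂GammaBeta] at h₂
    rw [h₂, TensorProduct.map_zero_left, LinearMap.zero_apply]
  have e₂ : ∀ t, LinearMap.lTensor M (LinearMap.mul' S B)
      (TensorProduct.assoc S M B B (gammaBetaAlpha 𝓑 𝓜 γ β α t)) =
        contractL S B M L (LinearMap.rTensor L (𝓜 _).subtype γ ⊗ₜ m₂BetaAlpha 𝓑 β α t) := by
    intro t
    induction t using TensorProduct.induction_on with
    | zero => simp
    | add t t' h h' => simp only [map_add, TensorProduct.tmul_add, h, h']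
    | tmul q v => exact mul_contractL _ _ _
  rw [barDiff_tripleWord, e₁, e₂, h₁, TensorProduct.tmul_zero]
  simp

/-- The triple product is the evaluation on a cycle of the bar complex. -/
theorem exists_cycle_evalTriple (h₁ : 0 < n₁) (h₂ : 0 < n₂) (t : Module.Dual S Q ⊗[S] Q)
    (h₃ : m₂BetaAlpha 𝓑 β α t = 0) (h₄ : m₂GammaBeta 𝓑 𝓜 γ β = 0) :
    ∃ y ∈ barDegree (plusDegree 𝓑) 𝓜 2 0, y ∈ barCycles (plusMul 𝓑) (plusRight M 𝓑) 2 ∧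
      ∀ f : MultilinearMap S (fun _ : Fin 3 => TrivSqZeroExt B M) (TrivSqZeroExt B M),
        evalTriple f (gammaBetaAlpha 𝓑 𝓜 γ β α t) = evalBar M 𝓑 f y := by
  obtain ⟨y, hy, h⟩ := exists_mem_barDegree (tripleWord_gammaBetaAlpha_mem α β γ h₁ h₂ t)
  refine ⟨y, hy, mem_barCycles_of_barDiff_barWord (d := 0)
    (by rw [h]; exact barDiff_tripleWord_gammaBetaAlpha α β γ t h₃ h₄), fun f => ?_⟩
  rw [← cof_tripleWord (d := 0), ← h, cof_barWord, zero_mul, pow_zero, one_smul]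

end TripleProduct

/-! ### Classification by a single value when the bar homology is invertible. -/

section Invertible

variable {S P H : Type*} [CommRing S] [AddCommGroup P] [Module S P] [Module.Invertible S P]
  [AddCommGroup H] [Module S H]

/-- A submodule of the dual of an invertible module is mapped bijectively to `S` by the evaluation at an
element, if this takes the value `1`. -/
theorem bijective_eval_of_eq_one {Ψ : H →ₗ[S] Module.Dual S P} (hΨ : Function.Injective Ψ) {p : P} {x₀ : H}
    (h : Ψ x₀ p = 1) : Function.Bijective fun x => Ψ x p := by
  -- The value `1` at `p` makes evaluation on the whole dual surjective, and a surjection from the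
  -- dual of an invertible module onto `S` is bijective.
  have hsurj : Function.Surjective (Module.Dual.eval S P p) := fun c => ⟨c • Ψ x₀, by simp [h]⟩
  refine ⟨fun x y hxy => hΨ ((Module.Invertible.bijective_of_surjective hsurj).1 hxy), fun c => ⟨c • x₀, ?_⟩⟩
  simp [h]

end Invertible

section TripleClassification

variable {S B M : Type*} [CommRing S] [Ring B] [Algebra S B] [AddCommGroup M] [Module S M]
  [Module B M] [Module Bᵐᵒᵖ M] [SMulCommClass B Bᵐᵒᵖ M] [IsScalarTower S B M]
  [IsScalarTower S Bᵐᵒᵖ M]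
  {𝓑 : ℕ → Submodule S B} [GradedAlgebra 𝓑] {𝓜 : ℤ → Submodule S M} {n₀ : ℤ}
  [DirectSum.Decomposition 𝓜]
  {s π : WordAlg S (TrivSqZeroExt B M) →ₗ[S] WordAlg S (TrivSqZeroExt B M)}

/-- The classification of `A_∞`-structures by the value of `m₃` on a cycle, if the homology of the bar
complex is invertible. -/
theorem classification_of_invertible (hG : IsGradedBimodule 𝓑 𝓜)
    (hbdd : ∀ n, n₀ < n → 𝓜 n = ⊥) (hW : IsBarSplitting 𝓑 𝓜 1 s π) (hP : Module.Invertible S (TorRight M 𝓑 2))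
    {y : BarTerm S (plus 𝓑) M 2} (hy : y ∈ barDegree (plusDegree 𝓑) 𝓜 2 0)
    (hc : y ∈ barCycles (plusMul 𝓑) (plusRight M 𝓑) 2) :
    (∀ μ ν : AInf 𝓑 𝓜 1, evalBar M 𝓑 (μ.m 3) y = 1 → evalBar M 𝓑 (ν.m 3) y = 1 → GaugeEquiv μ ν) ∧
      ((∃ μ : AInf 𝓑 𝓜 1, evalBar M 𝓑 (μ.m 3) y = 1) →
        ∃ Θ : Quot (GaugeEquiv : AInf 𝓑 𝓜 1 → AInf 𝓑 𝓜 1 → Prop) → S,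
          Function.Bijective Θ ∧ ∀ μ : AInf 𝓑 𝓜 1,
            algebraMap S (TrivSqZeroExt B M) (Θ (Quot.mk _ μ)) = evalBar M 𝓑 (μ.m 3) y) := by
  obtain ⟨hE, Φ, hΦ, hΦm⟩ := classification_squareZero hG le_rfl hbdd hW
  obtain ⟨Ψ, hΨ, hΨe⟩ := exists_evaluation hG le_rfl hbdd hW
  have hinj : Function.Injective (algebraMap S (TrivSqZeroExt B M)) := fun a b h =>
    hG.inj (congrArg TrivSqZeroExt.fst h)
  let p : TorRight M 𝓑 2 := Subquot.mk _ _ ⟨y, hc⟩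
  have hval : ∀ μ : AInf 𝓑 𝓜 1,
      algebraMap S (TrivSqZeroExt B M) (Ψ (Φ (Quot.mk _ μ)) p) = evalBar M 𝓑 (μ.m 3) y := by
    intro μ
    obtain ⟨hμ, h⟩ := hΦm μ
    rw [h]
    exact hΨe _ hμ y hy hc
  have hbij : ∀ μ : AInf 𝓑 𝓜 1, evalBar M 𝓑 (μ.m 3) y = 1 →
      Function.Bijective fun q => Ψ (Φ q) p := by
    intro μ hμ
    refine Function.Bijective.comp (g := fun x => Ψ x p)
      (bijective_eval_of_eq_one (P := TorRight M 𝓑 2) hΨ (x₀ := Φ (Quot.mk _ μ)) (hinj ?_)) hΦ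
    exact ((hval μ).trans hμ).trans (map_one _).symm
  refine ⟨fun μ ν hμ hν => ?_, fun ⟨μ, hμ⟩ => ⟨fun q => Ψ (Φ q) p, hbij μ hμ, hval⟩⟩
  have h := (hbij μ hμ).1 (hinj ((hval μ).trans ((hμ.trans hν.symm).trans (hval ν).symm)))
  exact hE.eqvGen_iff.1 (Quot.eqvGen_exact h)

end TripleClassification

end SqZero

end

open SqZero in
theorem theorem4p2 {S B M : Type*} [CommRing S] [Ring B] [Algebra S B]
    [AddCommGroup M] [Module S M] [Module B M] [Module Bᵐᵒᵖ M] [SMulCommClass B Bᵐᵒᵖ M]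
    [IsScalarTower S B M] [IsScalarTower S Bᵐᵒᵖ M]
    (𝓑 : ℕ → Submodule S B) [GradedAlgebra 𝓑]
    (hB₀ : Function.Injective (algebraMap S B) ∧ ∀ b ∈ 𝓑 0, ∃ s, algebraMap S B s = b)
    (𝓜 : ℤ → Submodule S M) (h𝓜 : DirectSum.IsInternal 𝓜)
    (hleft : ∀ (i : ℕ) (j : ℤ) (b : B) (x : M), b ∈ 𝓑 i → x ∈ 𝓜 j → b • x ∈ 𝓜 (i + j))
    (hright : ∀ (i : ℕ) (j : ℤ) (b : B) (x : M), b ∈ 𝓑 i → x ∈ 𝓜 j →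
      MulOpposite.op b • x ∈ 𝓜 (i + j))
    (hBproj : ∀ n, Module.Projective S (𝓑 n)) (hMproj : ∀ n, Module.Projective S (𝓜 n))
    (hbdd : ∃ n₀ : ℤ, ∀ n, n₀ < n → 𝓜 n = ⊥)
    (d : ℕ) (hd : 1 ≤ d)
    (hTorL : TorLeftConcentrated 𝓑 𝓜 (d + 1)) (hTorR : TorRightConcentrated 𝓑 𝓜 (d + 1)) :
    (∀ (m n : ℕ) (i : ℤ), 1 ≤ m → (n : ℤ) = i + m * d → i < 2 * m →
      Subsingleton (HH 𝓑 𝓜 d n (-(m * d : ℤ)))) ∧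
    (∀ φ : TorRight M 𝓑 (d + 1) →ₗ[S] BarTerm S (plus 𝓑) M (d + 1), IsCycleLift 𝓑 𝓜 (d + 1) φ →
      ∃ Ψ : HH 𝓑 𝓜 d (d + 2) (-d : ℤ) →ₗ[S] Module.Dual S (TorRight M 𝓑 (d + 1)),
        Function.Injective Ψ ∧
        ∀ f (hf : f ∈ cocycles (bigrading 𝓑 𝓜 d) (signInv S B M d) (d + 2) (-d : ℤ)) p,
          algebraMap S (TrivSqZeroExt B M) (Ψ (hochClass _ _ _ _ f hf) p) =
            evalBar M 𝓑 f (φ p)) ∧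
    (Equivalence (GaugeEquiv : AInf 𝓑 𝓜 d → AInf 𝓑 𝓜 d → Prop) ∧
      ∃ Φ : Quot (GaugeEquiv : AInf 𝓑 𝓜 d → AInf 𝓑 𝓜 d → Prop) → HH 𝓑 𝓜 d (d + 2) (-d : ℤ),
        Function.Bijective Φ ∧
        ∀ μ : AInf 𝓑 𝓜 d,
          ∃ hμ : μ.m (d + 2) ∈ cocycles (bigrading 𝓑 𝓜 d) (signInv S B M d) (d + 2) (-d : ℤ),
            Φ (Quot.mk _ μ) = hochClass _ _ _ _ (μ.m (d + 2)) hμ) ∧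
    (d = 1 → Module.Invertible S (TorRight M 𝓑 2) →
      ∀ (Q L : Type*) [AddCommGroup Q] [Module S Q] [Module.Finite S Q] [Module.Projective S Q]
        [AddCommGroup L] [Module S L] [Module.Invertible S L]
        (n₁ n₂ : ℕ), 0 < n₁ → 0 < n₂ →
      ∀ (α : Q →ₗ[S] 𝓑 n₁) (β : Module.Dual S Q →ₗ[S] 𝓑 n₂ ⊗[S] Module.Dual S L)
        (γ : 𝓜 (-(n₁ : ℤ) - n₂) ⊗[S] L)
        (idQ : Module.Dual S Q ⊗[S] Q), dualTensorHom S Q Q idQ = LinearMap.id →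
        m₂BetaAlpha 𝓑 β α idQ = 0 → m₂GammaBeta 𝓑 𝓜 γ β = 0 →
        (∀ μ ν : AInf 𝓑 𝓜 d,
          evalTriple (μ.m 3) (gammaBetaAlpha 𝓑 𝓜 γ β α idQ) = 1 →
          evalTriple (ν.m 3) (gammaBetaAlpha 𝓑 𝓜 γ β α idQ) = 1 → GaugeEquiv μ ν) ∧
        ((∃ μ : AInf 𝓑 𝓜 d, evalTriple (μ.m 3) (gammaBetaAlpha 𝓑 𝓜 γ β α idQ) = 1) →
          ∃ Θ : Quot (GaugeEquiv : AInf 𝓑 𝓜 d → AInf 𝓑 𝓜 d → Prop) → S,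
            Function.Bijective Θ ∧
            ∀ μ : AInf 𝓑 𝓜 d, algebraMap S (TrivSqZeroExt B M) (Θ (Quot.mk _ μ)) =
              evalTriple (μ.m 3) (gammaBetaAlpha 𝓑 𝓜 γ β α idQ))) := by
  have hG : IsGradedBimodule 𝓑 𝓜 := ⟨hB₀.1, hB₀.2, h𝓜, hleft, hright⟩
  let _ := h𝓜.chooseDecomposition
  obtain ⟨n₀, hn₀⟩ := hbdd
  obtain ⟨s, π, hW⟩ := exists_isBarSplitting hG hBproj hMproj hTorR
  refine ⟨fun m n i hm hn hi => ?_, fun φ hφ => ?_, classification_squareZero hG hd hn₀ hW, ?_⟩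
  · obtain ⟨σ, hσ⟩ := exists_isContraction hG hW hm
    -- With `n = i + m d`, the condition `i < 2 m` says exactly that `n` is below the length up to
    -- which the `m`-fold power of the bar complex is contractible.
    have hlt : n < m * (d + 2) := by
      zify
      linarith
    refine ⟨fun x y => ?_⟩
    obtain ⟨x, rfl⟩ := subquot_mk_surjective _ _ x
    obtain ⟨y, rfl⟩ := subquot_mk_surjective _ _ y
    exact subquot_mk_eq_iff.2
      (cocycles_le_coboundaries hG hd hm hn₀ hσ hlt (Submodule.sub_mem _ x.2 y.2))
  -- The functional is constructed without reference to `φ`; a cycle lift merely supplies particular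
  -- representatives of degree `0`.
  · obtain ⟨Ψ, hΨ, hΨe⟩ := exists_evaluation hG hd hn₀ hW
    refine ⟨Ψ, hΨ, fun f hf p => ?_⟩
    obtain ⟨h0, hc, hp⟩ := hφ p
    rw [← hΨe f hf (φ p) h0 hc, hp]
  · rintro rfl hP Q L _ _ _ _ _ _ _ n₁ n₂ h₁ h₂ α β γ idQ - h₃ h₄
    obtain ⟨y, hy, hc, h⟩ := exists_cycle_evalTriple α β γ h₁ h₂ idQ h₃ h₄
    simp only [h]
    exact classification_of_invertible hG hn₀ hW hP hy hc
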